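/- **Notation.** A local field $K$ is the fraction field of a complete discrete valuation ring $\mathcal O=\mathcal O_K$ with maximal ideal $\mathfrak p$ and finite residue field with $q$ elements; $v:K^\times\to\mathbb Z$ is its normalized valuation. Fix a separable closure $K^{\rm sep}$; all separable extensions of $K$ are taken inside it, and for such an extension $E$ let $\mathcal O_E$ be the integral closure of $\mathcal O$ in $E$. For $n\ge 1$ let $K_n=K(\mu_{q^n-1})$ be the unramified extension of degree $n$ and $K^{\rm ur}=\bigcup_{n\geq 1} K_n$, with arithmetic Frobenius $\varphi$ (the $K$-automorphism that induces the $q$-th power map on the residue field). Let $L=K_n$ for some $n\ge1$, let $\pi$ be a uniformizer of $L$, and let $f\in\mathcal O_L[X]$ be a monic polynomial with $f\equiv \pi X$ modulo degree $2$ and $f\equiv X^q$ modulo the maximal ideal of $\mathcal O_L$. For a polynomial or power series $g$ over $\mathcal O_L$, let $g^{\varphi^i}$ be the result of applying $\varphi^i$ to its coefficients. Put $f_0=X$, $f_m=f^{\varphi^{m-1}}\circ\cdots\circ f^{\varphi}\circ f$, let $\mu_{f,m}$ be the set of roots of $f_m$ in $K^{\rm sep}$, and $L_f^m=L(\mu_{f,m})$.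 Put $\pi_j=\prod_{t=0}^{j-1}\varphi^t(\pi)$ for $j\ge0$ and $\pi_j=\varphi^j(\pi_{-j}^{-1})$ for $j<0$. If $x\in K^\times$ and $v(x)=-j$, there is a unique power series $[x\pi_j]\in\mathcal O_L[[X]]$ with $[x\pi_j]\equiv x\pi_jX$ modulo degree $2$ and $f^{\varphi^j}\circ[x\pi_j]=[x\pi_j]^\varphi\circ f$. Let $$K^{\rm LT}=\bigcup_{m\ge1}K^{\rm ur}L_f^m ,$$ and for $x\in K^\times$ with $v(x)=-j$ let $\mathrm{Art}_K(x)\in\mathrm{Gal}(K^{\rm LT}/K)$ be the unique element that acts on $K^{\rm ur}$ as $\varphi^j$ and maps every $\alpha\in\mu_{f,m}$, $m\ge1$, to $[x\pi_j](\alpha)$. This element exists, and $\mathrm{Art}_K:K^\times\to\mathrm{Gal}(K^{\rm LT}/K)$ is a homomorphism. **Theorem (Base change).** Let $K$ be a local field and let $K'/K$ be a finite separable extension inside $K^{\rm sep}$, which is again a local field with ring of integers $\mathcal O_{K'}$. Let $K^{\rm LT},\mathrm{Art}_K$ and $K'^{\rm LT},\mathrm{Art}_{K'}$ be defined as above from arbitrary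 choices of $(n,\pi,f)$ for $K$ and for $K'$. Then $K^{\rm LT}\subset K'^{\rm LT}$, and for all $x'\in K'^\times$ $$\mathrm{Art}_{K'}(x')|_{K^{\rm LT}}=\mathrm{Art}_K\bigl(N_{K'/K}(x')\bigr).$$ -/

import Mathlib

open Polynomial

noncomputable section

namespace LubinTate

/-- The maximal ideal of a local ring, i.e. the ideal of all nonunits (see
`maxIdeal_eq_maximalIdeal`). All rings of integers `O_E` below are local, but this spelling does
not require the fact in order to be written down. -/
def maxIdeal (R : Type*) [CommRing R] : Ideal R := Ideal.span (nonunits R)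

theorem maxIdeal_eq_maximalIdeal (R : Type*) [CommRing R] [IsLocalRing R] :
    maxIdeal R = IsLocalRing.maximalIdeal R :=
  Ideal.span_eq (IsLocalRing.maximalIdeal R)

/-- `q`, the cardinality of the residue field. -/
def resCard (A : Type*) [CommRing A] : ℕ := Nat.card (A ⧸ maxIdeal A)

/-- `v(x) = n` for the normalized valuation `v` of the fraction field `F` of the discrete
valuation ring `A`: `x` is a unit times the `n`-th power of a uniformizer. -/
def HasVal (A : Type*) [CommRing A] {F : Type*} [Field F] [Algebra A F] (x : Fˣ) (n : ℤ) : Prop :=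
  ∃ ϖ : A, Ideal.span {ϖ} = maxIdeal A ∧
    ∃ u : Aˣ, (x : F) = algebraMap A F (u : A) * algebraMap A F ϖ ^ n

section Fields

variable (A : Type*) [CommRing A] (F : Type*) [Field F] [Algebra A F]
  (Ω : Type*) [Field Ω] [Algebra F Ω] [Algebra A Ω] [IsScalarTower A F Ω]

/-- `F_n = F(μ_{q^n - 1})`, for `n ≥ 1` the unramified extension of `F` of degree `n`. -/
def unr (n : ℕ) : IntermediateField F Ω :=
  IntermediateField.adjoin F {ζ : Ω | ζ ^ (resCard A ^ n - 1) = 1}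

/-- The maximal unramified extension `F^ur`, the union of the `F_n` for `n ≥ 1`. -/
def maxUnr : IntermediateField F Ω := ⨆ (n : ℕ) (_ : 1 ≤ n), unr A F Ω n

variable {F Ω}

/-- The ring of integers `O_E` of an extension `E / F`: the integral closure of `A` in `E`. -/
abbrev intRing (E : IntermediateField F Ω) : Subalgebra A E := integralClosure A E

/-- The automorphism of `O_E` induced by an automorphism of `E / F`. -/
def onInt {E : IntermediateField F Ω} (σ : E ≃ₐ[F] E) : intRing A E ≃ₐ[A] intRing A E :=
  (σ.restrictScalars A).mapIntegralClosure

/-- `φ` reduces modulo the maximal ideal of `O_E` to the `q`-th power map. -/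
def IsArithFrob (E : IntermediateField F Ω) (φ : E ≃ₐ[F] E) : Prop :=
  ∀ a : intRing A E, onInt A φ a - a ^ resCard A ∈ maxIdeal (intRing A E)

open Classical in
/-- The arithmetic Frobenius of an unramified extension `E / F`: the (unique) `F`-automorphism of
`E` that reduces to the `q`-th power map. -/
def arithFrob (E : IntermediateField F Ω) : E ≃ₐ[F] E :=
  if h : ∃ φ : E ≃ₐ[F] E, IsArithFrob A E φ then h.choose else 1

end Fields

variable (A : Type*) [CommRing A] (F : Type*) [Field F] [Algebra A F]
  (Ω : Type*) [Field Ω] [Algebra F Ω] [Algebra A Ω] [IsScalarTower A F Ω]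

/-- A choice of a finite unramified extension `L = F_n`, a uniformizer `π` of `L` and a monic
polynomial `f` over `O_L` with `f ≡ π X` modulo degree `2` and `f ≡ X ^ q` modulo the maximal
ideal. -/
structure Datum where
  n : ℕ
  one_le_n : 1 ≤ n
  π : intRing A (unr A F Ω n)
  span_π : Ideal.span {π} = maxIdeal (intRing A (unr A F Ω n))
  f : (intRing A (unr A F Ω n))[X]
  monic : f.Monic
  coeff_zero : f.coeff 0 = 0
  coeff_one : f.coeff 1 = π
  congr_X_pow : ∀ i, (f - X ^ resCard A).coeff i ∈ maxIdeal (intRing A (unr A F Ω n))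

namespace Datum

variable {A F Ω} (D : Datum A F Ω)

/-- The field `L`. -/
abbrev L : IntermediateField F Ω := unr A F Ω D.n

/-- The ring `O_L`. -/
abbrev OL : Subalgebra A D.L := intRing A D.L

/-- The arithmetic Frobenius `φ` of `L / F`. -/
def φ : D.L ≃ₐ[F] D.L := arithFrob A D.L

/-- `φ ^ i` as an endomorphism of `O_L`. -/
def φO (i : ℤ) : D.OL →+* D.OL := (onInt A (D.φ ^ i) : D.OL ≃ₐ[A] D.OL)

/-- `f_m = f^{φ^{m-1}} ∘ ⋯ ∘ f^φ ∘ f`, with `f_0 = X`. -/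
def fIter : ℕ → D.OL[X]
  | 0 => X
  | m + 1 => (D.f.map (D.φO m)).comp (fIter m)

/-- `π_m = ∏_{t < m} π^{φ^t}` for `m ≥ 0`. -/
def piNat (m : ℕ) : D.L := ∏ t ∈ Finset.range m, (D.φ ^ t) (D.π : D.L)

/-- `π_j` for all integers `j`, where `π_j = (π_{-j}⁻¹)^{φ^j}` for `j < 0`. -/
def piInt : ℤ → D.L
  | Int.ofNat m => D.piNat m
  | Int.negSucc m => (D.φ ^ (Int.negSucc m)) (D.piNat (m + 1))⁻¹

/-- `μ_{f,m}`, the set of roots of `f_m`. -/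
def torsion (m : ℕ) : Set Ω := {α | aeval α (D.fIter m) = 0}

/-- `L_f^m`, obtained from `L` by adjoining the roots of `f_m`. -/
def level (m : ℕ) : IntermediateField F Ω := D.L ⊔ IntermediateField.adjoin F (D.torsion m)

/-- `F^LT`, the union over `m ≥ 1` of the fields `F^m = F^ur L_f^m`. -/
def lubinTateField : IntermediateField F Ω :=
  ⨆ (m : ℕ) (_ : 1 ≤ m), maxUnr A F Ω ⊔ D.level m

/-- `g` is the power series `[θ]_{f,f'}` over `O_L`, for `f' = f^{φ^j}`: the (unique) one with
`g ≡ θ X` modulo degree `2` and `f' ∘ g = g^φ ∘ f`. -/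
def IsBracket (j : ℤ) (θ : D.L) (g : PowerSeries D.OL) : Prop :=
  PowerSeries.constantCoeff g = 0 ∧ ((PowerSeries.coeff 1 g : D.OL) : D.L) = θ ∧
    PowerSeries.subst g ((D.f.map (D.φO j) : D.OL[X]) : PowerSeries D.OL) =
      PowerSeries.subst ((D.f : D.OL[X]) : PowerSeries D.OL) (PowerSeries.map (D.φO 1) g)

/-- `y = g(α)` in the complete ring of integers `O_E` of a finite extension `E` of `L`, for a power
series `g` over `O_L` and `α` in the maximal ideal `P` of `O_E`: for all `N`, the value at `α` of
the truncation of `g` modulo degree `N` is congruent to `y` modulo `P ^ N`. -/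
def IsEval (E : IntermediateField F Ω) (g : PowerSeries D.OL) (α y : Ω) : Prop :=
  ∀ N : ℕ, ∃ c ∈ maxIdeal (intRing A E) ^ N,
    y = aeval α (PowerSeries.trunc N g) + algebraMap (intRing A E) Ω c

/-- `σ` lies in the Weil group of `F^LT / F` and corresponds to `x` under the isomorphism
`ρ : W(F^LT / F) ≅ Fˣ`: if `v(x) = -j`, then `σ` acts on `F^ur` as the `j`-th power of the
arithmetic Frobenius and on `μ_{f,m}` as the power series `[x π_j]_{f,f^{φ^j}}`, for all `m ≥ 1`. -/
def IsArtin (x : Fˣ) (σ : D.lubinTateField ≃ₐ[F] D.lubinTateField) : Prop :=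
  ∃ j : ℤ, HasVal A x (-j) ∧
    (∀ (a : D.lubinTateField) (b : maxUnr A F Ω), (a : Ω) = b →
      (σ a : Ω) = ((arithFrob A (maxUnr A F Ω) ^ j) b : maxUnr A F Ω)) ∧
    ∃ g : PowerSeries D.OL, D.IsBracket j (algebraMap F D.L x * D.piInt j) g ∧
      ∀ m : ℕ, 1 ≤ m → ∀ α : D.lubinTateField, (α : Ω) ∈ D.torsion m →
        D.IsEval (D.level m) g α (σ α)

open Classical in
/-- The Artin map `Art_F : Fˣ → Gal(F^LT / F)`, the inverse of `ρ`. -/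
def art : Fˣ →* (D.lubinTateField ≃ₐ[F] D.lubinTateField) :=
  if h : ∃ a : Fˣ →* (D.lubinTateField ≃ₐ[F] D.lubinTateField), ∀ x, D.IsArtin x (a x)
  then h.choose else 1

end Datum

end LubinTate

end

open Polynomial

set_option linter.unusedSectionVars false

noncomputable section

namespace LubinTate

/-! ### Power series intertwining two Frobenius lifts -/

section Bracket

open PowerSeries (subst HasSubst)

variable {R : Type*} [CommRing R]

/-! Both Artin maps are read off from automorphisms of the separable closure Ω. Let Λ be the
completion of Ω for the extended absolute value, and let `unrRing` be the ring of integers of the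
closure of K^ur in Λ. Over this complete ring Lubin–Tate polynomials, their brackets and their
torsion can be studied without fixing a finite level L. Results descend because fixed points of φ^n
in `unrRing` lie in K_n, and because finite-dimensional subspaces of Ω are closed in Λ.

The relation `IsLift f x j s` says that s in Gal(Ω/K) acts on K^ur as φ^j and on the torsion of f as
[xπ_j]. An s that acts on K^ur as an integral power of φ satisfies it for exactly one x
(`IsLT.exists_isLift`, `IsLift.unique`), and every nonzero x occurs (`IsLT.exists_galois_isLift`).
The relation is multiplicative (`IsLift.mul`), and it does not depend on f (`IsLift.change`),
because any two Lubin–Tate polynomials become isomorphic over the completed ring. Hence Art_K(x) is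
the restriction of any lift of x (`Datum.IsArtin.coe_apply`). Base change becomes the claim that a
lift s of x' over K' is, as a K-automorphism, a lift of N(x') (`IsLift.baseChange`).

By multiplicativity it is enough to treat an s that induces the Frobenius of K'^ur. It induces φ^d
on K^ur, with d the residue degree, and is a lift of some x in K. Independence of f permits the
choice of a polynomial g over K_d with N(π) = x⁻¹ and a polynomial g' over K' with π' = x'⁻¹. Then s
fixes all torsion of g and of g' (`IsLift.exists_fixed`). Primitive torsion points a of g and a' of
g' of level m + 1 therefore lie, together with K_d, in a finite extension T of K' fixed by s. Being
fixed by a Frobenius, T is totally ramified over K', and its residue field is also that of K_d. So a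
uniformizer t of T has as norms to K_d(a) and to K'(a') the elements a and a' up to units. Pushing
on to K and K' gives x⁻¹ and x'⁻¹ up to norms of units. Computing N_{T/K}(t) in two ways gives N(x')
= x up to units that tend to 1 as m grows (`norm_algebraNorm_mul_sub_one_le`,
`IsLift.algebraNorm_eq`).

The remaining ingredient is that norms to K of units of K_n(a), with a primitive of level m + 1, are
congruent to 1 modulo the (m + 1)-st power of the maximal ideal
(`IsLT.norm_algebraNorm_unit_sub_one_le`). If g(a) is such a unit and P_m is the product of g(β)
over the roots β of f_m, then P_{m+1} ≡ φ(P_m) modulo ϖ^(m+1) (`IsLT.torsDet_succ_sub_dvd`). So the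
norm of g(a) to K_n is congruent to φ(P_m)/P_m, whose norm to K is 1. The congruence for P_m is a
Dwork-type argument: f ≡ X^q modulo ϖ, and the derivative of f is divisible by ϖ.

The inclusion of the Lubin–Tate fields follows by Galois theory: an automorphism fixing K'^LT is a
lift of 1 over K', hence of N(1) = 1 over K, so it fixes K^LT. -/

/-- A ring `R` with a lift `φ` of the `q`-th power map of `R / ϖ` for which the equations
`x = a + b φ(x)` with `b` divisible by `ϖ` are uniquely solvable. -/
structure IsFrobeniusLift (φ : R →+* R) (ϖ : R) (q : ℕ) : Prop where
  exists_char : ∃ p r : ℕ, p.Prime ∧ 1 ≤ r ∧ q = p ^ r ∧ CharP (R ⧸ Ideal.span {ϖ}) p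
  dvd_sub : ∀ a, ϖ ∣ φ a - a ^ q
  regular : ∀ a, ϖ * a = 0 → a = 0
  existsUnique : ∀ a b, ϖ ∣ b → ∃! x, x = a + b * φ x

theorem hasSubst_of_zero {g : PowerSeries R} (hg : PowerSeries.constantCoeff g = 0) :
    HasSubst g := HasSubst.of_constantCoeff_zero' hg

theorem X_dvd_of_zero {g : PowerSeries R} (hg : PowerSeries.constantCoeff g = 0) :
    PowerSeries.X ∣ g := PowerSeries.X_dvd_iff.2 hg

/-- Splitting off the first `n` terms of `r` turns questions about substitution into questions about
polynomials, with an error divisible by `g ^ n`. -/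
theorem subst_eq_trunc_add {g : PowerSeries R} (hg : PowerSeries.constantCoeff g = 0)
    (n : ℕ) (r : PowerSeries R) :
    ∃ s : PowerSeries R, (subst g r : PowerSeries R) =
      aeval g (PowerSeries.trunc n r) + g ^ n * subst g s := by
  have hs := hasSubst_of_zero hg
  refine ⟨PowerSeries.mk fun i ↦ PowerSeries.coeff (i + n) r, ?_⟩
  conv_lhs => rw [PowerSeries.eq_X_pow_mul_shift_add_trunc n r]
  rw [PowerSeries.subst_add hs, PowerSeries.subst_mul hs, PowerSeries.subst_pow hs,
    PowerSeries.subst_X hs, PowerSeries.subst_coe hs, add_comm]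

/-- The truncated parts are polynomial values at `g` and `h`, so their difference is divisible by `g
- h`. The tails carry the factors `g ^ n` and `h ^ n`, which are divisible by `X ^ n` as there are
no constant terms. -/
theorem X_pow_dvd_subst_sub {g h : PowerSeries R} (hg : PowerSeries.constantCoeff g = 0)
    (hh : PowerSeries.constantCoeff h = 0) (r : PowerSeries R) {n : ℕ}
    (hgh : (PowerSeries.X : PowerSeries R) ^ n ∣ g - h) :
    (PowerSeries.X : PowerSeries R) ^ n ∣ subst g r - subst h r := by
  obtain ⟨s, hs⟩ := subst_eq_trunc_add hg n r
  obtain ⟨t, ht⟩ := subst_eq_trunc_add hh n r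
  rw [hs, ht, add_sub_add_comm]
  refine dvd_add ?_ (dvd_sub ?_ ?_)
  · refine hgh.trans ?_
    simp only [← eval_map_algebraMap]
    exact sub_dvd_eval_sub _ _ _
  · exact (pow_dvd_pow_of_dvd (X_dvd_of_zero hg) n).mul_right _
  · exact (pow_dvd_pow_of_dvd (X_dvd_of_zero hh) n).mul_right _

theorem constantCoeff_subst_of_zero {g r : PowerSeries R} (hg : PowerSeries.constantCoeff g = 0)
    (hr : PowerSeries.constantCoeff r = 0) :
    PowerSeries.constantCoeff (subst g r : PowerSeries R) = 0 :=
  PowerSeries.constantCoeff_subst_eq_zero hg r hr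

theorem coeff_one_subst {g r : PowerSeries R} (hg : PowerSeries.constantCoeff g = 0)
    (hr : PowerSeries.constantCoeff r = 0) :
    PowerSeries.coeff 1 (subst g r : PowerSeries R) =
      PowerSeries.coeff 1 r * PowerSeries.coeff 1 g := by
  obtain ⟨s, hs⟩ := subst_eq_trunc_add hg 2 r
  obtain ⟨g', rfl⟩ := X_dvd_of_zero hg
  have h2 : PowerSeries.coeff 1 ((PowerSeries.X * g') ^ 2 *
      (subst (PowerSeries.X * g') s : PowerSeries R)) = 0 := by
    rw [mul_pow, mul_assoc]
    exact PowerSeries.X_pow_dvd_iff.1 (dvd_mul_right _ _) 1 one_lt_two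
  rw [hs, map_add, h2, add_zero, PowerSeries.trunc_succ, PowerSeries.trunc_one_left]
  have hr' : PowerSeries.coeff 0 r = 0 := by simpa using hr
  simp [hr', aeval_monomial]

/-- The condition on `h` to be a power series `≡ θ X` with `g ∘ h = h^φ ∘ f`. -/
structure IsBracketSeries (φ : R →+* R) (f g : PowerSeries R) (θ : R) (h : PowerSeries R) :
    Prop where
  zero : PowerSeries.constantCoeff h = 0
  one : PowerSeries.coeff 1 h = θ
  comm : (subst h g : PowerSeries R) = subst f (PowerSeries.map φ h)

/-- A power series `f` without constant term, with `f ≡ X ^ q` modulo `ϖ` and linear coefficient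
associated to `ϖ`. -/
structure IsFrobeniusSeries (ϖ : R) (q : ℕ) (f : PowerSeries R) : Prop where
  zero : PowerSeries.constantCoeff f = 0
  one : Associated ϖ (PowerSeries.coeff 1 f)
  dvd : ∀ i, ϖ ∣ PowerSeries.coeff i (f - PowerSeries.X ^ q)

variable {φ : R →+* R} {ϖ : R} {q : ℕ} {f g : PowerSeries R}

theorem map_mk_eq_X_pow (hf : IsFrobeniusSeries ϖ q f) :
    PowerSeries.map (Ideal.Quotient.mk (Ideal.span {ϖ})) f = PowerSeries.X ^ q := by
  rw [← sub_eq_zero]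
  ext i
  have := (Ideal.Quotient.eq_zero_iff_dvd ϖ _).2 (hf.dvd i)
  simpa using this

theorem constantCoeff_map_of_zero {S : Type*} [CommRing S] (ψ : R →+* S) {h : PowerSeries R}
    (hh : PowerSeries.constantCoeff h = 0) :
    PowerSeries.constantCoeff (PowerSeries.map ψ h) = 0 := by
  rw [← PowerSeries.coeff_zero_eq_constantCoeff_apply, PowerSeries.coeff_map,
    PowerSeries.coeff_zero_eq_constantCoeff_apply, hh, map_zero]

theorem map_subst_of_zero {S : Type*} [CommRing S] (ψ : R →+* S) {h : PowerSeries R}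
    (hh : PowerSeries.constantCoeff h = 0) (r : PowerSeries R) :
    PowerSeries.map ψ (subst h r : PowerSeries R) =
      subst (PowerSeries.map ψ h) (PowerSeries.map ψ r) :=
  PowerSeries.map_subst (hasSubst_of_zero hh) r

/-- Modulo `ϖ` both `f` and `g` become `X ^ q` and `φ` becomes the `q`-th power map. So both sides
reduce to the `q`-th power of the reduction of `h`. This makes the error in each approximation step
divisible by `ϖ`. -/
theorem dvd_coeff_subst_sub (H : IsFrobeniusLift φ ϖ q) (hf : IsFrobeniusSeries ϖ q f)
    (hg : IsFrobeniusSeries ϖ q g) {h : PowerSeries R}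
    (hh : PowerSeries.constantCoeff h = 0) (i : ℕ) :
    ϖ ∣ PowerSeries.coeff i ((subst h g : PowerSeries R) - subst f (PowerSeries.map φ h)) := by
  obtain ⟨p, r, hp, hr, rfl, hchar⟩ := H.exists_char
  have := Fact.mk hp
  set m := Ideal.Quotient.mk (Ideal.span {ϖ}) with hm
  rw [← Ideal.Quotient.eq_zero_iff_dvd, ← hm, ← PowerSeries.coeff_map, map_sub,
    map_subst_of_zero _ hh, map_subst_of_zero _ hf.zero, map_mk_eq_X_pow hf, map_mk_eq_X_pow hg]
  have h1 : PowerSeries.map m (PowerSeries.map φ h) =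
      PowerSeries.map (iterateFrobenius _ p r) (PowerSeries.map m h) := by
    ext i
    have := (Ideal.Quotient.eq_zero_iff_dvd ϖ _).2 (H.dvd_sub (PowerSeries.coeff i h))
    rw [map_sub, sub_eq_zero, map_pow] at this
    simpa [iterateFrobenius_def] using this
  have hm0 := constantCoeff_map_of_zero m hh
  have h2 := MvPowerSeries.map_iterateFrobenius_expand p hp.ne_zero (PowerSeries.map m h) r
  have h3 : PowerSeries.map (iterateFrobenius _ p r)
      (PowerSeries.expand (p ^ r) (pow_ne_zero r hp.ne_zero) (PowerSeries.map m h)) =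
      (PowerSeries.map m h) ^ p ^ r := h2
  rw [PowerSeries.map_expand, PowerSeries.expand_apply] at h3
  rw [h1, h3, PowerSeries.subst_pow (hasSubst_of_zero hm0),
    PowerSeries.subst_X (hasSubst_of_zero hm0), sub_self, map_zero]

theorem coeff_of_X_pow_dvd {n : ℕ} {u : PowerSeries R} (hu : PowerSeries.X ^ (n + 1) ∣ u) :
    PowerSeries.coeff n u = 0 :=
  PowerSeries.X_pow_dvd_iff.1 hu n (Nat.lt_succ_self n)

/-- How the defect of commutativity depends on the leading coefficient of a perturbation. -/
theorem coeff_defect_sub (hf : PowerSeries.constantCoeff f = 0)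
    (hg : PowerSeries.constantCoeff g = 0) {h k : PowerSeries R}
    (hh : PowerSeries.constantCoeff h = 0) (hk : PowerSeries.constantCoeff k = 0) {n : ℕ}
    (hhk : PowerSeries.X ^ n ∣ h - k) :
    PowerSeries.X ^ n ∣ ((subst h g : PowerSeries R) - subst f (PowerSeries.map φ h)) -
      (subst k g - subst f (PowerSeries.map φ k)) ∧
    PowerSeries.coeff n (((subst h g : PowerSeries R) - subst f (PowerSeries.map φ h)) -
      (subst k g - subst f (PowerSeries.map φ k))) =
      PowerSeries.coeff 1 g * PowerSeries.coeff n (h - k) -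
        φ (PowerSeries.coeff n (h - k)) * PowerSeries.coeff 1 f ^ n := by
  obtain ⟨d, hd⟩ := hhk
  have hdn : PowerSeries.coeff n (h - k) = PowerSeries.constantCoeff d := by
    rw [hd]; simpa using PowerSeries.coeff_X_pow_mul d n 0
  obtain ⟨g', rfl⟩ := X_dvd_of_zero hg
  -- With `g = X g'` the difference is `(h - k) g'(h) + k (g'(h) - g'(k))`. The second summand is
  -- divisible by `X ^ (n + 1)` since `k` has no constant term, so only the first affects the `n`-th
  -- coefficient.
  have e1 : (subst h (PowerSeries.X * g') : PowerSeries R) - subst k (PowerSeries.X * g') =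
      PowerSeries.X ^ n * (d * subst h g') + k * (subst h g' - subst k g') := by
    have h1 := hasSubst_of_zero hh
    have h2 := hasSubst_of_zero hk
    rw [PowerSeries.subst_mul h1, PowerSeries.subst_mul h2, PowerSeries.subst_X h1,
      PowerSeries.subst_X h2, ← mul_assoc, ← hd]
    ring
  have e2 : (subst f (PowerSeries.map φ h) : PowerSeries R) - subst f (PowerSeries.map φ k) =
      f ^ n * subst f (PowerSeries.map φ d) := by
    have h1 := hasSubst_of_zero hf
    rw [← PowerSeries.subst_sub h1, ← map_sub, hd, map_mul, map_pow, PowerSeries.map_X,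
      PowerSeries.subst_mul h1, PowerSeries.subst_pow h1, PowerSeries.subst_X h1]
  obtain ⟨k', hk'⟩ := X_dvd_of_zero hk
  obtain ⟨f', rfl⟩ := X_dvd_of_zero hf
  obtain ⟨s, hs⟩ := X_pow_dvd_subst_sub hh hk g' ⟨d, hd⟩
  have e3 : ((subst h (PowerSeries.X * g') : PowerSeries R) -
      subst (PowerSeries.X * f') (PowerSeries.map φ h)) -
      (subst k (PowerSeries.X * g') - subst (PowerSeries.X * f') (PowerSeries.map φ k)) =
      PowerSeries.X ^ n * (d * subst h g' + PowerSeries.X * (k' * s) -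
        f' ^ n * subst (PowerSeries.X * f') (PowerSeries.map φ d)) := by
    rw [sub_sub_sub_comm, e1, e2, hs, hk']
    ring
  have hc : ∀ {u r : PowerSeries R}, PowerSeries.constantCoeff u = 0 →
      PowerSeries.constantCoeff (subst u r : PowerSeries R) = PowerSeries.constantCoeff r := by
    intro u r hu
    obtain ⟨s, hs⟩ := subst_eq_trunc_add hu 1 r
    rw [hs, PowerSeries.trunc_one_left]
    simp [hu]
  refine ⟨e3 ▸ dvd_mul_right _ _, ?_⟩
  have e4 := PowerSeries.coeff_X_pow_mul (d * subst h g' + PowerSeries.X * (k' * s) -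
        f' ^ n * subst (PowerSeries.X * f') (PowerSeries.map φ d)) n 0
  rw [zero_add] at e4
  rw [e3, e4, hdn, PowerSeries.coeff_zero_eq_constantCoeff_apply]
  have hφd : PowerSeries.constantCoeff (PowerSeries.map φ d) =
      φ (PowerSeries.constantCoeff d) := by
    rw [← PowerSeries.coeff_zero_eq_constantCoeff_apply, PowerSeries.coeff_map,
      PowerSeries.coeff_zero_eq_constantCoeff_apply]
  have c1 : ∀ u : PowerSeries R, PowerSeries.coeff 1 (PowerSeries.X * u) =
      PowerSeries.constantCoeff u := fun u ↦ by
    simp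
  simp only [map_sub, map_add, map_mul, map_pow, hc hh, hc hf, PowerSeries.constantCoeff_X,
    zero_mul, add_zero, hφd, c1]
  ring

/-- Unique solvability of the linear equation for the `n`-th coefficient. -/
theorem IsFrobeniusLift.existsUnique_coeff (H : IsFrobeniusLift φ ϖ q) {a b e : R}
    (ha : Associated ϖ a) (hb : ϖ ∣ b) (he : ϖ ∣ e) {n : ℕ} (hn : 2 ≤ n) :
    ∃! c, a * c - φ c * b ^ n = e := by
  obtain ⟨u, rfl⟩ := ha
  obtain ⟨b', rfl⟩ := hb
  obtain ⟨e', rfl⟩ := he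
  obtain ⟨n, rfl⟩ := Nat.exists_eq_add_of_le' hn
  -- Since the exponent is at least 2, dividing the equation by `ϖ` leaves the coefficient of `φ c`
  -- still divisible by `ϖ`. This is the shape in which the equation is assumed uniquely solvable.
  obtain ⟨c, hc, huniq⟩ := H.existsUnique (↑u⁻¹ * e') (↑u⁻¹ * (b' * (ϖ * b') ^ (n + 1)))
    (by rw [pow_succ]; exact ⟨↑u⁻¹ * (b' * ((ϖ * b') ^ n * b')), by ring⟩)
  have key : ∀ c, c = ↑u⁻¹ * e' + ↑u⁻¹ * (b' * (ϖ * b') ^ (n + 1)) * φ c ↔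
      ϖ * ↑u * c - φ c * (ϖ * b') ^ (n + 2) = ϖ * e' := by
    intro c
    constructor
    · intro h
      have h' : (u : R) * c = e' + b' * (ϖ * b') ^ (n + 1) * φ c := by
        conv_lhs => rw [h]
        rw [mul_assoc, ← mul_add, Units.mul_inv_cancel_left]
      linear_combination ϖ * h'
    · intro h
      have h' : (u : R) * c - (e' + b' * (ϖ * b') ^ (n + 1) * φ c) = 0 :=
        H.regular _ (by linear_combination h)
      rw [mul_assoc, ← mul_add, ← sub_eq_zero.1 h', Units.inv_mul_cancel_left]
  exact ⟨c, (key c).1 hc, fun y hy ↦ huniq y ((key y).2 hy)⟩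

/-- The coefficients in degrees 0 and 1 are prescribed. If two solutions agree below degree `i ≥ 2`,
the difference of their `i`-th coefficients solves the homogeneous linear equation, whose only
solution is zero. -/
theorem IsBracketSeries.unique (H : IsFrobeniusLift φ ϖ q) (hf : IsFrobeniusSeries ϖ q f)
    (hg : IsFrobeniusSeries ϖ q g) {θ : R} {h k : PowerSeries R}
    (hh : IsBracketSeries φ f g θ h) (hk : IsBracketSeries φ f g θ k) : h = k := by
  suffices ∀ n, PowerSeries.X ^ n ∣ h - k by
    rw [← sub_eq_zero]
    ext n
    exact coeff_of_X_pow_dvd (this (n + 1))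
  intro n
  induction n with
  | zero => simp
  | succ n ih =>
    rw [PowerSeries.X_pow_dvd_iff]
    intro i hi
    rcases Nat.lt_succ_iff_lt_or_eq.1 hi with hi | rfl
    · exact PowerSeries.X_pow_dvd_iff.1 ih i hi
    rcases Nat.lt_or_ge i 2 with hi2 | hi2
    · interval_cases i
      · simp [hh.zero, hk.zero]
      · simp [hh.one, hk.one]
    obtain ⟨-, h2⟩ := coeff_defect_sub (φ := φ) hf.zero hg.zero hh.zero hk.zero
      ih
    rw [hh.comm, hk.comm, sub_self, sub_self, sub_self, map_zero] at h2
    exact (H.existsUnique_coeff hg.one hf.one.dvd (dvd_zero ϖ) hi2).unique h2.symm (by simp)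

/-- Successive approximation: `hθ` makes `θ X` a solution modulo degree 2, and in each later degree
one coefficient is corrected. The linear equation for it is solvable because the defect is divisible
by `ϖ`. -/
theorem IsBracketSeries.exists (H : IsFrobeniusLift φ ϖ q) (hf : IsFrobeniusSeries ϖ q f)
    (hg : IsFrobeniusSeries ϖ q g) {θ : R}
    (hθ : PowerSeries.coeff 1 g * θ = φ θ * PowerSeries.coeff 1 f) :
    ∃ h, IsBracketSeries φ f g θ h := by
  let Δ : PowerSeries R → PowerSeries R := fun h ↦ subst h g - subst f (PowerSeries.map φ h)
  -- The premises stand under the existential so that the correction can be chosen as a total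
  -- function of `n` and `h`; it is 0 when they fail.
  have step : ∀ (n : ℕ) (h : PowerSeries R), ∃ c : R, PowerSeries.constantCoeff h = 0 →
      PowerSeries.X ^ (n + 2) ∣ Δ h →
      PowerSeries.X ^ (n + 3) ∣ Δ (h + PowerSeries.C c * PowerSeries.X ^ (n + 2)) := by
    intro n h
    by_cases h0 : PowerSeries.constantCoeff h = 0
    swap
    · exact ⟨0, fun h ↦ (h0 h).elim⟩
    by_cases hΔ : PowerSeries.X ^ (n + 2) ∣ Δ h
    swap
    · exact ⟨0, fun _ h ↦ (hΔ h).elim⟩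
    obtain ⟨c, hc, -⟩ := H.existsUnique_coeff hg.one hf.one.dvd
      ((dvd_neg.2 (dvd_coeff_subst_sub H hf hg h0 (n + 2)))) (by omega : 2 ≤ n + 2)
    refine ⟨c, fun _ _ ↦ ?_⟩
    have h1 : h + PowerSeries.C c * PowerSeries.X ^ (n + 2) - h =
      PowerSeries.X ^ (n + 2) * PowerSeries.C c := by ring
    have h0' : PowerSeries.constantCoeff (h + PowerSeries.C c * PowerSeries.X ^ (n + 2)) = 0 := by
      simp [h0]
    obtain ⟨k1, k2⟩ := coeff_defect_sub (φ := φ) hf.zero hg.zero h0' h0 ⟨_, h1⟩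
    have hcc : PowerSeries.coeff (n + 2) (h + PowerSeries.C c * PowerSeries.X ^ (n + 2) - h) =
        c := by
      rw [h1]; simp
    rw [hcc, hc] at k2
    have k3 : PowerSeries.X ^ (n + 2) ∣ Δ (h + PowerSeries.C c * PowerSeries.X ^ (n + 2)) := by
      have := dvd_add k1 hΔ
      simpa [Δ] using this
    rw [PowerSeries.X_pow_dvd_iff] at k3 ⊢
    intro i hi
    rcases Nat.lt_succ_iff_lt_or_eq.1 hi with hi | rfl
    · exact k3 i hi
    rw [map_sub, sub_eq_iff_eq_add] at k2
    rw [k2]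
    simp
  choose c hc using step
  let G : ℕ → PowerSeries R := fun n ↦ Nat.rec (PowerSeries.C θ * PowerSeries.X)
    (fun n h ↦ h + PowerSeries.C (c n h) * PowerSeries.X ^ (n + 2)) n
  have hGs : ∀ n, G (n + 1) = G n + PowerSeries.C (c n (G n)) * PowerSeries.X ^ (n + 2) :=
    fun n ↦ rfl
  have hG0 : ∀ n, PowerSeries.constantCoeff (G n) = 0 := by
    intro n
    induction n with
    | zero => simp [G]
    | succ n ih => simp [hGs, ih]
  have hGΔ : ∀ n, PowerSeries.X ^ (n + 2) ∣ Δ (G n) := by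
    intro n
    induction n with
    | zero =>
      rw [PowerSeries.X_pow_dvd_iff]
      have z := hG0 0
      intro i hi
      interval_cases i
      · simp [Δ, constantCoeff_subst_of_zero z hg.zero,
          constantCoeff_subst_of_zero hf.zero (constantCoeff_map_of_zero φ z)]
      · simp only [Δ, map_sub]
        rw [coeff_one_subst z hg.zero, coeff_one_subst hf.zero (constantCoeff_map_of_zero φ z)]
        have : PowerSeries.coeff 1 (G 0) = θ := by
          simp [G]
        rw [PowerSeries.coeff_map, this, hθ, sub_self]
    | succ n ih => exact hc n (G n) (hG0 n) ih
  have hGd : ∀ n m, PowerSeries.X ^ (n + 2) ∣ G (n + m) - G n := by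
    intro n m
    induction m with
    | zero => simp
    | succ m ih =>
      rw [← add_assoc, hGs, add_sub_right_comm]
      refine dvd_add ih ((pow_dvd_pow _ (by omega)).mul_left _)
  -- The `n`-th coefficient no longer changes from `G n` on, because `G (n + m)` agrees with `G n`
  -- modulo `X ^ (n + 2)`.
  let h : PowerSeries R := PowerSeries.mk fun n ↦ PowerSeries.coeff n (G n)
  have hh : ∀ n, PowerSeries.X ^ (n + 1) ∣ h - G n := by
    intro n
    rw [PowerSeries.X_pow_dvd_iff]
    intro i hi
    obtain ⟨m, rfl⟩ := Nat.exists_eq_add_of_le (Nat.lt_succ_iff.1 hi)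
    have := PowerSeries.X_pow_dvd_iff.1 (hGd i m) i (by omega)
    rw [map_sub, sub_eq_zero] at this
    simp [h, this]
  have h0 : PowerSeries.constantCoeff h = 0 := by
    rw [← PowerSeries.coeff_zero_eq_constantCoeff_apply]
    simp [h, hG0]
  refine ⟨h, h0, ?_, ?_⟩
  · have h1 : PowerSeries.coeff 1 h = PowerSeries.coeff 1 (G 1) := by simp [h]
    have h2 := PowerSeries.X_pow_dvd_iff.1 (hGd 0 1) 1 (by omega)
    rw [zero_add, map_sub, sub_eq_zero] at h2
    rw [h1, h2]
    simp [G]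
  · rw [← sub_eq_zero]
    ext n
    obtain ⟨k1, -⟩ := coeff_defect_sub (φ := φ) hf.zero hg.zero h0 (hG0 n) (hh n)
    have := dvd_add k1 ((pow_dvd_pow _ (by omega)).trans (hGΔ n))
    simp only [Δ, sub_add_cancel] at this
    exact coeff_of_X_pow_dvd this

/-- Move `f₃` past `k`, then `f₂` past `h`; the twists by `φ` accumulate to the twist of the
composite. -/
theorem IsBracketSeries.comp {f₁ f₂ f₃ : PowerSeries R} {θ η : R} {h k : PowerSeries R}
    (hf₁ : PowerSeries.constantCoeff f₁ = 0)
    (hh : IsBracketSeries φ f₁ f₂ θ h) (hk : IsBracketSeries φ f₂ f₃ η k)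
    (hf₂ : PowerSeries.constantCoeff f₂ = 0) :
    IsBracketSeries φ f₁ f₃ (η * θ) (subst h k) := by
  refine ⟨constantCoeff_subst_of_zero hh.zero hk.zero, ?_, ?_⟩
  · rw [coeff_one_subst hh.zero hk.zero, hh.one, hk.one]
  · have a1 := hasSubst_of_zero hh.zero
    have a2 := hasSubst_of_zero hk.zero
    have a3 := hasSubst_of_zero hf₁
    have a4 := hasSubst_of_zero hf₂
    have a5 := hasSubst_of_zero (constantCoeff_map_of_zero φ hh.zero)
    rw [← PowerSeries.subst_comp_subst_apply a2 a1, hk.comm,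
      PowerSeries.subst_comp_subst_apply a4 a1, hh.comm, map_subst_of_zero φ hh.zero,
      PowerSeries.subst_comp_subst_apply a5 a3]

theorem IsBracketSeries.X (hf : PowerSeries.constantCoeff f = 0) :
    IsBracketSeries φ f f 1 PowerSeries.X := by
  refine ⟨by simp, by simp, ?_⟩
  rw [PowerSeries.map_X, PowerSeries.subst_X (hasSubst_of_zero hf)]
  exact PowerSeries.X_subst f

theorem IsBracketSeries.map {S : Type*} [CommRing S] {ψ : S →+* S} (i : R →+* S)
    (hi : ∀ a, i (φ a) = ψ (i a)) {θ : R} {h : PowerSeries R}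
    (hf : PowerSeries.constantCoeff f = 0) (hh : IsBracketSeries φ f g θ h) :
    IsBracketSeries ψ (PowerSeries.map i f) (PowerSeries.map i g) (i θ) (PowerSeries.map i h) := by
  refine ⟨constantCoeff_map_of_zero i hh.zero, by rw [PowerSeries.coeff_map, hh.one], ?_⟩
  rw [← map_subst_of_zero i hh.zero, hh.comm, map_subst_of_zero i hf]
  congr 1
  ext n
  simp [hi]

end Bracket

/-! ### Evaluation of power series in a complete ultrametric field -/

section Eval

variable {Λ : Type*} [NormedField Λ] [CompleteSpace Λ] [IsUltrametricDist Λ]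
  {S : Type*} [CommRing S] {i : S →+* Λ} {α : Λ}

/-- The value at `α` of a power series over `S`, with coefficients read in `Λ`. -/
def evalSeries (i : S →+* Λ) (α : Λ) (g : PowerSeries S) : Λ :=
  ∑' n, i (PowerSeries.coeff n g) * α ^ n

theorem summable_norm_evalSeries (hi : ∀ a, ‖i a‖ ≤ 1) (hα : ‖α‖ < 1) (g : PowerSeries S) :
    Summable fun n ↦ ‖i (PowerSeries.coeff n g) * α ^ n‖ := by
  refine Summable.of_nonneg_of_le (fun _ ↦ norm_nonneg _) (fun n ↦ ?_)
    (summable_geometric_of_lt_one (norm_nonneg α) hα)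
  rw [norm_mul, norm_pow]
  exact mul_le_of_le_one_left (by positivity) (hi _)

theorem summable_evalSeries (hi : ∀ a, ‖i a‖ ≤ 1) (hα : ‖α‖ < 1) (g : PowerSeries S) :
    Summable fun n ↦ i (PowerSeries.coeff n g) * α ^ n :=
  (summable_norm_evalSeries hi hα g).of_norm

theorem evalSeries_coe (p : S[X]) : evalSeries i α (p : PowerSeries S) = p.eval₂ i α := by
  rw [evalSeries, tsum_eq_sum (s := p.support), eval₂_eq_sum, Polynomial.sum]
  · simp
  · intro n hn
    simp [Polynomial.notMem_support_iff.1 hn]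

theorem evalSeries_map {T : Type*} [CommRing T] (j : T →+* S) (g : PowerSeries T) :
    evalSeries i α (PowerSeries.map j g) = evalSeries (i.comp j) α g := by
  simp [evalSeries]

/-- Evaluation of power series as a ring homomorphism. -/
def evalSeriesHom (hi : ∀ a, ‖i a‖ ≤ 1) (hα : ‖α‖ < 1) : PowerSeries S →+* Λ where
  toFun := evalSeries i α
  map_zero' := by simp [evalSeries]
  map_one' := by simpa using evalSeries_coe (i := i) (α := α) (1 : S[X])
  map_add' g h := by
    simp only [evalSeries, map_add, add_mul]
    exact (summable_evalSeries hi hα g).tsum_add (summable_evalSeries hi hα h)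
  map_mul' g h := by
    simp only [evalSeries]
    rw [tsum_mul_tsum_eq_tsum_sum_antidiagonal_of_summable_norm
      (summable_norm_evalSeries hi hα g) (summable_norm_evalSeries hi hα h)]
    refine tsum_congr fun n ↦ ?_
    rw [PowerSeries.coeff_mul, map_sum, Finset.sum_mul]
    refine Finset.sum_congr rfl fun x hx ↦ ?_
    rw [← Finset.HasAntidiagonal.mem_antidiagonal.1 hx, map_mul, pow_add]
    ring

theorem evalSeriesHom_apply (hi : ∀ a, ‖i a‖ ≤ 1) (hα : ‖α‖ < 1) (g : PowerSeries S) :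
    evalSeriesHom hi hα g = evalSeries i α g := rfl

theorem norm_evalSeries_le_one (hi : ∀ a, ‖i a‖ ≤ 1) (hα : ‖α‖ < 1) (g : PowerSeries S) :
    ‖evalSeries i α g‖ ≤ 1 := by
  refine IsUltrametricDist.norm_tsum_le_of_forall_le_of_nonneg zero_le_one fun n ↦ ?_
  rw [norm_mul, norm_pow]
  exact mul_le_one₀ (hi _) (by positivity) (pow_le_one₀ (norm_nonneg _) hα.le)

theorem evalSeries_X : evalSeries i α PowerSeries.X = α := by
  simpa using evalSeries_coe (i := i) (α := α) (X : S[X])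

/-- The tail is `α ^ n` times the value of the shifted series, which lies in the unit ball. All
later comparisons of values go through this bound on truncations, so no double series is rearranged.
-/
theorem evalSeries_eq_add (hi : ∀ a, ‖i a‖ ≤ 1) (hα : ‖α‖ < 1) (g : PowerSeries S) (n : ℕ) :
    ∃ c : Λ, ‖c‖ ≤ 1 ∧
      evalSeries i α g = (PowerSeries.trunc n g).eval₂ i α + α ^ n * c := by
  refine ⟨_, norm_evalSeries_le_one hi hα (PowerSeries.mk fun k ↦ PowerSeries.coeff (k + n) g), ?_⟩
  rw [← evalSeriesHom_apply hi hα, ← evalSeriesHom_apply hi hα]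
  conv_lhs => rw [PowerSeries.eq_X_pow_mul_shift_add_trunc n g, map_add, map_mul, map_pow,
    evalSeriesHom_apply hi hα (PowerSeries.trunc n g : PowerSeries S), evalSeries_coe,
    evalSeriesHom_apply hi hα PowerSeries.X, evalSeries_X, add_comm]

theorem norm_evalSeries_sub_le (hi : ∀ a, ‖i a‖ ≤ 1) (hα : ‖α‖ < 1) (g : PowerSeries S) (n : ℕ) :
    ‖evalSeries i α g - (PowerSeries.trunc n g).eval₂ i α‖ ≤ ‖α‖ ^ n := by
  obtain ⟨c, hc, h⟩ := evalSeries_eq_add hi hα g n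
  rw [h, add_sub_cancel_left, norm_mul, norm_pow]
  exact mul_le_of_le_one_right (by positivity) hc

theorem norm_evalSeries_le (hi : ∀ a, ‖i a‖ ≤ 1) (hα : ‖α‖ < 1) {g : PowerSeries S}
    (hg : PowerSeries.constantCoeff g = 0) : ‖evalSeries i α g‖ ≤ ‖α‖ := by
  have := norm_evalSeries_sub_le hi hα g 1
  simpa [PowerSeries.trunc_one_left, hg] using this

theorem norm_sub_le_max' (a b : Λ) : ‖a - b‖ ≤ max ‖a‖ ‖b‖ := by
  simpa [sub_eq_add_neg] using IsUltrametricDist.norm_add_le_max a (-b)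

theorem eq_of_forall_norm_sub_le {r : ℝ} {a b : Λ} (hr0 : 0 ≤ r) (hr : r < 1)
    (h : ∀ n : ℕ, ‖a - b‖ ≤ r ^ n) : a = b := by
  rw [← sub_eq_zero, ← norm_le_zero_iff]
  exact ge_of_tendsto' (tendsto_pow_atTop_nhds_zero_of_lt_one hr0 hr) h

/-- Both sides equal the value of the same truncation of `g` up to a multiple of the `n`-th power of
`evalSeries i α h`, and that element has norm below 1. -/
theorem evalSeries_subst (hi : ∀ a, ‖i a‖ ≤ 1) (hα : ‖α‖ < 1) {h : PowerSeries S}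
    (hh : PowerSeries.constantCoeff h = 0) (g : PowerSeries S) :
    evalSeries i α (PowerSeries.subst h g) = evalSeries i (evalSeries i α h) g := by
  have hβ := (norm_evalSeries_le hi hα hh).trans_lt hα
  refine eq_of_forall_norm_sub_le (norm_nonneg _) hβ fun n ↦ ?_
  obtain ⟨s, hs⟩ := subst_eq_trunc_add hh n g
  have h1 : evalSeries i α (PowerSeries.subst h g) =
      (PowerSeries.trunc n g).eval₂ i (evalSeries i α h) +
        evalSeries i α h ^ n * evalSeries i α (PowerSeries.subst h s) := by
    rw [hs, ← evalSeriesHom_apply hi hα, map_add, map_mul, map_pow]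
    simp only [evalSeriesHom_apply]
    congr 1
    rw [← evalSeriesHom_apply hi hα, aeval_def, hom_eval₂]
    congr 1
    ext a
    have := evalSeries_coe (i := i) (α := α) (Polynomial.C a)
    simpa [evalSeriesHom_apply] using this
  obtain ⟨c, hc, h2⟩ := evalSeries_eq_add hi hβ g n
  rw [h1, h2, add_sub_add_left_eq_sub, ← mul_sub, norm_mul, norm_pow]
  refine mul_le_of_le_one_right (by positivity) ?_
  exact (norm_sub_le_max' _ _).trans
    (max_le (norm_evalSeries_le_one hi hα _) hc)

theorem map_evalSeries (s : Λ →+* Λ) (hs : ∀ x, ‖s x‖ = ‖x‖) (hi : ∀ a, ‖i a‖ ≤ 1)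
    (hα : ‖α‖ < 1) (g : PowerSeries S) :
    s (evalSeries i α g) = evalSeries (s.comp i) (s α) g := by
  refine eq_of_forall_norm_sub_le (norm_nonneg _) hα fun n ↦ ?_
  have h1 := norm_evalSeries_sub_le hi hα g n
  have h2 := norm_evalSeries_sub_le (i := s.comp i) (α := s α) (fun a ↦ by simpa [hs] using hi a)
    (by rwa [hs]) g n
  rw [hs] at h2
  rw [← hs, map_sub, hom_eval₂] at h1
  rw [← sub_sub_sub_cancel_right _ _ ((PowerSeries.trunc n g).eval₂ (s.comp i) (s α))]
  exact (norm_sub_le_max' _ _).trans (max_le h1 h2)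

variable (Λ) in
/-- The closed unit ball of `Λ`. -/
def unitBall : Subring Λ where
  carrier := {x | ‖x‖ ≤ 1}
  mul_mem' {a b} ha hb := by
    simpa using mul_le_one₀ (Set.mem_ofPred.1 ha) (norm_nonneg b) (Set.mem_ofPred.1 hb)
  one_mem' := by simp
  add_mem' {a b} ha hb := (IsUltrametricDist.norm_add_le_max a b).trans (max_le ha hb)
  zero_mem' := by simp
  neg_mem' {a} ha := by simpa using ha

theorem norm_unitBall_le (a : unitBall Λ) : ‖(unitBall Λ).subtype a‖ ≤ 1 := a.2

/-- The factor theorem for power series over the unit ball. -/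
theorem exists_eq_X_sub_C_mul (hα : ‖α‖ < 1) {g : PowerSeries (unitBall Λ)}
    (h : evalSeries (unitBall Λ).subtype α g = 0) :
    ∃ k : PowerSeries (unitBall Λ),
      g = (PowerSeries.X - PowerSeries.C (⟨α, hα.le⟩ : unitBall Λ)) * k := by
  let sh : ℕ → PowerSeries (unitBall Λ) := fun n ↦
    PowerSeries.mk fun m ↦ PowerSeries.coeff (m + n) g
  -- The values of the shifted series satisfy `v n = g_n + α v (n + 1)`, with `v 0` the value of
  -- `g`. When that vanishes, the `v (n + 1)` are the coefficients of the quotient by `X - α`.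
  let v : ℕ → unitBall Λ := fun n ↦
    ⟨evalSeries (unitBall Λ).subtype α (sh n), norm_evalSeries_le_one norm_unitBall_le hα _⟩
  have hv : ∀ n, v n = PowerSeries.coeff n g + ⟨α, hα.le⟩ * v (n + 1) := by
    intro n
    ext
    have e : sh n = PowerSeries.C (PowerSeries.coeff n g) + PowerSeries.X * sh (n + 1) := by
      ext m
      rcases m with _ | m
      · simp [sh]
      · simp [sh, PowerSeries.coeff_succ_X_mul, add_assoc, add_comm 1 n]
    have e2 := evalSeries_coe (i := (unitBall Λ).subtype) (α := α)
      (Polynomial.C (PowerSeries.coeff n g))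
    change evalSeries _ α (sh n) =
      ((PowerSeries.coeff n g : unitBall Λ) : Λ) + α * evalSeries _ α (sh (n + 1))
    rw [e, ← evalSeriesHom_apply norm_unitBall_le hα, map_add, map_mul]
    simp only [evalSeriesHom_apply, evalSeries_X]
    rw [coe_C, eval₂_C] at e2
    rw [e2]
    rfl
  have h0 : v 0 = 0 := by
    have e : sh 0 = g := by
      ext m
      simp [sh]
    ext
    change evalSeries _ α (sh 0) = 0
    rw [e, h]
  refine ⟨PowerSeries.mk fun n ↦ v (n + 1), ?_⟩
  ext n
  rw [sub_mul, map_sub]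
  rcases n with _ | n
  · have := hv 0
    rw [h0] at this
    rw [eq_neg_of_add_eq_zero_left this.symm]
    simp
  · rw [PowerSeries.coeff_succ_X_mul, PowerSeries.coeff_C_mul, PowerSeries.coeff_mk,
      PowerSeries.coeff_mk, hv (n + 1)]
    simp

/-- A power series over the unit ball that vanishes on a finite set of points is divisible by the
corresponding product of linear factors. -/
theorem exists_eq_prod_mul (s : Finset Λ) (hs : ∀ β ∈ s, ‖β‖ < 1)
    (g : PowerSeries (unitBall Λ)) (h : ∀ β ∈ s, evalSeries (unitBall Λ).subtype β g = 0) :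
    ∃ k : PowerSeries (unitBall Λ), PowerSeries.map (unitBall Λ).subtype g =
      ((∏ β ∈ s, (X - Polynomial.C β) : Λ[X]) : PowerSeries Λ) *
        PowerSeries.map (unitBall Λ).subtype k := by
  classical
  induction s using Finset.induction_on generalizing g with
  | empty => exact ⟨g, by simp⟩
  | insert β s hβ ih =>
    obtain ⟨k, hk⟩ := exists_eq_X_sub_C_mul (hs β (by simp)) (h β (by simp))
    obtain ⟨l, hl⟩ := ih (fun γ hγ ↦ hs γ (by simp [hγ])) k fun γ hγ ↦ by
      have h1 := h γ (by simp [hγ])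
      have hγ1 := hs γ (by simp [hγ])
      rw [hk, ← evalSeriesHom_apply norm_unitBall_le hγ1, map_mul, map_sub, mul_eq_zero] at h1
      refine h1.resolve_left fun h2 ↦ hβ ?_
      have e2 := evalSeries_coe (i := (unitBall Λ).subtype) (α := γ)
        (Polynomial.C (⟨β, (hs β (by simp)).le⟩ : unitBall Λ))
      rw [coe_C, eval₂_C] at e2
      rw [evalSeriesHom_apply, evalSeriesHom_apply, evalSeries_X, e2, sub_eq_zero] at h2
      have : γ = β := h2
      rwa [← this]
    refine ⟨l, ?_⟩
    rw [hk, map_mul, hl, Finset.prod_insert hβ]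
    simp [mul_assoc]

end Eval

/-! ### Local fields inside the completion of a separable closure -/

section Residue

variable (Λ : Type*) [NormedField Λ] [IsUltrametricDist Λ]

/-- The open unit ball as an ideal of the closed unit ball. -/
def ballIdeal : Ideal (unitBall Λ) where
  carrier := {x | ‖(x : Λ)‖ < 1}
  add_mem' {a b} ha hb := (IsUltrametricDist.norm_add_le_max (a : Λ) b).trans_lt (max_lt ha hb)
  zero_mem' := by simp
  smul_mem' a b hb := by
    simp only [Set.mem_ofPred_eq, smul_eq_mul, Subring.coe_mul, norm_mul] at hb ⊢
    exact (mul_le_of_le_one_left (norm_nonneg _) a.2).trans_lt hb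

variable {Λ}

theorem mem_ballIdeal {x : unitBall Λ} : x ∈ ballIdeal Λ ↔ ‖(x : Λ)‖ < 1 := Iff.rfl

theorem isUnit_unitBall {x : unitBall Λ} (hx : ‖(x : Λ)‖ = 1) : IsUnit x := by
  have hx0 : (x : Λ) ≠ 0 := fun h ↦ by simp [h] at hx
  exact IsUnit.of_mul_eq_one ⟨(x : Λ)⁻¹, by simp [unitBall, hx]⟩ (Subtype.ext (mul_inv_cancel₀ hx0))

instance : (ballIdeal Λ).IsMaximal := by
  rw [Ideal.isMaximal_iff]
  refine ⟨by simp [mem_ballIdeal], fun J x _ hx hJ ↦ ?_⟩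
  have : IsUnit x := isUnit_unitBall (le_antisymm x.2 (not_lt.1 hx))
  rw [Ideal.eq_top_of_isUnit_mem J hJ this]
  exact Submodule.mem_top

variable (Λ) in
/-- The residue field of `Λ`. -/
abbrev Residue : Type _ := unitBall Λ ⧸ ballIdeal Λ

instance : Field (Residue Λ) := Ideal.Quotient.field _

/-- The residue class of an element of the unit ball. -/
abbrev residue : unitBall Λ →+* Residue Λ := Ideal.Quotient.mk _

theorem residue_eq_iff {x y : unitBall Λ} : residue x = residue y ↔ ‖(x : Λ) - y‖ < 1 := by
  rw [Ideal.Quotient.eq, mem_ballIdeal]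
  rfl

theorem residue_eq_zero_iff {x : unitBall Λ} : residue x = 0 ↔ ‖(x : Λ)‖ < 1 := by
  rw [Ideal.Quotient.eq_zero_iff_mem, mem_ballIdeal]

end Residue

section Setup

variable (A F Ω Λ : Type*) [CommRing A] [Field F] [Algebra A F] [Field Ω] [Algebra F Ω]
  [Algebra A Ω] [NormedField Λ] [Algebra Ω Λ]

/-- `Λ` carries an absolute value that makes it a completion of the algebraic extension `Ω` of
the local field `F` with ring of integers `A`. -/
class LocalCompletion : Prop where
  norm_le_one_iff : ∀ x : Ω, ‖algebraMap Ω Λ x‖ ≤ 1 ↔ IsIntegral A x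
  isClosed_image : ∀ V : Submodule F Ω, FiniteDimensional F V → IsClosed (algebraMap Ω Λ '' V)
  exists_extension : ∀ σ : Ω ≃ₐ[F] Ω, ∃ s : Λ →+* Λ, (∀ x, ‖s x‖ = ‖x‖) ∧
    ∀ x, s (algebraMap Ω Λ x) = algebraMap Ω Λ (σ x)
  denseRange : DenseRange (algebraMap Ω Λ)

/-- The structure map from the ring of integers to the completion. -/
def emb : A →+* Λ := (algebraMap Ω Λ).comp (algebraMap A Ω)

/-- A uniformizer of a discrete valuation ring. -/
def unif [IsDomain A] [IsDiscreteValuationRing A] : A :=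
  (IsDiscreteValuationRing.exists_irreducible A).choose

theorem irreducible_unif [IsDomain A] [IsDiscreteValuationRing A] : Irreducible (unif A) :=
  (IsDiscreteValuationRing.exists_irreducible A).choose_spec

theorem resCard_eq [IsLocalRing A] : resCard A = Nat.card (IsLocalRing.ResidueField A) := by
  rw [resCard, maxIdeal_eq_maximalIdeal]
  rfl

end Setup

/-! ### Absolute values, residue classes and Teichmüller representatives -/

section Local

variable {A F Ω Λ : Type*} [CommRing A] [IsDomain A] [IsDiscreteValuationRing A]
  [Finite (IsLocalRing.ResidueField A)] [Field F] [Algebra A F] [IsFractionRing A F]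
  [Field Ω] [Algebra F Ω] [Algebra A Ω] [IsScalarTower A F Ω] [IsSepClosure F Ω]
  [NormedField Λ] [CompleteSpace Λ] [IsUltrametricDist Λ] [Algebra Ω Λ]

local notation "ι" => algebraMap Ω Λ
local notation "q" => resCard A

variable (A F) in
theorem norm_le_one_iff [LocalCompletion A F Ω Λ] (x : Ω) : ‖ι x‖ ≤ 1 ↔ IsIntegral A x :=
  LocalCompletion.norm_le_one_iff (F := F) x

variable (F) in
theorem norm_emb_le_one [LocalCompletion A F Ω Λ] (a : A) : ‖emb A Ω Λ a‖ ≤ 1 :=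
  (norm_le_one_iff A F _).2 isIntegral_algebraMap

theorem emb_eq (a : A) : emb A Ω Λ a = ι (algebraMap F Ω (algebraMap A F a)) := by
  rw [emb, RingHom.comp_apply, IsScalarTower.algebraMap_apply A F Ω]

theorem exists_algebraMap_eq [LocalCompletion A F Ω Λ] {x : F} (hx : ‖ι (algebraMap F Ω x)‖ ≤ 1) :
    ∃ a : A, algebraMap A F a = x := by
  rw [norm_le_one_iff A F, isIntegral_algebraMap_iff (algebraMap F Ω).injective] at hx
  exact IsIntegrallyClosed.isIntegral_iff.1 hx

variable (F) in
theorem emb_injective [LocalCompletion A F Ω Λ] : Function.Injective (emb A Ω Λ) := by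
  intro a b h
  rw [emb_eq (F := F), emb_eq (F := F)] at h
  exact IsFractionRing.injective A F ((algebraMap F Ω).injective ((algebraMap Ω Λ).injective h))

variable (F) in
theorem norm_emb_eq_one_iff [LocalCompletion A F Ω Λ] {a : A} : ‖emb A Ω Λ a‖ = 1 ↔ IsUnit a := by
  constructor
  · intro h
    have ha : a ≠ 0 := by rintro rfl; simp at h
    have ha' : algebraMap A F a ≠ 0 := by
      simpa using (IsFractionRing.injective A F).ne ha
    obtain ⟨b, hb⟩ := exists_algebraMap_eq (A := A) (Ω := Ω) (Λ := Λ) (x := (algebraMap A F a)⁻¹)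
      (by rw [map_inv₀, map_inv₀, ← emb_eq, norm_inv, h, inv_one])
    refine IsUnit.of_mul_eq_one b (IsFractionRing.injective A F ?_)
    rw [map_mul, hb, mul_inv_cancel₀ ha', map_one]
  · intro h
    obtain ⟨b, hb⟩ := h.exists_right_inv
    have h1 := norm_emb_le_one F (Ω := Ω) (Λ := Λ) a
    have h2 := norm_emb_le_one F (Ω := Ω) (Λ := Λ) b
    have h3 : ‖emb A Ω Λ a‖ * ‖emb A Ω Λ b‖ = 1 := by rw [← norm_mul, ← map_mul, hb]; simp
    refine le_antisymm h1 ?_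
    rw [← h3]
    exact mul_le_of_le_one_right (norm_nonneg _) h2

variable (F) in
theorem norm_emb_lt_one_iff [LocalCompletion A F Ω Λ] {a : A} :
    ‖emb A Ω Λ a‖ < 1 ↔ a ∈ IsLocalRing.maximalIdeal A := by
  rw [IsLocalRing.mem_maximalIdeal, mem_nonunits_iff, ← norm_emb_eq_one_iff F (Ω := Ω) (Λ := Λ)]
  exact ⟨fun h ↦ h.ne, fun h ↦ lt_of_le_of_ne (norm_emb_le_one F a) h⟩

variable (A Ω Λ) in
/-- The absolute value of a uniformizer. -/
def unifNorm : ℝ := ‖emb A Ω Λ (unif A)‖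

local notation "ρ" => unifNorm A Ω Λ

variable (F) in
theorem unifNorm_lt_one [LocalCompletion A F Ω Λ] : ρ < 1 :=
  (norm_emb_lt_one_iff F).2 ((IsLocalRing.mem_maximalIdeal _).2 (irreducible_unif A).not_isUnit)

variable (F) in
theorem unifNorm_pos [LocalCompletion A F Ω Λ] : 0 < ρ := by
  rw [unifNorm, norm_pos_iff]
  exact ((map_ne_zero_iff _ (emb_injective F)).2 (irreducible_unif A).ne_zero)

variable (F) in
theorem emb_unif_ne_zero [LocalCompletion A F Ω Λ] : emb A Ω Λ (unif A) ≠ 0 :=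
  norm_pos_iff.1 (unifNorm_pos F)

/-- Every nonzero element of `F` is a unit times a power of the uniformizer. -/
theorem exists_eq_unit_mul_zpow {x : F} (hx : x ≠ 0) :
    ∃ (u : Aˣ) (k : ℤ), x = algebraMap A F u * algebraMap A F (unif A) ^ k := by
  obtain ⟨a, b, hb, rfl⟩ := IsFractionRing.div_surjective A x
  have hinj := IsFractionRing.injective A F
  have ha : a ≠ 0 := by rintro rfl; simp at hx
  have hb : b ≠ 0 := nonZeroDivisors.ne_zero hb
  obtain ⟨m, u, rfl⟩ := IsDiscreteValuationRing.eq_unit_mul_pow_irreducible ha (irreducible_unif A)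
  obtain ⟨n, v, rfl⟩ := IsDiscreteValuationRing.eq_unit_mul_pow_irreducible hb (irreducible_unif A)
  have hϖ : algebraMap A F (unif A) ≠ 0 := by
    simpa using hinj.ne (irreducible_unif A).ne_zero
  have hv : algebraMap A F v ≠ 0 := by simp
  have hvi : algebraMap A F ↑v⁻¹ * algebraMap A F v = 1 := by rw [← map_mul]; simp
  refine ⟨u * v⁻¹, m - n, ?_⟩
  rw [zpow_sub₀ hϖ, zpow_natCast, zpow_natCast, map_mul, map_mul, map_pow, map_pow, Units.val_mul,
    map_mul, eq_inv_of_mul_eq_one_left hvi]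
  field_simp

theorem norm_unit_mul_zpow [LocalCompletion A F Ω Λ] (u : Aˣ) (k : ℤ) :
    ‖ι (algebraMap F Ω (algebraMap A F u * algebraMap A F (unif A) ^ k))‖ = ρ ^ k := by
  rw [map_mul, map_mul, map_zpow₀, map_zpow₀, ← emb_eq, ← emb_eq, norm_mul, norm_zpow,
    (norm_emb_eq_one_iff F).2 u.isUnit, one_mul]
  rfl

variable (A) in
theorem exists_norm_eq_zpow [LocalCompletion A F Ω Λ] {x : F} (hx : x ≠ 0) :
    ∃ k : ℤ, ‖ι (algebraMap F Ω x)‖ = ρ ^ k := by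
  obtain ⟨u, k, rfl⟩ := exists_eq_unit_mul_zpow (A := A) hx
  exact ⟨k, norm_unit_mul_zpow u k⟩

variable (F) in
theorem unifNorm_zpow_injective [LocalCompletion A F Ω Λ] : Function.Injective fun k : ℤ ↦ ρ ^ k :=
  zpow_right_injective₀ (unifNorm_pos F) (unifNorm_lt_one F).ne

theorem norm_galois [LocalCompletion A F Ω Λ] (σ : Ω ≃ₐ[F] Ω) (x : Ω) : ‖ι (σ x)‖ = ‖ι x‖ := by
  obtain ⟨s, hs, h⟩ := LocalCompletion.exists_extension (A := A) (Λ := Λ) σ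
  rw [← h, hs]

/-! #### The residue field -/

variable (F) in
/-- The structure map from the ring of integers to the unit ball. -/
def toBall [LocalCompletion A F Ω Λ] : A →+* unitBall Λ :=
  (emb A Ω Λ).codRestrict (unitBall Λ) (norm_emb_le_one F)

variable (A F Ω Λ) in
/-- The map of residue fields. -/
def residueMap [LocalCompletion A F Ω Λ] : IsLocalRing.ResidueField A →+* Residue Λ :=
  Ideal.Quotient.lift (IsLocalRing.maximalIdeal A) (residue.comp (toBall (Ω := Ω) F)) fun _ ha ↦
    residue_eq_zero_iff.2 ((norm_emb_lt_one_iff F).2 ha)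

variable (A) in
theorem exists_resCard_eq :
    ∃ p r : ℕ, p.Prime ∧ 1 ≤ r ∧ q = p ^ r ∧ CharP (IsLocalRing.ResidueField A) p := by
  have := Fintype.ofFinite (IsLocalRing.ResidueField A)
  obtain ⟨p, hp⟩ := CharP.exists (IsLocalRing.ResidueField A)
  obtain ⟨n, h1, h2⟩ := FiniteField.card (IsLocalRing.ResidueField A) p
  exact ⟨p, n, h1, n.2, by rw [resCard_eq, Nat.card_eq_fintype_card, h2], hp⟩

variable (A) in
theorem two_le_resCard : 2 ≤ q := by
  obtain ⟨p, r, hp, hr, h, -⟩ := exists_resCard_eq A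
  rw [h]
  exact hp.two_le.trans (Nat.le_self_pow (by omega) p)

variable (A) in
theorem resCard_ne_zero : q ≠ 0 := by have := two_le_resCard A; omega

variable (A) in
theorem one_lt_resCard_pow {n : ℕ} (hn : 1 ≤ n) : 1 < q ^ n :=
  Nat.one_lt_pow (by omega) (two_le_resCard A)

variable (A F Ω Λ) in
theorem exists_charP_residue [LocalCompletion A F Ω Λ] :
    ∃ p r : ℕ, p.Prime ∧ 1 ≤ r ∧ q = p ^ r ∧ CharP (Residue Λ) p := by
  obtain ⟨p, r, hp, hr, h, hc⟩ := exists_resCard_eq A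
  exact ⟨p, r, hp, hr, h, (RingHom.charP_iff _ (residueMap A F Ω Λ).injective p).1 hc⟩

variable (F Ω) in
theorem norm_resCard_lt_one [LocalCompletion A F Ω Λ] : ‖(q : Λ)‖ < 1 := by
  obtain ⟨p, r, hp, hr, h, hc⟩ := exists_charP_residue A F Ω Λ
  have : residue ((q : ℕ) : unitBall Λ) = 0 := by
    rw [map_natCast, h, Nat.cast_pow, CharP.cast_eq_zero, zero_pow (by omega)]
  simpa using residue_eq_zero_iff.1 this

/-- Raising to the `q`-th power contracts within residue classes. -/
theorem norm_pow_sub_pow_le {r : ℝ} (hr0 : ‖(q : Λ)‖ ≤ r) {x y : Λ} (hx : ‖x‖ ≤ 1) (hy : ‖y‖ ≤ 1)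
    (hr : ‖x - y‖ ≤ r) : ‖x ^ q - y ^ q‖ ≤ r * ‖x - y‖ := by
  rw [← geom_sum₂_mul, norm_mul]
  refine mul_le_mul_of_nonneg_right ?_ (norm_nonneg _)
  have hr' : 0 ≤ r := (norm_nonneg _).trans hr0
  -- Each of the `q` terms is compared with `y ^ (q - 1)`: the differences are small because `x` is
  -- close to `y`, and the main term is small because it carries the factor `q`.
  have e : ∑ i ∈ Finset.range q, x ^ i * y ^ (q - 1 - i) =
      ∑ i ∈ Finset.range q, (x ^ i - y ^ i) * y ^ (q - 1 - i) + q * y ^ (q - 1) := by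
    rw [← nsmul_eq_mul, ← Finset.card_range q, ← Finset.sum_const, Finset.card_range,
      ← Finset.sum_add_distrib]
    refine Finset.sum_congr rfl fun i hi ↦ ?_
    rw [Finset.mem_range] at hi
    rw [sub_mul, ← pow_add, show i + (q - 1 - i) = q - 1 by omega]
    ring
  rw [e]
  refine (IsUltrametricDist.norm_add_le_max _ _).trans (max_le ?_ ?_)
  · refine IsUltrametricDist.norm_sum_le_of_forall_le_of_nonneg hr' fun i _ ↦ ?_
    have h1 : ‖x ^ i - y ^ i‖ ≤ r := by
      rw [← geom_sum₂_mul, norm_mul]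
      refine (mul_le_of_le_one_left (norm_nonneg _) ?_).trans hr
      refine IsUltrametricDist.norm_sum_le_of_forall_le_of_nonneg zero_le_one fun j _ ↦ ?_
      rw [norm_mul, norm_pow, norm_pow]
      exact mul_le_one₀ (pow_le_one₀ (norm_nonneg _) hx) (by positivity)
        (pow_le_one₀ (norm_nonneg _) hy)
    rw [norm_mul, norm_pow]
    exact (mul_le_of_le_one_right (norm_nonneg _) (pow_le_one₀ (norm_nonneg _) hy)).trans h1
  · rw [norm_mul, norm_pow]
    exact (mul_le_of_le_one_right (norm_nonneg _) (pow_le_one₀ (norm_nonneg _) hy)).trans hr0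

theorem norm_le_one_of_pow_eq {x : Λ} {n : ℕ} (hn : 1 ≤ n) (h : x ^ q ^ n = x) : ‖x‖ ≤ 1 := by
  by_contra! hlt
  have h1 : ‖x‖ ^ q ^ n = ‖x‖ := by rw [← norm_pow, h]
  exact (lt_self_pow₀ hlt (one_lt_resCard_pow A hn)).ne h1.symm

variable (F Ω) in
/-- Distinct roots of `X ^ (q ^ n) - X` have distinct residue classes. -/
theorem eq_of_norm_sub_lt_one [LocalCompletion A F Ω Λ] {x y : Λ} {n : ℕ} (hn : 1 ≤ n)
    (hx : x ^ q ^ n = x)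
    (hy : y ^ q ^ n = y) (h : ‖x - y‖ < 1) : x = y := by
  have hx1 := norm_le_one_of_pow_eq hn hx
  have hy1 := norm_le_one_of_pow_eq hn hy
  set r := max ‖(q : Λ)‖ ‖x - y‖ with hr
  have hr1 : r < 1 := max_lt (norm_resCard_lt_one F Ω) h
  have hr0 : 0 ≤ r := (norm_nonneg _).trans (le_max_left _ _)
  -- Iterating the contraction up to `m = n` returns to `x - y` itself, so its norm is at most `r <
  -- 1` times itself.
  have key : ∀ m, 1 ≤ m → ‖x ^ q ^ m - y ^ q ^ m‖ ≤ r * ‖x - y‖ := by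
    intro m hm
    induction m, hm using Nat.le_induction with
    | base => simpa using norm_pow_sub_pow_le (le_max_left _ _) hx1 hy1 (le_max_right _ _)
    | succ m hm ih =>
      rw [pow_succ, pow_mul, pow_mul]
      have h3 : ‖x ^ q ^ m - y ^ q ^ m‖ ≤ r :=
        ih.trans (mul_le_of_le_one_right hr0 h.le)
      have := norm_pow_sub_pow_le (le_max_left _ _) (x := x ^ q ^ m) (y := y ^ q ^ m)
        (by rw [norm_pow]; exact pow_le_one₀ (norm_nonneg _) hx1)
        (by rw [norm_pow]; exact pow_le_one₀ (norm_nonneg _) hy1) h3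
      exact this.trans ((mul_le_of_le_one_left (norm_nonneg _) hr1.le).trans ih)
  have := key n hn
  rw [hx, hy] at this
  by_contra hne
  have hpos : 0 < ‖x - y‖ := norm_pos_iff.2 (sub_ne_zero.2 hne)
  nlinarith

/-- The elements of `Ω` integral over `A` are, modulo the open unit ball, roots of
`X ^ (q ^ n) - X`. -/
theorem exists_norm_pow_sub_lt_one [LocalCompletion A F Ω Λ] {b : Ω} (hb : ‖ι b‖ ≤ 1) :
    ∃ n : ℕ, 1 ≤ n ∧ ‖ι b ^ q ^ n - ι b‖ < 1 := by
  -- The integral equation of `b` reduces to one over the finite residue field. Hence the class of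
  -- `b` generates a finite field, and `n` is its degree.
  let := (residueMap A F Ω Λ).toAlgebra
  have := Fintype.ofFinite (IsLocalRing.ResidueField A)
  set β : Residue Λ := residue (⟨ι b, hb⟩ : unitBall Λ)
  have hinteg : IsIntegral (IsLocalRing.ResidueField A) β := by
    obtain ⟨P, hP, hP0⟩ := (norm_le_one_iff A F b).1 hb
    refine ⟨P.map (IsLocalRing.residue A), hP.map _, ?_⟩
    rw [eval₂_map]
    have h1 : (P.eval₂ (toBall (Ω := Ω) F) (⟨ι b, hb⟩ : unitBall Λ)) = 0 := by
      apply Subtype.ext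
      have h2 := congrArg ι hP0
      rw [hom_eval₂, map_zero] at h2
      have h3 := hom_eval₂ P (toBall (Ω := Ω) (Λ := Λ) F) (unitBall Λ).subtype ⟨ι b, hb⟩
      exact h3.trans h2
    have h4 := hom_eval₂ P (toBall (Ω := Ω) (Λ := Λ) F) residue ⟨ι b, hb⟩
    rw [h1, map_zero] at h4
    exact h4.symm
  have := IntermediateField.adjoin.finiteDimensional hinteg
  have := Module.finite_of_finite (IsLocalRing.ResidueField A)
    (M := IntermediateField.adjoin (IsLocalRing.ResidueField A) {β})
  have := Fintype.ofFinite (IntermediateField.adjoin (IsLocalRing.ResidueField A) {β})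
  refine ⟨Module.finrank (IsLocalRing.ResidueField A)
    (IntermediateField.adjoin (IsLocalRing.ResidueField A) {β}), Module.finrank_pos, ?_⟩
  have h1 := FiniteField.pow_card
    (⟨β, IntermediateField.mem_adjoin_simple_self _ β⟩ :
      IntermediateField.adjoin (IsLocalRing.ResidueField A) {β})
  rw [Module.card_eq_pow_finrank (K := IsLocalRing.ResidueField A),
    ← Nat.card_eq_fintype_card (α := IsLocalRing.ResidueField A), ← resCard_eq] at h1
  have h2 := congrArg Subtype.val h1
  rw [SubmonoidClass.coe_pow] at h2
  have h3 := h2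
  simp only [β] at h3
  rw [← map_pow, residue_eq_iff] at h3
  simpa using h3

variable (F Λ) in
theorem resCard_pow_sub_one_ne_zero [LocalCompletion A F Ω Λ] {n : ℕ} (hn : 1 ≤ n) :
    ((q ^ n - 1 : ℕ) : Ω) ≠ 0 := by
  have hQ1 := one_lt_resCard_pow A hn
  intro h
  have h0 : (q ^ n : Ω) = 1 := by
    rw [Nat.cast_sub hQ1.le, sub_eq_zero] at h
    exact_mod_cast h
  have h1 := congrArg (fun x ↦ ‖ι x‖) h0
  simp only [map_pow, map_natCast, norm_pow, map_one, norm_one] at h1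
  exact (pow_lt_one₀ (norm_nonneg _) (norm_resCard_lt_one (A := A) F Ω) (by omega)).ne h1

variable (F Λ) in
-- For `P = X ^ Q - X` one has `Q P - X P' = (1 - Q) X`, and `1 - Q` is nonzero because `Q` has
-- absolute value below 1. So `X` lies in the ideal of `P` and `P'`, and `P'` is `-1` modulo `X`. No
-- case distinction on the characteristic is needed.
theorem separable_X_pow_sub_X [LocalCompletion A F Ω Λ] {n : ℕ} (hn : 1 ≤ n) :
    (X ^ q ^ n - X : Polynomial Ω).Separable := by
  set Q := q ^ n with hQ
  have hQ1 : 1 < Q := one_lt_resCard_pow A hn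
  have hne : (1 - (Q : Ω)) ≠ 0 := by
    have h := resCard_pow_sub_one_ne_zero (A := A) (Ω := Ω) F Λ hn
    rw [Nat.cast_sub hQ1.le, Nat.cast_one] at h
    rw [← neg_sub]
    exact neg_ne_zero.2 h
  obtain ⟨m, hm⟩ := Nat.exists_eq_add_of_le' (show 2 ≤ Q from hQ1)
  rw [separable_def']
  have hc : (C (1 - (Q : Ω))⁻¹ : Polynomial Ω) * (1 - (Q : Polynomial Ω)) = 1 := by
    have : (1 - (Q : Polynomial Ω)) = C (1 - (Q : Ω)) := by simp
    rw [this, ← C_mul, inv_mul_cancel₀ hne, C_1]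
  refine ⟨C (1 - (Q : Ω))⁻¹ * ((Q : Polynomial Ω) * X ^ m) * (Q : Polynomial Ω),
    -(C (1 - (Q : Ω))⁻¹ * ((Q : Polynomial Ω) * X ^ m) * X) - 1, ?_⟩
  rw [derivative_sub, derivative_X_pow, derivative_X]
  have e : Q - 1 = m + 1 := by omega
  rw [e]
  have hp : (X : Polynomial Ω) ^ Q = X ^ m * X ^ 2 := by rw [← pow_add, hm]
  rw [hp]
  simp only [map_natCast]
  linear_combination ((Q : Polynomial Ω) * X ^ (m + 1)) * hc

/-- This plays the role of Hensel's lemma. The value at `b` is the product of the differences to the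
roots, and it could not be small if all factors had norm at least 1. -/
theorem exists_root_norm_sub_lt_one {p : Polynomial Ω} (hs : p.Splits) (hm : p.Monic) {b : Ω}
    (h : ‖ι (p.eval b)‖ < 1) : ∃ a, p.IsRoot a ∧ ‖ι b - ι a‖ < 1 := by
  have h1 := hs.eval_eq_prod_roots b
  rw [hm.leadingCoeff, one_mul] at h1
  rw [h1] at h
  by_contra! hcon
  have h3 : ∀ a ∈ p.roots, 1 ≤ ‖ι b - ι a‖ := fun a ha ↦ hcon a (mem_roots'.1 ha).2
  have h4 : ∀ s : Multiset Ω, (∀ a ∈ s, 1 ≤ ‖ι b - ι a‖) →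
      1 ≤ ‖ι (Multiset.map (fun a ↦ b - a) s).prod‖ := by
    intro s
    induction s using Multiset.induction_on with
    | empty => simp
    | cons a s ih =>
      intro hs
      rw [Multiset.map_cons, Multiset.prod_cons, map_mul, norm_mul, map_sub]
      exact one_le_mul_of_one_le_of_one_le (hs a (by simp)) (ih fun x hx ↦ hs x (by simp [hx]))
  exact absurd h (not_lt.2 (h4 _ h3))

/-- Existence of Teichmüller representatives. -/
theorem exists_teichmuller_of_norm_lt [LocalCompletion A F Ω Λ] {b : Ω} {n : ℕ} (hn : 1 ≤ n)
    (h : ‖ι b ^ q ^ n - ι b‖ < 1) : ∃ ζ : Ω, ζ ^ q ^ n = ζ ∧ ‖ι b - ι ζ‖ < 1 := by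
  have := IsSepClosure.sep_closed F (K := Ω)
  have hs := IsSepClosed.splits_of_separable _ (separable_X_pow_sub_X (A := A) F Λ (Ω := Ω) hn)
  have hQ1 : 1 < q ^ n := one_lt_resCard_pow A hn
  have hm : (X ^ q ^ n - X : Polynomial Ω).Monic :=
    monic_X_pow_sub (by rw [degree_X]; exact_mod_cast hQ1)
  obtain ⟨ζ, h1, h2⟩ := exists_root_norm_sub_lt_one hs hm (b := b) (Λ := Λ) (by simpa using h)
  exact ⟨ζ, by simpa [sub_eq_zero] using h1, h2⟩

variable (A F) in
theorem exists_teichmuller [LocalCompletion A F Ω Λ] {b : Ω} (hb : ‖ι b‖ ≤ 1) :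
    ∃ (n : ℕ) (ζ : Ω), 1 ≤ n ∧ ζ ^ q ^ n = ζ ∧ ‖ι b - ι ζ‖ < 1 := by
  obtain ⟨n, hn, h⟩ := exists_norm_pow_sub_lt_one (A := A) (F := F) hb
  obtain ⟨ζ, h1, h2⟩ := exists_teichmuller_of_norm_lt (F := F) hn h
  exact ⟨n, ζ, hn, h1, h2⟩

end Local

/-! ### The Frobenius automorphism -/

section Frobenius

variable {A F Ω Λ : Type*} [CommRing A] [IsDomain A] [IsDiscreteValuationRing A]
  [Finite (IsLocalRing.ResidueField A)] [Field F] [Algebra A F] [IsFractionRing A F]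
  [Field Ω] [Algebra F Ω] [Algebra A Ω] [IsScalarTower A F Ω] [IsSepClosure F Ω]
  [NormedField Λ] [CompleteSpace Λ] [IsUltrametricDist Λ] [Algebra Ω Λ]

local notation "ι" => algebraMap Ω Λ
local notation "q" => resCard A

/-- The set is empty or a coset of the open stabilizer of `x`. -/
theorem isClosed_setOf_apply_eq {F Ω : Type*} [Field F] [Field Ω] [Algebra F Ω] [IsGalois F Ω]
    (x y : Ω) : IsClosed {σ : Ω ≃ₐ[F] Ω | σ x = y} := by
  by_cases h : ∃ σ : Ω ≃ₐ[F] Ω, σ x = y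
  · obtain ⟨σ, rfl⟩ := h
    have h1 : IsClosed ((MulAction.stabilizer (Ω ≃ₐ[F] Ω) x : Subgroup _) : Set (Ω ≃ₐ[F] Ω)) :=
      Subgroup.isClosed_of_isOpen _ (stabilizer_isOpen_of_isIntegral x)
    have h2 := h1.preimage (continuous_const_mul σ⁻¹)
    convert h2 using 1
    ext τ
    simp only [Set.mem_ofPred_eq, Set.mem_preimage, SetLike.mem_coe, MulAction.mem_stabilizer_iff]
    change τ x = σ x ↔ σ⁻¹ (τ x) = x
    rw [AlgEquiv.aut_inv, AlgEquiv.symm_apply_eq]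
  · have : {σ : Ω ≃ₐ[F] Ω | σ x = y} = ∅ := by
      ext σ
      simp only [Set.mem_ofPred_eq, Set.mem_empty_iff_false, iff_false]
      exact fun h' ↦ h ⟨σ, h'⟩
    rw [this]
    exact isClosed_empty

/-- Compactness of the Galois group: compatible pointwise conditions can be satisfied
simultaneously. -/
theorem exists_galois_of_directed {F Ω : Type*} [Field F] [Field Ω] [Algebra F Ω] [IsGalois F Ω]
    (s : ℕ → Set (Ω ≃ₐ[F] Ω)) (hc : ∀ n, IsClosed (s n)) (hn : ∀ n, (s n).Nonempty)
    (hd : Directed (· ⊇ ·) s) : ∃ σ, ∀ n, σ ∈ s n := by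
  obtain ⟨σ, hσ⟩ := IsCompact.nonempty_iInter_of_directed_nonempty_isCompact_isClosed s hd hn
    (fun n ↦ (hc n).isCompact) hc
  exact ⟨σ, Set.mem_iInter.1 hσ⟩

variable (A F Λ) in
theorem exists_isPrimitiveRoot [LocalCompletion A F Ω Λ] {n : ℕ} (hn : 1 ≤ n) :
    ∃ ζ : Ω, IsPrimitiveRoot ζ (q ^ n - 1) := by
  have := IsSepClosure.sep_closed F (K := Ω)
  have : NeZero ((q ^ n - 1 : ℕ) : Ω) := ⟨resCard_pow_sub_one_ne_zero F Λ hn⟩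
  exact HasEnoughRootsOfUnity.exists_primitiveRoot Ω (q ^ n - 1)

theorem pow_eq_self_iff {n : ℕ} (hn : 1 ≤ n) {ζ : Ω} :
    ζ ^ q ^ n = ζ ↔ ζ = 0 ∨ ζ ^ (q ^ n - 1) = 1 := by
  have hQ := one_lt_resCard_pow A hn
  obtain ⟨m, hm⟩ := Nat.exists_eq_add_of_lt hQ
  rw [hm, show 1 + m + 1 - 1 = m + 1 by omega]
  rcases eq_or_ne ζ 0 with rfl | h
  · simp
  · rw [show 1 + m + 1 = (m + 1) + 1 by omega, pow_succ, mul_eq_right₀ h]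
    simp [h]

theorem pow_pow_eq_self {M : Type*} [Monoid M] {n : ℕ} {ζ : M} (h : ζ ^ q ^ n = ζ) (k : ℕ) :
    (ζ ^ k) ^ q ^ n = ζ ^ k := by
  rw [← pow_mul, mul_comm, pow_mul, h]

theorem pow_mul_eq_self {M : Type*} [Monoid M] {n : ℕ} {ζ : M} (h : ζ ^ q ^ n = ζ) (k : ℕ) :
    ζ ^ q ^ (n * k) = ζ := by
  induction k with
  | zero => simp
  | succ k ih => rw [mul_add, pow_add, pow_mul, ih, mul_one, h]

theorem eq_pow_of_isPrimitiveRoot {n : ℕ} (hn : 1 ≤ n) {ζ₀ ζ : Ω}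
    (h₀ : IsPrimitiveRoot ζ₀ (q ^ n - 1)) (h : ζ ^ q ^ n = ζ) : ζ = 0 ∨ ∃ i, ζ₀ ^ i = ζ := by
  have hQ := one_lt_resCard_pow A hn
  have : NeZero (q ^ n - 1) := ⟨by omega⟩
  refine ((pow_eq_self_iff hn).1 h).imp_right fun h ↦ ?_
  obtain ⟨i, -, hi⟩ := h₀.eq_pow_of_pow_eq_one h
  exact ⟨i, hi⟩

theorem galois_apply_of_primitive {n k : ℕ} (hn : 1 ≤ n) (hk : k ≠ 0) {ζ₀ : Ω}
    (h₀ : IsPrimitiveRoot ζ₀ (q ^ n - 1)) {σ : Ω →ₐ[F] Ω} (hσ : σ ζ₀ = ζ₀ ^ k) {ζ : Ω}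
    (h : ζ ^ q ^ n = ζ) : σ ζ = ζ ^ k := by
  rcases eq_pow_of_isPrimitiveRoot hn h₀ h with rfl | ⟨i, rfl⟩
  · simp [hk]
  · rw [map_pow, hσ, ← pow_mul, ← pow_mul, mul_comm]

theorem isPrimitiveRoot_pow_eq {n : ℕ} (hn : 1 ≤ n) {ζ₀ : Ω}
    (h₀ : IsPrimitiveRoot ζ₀ (q ^ n - 1)) : ζ₀ ^ q ^ n = ζ₀ :=
  (pow_eq_self_iff hn).2 (Or.inr h₀.pow_eq_one)

/-- The residue class of an integral element of `Ω`. -/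
def residueΩ (b : Ω) (hb : ‖ι b‖ ≤ 1) : Residue Λ := residue (⟨ι b, hb⟩ : unitBall Λ)

variable (F) in
theorem eval₂_residueMap [LocalCompletion A F Ω Λ] (P : A[X]) {b : Ω} (hb : ‖ι b‖ ≤ 1)
    (h : ‖ι (aeval b P)‖ ≤ 1) :
    (P.map (IsLocalRing.residue A)).eval₂ (residueMap A F Ω Λ) (residueΩ b hb) =
      residueΩ (aeval b P) h := by
  have h3 := hom_eval₂ P (toBall (Ω := Ω) (Λ := Λ) F) (unitBall Λ).subtype ⟨ι b, hb⟩
  have h4 := hom_eval₂ P (toBall (Ω := Ω) (Λ := Λ) F) residue ⟨ι b, hb⟩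
  have h5 : P.eval₂ (toBall (Ω := Ω) (Λ := Λ) F) ⟨ι b, hb⟩ = ⟨ι (aeval b P), h⟩ := by
    apply Subtype.ext
    change _ = ι (aeval b P)
    rw [aeval_def, hom_eval₂]
    exact h3
  rw [eval₂_map]
  rw [h5] at h4
  exact h4.symm

variable (F) in
theorem norm_aeval_le_one [LocalCompletion A F Ω Λ] (P : A[X]) {b : Ω} (hb : ‖ι b‖ ≤ 1) :
    ‖ι (aeval b P)‖ ≤ 1 := by
  rw [norm_le_one_iff A F] at hb ⊢
  exact IsIntegral.of_mem_of_fg _ hb.fg_adjoin_singleton _ (aeval_mem_adjoin_singleton A b)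

theorem norm_le_one_of_pow_eq' {ζ : Ω} {n : ℕ} (hn : 1 ≤ n) (h : ζ ^ q ^ n = ζ) :
    ‖ι ζ‖ ≤ 1 :=
  norm_le_one_of_pow_eq (A := A) hn (by rw [← map_pow, h])

variable (A F Λ) in
-- Let `ζ₀` be a primitive root of unity. Its minimal polynomial has coefficients in `A`, so modulo
-- the maximal ideal it also vanishes at `ζ₀ ^ q`. Hence `ζ₀ ^ q` is close to a conjugate of `ζ₀`.
-- Both are roots of `X ^ (q ^ n) - X`, where closeness forces equality.
theorem exists_galois_apply_eq_pow [LocalCompletion A F Ω Λ] {n : ℕ} (hn : 1 ≤ n) :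
    ∃ σ : Ω ≃ₐ[F] Ω, ∀ ζ : Ω, ζ ^ q ^ n = ζ → σ ζ = ζ ^ q := by
  have := Fintype.ofFinite (IsLocalRing.ResidueField A)
  obtain ⟨ζ₀, h₀⟩ := exists_isPrimitiveRoot A F Λ (Ω := Ω) hn
  have hζ := isPrimitiveRoot_pow_eq hn h₀
  have hb : ‖ι ζ₀‖ ≤ 1 := norm_le_one_of_pow_eq' hn hζ
  have hbq : ‖ι (ζ₀ ^ q)‖ ≤ 1 := norm_le_one_of_pow_eq' hn (pow_pow_eq_self hζ q)
  have hinteg : IsIntegral A ζ₀ := (norm_le_one_iff A F _).1 hb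
  set P := minpoly A ζ₀
  have h1 : ‖ι (aeval (ζ₀ ^ q) P)‖ < 1 := by
    have e1 := eval₂_residueMap (Λ := Λ) F P hb (norm_aeval_le_one F P hb)
    have e2 := eval₂_residueMap F P hbq (norm_aeval_le_one F P hbq)
    have e3 : residueΩ (ζ₀ ^ q) hbq = residueΩ ζ₀ hb ^ q := by
      rw [residueΩ, residueΩ, ← map_pow]
      congr 1
      exact Subtype.ext (map_pow _ _ _)
    have hq : q = Fintype.card (IsLocalRing.ResidueField A) := by
      rw [resCard_eq, Nat.card_eq_fintype_card]
    have e0 : residueΩ (aeval ζ₀ P) (norm_aeval_le_one F P hb) = (0 : Residue Λ) :=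
      residue_eq_zero_iff.2 (by simp [P, minpoly.aeval])
    rw [e0] at e1
    have e4 : (P.map (IsLocalRing.residue A)).eval₂ (residueMap A F Ω Λ)
        (residueΩ ζ₀ hb ^ q) = 0 := by
      have := congrArg (eval₂ (residueMap A F Ω Λ) (residueΩ ζ₀ hb))
        (FiniteField.expand_card (P.map (IsLocalRing.residue A)))
      rw [expand_eq_comp_X_pow, eval₂_comp, eval₂_pow, eval₂_pow, eval₂_X, e1,
        zero_pow Fintype.card_ne_zero, ← hq] at this
      exact this
    rw [← e3, e2] at e4
    exact residue_eq_zero_iff.1 e4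
  have hmp : minpoly F ζ₀ = P.map (algebraMap A F) :=
    minpoly.isIntegrallyClosed_eq_field_fractions' F hinteg
  have hintegF : IsIntegral F ζ₀ := hinteg.tower_top
  have hs : ((minpoly F ζ₀).map (algebraMap F Ω)).Splits := Normal.splits inferInstance ζ₀
  obtain ⟨r, hr, hr1⟩ := exists_root_norm_sub_lt_one (Λ := Λ) hs
    ((minpoly.monic hintegF).map _) (b := ζ₀ ^ q) (by
      rwa [eval_map_algebraMap, hmp, aeval_map_algebraMap])
  have hr' : aeval r (minpoly F ζ₀) = 0 := by
    rwa [IsRoot, eval_map_algebraMap] at hr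
  have hrn : r ^ q ^ n = r := by
    obtain ⟨Q, hQ⟩ := minpoly.dvd F ζ₀ (p := X ^ q ^ n - X) (by simp [hζ])
    have := congrArg (aeval r) hQ
    rw [map_mul, hr', zero_mul] at this
    simpa [sub_eq_zero] using this
  have hrq : ζ₀ ^ q = r := by
    apply (algebraMap Ω Λ).injective
    exact eq_of_norm_sub_lt_one (A := A) F Ω hn (by rw [← map_pow, pow_pow_eq_self hζ])
      (by rw [← map_pow, hrn]) hr1
  obtain ⟨σ, hσ⟩ := minpoly.exists_algEquiv_of_root hintegF.isAlgebraic hr'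
  refine ⟨σ⁻¹, fun ζ h ↦ ?_⟩
  refine galois_apply_of_primitive (σ := (σ⁻¹ : Ω ≃ₐ[F] Ω).toAlgHom) hn (resCard_ne_zero A) h₀ ?_ h
  change σ⁻¹ ζ₀ = ζ₀ ^ q
  rw [hrq, ← hσ]
  exact σ.symm_apply_apply r

variable (A F Λ) in
-- At each finite level a suitable automorphism exists. The conditions are closed and directed by
-- divisibility of degrees, so compactness of the Galois group gives one automorphism for all
-- levels.
theorem exists_frobenius [LocalCompletion A F Ω Λ] :
    ∃ Φ : Ω ≃ₐ[F] Ω, ∀ (n : ℕ) (ζ : Ω), 1 ≤ n → ζ ^ q ^ n = ζ → Φ ζ = ζ ^ q := by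
  obtain ⟨Φ, hΦ⟩ := exists_galois_of_directed (F := F) (Ω := Ω)
    (fun n ↦ {σ | ∀ ζ : Ω, ζ ^ q ^ (n + 1) = ζ → σ ζ = ζ ^ q})
    (fun n ↦ by
      have : {σ : Ω ≃ₐ[F] Ω | ∀ ζ : Ω, ζ ^ q ^ (n + 1) = ζ → σ ζ = ζ ^ q} =
        ⋂ (ζ : Ω) (_ : ζ ^ q ^ (n + 1) = ζ), {σ | σ ζ = ζ ^ q} := by ext; simp
      rw [this]
      exact isClosed_iInter fun ζ ↦ isClosed_iInter fun _ ↦ isClosed_setOf_apply_eq _ _)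
    (fun n ↦ exists_galois_apply_eq_pow A F Λ (by omega))
    -- Index `n` stands for degree `n + 1`, so the common refinement has degree `(m + 1) (n + 1)`.
    (fun m n ↦ ⟨(m + 1) * (n + 1) - 1, by
      have e : (m + 1) * (n + 1) - 1 + 1 = (m + 1) * (n + 1) :=
        Nat.succ_pred_eq_of_pos (Nat.mul_pos m.succ_pos n.succ_pos)
      constructor
      · intro σ hσ ζ hζ
        refine hσ ζ ?_
        rw [e]
        exact pow_mul_eq_self hζ _
      · intro σ hσ ζ hζ
        refine hσ ζ ?_
        rw [e, mul_comm]
        exact pow_mul_eq_self hζ _⟩)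
  refine ⟨Φ, fun n ζ hn hζ ↦ hΦ (n - 1) ζ ?_⟩
  rwa [Nat.sub_add_cancel hn]

variable (A F Ω) in
/-- An automorphism of `Ω` over `F` that acts as the `q`-th power map on the roots of unity of
order prime to the residue characteristic. -/
def frob : Ω ≃ₐ[F] Ω :=
  Classical.epsilon fun Φ : Ω ≃ₐ[F] Ω ↦
    ∀ (n : ℕ) (ζ : Ω), 1 ≤ n → ζ ^ q ^ n = ζ → Φ ζ = ζ ^ q

variable (Λ) in
theorem frob_apply [LocalCompletion A F Ω Λ] {n : ℕ} {ζ : Ω} (hn : 1 ≤ n) (h : ζ ^ q ^ n = ζ) :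
    frob A F Ω ζ = ζ ^ q :=
  Classical.epsilon_spec (exists_frobenius A F Λ (Ω := Ω)) n ζ hn h

variable (Λ) in
theorem frob_pow_apply [LocalCompletion A F Ω Λ] {n : ℕ} {ζ : Ω} (hn : 1 ≤ n)
    (h : ζ ^ q ^ n = ζ) (i : ℕ) : (frob A F Ω ^ i) ζ = ζ ^ q ^ i := by
  induction i with
  | zero => simp
  | succ i ih =>
    rw [pow_succ', AlgEquiv.mul_apply, ih, map_pow, frob_apply Λ hn h, ← pow_mul, pow_succ' q]

theorem norm_frob_sub_lt_one [LocalCompletion A F Ω Λ] {b : Ω} (hb : ‖ι b‖ ≤ 1) :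
    ‖ι (frob A F Ω b) - ι b ^ q‖ < 1 := by
  obtain ⟨n, ζ, hn, hζ, h⟩ := exists_teichmuller A F hb
  have h1 : ‖ι (frob A F Ω b) - ι ζ ^ q‖ < 1 := by
    rw [← map_pow, ← frob_apply (F := F) Λ hn hζ, ← map_sub, ← map_sub,
      norm_galois (A := A), map_sub]
    exact h
  have hζ1 : ‖ι ζ‖ ≤ 1 := norm_le_one_of_pow_eq' hn hζ
  have h2 : ‖ι ζ ^ q - ι b ^ q‖ < 1 := by
    have h3 := h
    rw [norm_sub_rev] at h3
    refine (norm_pow_sub_pow_le (r := max ‖(q : Λ)‖ ‖ι ζ - ι b‖) (le_max_left _ _) hζ1 hb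
      (le_max_right _ _)).trans_lt ?_
    have h4 : max ‖(q : Λ)‖ ‖ι ζ - ι b‖ < 1 := max_lt (norm_resCard_lt_one F Ω) h3
    exact (mul_le_of_le_one_left (norm_nonneg _) h4.le).trans_lt h3
  rw [← sub_add_sub_cancel _ (ι ζ ^ q)]
  exact (IsUltrametricDist.norm_add_le_max _ _).trans_lt (max_lt h1 h2)

/-- Every automorphism acts on the roots of unity of order `q ^ n - 1` as a power of Frobenius. -/
theorem exists_galois_apply_eq_frob [LocalCompletion A F Ω Λ] (σ : Ω ≃ₐ[F] Ω) {n : ℕ}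
    (hn : 1 ≤ n) : ∃ i : ℕ, ∀ ζ : Ω, ζ ^ q ^ n = ζ → σ ζ = ζ ^ q ^ i := by
  have := Fintype.ofFinite (IsLocalRing.ResidueField A)
  let := (residueMap A F Ω Λ).toAlgebra
  obtain ⟨s, hs, hsσ⟩ := LocalCompletion.exists_extension (A := A) (Λ := Λ) σ
  let s₁ : unitBall Λ →+* unitBall Λ := s.restrict (unitBall Λ) (unitBall Λ) fun x hx ↦ by
    change ‖s x‖ ≤ 1
    rw [hs]; exact hx
  let s₂ : Residue Λ →+* Residue Λ := Ideal.quotientMap (ballIdeal Λ) s₁ fun x hx ↦ by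
    change ‖s x‖ < 1
    rw [hs]; exact hx
  let s₃ : Residue Λ →ₐ[IsLocalRing.ResidueField A] Residue Λ :=
    { s₂ with
      commutes' := by
        intro r
        obtain ⟨a, rfl⟩ := IsLocalRing.residue_surjective r
        change s₂ (residue (toBall (Ω := Ω) F a)) = residue (toBall (Ω := Ω) F a)
        change residue (s₁ (toBall (Ω := Ω) F a)) = residue (toBall (Ω := Ω) F a)
        congr 1
        apply Subtype.ext
        change s (emb A Ω Λ a) = emb A Ω Λ a
        rw [emb_eq (F := F), hsσ, AlgEquiv.commutes] }
  obtain ⟨ζ₀, h₀⟩ := exists_isPrimitiveRoot A F Λ (Ω := Ω) hn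
  have hζ := isPrimitiveRoot_pow_eq hn h₀
  have hb : ‖ι ζ₀‖ ≤ 1 := norm_le_one_of_pow_eq' hn hζ
  set β : Residue Λ := residueΩ ζ₀ hb with hβ
  have hβn : β ^ q ^ n = β := by
    rw [hβ, residueΩ, ← map_pow]
    congr 1
    exact Subtype.ext (by simp [← map_pow, hζ])
  have hinteg : IsIntegral (IsLocalRing.ResidueField A) β :=
    ⟨X ^ q ^ n - X, monic_X_pow_sub (by
      rw [degree_X]; exact_mod_cast one_lt_resCard_pow A hn), by simp [hβn]⟩
  have := IntermediateField.adjoin.finiteDimensional hinteg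
  have := Module.finite_of_finite (IsLocalRing.ResidueField A)
    (M := IntermediateField.adjoin (IsLocalRing.ResidueField A) {β})
  -- The automorphism induced on residue classes preserves the finite field generated by `β`, whose
  -- Galois group consists of the powers of the `q`-Frobenius.
  obtain ⟨i, hi⟩ := (FiniteField.bijective_frobeniusAlgEquivOfAlgebraic_pow
    (IsLocalRing.ResidueField A) (IntermediateField.adjoin (IsLocalRing.ResidueField A) {β})).2
    (s₃.restrictNormal' (IntermediateField.adjoin (IsLocalRing.ResidueField A) {β}))
  have h1 := s₃.restrictNormal_commutes (IntermediateField.adjoin (IsLocalRing.ResidueField A) {β})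
    ⟨β, IntermediateField.mem_adjoin_simple_self _ β⟩
  have h2 : ∀ (j : ℕ) (x : IntermediateField.adjoin (IsLocalRing.ResidueField A) {β}),
      (FiniteField.frobeniusAlgEquivOfAlgebraic (IsLocalRing.ResidueField A)
        (IntermediateField.adjoin (IsLocalRing.ResidueField A) {β}) ^ j) x = x ^ q ^ j := by
    intro j x
    have hq : q = Fintype.card (IsLocalRing.ResidueField A) := by
      rw [resCard_eq, Nat.card_eq_fintype_card]
    induction j with
    | zero => simp
    | succ j ih =>
      rw [pow_succ', AlgEquiv.mul_apply, ih, FiniteField.coe_frobeniusAlgEquivOfAlgebraic, hq,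
        pow_succ, pow_mul]
  have h3 : s₃ β = β ^ q ^ (i : ℕ) := by
    have h4 := DFunLike.congr_fun hi (⟨β, IntermediateField.mem_adjoin_simple_self _ β⟩ :
      IntermediateField.adjoin (IsLocalRing.ResidueField A) {β})
    simp only [h2] at h4
    have h5 := congrArg Subtype.val h4
    rw [SubmonoidClass.coe_pow] at h5
    exact h1.symm.trans h5.symm
  refine ⟨i, fun ζ h ↦ galois_apply_of_primitive (σ := σ.toAlgHom) hn
    (pow_ne_zero _ (resCard_ne_zero A)) h₀ ?_ h⟩
  have hσζ : (σ ζ₀) ^ q ^ n = σ ζ₀ := by rw [← map_pow, hζ]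
  apply (algebraMap Ω Λ).injective
  refine eq_of_norm_sub_lt_one (A := A) F Ω hn (x := ι (σ ζ₀)) (y := ι (ζ₀ ^ q ^ (i : ℕ)))
    (by rw [← map_pow, hσζ]) (by rw [← map_pow, pow_pow_eq_self hζ]) ?_
  have h6 : residue (s₁ ⟨ι ζ₀, hb⟩) = residue (⟨ι ζ₀, hb⟩ ^ q ^ (i : ℕ) : unitBall Λ) := h3
  rw [residue_eq_iff] at h6
  rw [map_pow, ← hsσ]
  exact h6

end Frobenius

open scoped Matrix

/-! ### Unramified extensions -/

section Unramified

variable {A F Ω Λ : Type*} [CommRing A] [IsDomain A] [IsDiscreteValuationRing A]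
  [Finite (IsLocalRing.ResidueField A)] [Field F] [Algebra A F] [IsFractionRing A F]
  [Field Ω] [Algebra F Ω] [Algebra A Ω] [IsScalarTower A F Ω] [IsSepClosure F Ω]
  [NormedField Λ] [CompleteSpace Λ] [IsUltrametricDist Λ] [Algebra Ω Λ]

local notation "ι" => algebraMap Ω Λ
local notation "q" => resCard A
local notation "ρ" => unifNorm A Ω Λ

/-! #### Rings of integers of subfields -/

theorem norm_intRing_le_one [LocalCompletion A F Ω Λ] {E : IntermediateField F Ω}
    (a : intRing A E) : ‖ι ((a : E) : Ω)‖ ≤ 1 := by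
  rw [norm_le_one_iff A F]
  exact (isIntegral_algHom_iff (E.val.restrictScalars A) E.val.injective).2 a.2

theorem exists_intRing_eq [LocalCompletion A F Ω Λ] {E : IntermediateField F Ω} {x : Ω}
    (hx : x ∈ E) (h : ‖ι x‖ ≤ 1) : ∃ a : intRing A E, ((a : E) : Ω) = x := by
  rw [norm_le_one_iff A F] at h
  exact ⟨⟨⟨x, hx⟩,
    (isIntegral_algHom_iff (E.val.restrictScalars A) (x := ⟨x, hx⟩) E.val.injective).1 h⟩, rfl⟩

theorem isUnit_intRing_iff [LocalCompletion A F Ω Λ] {E : IntermediateField F Ω}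
    {a : intRing A E} : IsUnit a ↔ ‖ι ((a : E) : Ω)‖ = 1 := by
  constructor
  · intro h
    obtain ⟨b, hb⟩ := h.exists_right_inv
    have h1 := norm_intRing_le_one (Λ := Λ) a
    have h2 := norm_intRing_le_one (Λ := Λ) b
    have h3 : ‖ι ((a : E) : Ω)‖ * ‖ι ((b : E) : Ω)‖ = 1 := by
      rw [← norm_mul, ← map_mul]
      have := congrArg (fun x : intRing A E ↦ ((x : E) : Ω)) hb
      simp only [MulMemClass.coe_mul, OneMemClass.coe_one] at this
      rw [this]; simp
    refine le_antisymm h1 ?_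
    rw [← h3]
    exact mul_le_of_le_one_right (norm_nonneg _) h2
  · intro h
    have h0 : ((a : E) : Ω) ≠ 0 := by intro h'; simp [h'] at h
    obtain ⟨b, hb⟩ := exists_intRing_eq (A := A) (Λ := Λ) (E := E) (x := ((a : E) : Ω)⁻¹)
      (E.inv_mem (a : E).2) (by rw [map_inv₀, norm_inv, h, inv_one])
    refine IsUnit.of_mul_eq_one b (Subtype.ext (Subtype.ext ?_))
    simp only [MulMemClass.coe_mul, OneMemClass.coe_one, hb]
    exact mul_inv_cancel₀ h0

theorem mem_maxIdeal_iff [LocalCompletion A F Ω Λ] {E : IntermediateField F Ω}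
    {a : intRing A E} : a ∈ maxIdeal (intRing A E) ↔ ‖ι ((a : E) : Ω)‖ < 1 := by
  constructor
  · intro h
    refine Submodule.span_induction (p := fun (a : intRing A E) _ ↦ ‖ι ((a : E) : Ω)‖ < 1)
      ?_ ?_ ?_ ?_ h
    · intro x hx
      rw [mem_nonunits_iff, isUnit_intRing_iff (Λ := Λ)] at hx
      exact lt_of_le_of_ne (norm_intRing_le_one x) hx
    · simp
    · intro x y _ _ hx hy
      simp only [AddMemClass.coe_add, map_add]
      exact (IsUltrametricDist.norm_add_le_max _ _).trans_lt (max_lt hx hy)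
    · intro x y _ hy
      simp only [smul_eq_mul, MulMemClass.coe_mul, map_mul, norm_mul]
      exact (mul_le_of_le_one_left (norm_nonneg _) (norm_intRing_le_one x)).trans_lt hy
  · intro h
    refine Ideal.subset_span ?_
    rw [mem_nonunits_iff, isUnit_intRing_iff (Λ := Λ)]
    exact h.ne

/-! #### The fields `F_n` -/

theorem mem_unr_of_pow_eq {n : ℕ} (hn : 1 ≤ n) {ζ : Ω} (h : ζ ^ q ^ n = ζ) :
    ζ ∈ unr A F Ω n := by
  rcases (pow_eq_self_iff hn).1 h with rfl | h
  · exact zero_mem _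
  · exact IntermediateField.subset_adjoin F _ h

theorem unr_eq_adjoin_simple {n : ℕ} (hn : 1 ≤ n) {ζ₀ : Ω}
    (h₀ : IsPrimitiveRoot ζ₀ (q ^ n - 1)) :
    unr A F Ω n = IntermediateField.adjoin F {ζ₀} := by
  apply le_antisymm
  · rw [unr, IntermediateField.adjoin_le_iff]
    intro ζ hζ
    rcases eq_pow_of_isPrimitiveRoot hn h₀ ((pow_eq_self_iff hn).2 (Or.inr hζ)) with rfl | ⟨i, rfl⟩
    · exact zero_mem _
    · exact pow_mem (IntermediateField.mem_adjoin_simple_self F ζ₀) i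
  · rw [IntermediateField.adjoin_le_iff, Set.singleton_subset_iff]
    exact mem_unr_of_pow_eq hn (isPrimitiveRoot_pow_eq hn h₀)

variable (A F Ω Λ) in
theorem finiteDimensional_unr [LocalCompletion A F Ω Λ] {n : ℕ} (hn : 1 ≤ n) :
    FiniteDimensional F (unr A F Ω n) := by
  obtain ⟨ζ₀, h₀⟩ := exists_isPrimitiveRoot A F Λ (Ω := Ω) hn
  rw [unr_eq_adjoin_simple hn h₀]
  exact IntermediateField.adjoin.finiteDimensional (Algebra.IsIntegral.isIntegral ζ₀)

theorem eqOn_adjoin {T : Set Ω} {σ τ : Ω →ₐ[F] Ω} (h : ∀ x ∈ T, σ x = τ x) {x : Ω}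
    (hx : x ∈ IntermediateField.adjoin F T) : σ x = τ x := by
  induction hx using IntermediateField.adjoin_induction with
  | mem x hx => exact h x hx
  | algebraMap x => simp
  | add x y _ _ hx hy => simp [hx, hy]
  | inv x _ hx => simp [hx]
  | mul x y _ _ hx hy => simp [hx, hy]

theorem eqOn_unr {n : ℕ} (hn : 1 ≤ n) {σ τ : Ω ≃ₐ[F] Ω}
    (h : ∀ ζ, ζ ^ q ^ n = ζ → σ ζ = τ ζ) {x : Ω} (hx : x ∈ unr A F Ω n) : σ x = τ x :=
  eqOn_adjoin (σ := σ.toAlgHom) (τ := τ.toAlgHom)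
    (fun ζ hζ ↦ h ζ ((pow_eq_self_iff hn).2 (Or.inr hζ))) hx

theorem galois_mem_unr {n : ℕ} (σ : Ω ≃ₐ[F] Ω) {x : Ω} (hx : x ∈ unr A F Ω n) :
    σ x ∈ unr A F Ω n := by
  have : (unr A F Ω n).map (σ : Ω →ₐ[F] Ω) ≤ unr A F Ω n := by
    rw [unr, IntermediateField.adjoin_map, IntermediateField.adjoin_le_iff]
    rintro _ ⟨ζ, hζ, rfl⟩
    refine IntermediateField.subset_adjoin F _ ?_
    change (σ ζ) ^ _ = 1
    rw [← map_pow, hζ, map_one]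
  exact this ⟨x, hx, rfl⟩

theorem unr_mono {m n : ℕ} (hm : 1 ≤ m) (hn : 1 ≤ n) (h : m ∣ n) :
    unr A F Ω m ≤ unr A F Ω n := by
  obtain ⟨k, rfl⟩ := h
  rw [unr, IntermediateField.adjoin_le_iff]
  intro ζ hζ
  exact mem_unr_of_pow_eq hn (pow_mul_eq_self ((pow_eq_self_iff hm).2 (Or.inr hζ)) k)

theorem mem_maxUnr_iff {x : Ω} : x ∈ maxUnr A F Ω ↔ ∃ n, 1 ≤ n ∧ x ∈ unr A F Ω n := by
  rw [maxUnr, iSup_subtype']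
  have : Nonempty {n : ℕ // 1 ≤ n} := ⟨⟨1, le_rfl⟩⟩
  have hd : Directed (· ≤ ·) fun n : {n : ℕ // 1 ≤ n} ↦ unr A F Ω n := fun m n ↦
    ⟨⟨m * n, Nat.mul_pos m.2 n.2⟩, unr_mono m.2 (Nat.mul_pos m.2 n.2) (dvd_mul_right _ _),
      unr_mono n.2 (Nat.mul_pos m.2 n.2) (dvd_mul_left _ _)⟩
  rw [← SetLike.mem_coe, IntermediateField.coe_iSup_of_directed hd]
  simp

theorem unr_le_maxUnr {n : ℕ} (hn : 1 ≤ n) : unr A F Ω n ≤ maxUnr A F Ω :=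
  fun _ hx ↦ mem_maxUnr_iff.2 ⟨n, hn, hx⟩

theorem galois_mem_maxUnr (σ : Ω ≃ₐ[F] Ω) {x : Ω} (hx : x ∈ maxUnr A F Ω) :
    σ x ∈ maxUnr A F Ω := by
  obtain ⟨n, hn, h⟩ := mem_maxUnr_iff.1 hx
  exact mem_maxUnr_iff.2 ⟨n, hn, galois_mem_unr σ h⟩

variable (A F Ω) in
theorem maxUnr_eq_adjoin :
    maxUnr A F Ω = IntermediateField.adjoin F {ζ : Ω | ∃ n, 1 ≤ n ∧ ζ ^ q ^ n = ζ} := by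
  apply le_antisymm
  · intro x hx
    obtain ⟨n, hn, h⟩ := mem_maxUnr_iff.1 hx
    refine IntermediateField.adjoin.mono F _ _ ?_ h
    exact fun ζ hζ ↦ ⟨n, hn, (pow_eq_self_iff hn).2 (Or.inr hζ)⟩
  · rw [IntermediateField.adjoin_le_iff]
    rintro ζ ⟨n, hn, h⟩
    exact mem_maxUnr_iff.2 ⟨n, hn, mem_unr_of_pow_eq hn h⟩

variable (Λ) in
theorem frob_pow_eq_self [LocalCompletion A F Ω Λ] {n : ℕ} (hn : 1 ≤ n) {x : Ω}
    (hx : x ∈ unr A F Ω n) : (frob A F Ω ^ n) x = x :=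
  eqOn_unr (τ := 1) hn (fun ζ hζ ↦ by rw [frob_pow_apply Λ hn hζ, hζ]; rfl) hx

variable (Λ) in
theorem exists_galois_eq_frob_pow [LocalCompletion A F Ω Λ] (σ : Ω ≃ₐ[F] Ω) {n : ℕ}
    (hn : 1 ≤ n) : ∃ i : ℕ, ∀ x ∈ unr A F Ω n, σ x = (frob A F Ω ^ i) x := by
  obtain ⟨i, hi⟩ := exists_galois_apply_eq_frob (A := A) (Λ := Λ) σ hn
  exact ⟨i, fun x hx ↦ eqOn_unr hn (fun ζ hζ ↦ by rw [hi ζ hζ, frob_pow_apply Λ hn hζ]) hx⟩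

theorem normal_of_forall_mem {E : IntermediateField F Ω}
    (h : ∀ σ : Ω ≃ₐ[F] Ω, ∀ x ∈ E, σ x ∈ E) : Normal F E := by
  rw [IntermediateField.normal_iff_forall_map_le']
  rintro σ _ ⟨x, hx, rfl⟩
  exact h σ x hx

instance isGalois_unr (n : ℕ) : IsGalois F (unr A F Ω n) where
  to_normal := normal_of_forall_mem fun σ _ hx ↦ galois_mem_unr σ hx
  to_isSeparable := inferInstance

variable (A F Ω) in
/-- The restriction of the Frobenius automorphism to `F_n`. -/
def frobUnr (n : ℕ) : unr A F Ω n ≃ₐ[F] unr A F Ω n := (frob A F Ω).restrictNormal _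

theorem coe_frobUnr_pow (n i : ℕ) (x : unr A F Ω n) :
    (((frobUnr A F Ω n ^ i) x : unr A F Ω n) : Ω) = (frob A F Ω ^ i) x := by
  induction i with
  | zero => rfl
  | succ i ih =>
    rw [pow_succ', pow_succ', AlgEquiv.mul_apply, AlgEquiv.mul_apply, ← ih]
    exact (frob A F Ω).restrictNormal_commutes (unr A F Ω n) _

variable (A F Ω Λ) in
-- On a primitive root of unity the powers act by the exponents `q ^ i`, which are distinct below `q
-- ^ n`. Conversely every automorphism extends to `Ω`, acts there on roots of unity as a power of
-- Frobenius, and the exponent only matters modulo `n`.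
theorem bijective_frobUnr_pow [LocalCompletion A F Ω Λ] {n : ℕ} (hn : 1 ≤ n) :
    Function.Bijective fun i : Fin n ↦ frobUnr A F Ω n ^ (i : ℕ) := by
  have hcoe := coe_frobUnr_pow (A := A) (F := F) (Ω := Ω) n
  constructor
  · intro i j hij
    obtain ⟨ζ₀, h₀⟩ := exists_isPrimitiveRoot A F Λ (Ω := Ω) hn
    have hζ := isPrimitiveRoot_pow_eq hn h₀
    have h1 := congrArg Subtype.val (DFunLike.congr_fun hij
      (⟨ζ₀, mem_unr_of_pow_eq hn hζ⟩ : unr A F Ω n))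
    simp only [hcoe] at h1
    rw [frob_pow_apply Λ hn hζ, frob_pow_apply Λ hn hζ] at h1
    have hq2 := two_le_resCard A
    have hlt : ∀ k : Fin n, q ^ (k : ℕ) < q ^ n := fun k ↦ Nat.pow_lt_pow_right (by omega) k.2
    have hpos : ∀ k : Fin n, 0 < q ^ (k : ℕ) := fun k ↦ by positivity
    have h2 : ζ₀ ^ (q ^ (i : ℕ) - 1) = ζ₀ ^ (q ^ (j : ℕ) - 1) := by
      have hne : ζ₀ ≠ 0 := h₀.ne_zero (by have := one_lt_resCard_pow A hn; omega)
      apply mul_right_cancel₀ hne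
      rw [← pow_succ, ← pow_succ, Nat.sub_add_cancel (hpos i), Nat.sub_add_cancel (hpos j), h1]
    have h3 := h₀.pow_inj (by have := hlt i; have := hpos i; omega)
      (by have := hlt j; have := hpos j; omega) h2
    have h4 : q ^ (i : ℕ) = q ^ (j : ℕ) := by have := hpos i; have := hpos j; omega
    exact Fin.ext (Nat.pow_right_injective hq2 h4)
  · intro σ
    obtain ⟨τ, rfl⟩ := AlgEquiv.restrictNormalHom_surjective (F := F) (E := Ω)
      (K₁ := unr A F Ω n) σ
    obtain ⟨i, hi⟩ := exists_galois_eq_frob_pow (A := A) Λ τ hn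
    refine ⟨⟨i % n, Nat.mod_lt _ hn⟩, ?_⟩
    ext x
    have h1 : ((AlgEquiv.restrictNormalHom (unr A F Ω n) τ x : unr A F Ω n) : Ω) = τ x :=
      τ.restrictNormal_commutes (unr A F Ω n) x
    rw [h1, hi x x.2, hcoe]
    have h2 : ∀ k (y : Ω), y ∈ unr A F Ω n → (frob A F Ω ^ (n * k)) y = y := by
      intro k y hy
      induction k with
      | zero => rfl
      | succ k ih =>
        rw [mul_add, mul_one, pow_add, AlgEquiv.mul_apply, frob_pow_eq_self Λ hn hy, ih]
    conv_rhs => rw [← Nat.mod_add_div i n, pow_add, AlgEquiv.mul_apply, h2 _ _ x.2]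

variable (A F Ω Λ) in
theorem finrank_unr [LocalCompletion A F Ω Λ] {n : ℕ} (hn : 1 ≤ n) :
    Module.finrank F (unr A F Ω n) = n := by
  have := finiteDimensional_unr A F Ω Λ hn
  rw [← IsGalois.card_aut_eq_finrank,
    ← Nat.card_congr (Equiv.ofBijective _ (bijective_frobUnr_pow A F Ω Λ hn))]
  simp

variable (Λ) in
theorem norm_unr [LocalCompletion A F Ω Λ] {n : ℕ} (hn : 1 ≤ n) (x : unr A F Ω n) :
    algebraMap F Ω (Algebra.norm F x) = ∏ i ∈ Finset.range n, (frob A F Ω ^ i) (x : Ω) := by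
  have := finiteDimensional_unr A F Ω Λ hn
  have h := congrArg (algebraMap (unr A F Ω n) Ω) (Algebra.norm_eq_prod_automorphisms F x)
  rw [← IsScalarTower.algebraMap_apply, map_prod,
    ← (Equiv.ofBijective _ (bijective_frobUnr_pow A F Ω Λ hn)).prod_comp] at h
  rw [h, Finset.prod_range]
  exact Finset.prod_congr rfl fun i _ ↦ coe_frobUnr_pow n i x

/-- The value group of `F_n` is that of `F`. -/
theorem exists_norm_eq_of_mem_unr [LocalCompletion A F Ω Λ] {n : ℕ} (hn : 1 ≤ n) {x : Ω}
    (hx : x ∈ unr A F Ω n) : ∃ c : F, ‖ι x‖ = ‖ι (algebraMap F Ω c)‖ := by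
  have := finiteDimensional_unr A F Ω Λ hn
  obtain ⟨ζ₀, h₀⟩ := exists_isPrimitiveRoot A F Λ (Ω := Ω) hn
  have hζ := isPrimitiveRoot_pow_eq hn h₀
  have hinteg : IsIntegral F ζ₀ := Algebra.IsIntegral.isIntegral ζ₀
  have hfr := finrank_unr A F Ω Λ hn
  rw [unr_eq_adjoin_simple hn h₀] at hx hfr
  obtain ⟨f, hf, hxf⟩ := (IntermediateField.adjoin.powerBasis hinteg).exists_eq_aeval ⟨x, hx⟩
  rw [← PowerBasis.finrank, hfr] at hf
  have hxf' : x = aeval ζ₀ f := by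
    have := congrArg (IntermediateField.val _) hxf
    rw [← aeval_algHom_apply] at this
    simpa using this
  -- The conjugates of `x` are obtained from its coefficients by the Vandermonde matrix of the
  -- conjugates of `ζ₀`. Distinct conjugates have distinct residue classes, so this matrix is
  -- invertible over the unit ball. Hence `x` has the same norm as its largest coefficient, an
  -- element of `F`.
  let z : Fin n → unitBall Λ := fun i ↦ ⟨ι (ζ₀ ^ q ^ (i : ℕ)), norm_le_one_of_pow_eq' hn
    (pow_pow_eq_self hζ _)⟩
  have hz : IsUnit (Matrix.vandermonde z).det := by
    apply isUnit_unitBall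
    rw [Matrix.det_vandermonde]
    simp only [SubmonoidClass.coe_finsetProd, norm_prod]
    refine Finset.prod_eq_one fun i _ ↦ Finset.prod_eq_one fun j hj ↦ ?_
    refine le_antisymm (z j - z i).2 (not_lt.1 fun hlt ↦ ?_)
    have := eq_of_norm_sub_lt_one (A := A) F Ω hn (x := (z j : Λ)) (y := z i)
      (by simp only [z]; rw [← map_pow, pow_pow_eq_self hζ])
      (by simp only [z]; rw [← map_pow, pow_pow_eq_self hζ]) hlt
    have h1 : (frob A F Ω ^ (j : ℕ)) ζ₀ = (frob A F Ω ^ (i : ℕ)) ζ₀ := by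
      rw [frob_pow_apply Λ hn hζ, frob_pow_apply Λ hn hζ]
      exact (algebraMap Ω Λ).injective this
    have h2 : frobUnr A F Ω n ^ (j : ℕ) = frobUnr A F Ω n ^ (i : ℕ) := by
      ext y
      rw [coe_frobUnr_pow, coe_frobUnr_pow]
      have hy : (y : Ω) ∈ IntermediateField.adjoin F {ζ₀} :=
        (unr_eq_adjoin_simple hn h₀).le y.2
      exact eqOn_adjoin (σ := (frob A F Ω ^ (j : ℕ)).toAlgHom)
        (τ := (frob A F Ω ^ (i : ℕ)).toAlgHom) (fun w hw ↦ by
          rw [Set.mem_singleton_iff.1 hw]; exact h1) hy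
    have h3 := (bijective_frobUnr_pow A F Ω Λ hn).1 h2
    exact (Finset.mem_Ioi.1 hj).ne' h3
  let c : Fin n → Λ := fun k ↦ ι (algebraMap F Ω (f.coeff k))
  have hVc : (Matrix.vandermonde z).map (unitBall Λ).subtype *ᵥ c =
      fun i : Fin n ↦ ι ((frob A F Ω ^ (i : ℕ)) x) := by
    ext i
    rw [hxf', ← aeval_algHom_apply (frob A F Ω ^ (i : ℕ)), frob_pow_apply Λ hn hζ,
      aeval_eq_sum_range' hf, map_sum, Finset.sum_range]
    simp only [Matrix.mulVec, dotProduct]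
    refine Finset.sum_congr rfl fun k _ ↦ ?_
    rw [Algebra.smul_def, map_mul]
    simp [z, c, Matrix.vandermonde, mul_comm]
  have hc : ∀ k, ‖c k‖ ≤ ‖ι x‖ := by
    intro k
    have h1 : ((Matrix.vandermonde z)⁻¹.map (unitBall Λ).subtype) *ᵥ
        (fun i : Fin n ↦ ι ((frob A F Ω ^ (i : ℕ)) x)) = c := by
      rw [← hVc, Matrix.mulVec_mulVec, ← Matrix.map_mul, Matrix.nonsing_inv_mul _ hz]
      simp
    rw [← congrFun h1 k]
    simp only [Matrix.mulVec, dotProduct]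
    refine IsUltrametricDist.norm_sum_le_of_forall_le_of_nonneg (norm_nonneg _) fun i _ ↦ ?_
    rw [norm_mul, norm_galois (A := A)]
    exact mul_le_of_le_one_left (norm_nonneg _) ((Matrix.vandermonde z)⁻¹ k i).2
  have hle : ∃ k, ‖ι x‖ ≤ ‖c k‖ := by
    have hne : (Finset.univ : Finset (Fin n)).Nonempty := ⟨⟨0, hn⟩, Finset.mem_univ _⟩
    obtain ⟨k, -, hk⟩ := Finset.exists_max_image Finset.univ (fun k ↦ ‖c k‖) hne
    refine ⟨k, ?_⟩
    have h0 := congrFun hVc (⟨0, hn⟩ : Fin n)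
    simp only [pow_zero, AlgEquiv.one_apply] at h0
    rw [← h0]
    simp only [Matrix.mulVec, dotProduct]
    refine IsUltrametricDist.norm_sum_le_of_forall_le_of_nonneg (norm_nonneg _) fun i hi ↦ ?_
    rw [norm_mul]
    exact (mul_le_of_le_one_left (norm_nonneg _) (Matrix.vandermonde z _ i).2).trans (hk i hi)
  obtain ⟨k, hk⟩ := hle
  exact ⟨f.coeff k, le_antisymm hk (hc k)⟩

theorem exists_norm_eq_zpow_of_mem_maxUnr [LocalCompletion A F Ω Λ] {x : Ω}
    (hx : x ∈ maxUnr A F Ω) (h0 : x ≠ 0) : ∃ k : ℤ, ‖ι x‖ = ρ ^ k := by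
  obtain ⟨n, hn, h⟩ := mem_maxUnr_iff.1 hx
  obtain ⟨c, hc⟩ := exists_norm_eq_of_mem_unr (A := A) (F := F) (Λ := Λ) hn h
  obtain ⟨k, hk⟩ := exists_norm_eq_zpow A (F := F) (Ω := Ω) (Λ := Λ) (x := c) (by
    rintro rfl
    simp [h0] at hc)
  exact ⟨k, hc.trans hk⟩

/-! #### The arithmetic Frobenius -/

variable (Λ) in
-- The defining congruence sends a root of unity `ζ` in `T` to a root of unity in the class of `ζ ^
-- q`, which can only be `ζ ^ q`; this determines the automorphism on the field generated by `T`.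
-- Conversely every integral element is congruent to a root of unity, where the congruence is clear.
theorem isArithFrob_iff [LocalCompletion A F Ω Λ] {E : IntermediateField F Ω} {T : Set Ω}
    (hE : E = IntermediateField.adjoin F T) (hT : ∀ ζ ∈ T, ∃ n, 1 ≤ n ∧ ζ ^ q ^ n = ζ)
    (φ : E ≃ₐ[F] E) : IsArithFrob A E φ ↔ ∀ x : E, (φ x : Ω) = frob A F Ω x := by
  constructor
  · intro h x
    subst hE
    have key : ∀ y : Ω, ∀ hy : y ∈ IntermediateField.adjoin F T,
        (φ ⟨y, hy⟩ : Ω) = frob A F Ω y := by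
      intro y hy
      induction hy using IntermediateField.adjoin_induction with
      | mem ζ hζ =>
        obtain ⟨n, hn, hζn⟩ := hT ζ hζ
        have hmem := IntermediateField.subset_adjoin F T hζ
        obtain ⟨a, ha⟩ := exists_intRing_eq (A := A) (Λ := Λ) hmem (norm_le_one_of_pow_eq' hn hζn)
        have h1 := h a
        rw [mem_maxIdeal_iff (Λ := Λ)] at h1
        have ha' : (a : IntermediateField.adjoin F T) = ⟨ζ, hmem⟩ := Subtype.ext ha
        have h2 : ((((onInt A φ a - a ^ q : intRing A (IntermediateField.adjoin F T)) :
            IntermediateField.adjoin F T)) : Ω) = (φ ⟨ζ, hmem⟩ : Ω) - ζ ^ q := by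
          rw [← ha']
          simp [onInt, ha]
        rw [h2, map_sub] at h1
        rw [frob_apply Λ hn hζn]
        apply (algebraMap Ω Λ).injective
        refine eq_of_norm_sub_lt_one (A := A) F Ω hn ?_ ?_ h1
        · have : (⟨ζ, hmem⟩ : IntermediateField.adjoin F T) ^ q ^ n = ⟨ζ, hmem⟩ :=
            Subtype.ext hζn
          rw [← map_pow, ← SubmonoidClass.coe_pow, ← map_pow, this]
        · rw [← map_pow, pow_pow_eq_self hζn]
      | algebraMap x =>
        have : (⟨algebraMap F Ω x, IntermediateField.algebraMap_mem _ x⟩ :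
          IntermediateField.adjoin F T) = algebraMap F _ x := rfl
        rw [this, AlgEquiv.commutes, AlgEquiv.commutes]
        rfl
      | add x y hx hy hx' hy' =>
        rw [map_add, ← hx', ← hy', ← AddMemClass.coe_add, ← map_add]
        rfl
      | inv x hx hx' =>
        rw [map_inv₀, ← hx', ← IntermediateField.coe_inv, ← map_inv₀]
        rfl
      | mul x y hx hy hx' hy' =>
        rw [map_mul, ← hx', ← hy', ← MulMemClass.coe_mul, ← map_mul]
        rfl
    exact key x x.2
  · intro h a
    rw [mem_maxIdeal_iff (Λ := Λ)]
    have h2 : (((onInt A φ a - a ^ q : intRing A E) : E) : Ω) =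
        frob A F Ω (a : E) - ((a : E) : Ω) ^ q := by
      rw [← h]
      simp [onInt]
    rw [h2, map_sub, map_pow]
    exact norm_frob_sub_lt_one (norm_intRing_le_one a)

variable (Λ) in
-- Stability of `E` makes the restriction of `frob` available, so the definition of `arithFrob` is
-- in its existence branch. Whatever automorphism is chosen there, the characterisation identifies
-- it with `frob`.
theorem coe_arithFrob [LocalCompletion A F Ω Λ] {E : IntermediateField F Ω} {T : Set Ω}
    (hE : E = IntermediateField.adjoin F T) (hT : ∀ ζ ∈ T, ∃ n, 1 ≤ n ∧ ζ ^ q ^ n = ζ)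
    (hst : ∀ σ : Ω ≃ₐ[F] Ω, ∀ x ∈ E, σ x ∈ E) (x : E) :
    (arithFrob A E x : Ω) = frob A F Ω x := by
  have hex : ∃ φ : E ≃ₐ[F] E, IsArithFrob A E φ := by
    have := normal_of_forall_mem hst
    refine ⟨(frob A F Ω).restrictNormal E, (isArithFrob_iff Λ hE hT _).2 fun x ↦ ?_⟩
    exact (frob A F Ω).restrictNormal_commutes E x
  rw [arithFrob, dif_pos hex]
  exact (isArithFrob_iff Λ hE hT _).1 hex.choose_spec x

theorem coe_zpow_of_coe_eq {E : IntermediateField F Ω} {φ : E ≃ₐ[F] E} {Φ : Ω ≃ₐ[F] Ω}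
    (h : ∀ x : E, (φ x : Ω) = Φ x) (j : ℤ) (x : E) : ((φ ^ j) x : Ω) = (Φ ^ j) x := by
  have hinv : ∀ x : E, ((φ⁻¹ x : E) : Ω) = Φ⁻¹ x := fun x ↦ by
    have := h (φ⁻¹ x)
    rw [← AlgEquiv.mul_apply, mul_inv_cancel, AlgEquiv.one_apply] at this
    rw [this, ← AlgEquiv.mul_apply, inv_mul_cancel, AlgEquiv.one_apply]
  induction j with
  | zero => rfl
  | succ j ih =>
    rw [add_comm, zpow_add, zpow_add, zpow_one, zpow_one, AlgEquiv.mul_apply, h, ih,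
      AlgEquiv.mul_apply]
  | pred j ih =>
    rw [sub_eq_add_neg, add_comm, zpow_add, zpow_add, zpow_neg_one, zpow_neg_one,
      AlgEquiv.mul_apply, hinv, ih, AlgEquiv.mul_apply]

variable (Λ) in
theorem coe_arithFrob_maxUnr_zpow [LocalCompletion A F Ω Λ] (j : ℤ) (x : maxUnr A F Ω) :
    ((arithFrob A (maxUnr A F Ω) ^ j) x : Ω) = (frob A F Ω ^ j) x :=
  coe_zpow_of_coe_eq (coe_arithFrob Λ (maxUnr_eq_adjoin A F Ω) (fun _ h ↦ h)
    fun σ _ hx ↦ galois_mem_maxUnr σ hx) j x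

variable (Λ) in
theorem coe_arithFrob_unr_zpow [LocalCompletion A F Ω Λ] {n : ℕ} (hn : 1 ≤ n) (j : ℤ)
    (x : unr A F Ω n) : ((arithFrob A (unr A F Ω n) ^ j) x : Ω) = (frob A F Ω ^ j) x :=
  coe_zpow_of_coe_eq (coe_arithFrob Λ rfl
    (fun _ hζ ↦ ⟨n, hn, (pow_eq_self_iff hn).2 (Or.inr hζ)⟩) fun σ _ hx ↦ galois_mem_unr σ hx) j x

end Unramified

/-! ### The completed maximal unramified extension -/

section Completion

variable {A F Ω Λ : Type*} [CommRing A] [IsDomain A] [IsDiscreteValuationRing A]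
  [Finite (IsLocalRing.ResidueField A)] [Field F] [Algebra A F] [IsFractionRing A F]
  [Field Ω] [Algebra F Ω] [Algebra A Ω] [IsScalarTower A F Ω] [IsSepClosure F Ω]
  [NormedField Λ] [CompleteSpace Λ] [IsUltrametricDist Λ] [Algebra Ω Λ]

local notation "ι" => algebraMap Ω Λ
local notation "q" => resCard A
local notation "ρ" => unifNorm A Ω Λ

variable (A Λ) in
/-- The continuous extension of a Galois automorphism to the completion. -/
def galExt [LocalCompletion A F Ω Λ] (σ : Ω ≃ₐ[F] Ω) : Λ →+* Λ :=
  (LocalCompletion.exists_extension (A := A) (Λ := Λ) σ).choose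

theorem norm_galExt [LocalCompletion A F Ω Λ] (σ : Ω ≃ₐ[F] Ω) (x : Λ) :
    ‖galExt A Λ σ x‖ = ‖x‖ :=
  (LocalCompletion.exists_extension (A := A) (Λ := Λ) σ).choose_spec.1 x

theorem galExt_algebraMap [LocalCompletion A F Ω Λ] (σ : Ω ≃ₐ[F] Ω) (x : Ω) :
    galExt A Λ σ (ι x) = ι (σ x) :=
  (LocalCompletion.exists_extension (A := A) (Λ := Λ) σ).choose_spec.2 x

theorem galExt_emb [LocalCompletion A F Ω Λ] (σ : Ω ≃ₐ[F] Ω) (a : A) :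
    galExt A Λ σ (emb A Ω Λ a) = emb A Ω Λ a := by
  rw [emb_eq (F := F), galExt_algebraMap, AlgEquiv.commutes]

theorem continuous_galExt [LocalCompletion A F Ω Λ] (σ : Ω ≃ₐ[F] Ω) :
    Continuous (galExt A Λ σ) :=
  (AddMonoidHomClass.isometry_of_norm (galExt A Λ σ) (norm_galExt σ)).continuous

/-- An element of the closure of a subfield is approximated by elements of the subfield. -/
theorem exists_norm_sub_lt {s : Set Ω} {x : Λ} (hx : x ∈ closure (algebraMap Ω Λ '' s)) {ε : ℝ}
    (hε : 0 < ε) : ∃ y ∈ s, ‖x - ι y‖ < ε := by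
  obtain ⟨_, ⟨y, hy, rfl⟩, h⟩ := Metric.mem_closure_iff.1 hx ε hε
  exact ⟨y, hy, by rwa [dist_eq_norm] at h⟩

theorem galExt_mul [LocalCompletion A F Ω Λ] (σ τ : Ω ≃ₐ[F] Ω) (x : Λ) :
    galExt A Λ (σ * τ) x = galExt A Λ σ (galExt A Λ τ x) := by
  refine congrFun ((LocalCompletion.denseRange A F (Ω := Ω) (Λ := Λ)).equalizer
    (continuous_galExt (A := A) (σ * τ))
    ((continuous_galExt (A := A) σ).comp (continuous_galExt (A := A) τ)) ?_) x
  ext x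
  simp [galExt_algebraMap]

theorem galExt_one [LocalCompletion A F Ω Λ] (x : Λ) : galExt A Λ (1 : Ω ≃ₐ[F] Ω) x = x := by
  refine congrFun ((LocalCompletion.denseRange A F (Ω := Ω) (Λ := Λ)).equalizer
    (continuous_galExt (A := A) (1 : Ω ≃ₐ[F] Ω)) continuous_id ?_) x
  ext x
  simp [galExt_algebraMap]

variable (A F Ω Λ) in
/-- The ring of integers of the completion of the maximal unramified extension. -/
def unrRing : Subring Λ :=
  ((maxUnr A F Ω).toSubalgebra.toSubring.map (algebraMap Ω Λ)).topologicalClosure ⊓ unitBall Λ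

local notation "𝓡" => unrRing A F Ω Λ

theorem mem_unrRing {x : Λ} :
    x ∈ 𝓡 ↔ x ∈ closure (algebraMap Ω Λ '' (maxUnr A F Ω : Set Ω)) ∧ ‖x‖ ≤ 1 := Iff.rfl

theorem norm_unrRing_le (x : 𝓡) : ‖(𝓡).subtype x‖ ≤ 1 := x.2.2

theorem isClosed_unrRing : IsClosed (unrRing A F Ω Λ : Set Λ) := by
  have : (unrRing A F Ω Λ : Set Λ) =
      closure (algebraMap Ω Λ '' (maxUnr A F Ω : Set Ω)) ∩ {x | ‖x‖ ≤ 1} := rfl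
  rw [this]
  exact isClosed_closure.inter (isClosed_le continuous_norm continuous_const)

instance : CompleteSpace 𝓡 := isClosed_unrRing.completeSpace_coe

theorem algebraMap_mem_unrRing {x : Ω} (hx : x ∈ maxUnr A F Ω) (h : ‖ι x‖ ≤ 1) : ι x ∈ 𝓡 :=
  mem_unrRing.2 ⟨subset_closure ⟨x, hx, rfl⟩, h⟩

theorem galExt_mem_unrRing [LocalCompletion A F Ω Λ] (σ : Ω ≃ₐ[F] Ω) {x : Λ} (hx : x ∈ 𝓡) :
    galExt A Λ σ x ∈ 𝓡 := by
  refine mem_unrRing.2 ⟨?_, (norm_galExt σ x).trans_le hx.2⟩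
  refine map_mem_closure (continuous_galExt σ) hx.1 ?_
  rintro _ ⟨y, hy, rfl⟩
  exact ⟨σ y, galois_mem_maxUnr σ hy, (galExt_algebraMap σ y).symm⟩

theorem galExt_eq_of_eqOn [LocalCompletion A F Ω Λ] {σ τ : Ω ≃ₐ[F] Ω}
    (h : ∀ x ∈ maxUnr A F Ω, σ x = τ x) {x : Λ} (hx : x ∈ 𝓡) :
    galExt A Λ σ x = galExt A Λ τ x := by
  have h1 : Set.EqOn (galExt A Λ σ) (galExt A Λ τ)
      (closure (algebraMap Ω Λ '' (maxUnr A F Ω : Set Ω))) := by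
    refine Set.EqOn.closure ?_ (continuous_galExt σ) (continuous_galExt τ)
    rintro _ ⟨y, hy, rfl⟩
    rw [galExt_algebraMap, galExt_algebraMap, h y hy]
  exact h1 hx.1

variable (A F Ω Λ) in
/-- The powers of the Frobenius automorphism on the completed maximal unramified extension. -/
def frobR [LocalCompletion A F Ω Λ] (j : ℤ) : 𝓡 →+* 𝓡 :=
  (galExt A Λ (frob A F Ω ^ j)).restrict 𝓡 𝓡 fun _ hx ↦ galExt_mem_unrRing _ hx

local notation "Φ" => frobR A F Ω Λ

theorem coe_frobR [LocalCompletion A F Ω Λ] (j : ℤ) (x : 𝓡) :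
    (Φ j x : Λ) = galExt A Λ (frob A F Ω ^ j) x := rfl

theorem frobR_add [LocalCompletion A F Ω Λ] (i j : ℤ) (x : 𝓡) : Φ (i + j) x = Φ i (Φ j x) :=
  Subtype.ext (by rw [coe_frobR, coe_frobR, coe_frobR, zpow_add, galExt_mul])

theorem frobR_zero [LocalCompletion A F Ω Λ] (x : 𝓡) : Φ 0 x = x :=
  Subtype.ext (by rw [coe_frobR, zpow_zero, galExt_one])

theorem frobR_comm [LocalCompletion A F Ω Λ] (i j : ℤ) (x : 𝓡) : Φ i (Φ j x) = Φ j (Φ i x) := by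
  rw [← frobR_add, add_comm, frobR_add]

theorem norm_frobR [LocalCompletion A F Ω Λ] (j : ℤ) (x : 𝓡) : ‖(Φ j x : Λ)‖ = ‖(x : Λ)‖ :=
  norm_galExt _ _

variable (A F Ω Λ) in
/-- The ring of integers of `F` inside the completed maximal unramified extension. -/
def embR [LocalCompletion A F Ω Λ] : A →+* 𝓡 :=
  (emb A Ω Λ).codRestrict 𝓡 fun a ↦ mem_unrRing.2
    ⟨subset_closure ⟨algebraMap A Ω a, by
      rw [IsScalarTower.algebraMap_apply A F Ω]; exact (maxUnr A F Ω).algebraMap_mem _, rfl⟩,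
      norm_emb_le_one F a⟩

theorem coe_embR [LocalCompletion A F Ω Λ] (a : A) : (embR A F Ω Λ a : Λ) = emb A Ω Λ a := rfl

theorem frobR_embR [LocalCompletion A F Ω Λ] (j : ℤ) (a : A) :
    Φ j (embR A F Ω Λ a) = embR A F Ω Λ a :=
  Subtype.ext (galExt_emb _ a)

variable (A F Ω Λ) in
/-- The uniformizer of `F` inside the completed maximal unramified extension. -/
def unifR [LocalCompletion A F Ω Λ] : 𝓡 := embR A F Ω Λ (unif A)

local notation "ϖ" => unifR A F Ω Λ

theorem norm_unifR [LocalCompletion A F Ω Λ] : ‖(ϖ : Λ)‖ = ρ := rfl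

theorem unifR_ne_zero [LocalCompletion A F Ω Λ] : ϖ ≠ 0 := fun h ↦
  emb_unif_ne_zero (A := A) F (Ω := Ω) (Λ := Λ) (congrArg Subtype.val h)

theorem frobR_unifR [LocalCompletion A F Ω Λ] (j : ℤ) : Φ j ϖ = ϖ := frobR_embR j _

/-- By the ultrametric inequality a sufficiently close element of the maximal unramified extension
has exactly the same norm, so completion does not enlarge the value group. -/
theorem unrRing_exists_norm_eq [LocalCompletion A F Ω Λ] {x : 𝓡} (hx : x ≠ 0) :
    ∃ k : ℕ, ‖(x : Λ)‖ = ρ ^ k := by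
  have hx0 : 0 < ‖(x : Λ)‖ := norm_pos_iff.2 (by simpa using hx)
  obtain ⟨y, hy, hxy⟩ := exists_norm_sub_lt x.2.1 hx0
  have h1 : ‖ι y‖ = ‖(x : Λ)‖ := by
    rw [norm_sub_rev] at hxy
    have := IsUltrametricDist.norm_add_eq_max_of_norm_ne_norm hxy.ne
    rwa [sub_add_cancel, max_eq_right hxy.le] at this
  obtain ⟨k, hk⟩ := exists_norm_eq_zpow_of_mem_maxUnr (A := A) (F := F) (Λ := Λ) hy (by
    rintro rfl
    rw [map_zero, norm_zero] at h1
    exact hx0.ne h1)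
  have hk0 : 0 ≤ k := by
    by_contra! hlt
    have h2 : ‖(x : Λ)‖ ≤ 1 := x.2.2
    rw [← h1, hk] at h2
    exact absurd h2 (not_le.2 (one_lt_zpow_of_neg₀ (unifNorm_pos F) (unifNorm_lt_one F) hlt))
  obtain ⟨k, rfl⟩ := Int.eq_ofNat_of_zero_le hk0
  exact ⟨k, by rw [← h1, hk]; simp⟩

/-- The closure of a subfield is closed under division, so the quotient lies in it, and it is
integral exactly when its norm is at most 1. Divisibility, units and associates in the completed
ring thereby become comparisons of norms. -/
theorem unrRing_dvd_iff [LocalCompletion A F Ω Λ] {x y : 𝓡} :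
    x ∣ y ↔ ‖(y : Λ)‖ ≤ ‖(x : Λ)‖ := by
  constructor
  · rintro ⟨z, rfl⟩
    rw [Subring.coe_mul, norm_mul]
    exact mul_le_of_le_one_right (norm_nonneg _) z.2.2
  · intro h
    rcases eq_or_ne x 0 with rfl | hx
    · have : y = 0 := by simpa using h
      rw [this]
    have hx' : (x : Λ) ≠ 0 := by simpa using hx
    have hinv : (x : Λ)⁻¹ ∈ closure (algebraMap Ω Λ '' (maxUnr A F Ω : Set Ω)) := by
      refine closure_mono (s := (fun z : Λ ↦ z⁻¹) '' (algebraMap Ω Λ '' (maxUnr A F Ω : Set Ω)))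
        ?_ ?_
      · rintro _ ⟨_, ⟨z, hz, rfl⟩, rfl⟩
        exact ⟨z⁻¹, (maxUnr A F Ω).inv_mem hz, map_inv₀ _ _⟩
      · exact mem_closure_image (continuousAt_inv₀ hx') x.2.1
    have hmul : (x : Λ)⁻¹ * y ∈ closure (algebraMap Ω Λ '' (maxUnr A F Ω : Set Ω)) :=
      ((maxUnr A F Ω).toSubalgebra.toSubring.map (algebraMap Ω Λ)).topologicalClosure.mul_mem
        hinv y.2.1
    refine ⟨⟨(x : Λ)⁻¹ * y, mem_unrRing.2 ⟨hmul, ?_⟩⟩, Subtype.ext ?_⟩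
    · rw [norm_mul, norm_inv, inv_mul_le_iff₀ (norm_pos_iff.2 hx'), mul_one]
      exact h
    · simp [mul_inv_cancel_left₀ hx']

theorem unrRing_isUnit_iff [LocalCompletion A F Ω Λ] {x : 𝓡} : IsUnit x ↔ ‖(x : Λ)‖ = 1 := by
  rw [isUnit_iff_dvd_one, unrRing_dvd_iff]
  simp only [Subring.coe_one, norm_one]
  exact ⟨fun h ↦ le_antisymm x.2.2 h, fun h ↦ h.ge⟩

theorem norm_le_unifNorm [LocalCompletion A F Ω Λ] {x : 𝓡} (h : ‖(x : Λ)‖ < 1) :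
    ‖(x : Λ)‖ ≤ ρ := by
  rcases eq_or_ne x 0 with rfl | hx
  · simpa using (unifNorm_pos F).le
  obtain ⟨k, hk⟩ := unrRing_exists_norm_eq hx
  rcases k with _ | k
  · rw [hk] at h; simp at h
  · rw [hk, pow_succ]
    exact mul_le_of_le_one_left (unifNorm_pos F).le
      (pow_le_one₀ (unifNorm_pos F).le (unifNorm_lt_one F).le)

theorem unifR_dvd_iff [LocalCompletion A F Ω Λ] {x : 𝓡} : ϖ ∣ x ↔ ‖(x : Λ)‖ < 1 := by
  rw [unrRing_dvd_iff, norm_unifR]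
  exact ⟨fun h ↦ h.trans_lt (unifNorm_lt_one F), norm_le_unifNorm⟩

theorem unifR_pow_dvd_iff [LocalCompletion A F Ω Λ] {x : 𝓡} (k : ℕ) :
    ϖ ^ k ∣ x ↔ ‖(x : Λ)‖ ≤ ρ ^ k := by
  rw [unrRing_dvd_iff, Subring.coe_pow, norm_pow, norm_unifR]

theorem unrRing_associated_iff [LocalCompletion A F Ω Λ] {x y : 𝓡} :
    Associated x y ↔ ‖(x : Λ)‖ = ‖(y : Λ)‖ := by
  rw [← dvd_dvd_iff_associated, unrRing_dvd_iff, unrRing_dvd_iff]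
  exact ⟨fun h ↦ le_antisymm h.2 h.1, fun h ↦ ⟨h.ge, h.le⟩⟩

/-- A root of `X ^ (q ^ n) - X` as an element of the completed ring. -/
def teichR {n : ℕ} (hn : 1 ≤ n) {ζ : Ω} (h : ζ ^ q ^ n = ζ) : 𝓡 :=
  ⟨ι ζ, algebraMap_mem_unrRing (mem_maxUnr_iff.2 ⟨n, hn, mem_unr_of_pow_eq hn h⟩)
    (norm_le_one_of_pow_eq' hn h)⟩

theorem exists_teichR [LocalCompletion A F Ω Λ] (x : 𝓡) :
    ∃ (n : ℕ) (_ : 1 ≤ n) (ζ : Ω) (_ : ζ ^ q ^ n = ζ), ‖(x : Λ) - ι ζ‖ < 1 := by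
  obtain ⟨y, hy, hxy⟩ := exists_norm_sub_lt x.2.1 one_pos
  have hy1 : ‖ι y‖ ≤ 1 := by
    have h := norm_sub_le_max' (x : Λ) ((x : Λ) - ι y)
    rw [sub_sub_cancel] at h
    exact h.trans (max_le x.2.2 hxy.le)
  obtain ⟨n, ζ, hn, hζ, h⟩ := exists_teichmuller A F hy1
  refine ⟨n, hn, ζ, hζ, ?_⟩
  have := IsUltrametricDist.norm_add_le_max ((x : Λ) - ι y) (ι y - ι ζ)
  rw [sub_add_sub_cancel] at this
  exact this.trans_lt (max_lt hxy h)

theorem norm_pow_sub_pow_lt_one {x y : Λ} (hx : ‖x‖ ≤ 1) (hy : ‖y‖ ≤ 1) (h : ‖x - y‖ < 1)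
    (n : ℕ) : ‖x ^ n - y ^ n‖ < 1 := by
  let x' : unitBall Λ := ⟨x, hx⟩
  let y' : unitBall Λ := ⟨y, hy⟩
  have h1 : residue x' = residue y' := residue_eq_iff.2 h
  have h2 : residue (x' ^ n) = residue (y' ^ n) := by rw [map_pow, map_pow, h1]
  exact residue_eq_iff.1 h2

theorem norm_frobR_sub_pow_lt_one [LocalCompletion A F Ω Λ] (j : ℕ) (x : 𝓡) :
    ‖(Φ j x : Λ) - (x : Λ) ^ q ^ j‖ < 1 := by
  obtain ⟨n, hn, ζ, hζ, h⟩ := exists_teichR x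
  have h1 : ‖(Φ j x : Λ) - ι ζ ^ q ^ j‖ < 1 := by
    rw [← map_pow, ← frob_pow_apply (F := F) Λ hn hζ, ← zpow_natCast, ← galExt_algebraMap (A := A),
      coe_frobR, ← map_sub, norm_galExt]
    exact h
  have h2 := norm_pow_sub_pow_lt_one (norm_le_one_of_pow_eq' hn hζ) x.2.2
    (by rwa [norm_sub_rev] at h) (q ^ j)
  have := IsUltrametricDist.norm_add_le_max ((Φ j x : Λ) - ι ζ ^ q ^ j)
    (ι ζ ^ q ^ j - (x : Λ) ^ q ^ j)
  rw [sub_add_sub_cancel] at this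
  exact this.trans_lt (max_lt h1 h2)

/-- Elements fixed by a power of Frobenius lie in the unramified extension of that degree. -/
theorem exists_unr_of_frobR_eq [LocalCompletion A F Ω Λ] {n : ℕ} (hn : 1 ≤ n) {x : 𝓡}
    (hx : Φ n x = x) : ∃ y ∈ unr A F Ω n, ι y = x := by
  have key : ∀ (k : ℕ) (x : 𝓡), Φ n x = x → ∃ y ∈ unr A F Ω n, ‖(x : Λ) - ι y‖ ≤ ρ ^ k := by
    intro k
    induction k with
    | zero => exact fun x _ ↦ ⟨0, zero_mem _, by simpa using norm_unrRing_le x⟩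
    | succ k ih =>
      intro x hx
      obtain ⟨m, hm, ζ, hζ, h⟩ := exists_teichR x
      -- The class of `x` is fixed by the `q ^ n`-th power map, because `x = φ^n x` is congruent to
      -- `x ^ (q ^ n)`. Its Teichmüller representative inherits this, and the remainder divided by
      -- the uniformizer is again fixed by `φ^n`.
      have hζn : ζ ^ q ^ n = ζ := by
        apply (algebraMap Ω Λ).injective
        refine eq_of_norm_sub_lt_one (A := A) F Ω hm ?_ ?_ ?_
        · rw [← map_pow, pow_pow_eq_self hζ]
        · rw [← map_pow, hζ]
        · have h1 := norm_frobR_sub_pow_lt_one n x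
          rw [hx] at h1
          have h2 := norm_pow_sub_pow_lt_one (norm_le_one_of_pow_eq' hm hζ) x.2.2
            (by rwa [norm_sub_rev] at h) (q ^ n)
          have h3 := IsUltrametricDist.norm_add_le_max (ι ζ ^ q ^ n - (x : Λ) ^ q ^ n)
            ((x : Λ) ^ q ^ n - x)
          have h4 := IsUltrametricDist.norm_add_le_max (ι ζ ^ q ^ n - x) (x - ι ζ)
          rw [sub_add_sub_cancel] at h3 h4
          rw [map_pow]
          rw [norm_sub_rev] at h1
          exact h4.trans_lt (max_lt (h3.trans_lt (max_lt h2 h1)) h)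
      let z : 𝓡 := teichR hm hζ
      obtain ⟨x₁, hx₁⟩ : ϖ ∣ x - z := unifR_dvd_iff.2 h
      have hz : Φ n z = z := by
        apply Subtype.ext
        rw [coe_frobR]
        change galExt A Λ _ (ι ζ) = ι ζ
        rw [galExt_algebraMap, zpow_natCast, frob_pow_apply Λ hm hζ, hζn]
      have hfix : Φ n x₁ = x₁ := by
        have h5 := congrArg (Φ n) hx₁
        rw [map_sub, hx, hz, map_mul, frobR_unifR, hx₁] at h5
        exact (mul_left_cancel₀ unifR_ne_zero h5).symm
      obtain ⟨y, hy, hxy⟩ := ih x₁ hfix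
      refine ⟨ζ + algebraMap A Ω (unif A) * y, add_mem (mem_unr_of_pow_eq hn hζn)
        (mul_mem ?_ hy), ?_⟩
      · rw [IsScalarTower.algebraMap_apply A F Ω]
        exact (unr A F Ω n).algebraMap_mem _
      · have h6 : (x : Λ) - ι (ζ + algebraMap A Ω (unif A) * y) = ϖ * (x₁ - ι y) := by
          have := congrArg Subtype.val hx₁
          simp only [Subring.coe_mul, AddSubgroupClass.coe_sub] at this
          rw [mul_sub, ← this, map_add, map_mul, sub_add_eq_sub_sub]
          rfl
        rw [h6, norm_mul, norm_unifR, pow_succ']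
        exact mul_le_mul_of_nonneg_left hxy (unifNorm_pos F).le
  have hfd := finiteDimensional_unr A F Ω Λ hn
  -- The approximations all lie in one finite extension, which is closed in `Λ`; so the limit itself
  -- comes from there.
  have hcl := LocalCompletion.isClosed_image A (Λ := Λ) (unr A F Ω n).toSubmodule hfd
  have : (x : Λ) ∈ closure (algebraMap Ω Λ '' (unr A F Ω n : Set Ω)) := by
    rw [Metric.mem_closure_iff]
    intro ε hε
    obtain ⟨k, hk⟩ := exists_pow_lt_of_lt_one hε (unifNorm_lt_one F (A := A) (Ω := Ω) (Λ := Λ))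
    obtain ⟨y, hy, hxy⟩ := key k x hx
    exact ⟨_, ⟨y, hy, rfl⟩, by rw [dist_eq_norm]; exact hxy.trans_lt hk⟩
  obtain ⟨y, hy, h⟩ := hcl.closure_eq.le this
  exact ⟨y, hy, h⟩

variable (A F Ω Λ) in
-- The equation `x = a + b φ x` is a fixed point problem: Frobenius is an isometry and `ϖ ∣ b`
-- bounds the norm of `b` by `ρ < 1`, so the right side is a contraction of a complete space.
theorem isFrobeniusLift [LocalCompletion A F Ω Λ] : IsFrobeniusLift (Φ 1) ϖ q where
  exists_char := by
    obtain ⟨p, r, hp, hr, h, hc⟩ := exists_charP_residue A F Ω Λ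
    refine ⟨p, r, hp, hr, h, ?_⟩
    have : Nontrivial (𝓡 ⧸ Ideal.span {ϖ}) := by
      rw [Ideal.Quotient.nontrivial_iff, Ne, Ideal.span_singleton_eq_top, unrRing_isUnit_iff,
        norm_unifR]
      exact (unifNorm_lt_one F).ne
    rw [CharP.charP_iff_prime_eq_zero hp, ← map_natCast (Ideal.Quotient.mk (Ideal.span {ϖ})),
      Ideal.Quotient.eq_zero_iff_dvd, unifR_dvd_iff]
    have : residue ((p : ℕ) : unitBall Λ) = 0 := by rw [map_natCast, CharP.cast_eq_zero]
    simpa using residue_eq_zero_iff.1 this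
  dvd_sub a := by
    have := norm_frobR_sub_pow_lt_one 1 a
    rw [unifR_dvd_iff]
    simpa using this
  regular a h := (mul_eq_zero.1 h).resolve_left unifR_ne_zero
  existsUnique a b hb := by
    have hb' : ‖(b : Λ)‖ ≤ ρ := by
      rw [← norm_unifR (F := F)]
      exact unrRing_dvd_iff.1 hb
    have hc : ContractingWith (⟨ρ, (unifNorm_pos F).le⟩ : NNReal) fun x : 𝓡 ↦ a + b * Φ 1 x := by
      refine ⟨unifNorm_lt_one F, LipschitzWith.of_dist_le_mul fun x y ↦ ?_⟩
      have : ((a + b * Φ 1 x : 𝓡) : Λ) - ((a + b * Φ 1 y : 𝓡) : Λ) =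
          b * ((Φ 1 (x - y) : 𝓡) : Λ) := by
        rw [map_sub]
        simp only [Subring.coe_add, Subring.coe_mul, AddSubgroupClass.coe_sub]
        ring
      rw [Subtype.dist_eq, Subtype.dist_eq, dist_eq_norm, dist_eq_norm, this, norm_mul, norm_frobR]
      exact mul_le_mul_of_nonneg_right hb' (norm_nonneg _)
    exact ⟨hc.fixedPoint, hc.fixedPoint_isFixedPt.symm, fun y hy ↦
      hc.fixedPoint_unique hy.symm⟩

/-! #### Frobenius eigenvectors -/

/-- For `P = X ^ Q - a X - c` the combination `X P' - Q P` is linear with root `e`. At `e` the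
derivative is nonzero, because `Q e ^ (Q - 1)` is small and `a` is a unit; hence `P` is separable
and has a root in `Ω`. A root of norm above 1 would violate `b ^ Q = a b + c`. -/
theorem exists_root_pow_sub [LocalCompletion A F Ω Λ] {Q : ℕ} (hQ : 1 < Q) (hQ1 : ‖(Q : Λ)‖ < 1)
    {a c : Ω} (ha : ‖ι a‖ = 1) (hc : ‖ι c‖ ≤ 1) :
    ∃ b : Ω, ‖ι b‖ ≤ 1 ∧ b ^ Q - a * b - c = 0 := by
  have := IsSepClosure.sep_closed F (K := Ω)
  have ha0 : a ≠ 0 := by rintro rfl; simp at ha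
  have hQu : ‖ι (Q - 1)‖ = 1 := by
    have : ‖(Q : Λ)‖ ≠ ‖(-1 : Λ)‖ := by simpa using hQ1.ne
    have := IsUltrametricDist.norm_add_eq_max_of_norm_ne_norm this
    rw [← sub_eq_add_neg, norm_neg, norm_one, max_eq_right hQ1.le] at this
    simpa using this
  have hQ0 : (Q : Ω) - 1 ≠ 0 := fun h ↦ by simp [h] at hQu
  set P : Polynomial Ω := X ^ Q - C a * X - C c with hP
  have hdeg : (C a * X + C c : Polynomial Ω).degree < Q :=
    (degree_linear_le).trans_lt (by exact_mod_cast hQ)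
  have hPm : P.Monic := by
    rw [hP, sub_sub]
    exact monic_X_pow_sub hdeg
  set e : Ω := -(Q * c) / ((Q - 1) * a) with he
  have hval : (Q : Ω) * e ^ (Q - 1) - a ≠ 0 := by
    intro h
    have h1 : ι a = ι (Q * e ^ (Q - 1)) := by
      congr 1
      linear_combination -h
    have h2 : ‖ι e‖ ≤ 1 := by
      rw [he, map_div₀, map_neg, norm_div, norm_neg, map_mul, map_mul, norm_mul, norm_mul, hQu, ha,
        map_natCast, mul_one, div_one]
      exact mul_le_one₀ hQ1.le (norm_nonneg _) hc
    have h3 : ‖ι a‖ < 1 := by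
      rw [h1, map_mul, map_pow, norm_mul, norm_pow, map_natCast]
      exact (mul_le_of_le_one_right (norm_nonneg _) (pow_le_one₀ (norm_nonneg _) h2)).trans_lt hQ1
    exact h3.ne ha
  have hd : derivative P = C (Q : Ω) * X ^ (Q - 1) - C a := by
    simp [hP, derivative_X_pow]
  have hsep : P.Separable := by
    rw [Polynomial.Separable, hd]
    obtain ⟨h, hh⟩ := X_sub_C_dvd_sub_C_eval (a := e) (p := C (Q : Ω) * X ^ (Q - 1) - C a)
    have hev : (C (Q : Ω) * X ^ (Q - 1) - C a).eval e = Q * e ^ (Q - 1) - a := by simp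
    rw [hev] at hh
    have hlin : X * (C (Q : Ω) * X ^ (Q - 1) - C a) - C (Q : Ω) * P =
        C ((Q - 1) * a) * (X - C e) := by
      have h1 : C ((Q - 1) * a) * (X - C e) = C ((Q - 1) * a) * X + C (Q * c : Ω) := by
        rw [mul_sub, ← C_mul, he, mul_div_cancel₀ _ (mul_ne_zero hQ0 ha0), C_neg, sub_neg_eq_add]
      have h2 : (X : Polynomial Ω) ^ Q = X * X ^ (Q - 1) := by
        rw [← pow_succ']; congr 1; omega
      rw [h1, hP, h2]
      simp only [C_mul, C_sub, C_1, map_natCast]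
      ring
    set v := Q * e ^ (Q - 1) - a
    set w := (Q - 1) * a
    have hw : w ≠ 0 := mul_ne_zero hQ0 ha0
    refine ⟨C v⁻¹ * h * C w⁻¹ * C (Q : Ω), C v⁻¹ * (1 - h * C w⁻¹ * X), ?_⟩
    have hCv : C v⁻¹ * C v = (1 : Polynomial Ω) := by rw [← C_mul, inv_mul_cancel₀ hval, C_1]
    have hCw : C w⁻¹ * C w = (1 : Polynomial Ω) := by rw [← C_mul, inv_mul_cancel₀ hw, C_1]
    set D := C (Q : Ω) * X ^ (Q - 1) - C a
    linear_combination (-C v⁻¹ * h * C w⁻¹) * hlin + hCv + C v⁻¹ * hh -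
      C v⁻¹ * h * (X - C e) * hCw
  obtain ⟨b, hb⟩ := IsSepClosed.exists_root P
    (by
      have : P.natDegree = Q := by
        rw [hP, sub_sub]
        rw [natDegree_sub_eq_left_of_natDegree_lt] <;> rw [natDegree_X_pow]
        exact (natDegree_linear_le).trans_lt hQ
      intro h0
      rw [degree_eq_natDegree hPm.ne_zero, this] at h0
      norm_cast at h0
      omega) hsep
  have hb0 : b ^ Q - a * b - c = 0 := by simpa [hP, IsRoot] using hb
  refine ⟨b, ?_, hb0⟩
  by_contra! hlt
  have h1 : ‖ι b‖ ^ Q ≤ ‖ι b‖ := by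
    have h2 : ι b ^ Q = ι a * ι b + ι c := by
      rw [← map_pow, ← map_mul, ← map_add]
      congr 1
      linear_combination hb0
    rw [← norm_pow, h2]
    refine (IsUltrametricDist.norm_add_le_max _ _).trans (max_le ?_ (hc.trans hlt.le))
    rw [norm_mul, ha, one_mul]
  exact absurd (lt_self_pow₀ hlt hQ) (not_lt.2 h1)

theorem norm_resCard_pow_lt_one [LocalCompletion A F Ω Λ] {j : ℕ} (hj : 1 ≤ j) :
    ‖((q ^ j : ℕ) : Λ)‖ < 1 := by
  rw [Nat.cast_pow, norm_pow]
  exact pow_lt_one₀ (norm_nonneg _) (norm_resCard_lt_one F Ω) (by omega)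

theorem norm_sub_lt_trans {x y z : Λ} {r : ℝ} (h1 : ‖x - y‖ < r) (h2 : ‖y - z‖ < r) :
    ‖x - z‖ < r := by
  rw [← sub_add_sub_cancel x y z]
  exact (IsUltrametricDist.norm_add_le_max _ _).trans_lt (max_lt h1 h2)

theorem norm_mul_sub_mul_lt_one {a b c d : Λ} (ha : ‖a‖ ≤ 1) (hd : ‖d‖ ≤ 1) (h1 : ‖a - c‖ < 1)
    (h2 : ‖b - d‖ < 1) : ‖a * b - c * d‖ < 1 := by
  have : a * b - c * d = a * (b - d) + (a - c) * d := by ring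
  rw [this]
  refine (IsUltrametricDist.norm_add_le_max _ _).trans_lt (max_lt ?_ ?_) <;> rw [norm_mul]
  · exact (mul_le_of_le_one_left (norm_nonneg _) ha).trans_lt h2
  · exact (mul_le_of_le_one_right (norm_nonneg _) hd).trans_lt h1

theorem exists_teichR_of_norm_le [LocalCompletion A F Ω Λ] {b : Ω} (hb : ‖ι b‖ ≤ 1) :
    ∃ z : 𝓡, ‖(z : Λ) - ι b‖ < 1 := by
  obtain ⟨m, ζ, hm, hζ, h⟩ := exists_teichmuller A F hb
  exact ⟨teichR hm hζ, by rwa [norm_sub_rev] at h⟩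

/-- The equation `φ^j z - a z = c` is solvable modulo the maximal ideal. -/
theorem exists_norm_frobR_sub_lt_one [LocalCompletion A F Ω Λ] {j : ℕ} (hj : 1 ≤ j) {a : 𝓡}
    (ha : ‖(a : Λ)‖ = 1) (c : 𝓡) : ∃ z : 𝓡, ‖((Φ j z - a * z - c : 𝓡) : Λ)‖ < 1 := by
  obtain ⟨n, hn, ξ, hξ, h⟩ := exists_teichR a
  obtain ⟨n', hn', γ, hγ, hcγ⟩ := exists_teichR c
  have hξ1 : ‖ι ξ‖ = 1 := by
    refine le_antisymm (norm_le_one_of_pow_eq' hn hξ) (not_lt.1 fun hlt ↦ ?_)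
    have := norm_sub_lt_trans (z := 0) h (by simpa using hlt)
    rw [sub_zero] at this
    exact this.ne ha
  -- On residue classes `φ^j` is the `q ^ j`-th power, so the congruence is an Artin–Schreier type
  -- equation. It is solved in `Ω` with roots of unity as coefficients, and its root is then
  -- replaced by an unramified representative.
  obtain ⟨b, hb, hb0⟩ := exists_root_pow_sub (A := A) (F := F) (one_lt_resCard_pow A hj)
    (norm_resCard_pow_lt_one (A := A) (F := F) (Ω := Ω) hj) hξ1 (norm_le_one_of_pow_eq' hn' hγ)
  obtain ⟨z, hz⟩ := exists_teichR_of_norm_le (A := A) (F := F) hb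
  refine ⟨z, ?_⟩
  have h1 := norm_frobR_sub_pow_lt_one j z
  have h2 := norm_pow_sub_pow_lt_one z.2.2 hb hz (q ^ j)
  have h3 := norm_sub_lt_trans h1 h2
  have h4 := norm_mul_sub_mul_lt_one a.2.2 hb h hz
  have h5 : ι b ^ q ^ j = ι ξ * ι b + ι γ := by
    rw [← map_pow, ← map_mul, ← map_add]
    congr 1
    linear_combination hb0
  have h6 : ((Φ j z - a * z - c : 𝓡) : Λ) = ((Φ j z : Λ) - ι b ^ q ^ j) -
      (a * z - ι ξ * ι b) - (c - ι γ) := by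
    rw [h5]
    simp only [AddSubgroupClass.coe_sub, Subring.coe_mul]
    ring
  rw [h6]
  exact (norm_sub_le_max' _ _).trans_lt (max_lt ((norm_sub_le_max' _ _).trans_lt
    (max_lt h3 h4)) hcγ)

/-- The equation `φ^j η = u η` has a unit solution modulo the maximal ideal. -/
theorem exists_unit_norm_frobR_sub_lt_one [LocalCompletion A F Ω Λ] {j : ℕ} (hj : 1 ≤ j) {u : 𝓡}
    (hu : ‖(u : Λ)‖ = 1) :
    ∃ z : 𝓡, ‖(z : Λ)‖ = 1 ∧ ‖((Φ j z - u * z : 𝓡) : Λ)‖ < 1 := by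
  have := IsSepClosure.sep_closed F (K := Ω)
  obtain ⟨n, hn, ξ, hξ, h⟩ := exists_teichR u
  have hξ1 : ‖ι ξ‖ = 1 := by
    refine le_antisymm (norm_le_one_of_pow_eq' hn hξ) (not_lt.1 fun hlt ↦ ?_)
    have := norm_sub_lt_trans (z := 0) h (by simpa using hlt)
    rw [sub_zero] at this
    exact this.ne hu
  have hξ0 : ξ ≠ 0 := by rintro rfl; simp at hξ1
  have hQ := one_lt_resCard_pow A hj
  have : NeZero ((q ^ j - 1 : ℕ) : Ω) := ⟨resCard_pow_sub_one_ne_zero F Λ hj⟩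
  -- Modulo the maximal ideal a unit solution of `z ^ (q ^ j) = u z` is a root of order `q ^ j - 1`
  -- of `u`.
  obtain ⟨b, hb⟩ := IsSepClosed.exists_pow_nat_eq ξ (q ^ j - 1)
  have hb1 : ‖ι b‖ = 1 := by
    have : ‖ι b‖ ^ (q ^ j - 1) = 1 := by rw [← norm_pow, ← map_pow, hb, hξ1]
    exact (pow_eq_one_iff_of_nonneg (norm_nonneg _) (by omega)).1 this
  obtain ⟨z, hz⟩ := exists_teichR_of_norm_le (A := A) (F := F) hb1.le
  refine ⟨z, ?_, ?_⟩
  · refine le_antisymm z.2.2 (not_lt.1 fun hlt ↦ ?_)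
    have := norm_sub_lt_trans (x := ι b) (y := (z : Λ)) (z := 0) (r := 1)
      (by rwa [norm_sub_rev] at hz) (by simpa using hlt)
    rw [sub_zero] at this
    exact this.ne hb1
  · have h1 := norm_frobR_sub_pow_lt_one j z
    have h2 := norm_pow_sub_pow_lt_one z.2.2 hb1.le hz (q ^ j)
    have h3 := norm_sub_lt_trans h1 h2
    have h4 := norm_mul_sub_mul_lt_one u.2.2 hb1.le h hz
    have h5 : ι b ^ q ^ j = ι ξ * ι b := by
      rw [← map_pow, ← map_mul, ← hb, ← pow_succ]
      congr 2
      omega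
    have h6 : ((Φ j z - u * z : 𝓡) : Λ) = ((Φ j z : Λ) - ι b ^ q ^ j) - (u * z - ι ξ * ι b) := by
      rw [h5]
      simp only [AddSubgroupClass.coe_sub, Subring.coe_mul]
      ring
    rw [h6]
    exact (norm_sub_le_max' _ _).trans_lt (max_lt h3 h4)

/-- Units are Frobenius coboundaries. -/
theorem exists_frobR_eq_mul [LocalCompletion A F Ω Λ] {j : ℕ} (hj : 1 ≤ j) {u : 𝓡}
    (hu : ‖(u : Λ)‖ = 1) : ∃ η : 𝓡, ‖(η : Λ)‖ = 1 ∧ Φ j η = u * η := by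
  obtain ⟨z₀, hz₀, hz₀'⟩ := exists_unit_norm_frobR_sub_lt_one hj hu
  -- If the defect of `y` is `ϖ ^ (k + 1) c`, adding `ϖ ^ (k + 1) z` with `φ^j z - u z` congruent to
  -- `-c` gains one more power of `ϖ`.
  have step : ∀ (k : ℕ) (y : 𝓡), ∃ y' : 𝓡, ϖ ^ (k + 1) ∣ Φ j y - u * y →
      ϖ ^ (k + 1) ∣ y' - y ∧ ϖ ^ (k + 2) ∣ Φ j y' - u * y' := by
    intro k y
    by_cases hy : ϖ ^ (k + 1) ∣ Φ j y - u * y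
    · obtain ⟨c, hc⟩ := hy
      obtain ⟨z, hz⟩ := exists_norm_frobR_sub_lt_one hj hu (-c)
      obtain ⟨d, hd⟩ := unifR_dvd_iff.2 hz
      refine ⟨y + ϖ ^ (k + 1) * z, fun _ ↦ ⟨⟨z, by ring⟩, d, ?_⟩⟩
      rw [map_add, map_mul, map_pow, frobR_unifR]
      linear_combination hc + ϖ ^ (k + 1) * hd
    · exact ⟨y, fun h ↦ absurd h hy⟩
  choose nx hnx using step
  obtain ⟨y, hy0, hys⟩ : ∃ y : ℕ → 𝓡, y 0 = z₀ ∧ ∀ k, y (k + 1) = nx k (y k) :=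
    ⟨fun k ↦ Nat.rec z₀ (fun k y ↦ nx k y) k, rfl, fun _ ↦ rfl⟩
  have hy : ∀ k, ϖ ^ (k + 1) ∣ Φ j (y k) - u * y k := by
    intro k
    induction k with
    | zero => rw [zero_add, pow_one, hy0]; exact unifR_dvd_iff.2 hz₀'
    | succ k ih => rw [hys]; exact (hnx k (y k) ih).2
  have hρ0 := unifNorm_pos F (A := A) (Ω := Ω) (Λ := Λ)
  have hρ1 := unifNorm_lt_one F (A := A) (Ω := Ω) (Λ := Λ)
  have hd : ∀ k, ‖((y (k + 1) - y k : 𝓡) : Λ)‖ ≤ ρ ^ (k + 1) := fun k ↦ by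
    rw [hys]
    exact (unifR_pow_dvd_iff (k + 1)).1 (hnx k (y k) (hy k)).1
  have hcs : CauchySeq y := by
    refine cauchySeq_of_le_geometric ρ ρ hρ1 fun k ↦ ?_
    rw [dist_comm, Subtype.dist_eq, dist_eq_norm, ← pow_succ']
    exact hd k
  obtain ⟨η, hη⟩ := cauchySeq_tendsto_of_complete hcs
  have hη' : Filter.Tendsto (Subtype.val ∘ y) Filter.atTop (nhds (η : Λ)) :=
    (continuous_subtype_val.tendsto η).comp hη
  have hnorm : ∀ k : ℕ, ‖((y k : 𝓡) : Λ)‖ = 1 := by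
    intro k
    induction k with
    | zero => rw [hy0]; exact hz₀
    | succ k ih =>
      have h1 : ‖((y (k + 1) - y k : 𝓡) : Λ)‖ < ‖(y k : Λ)‖ := by
        rw [ih]
        exact (hd k).trans_lt (pow_lt_one₀ hρ0.le hρ1 (by omega))
      have := IsUltrametricDist.norm_add_eq_max_of_norm_ne_norm h1.ne
      rw [max_eq_right h1.le, ih] at this
      rw [← this]
      congr 1
      simp
  refine ⟨η, ?_, ?_⟩
  · refine tendsto_nhds_unique hη'.norm ?_
    exact tendsto_const_nhds.congr fun k ↦ (hnorm k).symm
  · apply Subtype.ext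
    rw [← sub_eq_zero]
    refine tendsto_nhds_unique (f := fun k ↦ ((Φ j (y k) - u * y k : 𝓡) : Λ)) (l := Filter.atTop)
      ?_ ?_
    · simp only [AddSubgroupClass.coe_sub, Subring.coe_mul, coe_frobR]
      exact (((continuous_galExt _).tendsto _).comp hη').sub (hη'.const_mul _)
    · refine squeeze_zero_norm (a := fun k ↦ ρ ^ (k + 1))
        (fun k ↦ (unifR_pow_dvd_iff (k + 1)).1 (hy k)) ?_
      exact (tendsto_pow_atTop_nhds_zero_of_lt_one hρ0.le hρ1).comp (Filter.tendsto_add_atTop_nat 1)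

end Completion

/-! ### Lubin–Tate polynomials over the completed maximal unramified extension -/

section LubinTatePolynomial

variable {A F Ω Λ : Type*} [CommRing A] [IsDomain A] [IsDiscreteValuationRing A]
  [Finite (IsLocalRing.ResidueField A)] [Field F] [Algebra A F] [IsFractionRing A F]
  [Field Ω] [Algebra F Ω] [Algebra A Ω] [IsScalarTower A F Ω] [IsSepClosure F Ω]
  [NormedField Λ] [CompleteSpace Λ] [IsUltrametricDist Λ] [Algebra Ω Λ]

local notation "ι" => algebraMap Ω Λ
local notation "q" => resCard A
local notation "ρ" => unifNorm A Ω Λ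
local notation "𝓡" => unrRing A F Ω Λ
local notation "Φ" => frobR A F Ω Λ
local notation "ϖ" => unifR A F Ω Λ

variable (A F Ω Λ) in
/-- The inclusion of the maximal unramified extension into the completion. -/
def unrEmb : maxUnr A F Ω →+* Λ := (algebraMap Ω Λ).comp (algebraMap (maxUnr A F Ω) Ω)

theorem unrEmb_apply (x : maxUnr A F Ω) : unrEmb A F Ω Λ x = ι x := rfl

/-- A monic polynomial over the maximal unramified extension with `f ≡ π X` modulo degree `2` for
a uniformizer `π` and `f ≡ X ^ q` modulo the maximal ideal. -/
structure IsLT [LocalCompletion A F Ω Λ] (f : Polynomial 𝓡) : Prop where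
  monic : f.Monic
  coeff_zero : f.coeff 0 = 0
  norm_coeff_one : ‖(f.coeff 1 : Λ)‖ = ρ
  dvd : C ϖ ∣ f - X ^ q
  lifts : f.map (algebraMap 𝓡 Λ) ∈ Polynomial.lifts (unrEmb A F Ω Λ)

section IsLT

variable [LocalCompletion A F Ω Λ] {f g : Polynomial (unrRing A F Ω Λ)}

theorem IsLT.natDegree (hf : IsLT f) : f.natDegree = q := by
  have hn : Nontrivial (𝓡 ⧸ Ideal.span {ϖ}) := by
    rw [Ideal.Quotient.nontrivial_iff, Ne, Ideal.span_singleton_eq_top, unrRing_isUnit_iff,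
      norm_unifR]
    exact (unifNorm_lt_one F).ne
  rw [← hf.monic.natDegree_map (Ideal.Quotient.mk (Ideal.span {ϖ}))]
  obtain ⟨r, hr⟩ := hf.dvd
  have h0 : Ideal.Quotient.mk (Ideal.span {ϖ}) ϖ = 0 :=
    Ideal.Quotient.eq_zero_iff_mem.2 (Ideal.mem_span_singleton_self ϖ)
  have : f.map (Ideal.Quotient.mk (Ideal.span {ϖ})) = X ^ q := by
    rw [eq_add_of_sub_eq hr, Polynomial.map_add, Polynomial.map_mul, map_C, h0]
    simp
  rw [this, natDegree_X_pow]

theorem IsLT.isFrobeniusSeries (hf : IsLT f) : IsFrobeniusSeries ϖ q (f : PowerSeries 𝓡) where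
  zero := by simp [hf.coeff_zero]
  one := by
    rw [Polynomial.coeff_coe, unrRing_associated_iff, hf.norm_coeff_one, norm_unifR]
  dvd i := by
    have := (C_dvd_iff_dvd_coeff _ _).1 hf.dvd i
    rw [← Polynomial.coeff_coe] at this
    simpa using this

theorem IsLT.constantCoeff (hf : IsLT f) : PowerSeries.constantCoeff (f : PowerSeries 𝓡) = 0 :=
  hf.isFrobeniusSeries.zero

theorem map_frobR_lifts (j : ℤ) {p : Polynomial 𝓡}
    (hp : p.map (algebraMap 𝓡 Λ) ∈ Polynomial.lifts (unrEmb A F Ω Λ)) :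
    (p.map (Φ j)).map (algebraMap 𝓡 Λ) ∈ Polynomial.lifts (unrEmb A F Ω Λ) := by
  rw [lifts_iff_coeff_lifts] at hp ⊢
  intro i
  obtain ⟨y, hy⟩ := hp i
  refine ⟨⟨(frob A F Ω ^ j) y, galois_mem_maxUnr _ y.2⟩, ?_⟩
  rw [coeff_map, coeff_map]
  rw [coeff_map] at hy
  change _ = galExt A Λ (frob A F Ω ^ j) (algebraMap 𝓡 Λ (p.coeff i))
  rw [← hy, unrEmb_apply, unrEmb_apply, galExt_algebraMap]

theorem IsLT.map_frobR (hf : IsLT f) (j : ℤ) : IsLT (f.map (Φ j)) where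
  monic := hf.monic.map _
  coeff_zero := by rw [coeff_map, hf.coeff_zero, map_zero]
  norm_coeff_one := by rw [coeff_map, norm_frobR, hf.norm_coeff_one]
  dvd := by
    obtain ⟨r, hr⟩ := hf.dvd
    refine ⟨r.map (Φ j), ?_⟩
    have := congrArg (Polynomial.map (Φ j)) hr
    simpa [frobR_unifR] using this
  lifts := map_frobR_lifts j hf.lifts

theorem map_frobR_map (i j : ℤ) (p : Polynomial 𝓡) :
    (p.map (Φ j)).map (Φ i) = p.map (Φ (i + j)) := by
  ext k
  simp [frobR_add]

theorem map_frobR_zero (p : Polynomial 𝓡) : p.map (Φ 0) = p := by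
  ext k
  simp [frobR_zero]

/-- `f_m = f^{φ^{m-1}} ∘ ⋯ ∘ f^φ ∘ f`. -/
def ltIter (f : Polynomial 𝓡) : ℕ → Polynomial 𝓡
  | 0 => X
  | m + 1 => (f.map (Φ m)).comp (ltIter f m)

theorem ltIter_add (f : Polynomial 𝓡) (m k : ℕ) :
    ltIter f (m + k) = (ltIter (f.map (Φ k)) m).comp (ltIter f k) := by
  induction m with
  | zero => simp [ltIter]
  | succ m ih =>
    rw [show m + 1 + k = (m + k) + 1 by omega, ltIter, ih, ltIter, map_frobR_map, comp_assoc]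
    push_cast
    rfl

theorem ltIter_one (f : Polynomial 𝓡) : ltIter f 1 = f := by
  simp [ltIter, map_frobR_zero]

theorem ltIter_succ' (f : Polynomial 𝓡) (m : ℕ) :
    ltIter f (m + 1) = (ltIter (f.map (Φ 1)) m).comp f := by
  have := ltIter_add f m 1
  rwa [ltIter_one] at this

theorem ltIter_map (f : Polynomial 𝓡) (m : ℕ) (j : ℤ) :
    (ltIter f m).map (Φ j) = ltIter (f.map (Φ j)) m := by
  induction m with
  | zero => simp [ltIter]
  | succ m ih =>
    rw [ltIter, ltIter, Polynomial.map_comp, ih, map_frobR_map, map_frobR_map, add_comm]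

theorem IsLT.iter_monic_and (hf : IsLT f) (m : ℕ) :
    (ltIter f m).Monic ∧ (ltIter f m).natDegree = q ^ m := by
  induction m with
  | zero => exact ⟨monic_X, by simp [ltIter]⟩
  | succ m ih =>
    have h := hf.map_frobR m
    refine ⟨h.monic.comp ih.1 ?_, ?_⟩
    · rw [ih.2]; exact pow_ne_zero _ (resCard_ne_zero A)
    · rw [ltIter, natDegree_comp, h.natDegree, ih.2, pow_succ']

theorem IsLT.iter_monic (hf : IsLT f) (m : ℕ) : (ltIter f m).Monic := (hf.iter_monic_and m).1

theorem IsLT.iter_natDegree (hf : IsLT f) (m : ℕ) : (ltIter f m).natDegree = q ^ m :=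
  (hf.iter_monic_and m).2

theorem IsLT.iter_coeff_zero (hf : IsLT f) (m : ℕ) : (ltIter f m).coeff 0 = 0 := by
  induction m with
  | zero => simp [ltIter]
  | succ m ih =>
    rw [coeff_zero_eq_eval_zero] at ih ⊢
    rw [ltIter, eval_comp, ih, ← coeff_zero_eq_eval_zero, (hf.map_frobR m).coeff_zero]

theorem IsLT.iter_dvd (hf : IsLT f) (m : ℕ) : C ϖ ∣ ltIter f m - X ^ q ^ m := by
  induction m with
  | zero => simp [ltIter]
  | succ m ih =>
    obtain ⟨r, hr⟩ := (hf.map_frobR m).dvd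
    have h1 : ltIter f (m + 1) = (ltIter f m) ^ q + C ϖ * r.comp (ltIter f m) := by
      have := congrArg (fun p ↦ Polynomial.comp p (ltIter f m)) hr
      simp only [sub_comp, mul_comp, C_comp, X_pow_comp] at this
      rw [ltIter]
      linear_combination this
    rw [h1, pow_succ, pow_mul, add_sub_right_comm]
    exact dvd_add (ih.trans (sub_dvd_pow_sub_pow _ _ _)) (dvd_mul_right _ _)

theorem IsLT.iter_lifts (hf : IsLT f) (m : ℕ) :
    (ltIter f m).map (algebraMap 𝓡 Λ) ∈ Polynomial.lifts (unrEmb A F Ω Λ) := by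
  induction m with
  | zero => rw [ltIter, map_X]; exact X_mem_lifts _
  | succ m ih =>
    obtain ⟨a, ha⟩ := (mem_lifts _).1 (hf.map_frobR m).lifts
    obtain ⟨b, hb⟩ := (mem_lifts _).1 ih
    rw [ltIter, Polynomial.map_comp, ← ha, ← hb, ← Polynomial.map_comp]
    exact (mem_lifts _).2 ⟨_, rfl⟩

/-- The derivative of a Lubin–Tate polynomial. -/
theorem IsLT.derivative_eq (hf : IsLT f) :
    ∃ w : Polynomial 𝓡, derivative f = C ϖ * w ∧ IsUnit (w.coeff 0) := by
  have hq : ϖ ∣ (q : 𝓡) := by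
    rw [unifR_dvd_iff]
    simpa using norm_resCard_lt_one (A := A) (Λ := Λ) F Ω
  have hd : C ϖ ∣ derivative f := by
    obtain ⟨r, hr⟩ := hf.dvd
    rw [eq_add_of_sub_eq hr, derivative_add, derivative_C_mul, derivative_X_pow]
    exact dvd_add (dvd_mul_right _ _) ((map_dvd C hq).mul_right _)
  obtain ⟨w, hw⟩ := hd
  refine ⟨w, hw, ?_⟩
  have h := congrArg (fun p ↦ ‖((coeff p 0 : 𝓡) : Λ)‖) hw
  simp only [coeff_derivative, coeff_C_mul, Nat.cast_zero, zero_add, mul_one, hf.norm_coeff_one,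
    Subring.coe_mul, norm_mul, norm_unifR] at h
  rw [unrRing_isUnit_iff]
  exact (mul_eq_left₀ (unifNorm_pos F).ne').1 h.symm

/-- By the chain rule each of the `m` composed polynomials contributes one factor `ϖ`; the constant
terms of the cofactors are units, and composing with `f_m` keeps them, as `f_m` vanishes at 0. -/
theorem IsLT.derivative_iter_eq (hf : IsLT f) (m : ℕ) :
    ∃ w : Polynomial 𝓡, derivative (ltIter f m) = C (ϖ ^ m) * w ∧ IsUnit (w.coeff 0) := by
  induction m with
  | zero => exact ⟨1, by simp [ltIter], by simp⟩
  | succ m ih =>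
    obtain ⟨v, hv, hv0⟩ := ih
    obtain ⟨w, hw, hw0⟩ := (hf.map_frobR m).derivative_eq
    refine ⟨v * w.comp (ltIter f m), ?_, ?_⟩
    · rw [ltIter, derivative_comp, hv, hw, mul_comp, C_comp, pow_succ, C_mul]
      ring
    · rw [mul_coeff_zero]
      refine hv0.mul ?_
      rwa [coeff_zero_eq_eval_zero, eval_comp, ← coeff_zero_eq_eval_zero, hf.iter_coeff_zero,
        ← coeff_zero_eq_eval_zero]

theorem IsLT.norm_iter_coeff_one (hf : IsLT f) (m : ℕ) :
    ‖(((ltIter f m).coeff 1 : 𝓡) : Λ)‖ = ρ ^ m := by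
  obtain ⟨w, hw, hw0⟩ := hf.derivative_iter_eq m
  have h := congrArg (fun p ↦ ‖((coeff p 0 : 𝓡) : Λ)‖) hw
  simp only [coeff_derivative, coeff_C_mul, Nat.cast_zero, zero_add, mul_one,
    Subring.coe_mul, norm_mul, (unrRing_isUnit_iff.1 hw0), Subring.coe_pow, norm_pow,
    norm_unifR] at h
  exact h

/-- A maximal ideal of the quotient ring modulo `P` lies over the ideal of `ϖ` by integrality, hence
contains the class of `X`, because `P` is `X ^ N` modulo `ϖ`. Modulo it `w` equals its constant
term, a unit. So `w` is invertible modulo `P`. -/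
theorem isCoprime_of_dvd {P w : Polynomial 𝓡} (hP : P.Monic) {N : ℕ} (h : C ϖ ∣ P - X ^ N)
    (hw : IsUnit (w.coeff 0)) : IsCoprime P w := by
  have hu : IsUnit (AdjoinRoot.mk P w) := by
    by_contra hu
    obtain ⟨M, hM, hwM⟩ := exists_max_ideal_of_mem_nonunits hu
    have := hP.finite_adjoinRoot
    have hJ := Ideal.isMaximal_comap_of_isIntegral_of_isMaximal (R := 𝓡) M
    set J := M.comap (algebraMap 𝓡 (AdjoinRoot P)) with hJdef
    have hle : J ≤ Ideal.span {ϖ} := by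
      intro x hx
      rw [Ideal.mem_span_singleton, unifR_dvd_iff]
      refine lt_of_le_of_ne x.2.2 fun hx1 ↦ hJ.ne_top ?_
      exact Ideal.eq_top_of_isUnit_mem _ hx (unrRing_isUnit_iff.2 hx1)
    have hJe := hJ.eq_of_le (by
      rw [Ne, Ideal.span_singleton_eq_top, unrRing_isUnit_iff, norm_unifR]
      exact (unifNorm_lt_one F).ne) hle
    have hϖ : AdjoinRoot.mk P (C ϖ) ∈ M := by
      have : ϖ ∈ J := hJe ▸ Ideal.mem_span_singleton_self ϖ
      exact this
    have hX : AdjoinRoot.mk P X ∈ M := by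
      obtain ⟨r, hr⟩ := h
      have h1 := congrArg (AdjoinRoot.mk P) hr
      rw [map_sub, AdjoinRoot.mk_self, zero_sub, map_mul, map_pow] at h1
      refine hM.isPrime.mem_of_pow_mem N ?_
      rw [← neg_mem_iff, h1]
      exact M.mul_mem_right _ hϖ
    have h2 : AdjoinRoot.mk P (C (w.coeff 0)) ∈ M := by
      have h3 := congrArg (AdjoinRoot.mk P) (X_mul_divX_add w)
      rw [map_add, map_mul] at h3
      have := M.sub_mem hwM (M.mul_mem_right (AdjoinRoot.mk P w.divX) hX)
      rwa [← h3, add_sub_cancel_left] at this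
    exact hM.ne_top (Ideal.eq_top_of_isUnit_mem _ h2 ((hw.map C).map _))
  obtain ⟨v, hv⟩ := hu.exists_right_inv
  obtain ⟨v, rfl⟩ := AdjoinRoot.mk_surjective v
  rw [← map_mul, ← map_one (AdjoinRoot.mk P), AdjoinRoot.mk_eq_mk] at hv
  obtain ⟨c, hc⟩ := hv
  exact ⟨-c, v, by linear_combination hc⟩

/-- The power of `ϖ` in the derivative becomes invertible over `Λ`, and the other factor is coprime
to `f_m` already over the integers. -/
theorem IsLT.separable_iter (hf : IsLT f) (m : ℕ) :
    ((ltIter f m).map (algebraMap 𝓡 Λ)).Separable := by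
  obtain ⟨w, hw, hw0⟩ := hf.derivative_iter_eq m
  have h := (isCoprime_of_dvd (hf.iter_monic m) (hf.iter_dvd m) hw0).map
    (mapRingHom (algebraMap 𝓡 Λ))
  rw [Polynomial.Separable, derivative_map, hw, Polynomial.map_mul, map_C]
  refine IsCoprime.mul_right ?_ h
  have hu : IsUnit (C (algebraMap 𝓡 Λ (ϖ ^ m)) : Polynomial Λ) :=
    IsUnit.map C (IsUnit.mk0 _ (by
      rw [map_pow]
      exact pow_ne_zero _ (emb_unif_ne_zero F)))
  obtain ⟨v, hv⟩ := hu.exists_left_inv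
  exact ⟨0, v, by rw [zero_mul, zero_add, hv]⟩

/-- The roots of `f_m` lie in `Ω`. -/
theorem IsLT.exists_splits (hf : IsLT f) (m : ℕ) :
    ∃ P : Polynomial (maxUnr A F Ω), P.Monic ∧
      P.map (unrEmb A F Ω Λ) = (ltIter f m).map (algebraMap 𝓡 Λ) ∧
      (P.map (algebraMap (maxUnr A F Ω) Ω)).Splits := by
  obtain ⟨P, hP⟩ := (mem_lifts _).1 (hf.iter_lifts m)
  have hm : P.Monic := by
    have := (hf.iter_monic m).map (algebraMap 𝓡 Λ)
    rw [← hP] at this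
    exact monic_of_injective (unrEmb A F Ω Λ).injective this
  refine ⟨P, hm, hP, ?_⟩
  have := IsSepClosure.sep_closed F (K := Ω)
  refine IsSepClosed.splits_of_separable _ ?_
  rw [← separable_map (algebraMap Ω Λ), Polynomial.map_map]
  change (P.map (unrEmb A F Ω Λ)).Separable
  rw [hP]
  exact hf.separable_iter m

theorem IsLT.splits_iter (hf : IsLT f) (m : ℕ) :
    ((ltIter f m).map (algebraMap 𝓡 Λ)).Splits := by
  obtain ⟨P, -, hP, hs⟩ := hf.exists_splits m
  rw [← hP, unrEmb, ← Polynomial.map_map]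
  exact hs.map _

open Classical in
/-- The roots of `f_m`. -/
def torsΛ (f : Polynomial 𝓡) (m : ℕ) : Finset Λ :=
  ((ltIter f m).map (algebraMap 𝓡 Λ)).roots.toFinset

theorem IsLT.mem_tors (hf : IsLT f) {m : ℕ} {α : Λ} : α ∈ torsΛ f m ↔ aeval α (ltIter f m) = 0 := by
  classical
  rw [torsΛ, Multiset.mem_toFinset, mem_roots ((hf.iter_monic m).map _).ne_zero, IsRoot.def,
    eval_map, aeval_def]

theorem IsLT.card_tors (hf : IsLT f) (m : ℕ) : (torsΛ f m).card = q ^ m := by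
  classical
  rw [torsΛ, Multiset.toFinset_card_of_nodup (nodup_roots (hf.separable_iter m)),
    ← (hf.splits_iter m).natDegree_eq_card_roots, (hf.iter_monic m).natDegree_map,
    hf.iter_natDegree]

theorem IsLT.iter_eq_prod (hf : IsLT f) (m : ℕ) :
    (ltIter f m).map (algebraMap 𝓡 Λ) = ∏ β ∈ torsΛ f m, (X - C β) := by
  classical
  have h := (hf.splits_iter m).eq_prod_roots
  rw [((hf.iter_monic m).map _).leadingCoeff, C_1, one_mul] at h
  rw [h, Finset.prod_eq_multiset_prod, torsΛ, Multiset.toFinset_val,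
    Multiset.dedup_eq_self.2 (nodup_roots (hf.separable_iter m))]

theorem IsLT.exists_algebraMap_eq (hf : IsLT f) {m : ℕ} {α : Λ} (hα : α ∈ torsΛ f m) :
    ∃ a : Ω, ι a = α := by
  classical
  obtain ⟨P, hm, hP, hs⟩ := hf.exists_splits m
  rw [torsΛ, Multiset.mem_toFinset, ← hP, unrEmb, ← Polynomial.map_map, hs.roots_map] at hα
  obtain ⟨a, -, h⟩ := Multiset.mem_map.1 hα
  exact ⟨a, h⟩

theorem norm_aeval_le {α : Λ} (hα : ‖α‖ ≤ 1) (p : Polynomial 𝓡) : ‖aeval α p‖ ≤ 1 := by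
  rw [aeval_eq_sum_range]
  refine IsUltrametricDist.norm_sum_le_of_forall_le_of_nonneg zero_le_one fun i _ ↦ ?_
  rw [Algebra.smul_def, norm_mul, norm_pow]
  exact mul_le_one₀ (norm_unrRing_le _) (by positivity) (pow_le_one₀ (norm_nonneg _) hα)

theorem norm_lt_one_of_monic {P : Polynomial 𝓡} {N : ℕ} (hP : P.Monic) (h : C ϖ ∣ P - X ^ N) {α : Λ}
    (hα : aeval α P = 0) : ‖α‖ < 1 := by
  have h1 : ‖α‖ ≤ 1 := by
    by_contra! hlt
    have hsum := hα
    rw [aeval_eq_sum_range, Finset.sum_range_succ, hP.coeff_natDegree, one_smul] at hsum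
    rcases eq_or_ne P.natDegree 0 with h0 | h0
    · rw [h0] at hsum; simp at hsum
    have h2 : ‖∑ i ∈ Finset.range P.natDegree, P.coeff i • α ^ i‖ ≤ ‖α‖ ^ (P.natDegree - 1) := by
      refine IsUltrametricDist.norm_sum_le_of_forall_le_of_nonneg (by positivity) fun i hi ↦ ?_
      rw [Algebra.smul_def, norm_mul, norm_pow]
      refine (mul_le_of_le_one_left (by positivity) (norm_unrRing_le _)).trans ?_
      exact pow_le_pow_right₀ hlt.le (by have := Finset.mem_range.1 hi; omega)
    rw [eq_neg_of_add_eq_zero_left hsum, norm_neg, norm_pow] at h2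
    exact absurd h2 (not_le.2 (pow_lt_pow_right₀ hlt (by omega)))
  obtain ⟨r, hr⟩ := h
  have h2 := congrArg (aeval α) hr
  rw [map_sub, hα, zero_sub, map_mul, map_pow, aeval_X, aeval_C] at h2
  refine (pow_lt_one_iff_of_nonneg (norm_nonneg _) (n := N) ?_).1 ?_
  · rintro rfl
    have h3 := congrArg norm h2
    rw [pow_zero, norm_neg, norm_one, norm_mul] at h3
    have h4 : ‖algebraMap 𝓡 Λ ϖ‖ < 1 := unifNorm_lt_one F
    have h5 := norm_aeval_le h1 r
    have := mul_lt_one_of_nonneg_of_lt_one_left (norm_nonneg _) h4 h5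
    exact this.ne h3.symm
  · rw [← norm_pow, ← norm_neg, h2, norm_mul]
    exact mul_lt_one_of_nonneg_of_lt_one_left (norm_nonneg _) (unifNorm_lt_one F)
      (norm_aeval_le h1 r)

theorem IsLT.norm_lt_one (hf : IsLT f) {m : ℕ} {α : Λ} (hα : α ∈ torsΛ f m) : ‖α‖ < 1 :=
  norm_lt_one_of_monic (hf.iter_monic m) (hf.iter_dvd m) (hf.mem_tors.1 hα)

theorem IsLT.zero_mem_tors (hf : IsLT f) (m : ℕ) : (0 : Λ) ∈ torsΛ f m := by
  rw [hf.mem_tors, aeval_def, eval₂_at_zero, hf.iter_coeff_zero, map_zero]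

theorem IsLT.aeval_zero (hf : IsLT f) : aeval (0 : Λ) f = 0 := by
  rw [aeval_def, eval₂_at_zero, hf.coeff_zero, map_zero]

theorem IsLT.tors_succ (hf : IsLT f) {m : ℕ} {α : Λ} (h : α ∈ torsΛ f m) :
    α ∈ torsΛ f (m + 1) := by
  rw [hf.mem_tors] at h ⊢
  rw [ltIter, aeval_comp, h, (hf.map_frobR m).aeval_zero]

theorem IsLT.tors_mono (hf : IsLT f) {m k : ℕ} (hmk : m ≤ k) {α : Λ} (h : α ∈ torsΛ f m) :
    α ∈ torsΛ f k := by
  induction k, hmk using Nat.le_induction with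
  | base => exact h
  | succ k _ ih => exact hf.tors_succ ih

theorem IsLT.mem_tors_succ (hf : IsLT f) {m : ℕ} {α : Λ} :
    α ∈ torsΛ f (m + 1) ↔ aeval α f ∈ torsΛ (f.map (Φ 1)) m := by
  rw [hf.mem_tors, (hf.map_frobR 1).mem_tors, ltIter_succ', aeval_comp]

theorem IsLT.mem_tors_zero (hf : IsLT f) {α : Λ} : α ∈ torsΛ f 0 ↔ α = 0 := by
  rw [hf.mem_tors, ltIter, aeval_X]

/-- The shape of a Lubin–Tate polynomial. -/
theorem IsLT.exists_eq (hf : IsLT f) :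
    ∃ r : Polynomial 𝓡, f = X ^ q + C (f.coeff 1) * X + C ϖ * (X ^ 2 * r) := by
  have hq := two_le_resCard A
  have h1 : ∃ s, f - X ^ q = X * s := by
    have : X ∣ f - X ^ q := X_dvd_iff.2 (by
      rw [coeff_sub, hf.coeff_zero, coeff_X_pow, if_neg (by omega), sub_zero])
    exact this
  obtain ⟨s, hs⟩ := h1
  have hs0 : s.coeff 0 = f.coeff 1 := by
    have := congrArg (fun p ↦ coeff p 1) hs
    simp only [coeff_sub, coeff_X_pow, if_neg (show 1 ≠ q by omega), sub_zero] at this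
    rw [this, ← coeff_X_mul]
  have h2 : C ϖ ∣ X * (s - C (s.coeff 0)) := by
    rw [C_dvd_iff_dvd_coeff]
    intro i
    rcases i with _ | _ | i
    · simp
    · rw [coeff_X_mul]; simp
    · have := (C_dvd_iff_dvd_coeff _ _).1 hf.dvd (i + 2)
      rw [hs] at this
      rw [coeff_X_mul] at this ⊢
      simpa [coeff_C] using this
  obtain ⟨t, ht⟩ := h2
  have h3 : X ∣ t := by
    have h4 : X ∣ C ϖ * t := ⟨_, ht.symm⟩
    rw [X_dvd_iff, coeff_C_mul] at h4
    exact X_dvd_iff.2 ((mul_eq_zero.1 h4).resolve_left unifR_ne_zero)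
  obtain ⟨t', rfl⟩ := h3
  have h5 : s - C (s.coeff 0) = C ϖ * t' := by
    apply mul_left_cancel₀ (X_ne_zero (R := 𝓡))
    rw [ht]; ring
  have h6 : X ∣ t' := by
    have h7 := congrArg (fun p ↦ coeff p 0) h5
    simp only [coeff_sub, coeff_C_zero, sub_self, coeff_C_mul] at h7
    exact X_dvd_iff.2 ((mul_eq_zero.1 h7.symm).resolve_left unifR_ne_zero)
  obtain ⟨r, rfl⟩ := h6
  refine ⟨r, ?_⟩
  rw [← hs0]
  linear_combination hs + X * h5

theorem IsLT.norm_aeval_sub_le (hf : IsLT f) {α : Λ} (hα : ‖α‖ ≤ 1) :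
    ‖aeval α f - α ^ q‖ ≤ ρ * ‖α‖ := by
  obtain ⟨r, hr⟩ := hf.exists_eq
  have h : aeval α f - α ^ q = α * (algebraMap 𝓡 Λ (f.coeff 1) +
      algebraMap 𝓡 Λ ϖ * (α * aeval α r)) := by
    conv_lhs => rw [hr]
    simp only [map_add, map_mul, map_pow, aeval_X, aeval_C]
    ring
  rw [h, norm_mul, mul_comm]
  refine mul_le_mul_of_nonneg_right ?_ (norm_nonneg _)
  refine (IsUltrametricDist.norm_add_le_max _ _).trans (max_le hf.norm_coeff_one.le ?_)
  rw [norm_mul]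
  refine (mul_le_of_le_one_right (norm_nonneg _) ?_).trans (norm_unifR (F := F)).le
  rw [norm_mul]
  exact mul_le_one₀ hα (norm_nonneg _) (norm_aeval_le hα r)

/-- The absolute value of a root of exact level `m + 1`. -/
theorem IsLT.norm_pow_eq (hf : IsLT f) {m : ℕ} {α : Λ} (h1 : α ∈ torsΛ f (m + 1))
    (h2 : α ∉ torsΛ f m) : ‖α‖ ^ (q ^ m * (q - 1)) = ρ := by
  have hq := two_le_resCard A
  have hρ0 := unifNorm_pos F (A := A) (Ω := Ω) (Λ := Λ)
  induction m generalizing f α with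
  | zero =>
    rw [hf.mem_tors_zero] at h2
    have hα1 := hf.norm_lt_one h1
    rw [hf.mem_tors, ltIter_one] at h1
    obtain ⟨r, hr⟩ := hf.exists_eq
    rw [hr] at h1
    simp only [map_add, map_mul, map_pow, aeval_X, aeval_C] at h1
    -- At the lowest level division by `α ≠ 0` leaves `α ^ (q - 1)` equal to minus the linear
    -- coefficient up to terms of norm below `ρ`.
    have h3 : α ^ (q - 1) + algebraMap 𝓡 Λ (f.coeff 1) = -(algebraMap 𝓡 Λ ϖ * (α * aeval α r)) := by
      apply mul_left_cancel₀ h2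
      have : α ^ q = α * α ^ (q - 1) := by rw [← pow_succ']; congr 1; omega
      rw [this] at h1
      linear_combination h1
    have h4 : ‖α ^ (q - 1) + algebraMap 𝓡 Λ (f.coeff 1)‖ < ρ := by
      rw [h3, norm_neg, norm_mul]
      have h5 : ‖α * aeval α r‖ < 1 := by
        rw [norm_mul]
        exact mul_lt_one_of_nonneg_of_lt_one_left (norm_nonneg _) hα1 (norm_aeval_le hα1.le r)
      exact mul_lt_of_lt_one_right hρ0 h5
    rw [pow_zero, one_mul, ← norm_pow]
    have h6 : ‖algebraMap 𝓡 Λ (f.coeff 1)‖ = ρ := hf.norm_coeff_one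
    by_contra hne
    have h7 := IsUltrametricDist.norm_add_eq_max_of_norm_ne_norm (h6.symm ▸ hne)
    rw [h7, h6] at h4
    exact absurd (le_max_right _ _) (not_le.2 h4)
  | succ m ih =>
    have hα1 := hf.norm_lt_one h1
    rw [hf.mem_tors_succ] at h1 h2
    have h3 := ih (hf.map_frobR 1) h1 h2
    set β := aeval α f
    have hβ1 := (hf.map_frobR 1).norm_lt_one h1
    have hβ : ρ ≤ ‖β‖ := by
      rw [← h3]
      refine pow_le_of_le_one (norm_nonneg _) hβ1.le ?_
      exact mul_ne_zero (pow_ne_zero _ (by omega)) (by omega)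
    -- The value of `f` at `α` is dominated by `α ^ q`: the other terms have norm at most `ρ ‖α‖`,
    -- whereas `β`, being of lower level, has norm at least `ρ`.
    have h4 : ‖β - α ^ q‖ < ‖β‖ := by
      refine (hf.norm_aeval_sub_le hα1.le).trans_lt (lt_of_lt_of_le ?_ hβ)
      exact mul_lt_of_lt_one_right hρ0 hα1
    have h5 : ‖α ^ q‖ = ‖β‖ := by
      rw [norm_sub_rev] at h4
      have := IsUltrametricDist.norm_add_eq_max_of_norm_ne_norm h4.ne
      rwa [sub_add_cancel, max_eq_right h4.le] at this
    rw [← h3, ← h5, norm_pow, ← pow_mul, pow_succ]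
    congr 1
    ring

/-- Nonvanishing of polynomials of small degree at a primitive root. -/
theorem IsLT.norm_coeff_mul_pow_le (hf : IsLT f) {m : ℕ} {a : Ω} (h1 : ι a ∈ torsΛ f (m + 1))
    (h2 : ι a ∉ torsΛ f m) {P : Polynomial (maxUnr A F Ω)}
    (hdeg : P.natDegree < q ^ m * (q - 1)) (i : ℕ) :
    ‖ι (P.coeff i : Ω)‖ * ‖ι a‖ ^ i ≤ ‖ι (aeval a P)‖ := by
  rcases eq_or_ne (P.coeff i) 0 with h0 | h0
  · rw [h0]
    simp
  have hα := hf.norm_pow_eq h1 h2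
  generalize q ^ m * (q - 1) = e at hα hdeg
  have hρ0 := unifNorm_pos F (A := A) (Ω := Ω) (Λ := Λ)
  have hi₀ : i ∈ P.support := mem_support_iff.2 h0
  have hne : P.support.Nonempty := ⟨i, hi₀⟩
  -- The `e`-th power of the norm of the `i`-th term is `ρ ^ (k e + i)`. The exponents are distinct
  -- modulo `e` since all `i` are below `e`, so no two terms have equal norm and the norm of the sum
  -- is the largest of them.
  have hval : ∀ i ∈ P.support, ∃ k : ℤ, ‖ι (P.coeff i : Ω) * ι a ^ i‖ ^ e = ρ ^ (k * e + i) := by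
    intro i hi
    have hc : ((P.coeff i : maxUnr A F Ω) : Ω) ≠ 0 := by simpa using mem_support_iff.1 hi
    obtain ⟨k, hk⟩ := exists_norm_eq_zpow_of_mem_maxUnr (A := A) (F := F) (Λ := Λ)
      (P.coeff i).2 hc
    refine ⟨k, ?_⟩
    rw [norm_mul, norm_pow, mul_pow, ← pow_mul, mul_comm i e, pow_mul, hα, hk, zpow_add₀ hρ0.ne',
      zpow_mul, zpow_natCast, zpow_natCast]
  have hpw : (P.support : Set ℕ).Pairwise fun i j ↦
      ‖ι (P.coeff i : Ω) * ι a ^ i‖ ≠ ‖ι (P.coeff j : Ω) * ι a ^ j‖ := by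
    intro i hi j hj hij heq
    obtain ⟨k, hk⟩ := hval i hi
    obtain ⟨l, hl⟩ := hval j hj
    rw [heq, hl] at hk
    have h3 := unifNorm_zpow_injective F (A := A) (Ω := Ω) (Λ := Λ) hk
    have hi' : i < e := (le_natDegree_of_mem_supp i hi).trans_lt hdeg
    have hj' : j < e := (le_natDegree_of_mem_supp j hj).trans_lt hdeg
    have h4 : ((j : ℤ) - i) = (k - l) * e := by linarith
    have h5 : (e : ℤ) ∣ (j : ℤ) - i := ⟨k - l, by rw [h4]; ring⟩
    have h6 : (j : ℤ) - i = 0 := Int.eq_zero_of_abs_lt_dvd h5 (by rw [abs_lt]; omega)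
    exact hij (by omega)
  have h3 := IsUltrametricDist.norm_sum_eq_sup'_of_pairwise_ne hne hpw
  have h4 : ι (aeval a P) = ∑ i ∈ P.support, ι (P.coeff i : Ω) * ι a ^ i := by
    rw [aeval_def, eval₂_eq_sum, Polynomial.sum, map_sum]
    simp
  rw [h4, h3, ← norm_pow, ← norm_mul]
  exact Finset.le_sup' (fun i ↦ ‖ι (P.coeff i : Ω) * ι a ^ i‖) hi₀

theorem IsLT.aeval_ne_zero (hf : IsLT f) {m : ℕ} {a : Ω} (h1 : ι a ∈ torsΛ f (m + 1))
    (h2 : ι a ∉ torsΛ f m) {P : Polynomial (maxUnr A F Ω)} (hP : P ≠ 0)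
    (hdeg : P.natDegree < q ^ m * (q - 1)) : aeval a P ≠ 0 := by
  intro h0
  have h3 := hf.norm_coeff_mul_pow_le h1 h2 hdeg P.natDegree
  have h4 : (0 : Λ) ∈ torsΛ f m := hf.zero_mem_tors m
  rw [h0, map_zero, norm_zero, ← norm_pow, ← norm_mul, norm_le_zero_iff, mul_eq_zero] at h3
  rcases h3 with h3 | h3
  · exact hP (leadingCoeff_eq_zero.1 (by simpa using h3))
  · rw [eq_zero_of_pow_eq_zero h3] at h2
    exact h2 h4

/-- The Galois group over the maximal unramified extension permutes the primitive roots
transitively. -/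
theorem IsLT.exists_galois (hf : IsLT f) {m : ℕ} {α β : Λ} (h1 : α ∈ torsΛ f (m + 1))
    (h2 : α ∉ torsΛ f m) (h3 : β ∈ torsΛ f (m + 1)) (h4 : β ∉ torsΛ f m) :
    ∃ σ : Ω ≃ₐ[F] Ω, (∀ x ∈ maxUnr A F Ω, σ x = x) ∧ galExt A Λ σ α = β := by
  obtain ⟨a, rfl⟩ := hf.exists_algebraMap_eq h1
  obtain ⟨b, rfl⟩ := hf.exists_algebraMap_eq h3
  obtain ⟨P, hPm, hP, -⟩ := hf.exists_splits m
  obtain ⟨P', hPm', hP', -⟩ := hf.exists_splits (m + 1)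
  have hroot : ∀ (k : ℕ) (Q : Polynomial (maxUnr A F Ω)),
      Q.map (unrEmb A F Ω Λ) = (ltIter f k).map (algebraMap 𝓡 Λ) → ∀ c : Ω,
      (aeval c Q = 0 ↔ ι c ∈ torsΛ f k) := by
    intro k Q hQ c
    rw [hf.mem_tors, aeval_def (ι c), ← eval_map, ← hQ, eval_map, unrEmb, ← hom_eval₂,
      ← aeval_def, map_eq_zero (algebraMap Ω Λ)]
  have hdvd : P ∣ P' := by
    rw [← map_dvd_map _ (unrEmb A F Ω Λ).injective hPm, hP, hP']
    refine map_dvd (mapRingHom (algebraMap 𝓡 Λ)) ?_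
    have : X ∣ f.map (Φ m) := X_dvd_iff.2 (hf.map_frobR m).coeff_zero
    obtain ⟨r, hr⟩ := this
    rw [ltIter, hr, mul_comp, X_comp]
    exact dvd_mul_right _ _
  obtain ⟨g, hg⟩ := hdvd
  have hgm : g.Monic := hPm.of_mul_monic_left (hg ▸ hPm')
  have hdegP : P.natDegree = q ^ m := by
    rw [← hPm.natDegree_map (unrEmb A F Ω Λ), hP, (hf.iter_monic m).natDegree_map,
      hf.iter_natDegree]
  have hdegP' : P'.natDegree = q ^ (m + 1) := by
    rw [← hPm'.natDegree_map (unrEmb A F Ω Λ), hP', (hf.iter_monic _).natDegree_map,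
      hf.iter_natDegree]
  have hdegg : g.natDegree = q ^ m * (q - 1) := by
    have := congrArg Polynomial.natDegree hg
    rw [hPm.natDegree_mul hgm, hdegP, hdegP', pow_succ] at this
    rw [Nat.mul_sub, mul_one]
    omega
  have hgroot : ∀ c : Ω, ι c ∈ torsΛ f (m + 1) → ι c ∉ torsΛ f m → aeval c g = 0 := by
    intro c hc hc'
    have := (hroot _ P' hP' c).2 hc
    rw [hg, map_mul] at this
    exact (mul_eq_zero.1 this).resolve_left fun h ↦ hc' ((hroot _ P hP c).1 h)
  have hinteg : IsIntegral (maxUnr A F Ω) b := Algebra.IsIntegral.isIntegral b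
  -- The quotient of the two iterates vanishes at all primitive roots, and no nonzero polynomial of
  -- smaller degree vanishes at one of them; so it is their common minimal polynomial.
  have hmin : minpoly (maxUnr A F Ω) b = g := by
    have hd := minpoly.dvd (maxUnr A F Ω) b (hgroot b h3 h4)
    refine (eq_of_monic_of_dvd_of_natDegree_le (minpoly.monic hinteg) hgm hd ?_).symm
    rw [hdegg]
    by_contra! hlt
    exact hf.aeval_ne_zero h3 h4 (minpoly.ne_zero hinteg) hlt (minpoly.aeval _ _)
  obtain ⟨σ, hσ⟩ := minpoly.exists_algEquiv_of_root (K := maxUnr A F Ω) (x := a) (y := b)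
    hinteg.isAlgebraic (by rw [hmin]; exact hgroot a h1 h2)
  refine ⟨σ.restrictScalars F, fun x hx ↦ σ.commutes ⟨x, hx⟩, ?_⟩
  rw [galExt_algebraMap]
  exact congrArg ι hσ

theorem IsLT.exists_primitive (hf : IsLT f) (m : ℕ) :
    ∃ α, α ∈ torsΛ f (m + 1) ∧ α ∉ torsΛ f m := by
  by_contra! h
  have := Finset.card_le_card (s := torsΛ f (m + 1)) (t := torsΛ f m) h
  rw [hf.card_tors, hf.card_tors] at this
  exact absurd this (not_le.2 (Nat.pow_lt_pow_right (two_le_resCard A) (Nat.lt_succ_self m)))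

end IsLT

end LubinTatePolynomial

/-! ### Brackets and torsion -/

section Brackets

variable {A F Ω Λ : Type*} [CommRing A] [IsDomain A] [IsDiscreteValuationRing A]
  [Finite (IsLocalRing.ResidueField A)] [Field F] [Algebra A F] [IsFractionRing A F]
  [Field Ω] [Algebra F Ω] [Algebra A Ω] [IsScalarTower A F Ω] [IsSepClosure F Ω]
  [NormedField Λ] [CompleteSpace Λ] [IsUltrametricDist Λ] [Algebra Ω Λ]

local notation "ι" => algebraMap Ω Λ
local notation "q" => resCard A
local notation "ρ" => unifNorm A Ω Λ
local notation "𝓡" => unrRing A F Ω Λ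
local notation "Φ" => frobR A F Ω Λ
local notation "ϖ" => unifR A F Ω Λ

theorem norm_algebraMap_unrRing_le (x : 𝓡) : ‖algebraMap 𝓡 Λ x‖ ≤ 1 := x.2.2

/-- The value of a power series over the completed maximal unramified extension. -/
def evR (α : Λ) (h : PowerSeries 𝓡) : Λ := evalSeries (algebraMap 𝓡 Λ) α h

theorem evR_coe (α : Λ) (p : Polynomial 𝓡) : evR α (p : PowerSeries 𝓡) = aeval α p :=
  evalSeries_coe p

theorem evR_X (α : Λ) : evR α (PowerSeries.X : PowerSeries 𝓡) = α := evalSeries_X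

theorem evR_subst {α : Λ} (hα : ‖α‖ < 1) {h : PowerSeries 𝓡}
    (hh : PowerSeries.constantCoeff h = 0) (g : PowerSeries 𝓡) :
    evR α (PowerSeries.subst h g) = evR (evR α h) g :=
  evalSeries_subst norm_algebraMap_unrRing_le hα hh g

theorem norm_evR_le {α : Λ} (hα : ‖α‖ < 1) {h : PowerSeries 𝓡}
    (hh : PowerSeries.constantCoeff h = 0) : ‖evR α h‖ ≤ ‖α‖ :=
  norm_evalSeries_le norm_algebraMap_unrRing_le hα hh

theorem evR_zero {h : PowerSeries 𝓡} (hh : PowerSeries.constantCoeff h = 0) :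
    evR (0 : Λ) h = 0 := by
  have := norm_evR_le (α := (0 : Λ)) (by simp) hh
  simpa using this

theorem norm_evR_lt_one {α : Λ} (hα : ‖α‖ < 1) {h : PowerSeries 𝓡}
    (hh : PowerSeries.constantCoeff h = 0) : ‖evR α h‖ < 1 :=
  (norm_evR_le hα hh).trans_lt hα

variable (A F Ω Λ) in
theorem emb_sub_le_iff [LocalCompletion A F Ω Λ] {a b : A} {m : ℕ} :
    ‖emb A Ω Λ a - emb A Ω Λ b‖ ≤ ρ ^ m ↔ a - b ∈ IsLocalRing.maximalIdeal A ^ m := by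
  rw [(irreducible_unif A).maximalIdeal_eq, Ideal.span_singleton_pow, Ideal.mem_span_singleton,
    ← map_sub]
  constructor
  · intro h
    rcases eq_or_ne (a - b) 0 with h0 | h0
    · rw [h0]; exact dvd_zero _
    obtain ⟨n, u, hu⟩ := IsDiscreteValuationRing.eq_unit_mul_pow_irreducible h0 (irreducible_unif A)
    rw [hu, map_mul, map_pow, norm_mul, norm_pow, (norm_emb_eq_one_iff F).2 u.isUnit, one_mul] at h
    have hmn : m ≤ n := (pow_le_pow_iff_right_of_lt_one₀ (unifNorm_pos F) (unifNorm_lt_one F)).1 h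
    rw [hu]
    exact (pow_dvd_pow _ hmn).mul_left _
  · rintro ⟨c, hc⟩
    rw [hc, map_mul, map_pow, norm_mul, norm_pow]
    exact mul_le_of_le_one_right (pow_nonneg (norm_nonneg _) _) (norm_emb_le_one F c)

variable [LocalCompletion A F Ω Λ] {f g : Polynomial (unrRing A F Ω Λ)}

theorem galExt_evR {s : Ω ≃ₐ[F] Ω} {j : ℤ} (hs : ∀ x ∈ maxUnr A F Ω, s x = (frob A F Ω ^ j) x)
    {α : Λ} (hα : ‖α‖ < 1) (h : PowerSeries 𝓡) :
    galExt A Λ s (evR α h) = evR (galExt A Λ s α) (PowerSeries.map (Φ j) h) := by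
  rw [evR, map_evalSeries (i := algebraMap 𝓡 Λ) _ (norm_galExt s) norm_algebraMap_unrRing_le hα,
    evR, evalSeries_map]
  congr 1
  ext x
  exact galExt_eq_of_eqOn hs x.2

theorem galExt_aeval {s : Ω ≃ₐ[F] Ω} {j : ℤ} (hs : ∀ x ∈ maxUnr A F Ω, s x = (frob A F Ω ^ j) x)
    (α : Λ) (p : Polynomial 𝓡) :
    galExt A Λ s (aeval α p) = aeval (galExt A Λ s α) (p.map (Φ j)) := by
  rw [aeval_def, hom_eval₂, aeval_def, eval₂_map]
  congr 1
  ext x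
  exact galExt_eq_of_eqOn hs x.2

theorem IsLT.galExt_mem_tors (hf : IsLT f) {s : Ω ≃ₐ[F] Ω} {j : ℤ}
    (hs : ∀ x ∈ maxUnr A F Ω, s x = (frob A F Ω ^ j) x) {α : Λ} {m : ℕ} :
    galExt A Λ s α ∈ torsΛ (f.map (Φ j)) m ↔ α ∈ torsΛ f m := by
  rw [(hf.map_frobR j).mem_tors, hf.mem_tors, ← ltIter_map, ← galExt_aeval hs, map_eq_zero]

/-- `h` is the bracket `[θ]_{f,g}`. -/
abbrev IsBrk (f g : Polynomial 𝓡) (θ : 𝓡) (h : PowerSeries 𝓡) : Prop :=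
  IsBracketSeries (Φ 1) (f : PowerSeries 𝓡) (g : PowerSeries 𝓡) θ h

theorem IsBrk.map {θ : 𝓡} {h : PowerSeries 𝓡} (hf : IsLT f) (hh : IsBrk f g θ h) (j : ℤ) :
    IsBrk (f.map (Φ j)) (g.map (Φ j)) (Φ j θ) (PowerSeries.map (Φ j) h) := by
  have := IsBracketSeries.map (ψ := Φ 1) (Φ j) (fun a ↦ frobR_comm j 1 a) hf.constantCoeff hh
  rwa [← polynomial_map_coe, ← polynomial_map_coe] at this

theorem IsBrk.unique {θ : 𝓡} {h k : PowerSeries 𝓡} (hf : IsLT f) (hg : IsLT g)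
    (hh : IsBrk f g θ h) (hk : IsBrk f g θ k) : h = k :=
  IsBracketSeries.unique (isFrobeniusLift A F Ω Λ) hf.isFrobeniusSeries hg.isFrobeniusSeries hh hk

theorem exists_isBrk {θ : 𝓡} (hf : IsLT f) (hg : IsLT g)
    (hθ : g.coeff 1 * θ = Φ 1 θ * f.coeff 1) : ∃ h, IsBrk f g θ h :=
  IsBracketSeries.exists (isFrobeniusLift A F Ω Λ) hf.isFrobeniusSeries hg.isFrobeniusSeries
    (by rwa [Polynomial.coeff_coe, Polynomial.coeff_coe])

theorem IsBrk.comp {k : Polynomial 𝓡} {θ η : 𝓡} {h h' : PowerSeries 𝓡} (hf : IsLT f) (hg : IsLT g)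
    (hh : IsBrk f g θ h) (hh' : IsBrk g k η h') : IsBrk f k (η * θ) (PowerSeries.subst h h') :=
  IsBracketSeries.comp hf.constantCoeff hh hh' hg.constantCoeff

theorem IsBrk.coeff_eq {θ : 𝓡} {h : PowerSeries 𝓡} (hf : IsLT f) (hg : IsLT g)
    (hh : IsBrk f g θ h) : g.coeff 1 * θ = Φ 1 θ * f.coeff 1 := by
  have := congrArg (PowerSeries.coeff 1) hh.comm
  rwa [coeff_one_subst hh.zero hg.constantCoeff, coeff_one_subst hf.constantCoeff
    (constantCoeff_map_of_zero _ hh.zero), PowerSeries.coeff_map, hh.one, Polynomial.coeff_coe,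
    Polynomial.coeff_coe] at this

/-- Two composites of brackets with the same linear coefficient agree on small elements. -/
theorem IsBrk.evR_comp_eq {g' k : Polynomial 𝓡} {θ η θ' η' : 𝓡} {h₁ h₂ h₃ h₄ : PowerSeries 𝓡}
    (hf : IsLT f) (hg : IsLT g) (hg' : IsLT g') (hk : IsLT k)
    (h1 : IsBrk f g θ h₁) (h2 : IsBrk g k η h₂) (h3 : IsBrk f g' θ' h₃) (h4 : IsBrk g' k η' h₄)
    (h : η * θ = η' * θ') {α : Λ} (hα : ‖α‖ < 1) :
    evR (evR α h₁) h₂ = evR (evR α h₃) h₄ := by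
  rw [← evR_subst hα h1.zero, ← evR_subst hα h3.zero,
    IsBrk.unique hf hk (h1.comp hf hg h2) (h ▸ h3.comp hf hg' h4)]

theorem IsBrk.aeval_evR {θ : 𝓡} {h : PowerSeries 𝓡} (hf : IsLT f) (hh : IsBrk f g θ h) {α : Λ}
    (hα : ‖α‖ < 1) : aeval (evR α h) g = evR (aeval α f) (PowerSeries.map (Φ 1) h) := by
  rw [← evR_coe, ← evR_subst hα hh.zero, hh.comm, evR_subst hα hf.constantCoeff, evR_coe]

theorem IsLT.norm_aeval_lt_one (hf : IsLT f) {α : Λ} (hα : ‖α‖ < 1) : ‖aeval α f‖ < 1 := by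
  rw [← evR_coe]
  exact norm_evR_lt_one hα hf.constantCoeff

theorem map_frobR_zero_series (h : PowerSeries 𝓡) : PowerSeries.map (Φ 0) h = h := by
  ext k
  simp [frobR_zero]

/-- Applying `g` to the value of `h` at `α` is the same as applying the twist of `h` to the value of
`f` at `α`. So the level drops by one on both sides, with all data twisted by Frobenius. -/
theorem IsBrk.evR_mem_tors {θ : 𝓡} {h : PowerSeries 𝓡} (hf : IsLT f) (hg : IsLT g)
    (hh : IsBrk f g θ h) {m : ℕ} {α : Λ} (hα : α ∈ torsΛ f m) : evR α h ∈ torsΛ g m := by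
  induction m generalizing f g θ h α with
  | zero =>
    rw [hf.mem_tors_zero] at hα
    rw [hg.mem_tors_zero, hα, evR_zero hh.zero]
  | succ m ih =>
    have h1 := hf.norm_lt_one hα
    rw [hf.mem_tors_succ] at hα
    rw [hg.mem_tors_succ, hh.aeval_evR hf h1]
    exact ih (hf.map_frobR 1) (hg.map_frobR 1) (hh.map hf 1) hα

theorem IsBrk.X (hf : IsLT f) : IsBrk f f 1 PowerSeries.X := IsBracketSeries.X hf.constantCoeff

/-- Brackets of units are invertible. -/
theorem IsBrk.exists_inverse {θ : 𝓡} {h : PowerSeries 𝓡} (hf : IsLT f) (hg : IsLT g)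
    (hh : IsBrk f g θ h) (hθ : IsUnit θ) : ∃ (η : 𝓡) (k : PowerSeries 𝓡), θ * η = 1 ∧
      IsBrk g f η k ∧ (∀ α : Λ, ‖α‖ < 1 → evR (evR α h) k = α) ∧
      ∀ α : Λ, ‖α‖ < 1 → evR (evR α k) h = α := by
  obtain ⟨η, hη⟩ := hθ.exists_right_inv
  have hη' : η * θ = 1 := by rw [mul_comm, hη]
  obtain ⟨k, hk⟩ := exists_isBrk (θ := η) hg hf (by
    have h1 := hh.coeff_eq hf hg
    have h2 : Φ 1 η * Φ 1 θ = 1 := by rw [← map_mul, hη', map_one]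
    linear_combination (-η * Φ 1 η) * h1 - (f.coeff 1 * η) * h2 +
      (g.coeff 1 * Φ 1 η) * hη)
  refine ⟨η, k, hη, hk, fun α hα ↦ ?_, fun α hα ↦ ?_⟩
  · have := IsBrk.evR_comp_eq hf hg hf hf hh hk (IsBrk.X hf) (IsBrk.X hf) (by rw [hη', one_mul]) hα
    rwa [evR_X, evR_X] at this
  · have := IsBrk.evR_comp_eq hg hf hg hg hk hh (IsBrk.X hg) (IsBrk.X hg) (by rw [hη, one_mul]) hα
    rwa [evR_X, evR_X] at this

theorem IsBrk.evR_mem_tors_iff {θ : 𝓡} {h : PowerSeries 𝓡} (hf : IsLT f) (hg : IsLT g)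
    (hh : IsBrk f g θ h) (hθ : IsUnit θ) {m : ℕ} {α : Λ} (hα : ‖α‖ < 1) :
    evR α h ∈ torsΛ g m ↔ α ∈ torsΛ f m := by
  refine ⟨fun h1 ↦ ?_, fun h1 ↦ hh.evR_mem_tors hf hg h1⟩
  obtain ⟨η, k, -, hk, h2, -⟩ := hh.exists_inverse hf hg hθ
  have := hk.evR_mem_tors hg hf h1
  rwa [h2 α hα] at this

theorem IsBrk.evR_injective {θ : 𝓡} {h : PowerSeries 𝓡} (hf : IsLT f) (hg : IsLT g)
    (hh : IsBrk f g θ h) (hθ : IsUnit θ) {α β : Λ} (hα : ‖α‖ < 1) (hβ : ‖β‖ < 1)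
    (hαβ : evR α h = evR β h) : α = β := by
  obtain ⟨η, k, -, hk, h2, -⟩ := hh.exists_inverse hf hg hθ
  rw [← h2 α hα, hαβ, h2 β hβ]

/-! #### Multiplication by scalars -/

theorem IsLT.exists_brk (hf : IsLT f) (a : A) : ∃ h, IsBrk f f (embR A F Ω Λ a) h :=
  exists_isBrk hf hf (by rw [frobR_embR, mul_comm])

/-- The series `[a]_f` for an integer `a` of the base field. -/
def IsLT.brk (hf : IsLT f) (a : A) : PowerSeries 𝓡 := (hf.exists_brk a).choose

theorem IsLT.isBrk (hf : IsLT f) (a : A) : IsBrk f f (embR A F Ω Λ a) (hf.brk a) :=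
  (hf.exists_brk a).choose_spec

theorem IsLT.evR_brk_mul (hf : IsLT f) (a b : A) {α : Λ} (hα : ‖α‖ < 1) :
    evR α (hf.brk (a * b)) = evR (evR α (hf.brk b)) (hf.brk a) := by
  have := IsBrk.evR_comp_eq hf hf hf hf (hf.isBrk b) (hf.isBrk a) (hf.isBrk (a * b)) (IsBrk.X hf)
    (by rw [map_mul, one_mul]) hα
  rw [this, evR_X]

theorem IsLT.evR_brk_comm (hf : IsLT f) (a b : A) {α : Λ} (hα : ‖α‖ < 1) :
    evR (evR α (hf.brk b)) (hf.brk a) = evR (evR α (hf.brk a)) (hf.brk b) := by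
  rw [← hf.evR_brk_mul a b hα, ← hf.evR_brk_mul b a hα, mul_comm]

theorem IsLT.evR_brk_one (hf : IsLT f) (α : Λ) : evR α (hf.brk 1) = α := by
  rw [IsBrk.unique hf hf (hf.isBrk 1) ((map_one (embR A F Ω Λ)).symm ▸ IsBrk.X hf), evR_X]

theorem IsLT.norm_evR_brk (hf : IsLT f) (a : A) {α : Λ} (hα : ‖α‖ < 1) :
    ‖evR α (hf.brk a)‖ < 1 := norm_evR_lt_one hα (hf.isBrk a).zero

theorem IsLT.isBrk_self (hf : IsLT f) :
    IsBrk f (f.map (Φ 1)) (f.coeff 1) (f : PowerSeries 𝓡) where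
  zero := hf.constantCoeff
  one := Polynomial.coeff_coe ..
  comm := by rw [polynomial_map_coe]

/-- Multiplication by the uniformizer lowers the level by one. -/
theorem IsLT.evR_unif_mem_tors_iff (hf : IsLT f) {m : ℕ} {α : Λ} (hα : ‖α‖ < 1) :
    evR α (hf.brk (unif A)) ∈ torsΛ f m ↔ α ∈ torsΛ f (m + 1) := by
  -- Writing `ϖ = w π` with `w` a unit, `[ϖ]` factors as `f` followed by the invertible bracket of
  -- `w` from the twist of `f` back to `f`. The effect on levels is therefore that of `f`.
  obtain ⟨w, hw⟩ : f.coeff 1 ∣ ϖ := by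
    rw [unrRing_dvd_iff, hf.norm_coeff_one, norm_unifR]
  have hf0 : f.coeff 1 ≠ 0 := by
    rintro h
    rw [h, zero_mul] at hw
    exact unifR_ne_zero hw
  have hwu : IsUnit w := by
    have h1 := congrArg (fun x : 𝓡 ↦ ‖(x : Λ)‖) hw
    simp only [Subring.coe_mul, norm_mul, hf.norm_coeff_one, norm_unifR] at h1
    rw [unrRing_isUnit_iff]
    exact (mul_eq_left₀ (unifNorm_pos F).ne').1 h1.symm
  have hw' := congrArg (Φ 1) hw
  rw [frobR_unifR, map_mul] at hw'
  obtain ⟨k, hk⟩ := exists_isBrk (θ := w) (hf.map_frobR 1) hf (by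
    rw [coeff_map]
    linear_combination hw' - hw)
  have hX := IsBrk.evR_comp_eq hf (hf.map_frobR 1) hf hf hf.isBrk_self hk
    (hf.isBrk (unif A)) (IsBrk.X hf) (by
      change w * f.coeff 1 = 1 * ϖ
      rw [one_mul, hw, mul_comm]) hα
  rw [evR_X, evR_coe] at hX
  rw [← hX, hk.evR_mem_tors_iff (hf.map_frobR 1) hf hwu (hf.norm_aeval_lt_one hα),
    hf.mem_tors_succ]

/-- Automorphisms over the maximal unramified extension commute with scalar brackets and move `α` to
any other point of exact level `m + 1`. Points of lower level are reached by recursion, with `[ϖ]α`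
as primitive point one level down. -/
theorem IsLT.evR_eq_on_tors (hf : IsLT f) {m : ℕ} {α : Λ} (h1 : α ∈ torsΛ f (m + 1))
    (h2 : α ∉ torsΛ f m) {a b : A} (hab : evR α (hf.brk a) = evR α (hf.brk b)) {β : Λ}
    (hβ : β ∈ torsΛ f (m + 1)) : evR β (hf.brk a) = evR β (hf.brk b) := by
  have hα1 := hf.norm_lt_one h1
  have htrans : ∀ γ, γ ∈ torsΛ f (m + 1) → γ ∉ torsΛ f m →
      evR γ (hf.brk a) = evR γ (hf.brk b) := by
    intro γ h3 h4
    obtain ⟨σ, hσ, rfl⟩ := hf.exists_galois h1 h2 h3 h4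
    have hσ' : ∀ x ∈ maxUnr A F Ω, σ x = (frob A F Ω ^ (0 : ℤ)) x := fun x hx ↦ by
      rw [zpow_zero, hσ x hx]; rfl
    have key := congrArg (galExt A Λ σ) hab
    rwa [galExt_evR hσ' hα1, galExt_evR hσ' hα1, map_frobR_zero_series,
      map_frobR_zero_series] at key
  by_cases h3 : β ∈ torsΛ f m
  · cases m with
    | zero =>
      rw [hf.mem_tors_zero] at h3
      rw [h3, evR_zero (hf.isBrk a).zero, evR_zero (hf.isBrk b).zero]
    | succ m =>
      refine IsLT.evR_eq_on_tors hf (α := evR α (hf.brk (unif A)))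
        ((hf.evR_unif_mem_tors_iff hα1).2 h1)
        (fun h ↦ h2 ((hf.evR_unif_mem_tors_iff hα1).1 h)) ?_ h3
      rw [hf.evR_brk_comm a (unif A) hα1, hf.evR_brk_comm b (unif A) hα1, hab]
  · exact htrans β hβ h3

theorem coeff_one_mul {R : Type*} [CommRing R] (p k : PowerSeries R)
    (hp : PowerSeries.constantCoeff p = 0) :
    PowerSeries.coeff 1 (p * k) = PowerSeries.coeff 1 p * PowerSeries.constantCoeff k := by
  rw [PowerSeries.coeff_mul, Finset.Nat.antidiagonal_succ]
  simp [hp]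

/-- The series `[a] - [b]` vanishes on all torsion of level `m + 1`, so over the unit ball it is
divisible by `f_{m+1}`. Comparing linear coefficients shows that `a - b` is divisible by that of
`f_{m+1}`, which has norm `ρ ^ (m + 1)`. -/
theorem IsLT.norm_emb_sub_le (hf : IsLT f) {m : ℕ} {α : Λ} (h1 : α ∈ torsΛ f (m + 1))
    (h2 : α ∉ torsΛ f m) {a b : A} (hab : evR α (hf.brk a) = evR α (hf.brk b)) :
    ‖emb A Ω Λ a - emb A Ω Λ b‖ ≤ ρ ^ (m + 1) := by
  let i : 𝓡 →+* unitBall Λ := Subring.inclusion fun x hx ↦ hx.2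
  have hi : (unitBall Λ).subtype.comp i = algebraMap 𝓡 Λ := rfl
  have hsub : ∀ β ∈ torsΛ f (m + 1), evalSeries (unitBall Λ).subtype β
      (PowerSeries.map i (hf.brk a - hf.brk b)) = 0 := by
    intro β hβ
    have hβ1 := hf.norm_lt_one hβ
    rw [evalSeries_map, hi,
      ← evalSeriesHom_apply (i := algebraMap 𝓡 Λ) norm_algebraMap_unrRing_le hβ1, map_sub,
      sub_eq_zero]
    exact hf.evR_eq_on_tors h1 h2 hab hβ
  obtain ⟨k, hk⟩ := exists_eq_prod_mul (torsΛ f (m + 1)) (fun β hβ ↦ hf.norm_lt_one hβ) _ hsub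
  rw [← hf.iter_eq_prod] at hk
  have h3 := congrArg (PowerSeries.coeff 1) hk
  rw [coeff_one_mul _ _ (by
    rw [← PowerSeries.coeff_zero_eq_constantCoeff_apply, Polynomial.coeff_coe, coeff_map,
      hf.iter_coeff_zero, map_zero]), PowerSeries.coeff_map, PowerSeries.coeff_map, map_sub,
    (hf.isBrk a).one, (hf.isBrk b).one, Polynomial.coeff_coe, coeff_map] at h3
  have h4 : emb A Ω Λ a - emb A Ω Λ b = algebraMap 𝓡 Λ ((ltIter f (m + 1)).coeff 1) *
    PowerSeries.constantCoeff (PowerSeries.map (unitBall Λ).subtype k) := h3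
  rw [h4, norm_mul]
  have h5 : ‖algebraMap 𝓡 Λ ((ltIter f (m + 1)).coeff 1)‖ = ρ ^ (m + 1) :=
    hf.norm_iter_coeff_one (m + 1)
  rw [h5]
  refine mul_le_of_le_one_right (pow_nonneg (unifNorm_pos F).le _) ?_
  rw [← PowerSeries.coeff_zero_eq_constantCoeff_apply, PowerSeries.coeff_map]
  exact norm_unitBall_le _

variable (A) in
theorem natCard_quotient_pow (m : ℕ) : Nat.card (A ⧸ IsLocalRing.maximalIdeal A ^ m) = q ^ m := by
  have := cardQuot_pow_of_prime (IsDiscreteValuationRing.not_a_field A) (i := m)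
  rw [Submodule.cardQuot_apply, Submodule.cardQuot_apply] at this
  rw [resCard_eq]
  exact this

/-- Injectivity is the preceding norm bound, and source and target both have `q ^ (m + 1)` elements.
-/
theorem IsLT.bijective_evR_brk (hf : IsLT f) {m : ℕ} {α : Λ} (h1 : α ∈ torsΛ f (m + 1))
    (h2 : α ∉ torsΛ f m) : Function.Bijective
      fun x : A ⧸ IsLocalRing.maximalIdeal A ^ (m + 1) ↦
        (⟨evR α (hf.brk x.out), (hf.isBrk _).evR_mem_tors hf hf h1⟩ : torsΛ f (m + 1)) := by
  refine Function.Injective.bijective_of_nat_card_le (fun x y hxy ↦ ?_) (by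
    rw [natCard_quotient_pow, Nat.card_eq_fintype_card, Fintype.card_coe, hf.card_tors])
  have := hf.norm_emb_sub_le h1 h2 (congrArg Subtype.val hxy)
  rwa [emb_sub_le_iff A F Ω Λ, ← Ideal.Quotient.eq, Ideal.Quotient.mk_out,
    Ideal.Quotient.mk_out] at this

/-- The scalars act transitively on the torsion points through a primitive one. -/
theorem IsLT.exists_evR_brk_eq (hf : IsLT f) {m : ℕ} {α : Λ} (h1 : α ∈ torsΛ f (m + 1))
    (h2 : α ∉ torsΛ f m) {β : Λ} (hβ : β ∈ torsΛ f (m + 1)) : ∃ a : A, evR α (hf.brk a) = β := by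
  obtain ⟨x, hx⟩ := (hf.bijective_evR_brk h1 h2).2 ⟨β, hβ⟩
  exact ⟨x.out, congrArg Subtype.val hx⟩

theorem IsLT.exists_level (hf : IsLT f) {m : ℕ} {α : Λ} (hα : α ∈ torsΛ f m) :
    α = 0 ∨ ∃ k < m, α ∈ torsΛ f (k + 1) ∧ α ∉ torsΛ f k := by
  induction m with
  | zero => exact Or.inl (hf.mem_tors_zero.1 hα)
  | succ m ih =>
    by_cases h : α ∈ torsΛ f m
    · exact (ih h).imp_right fun ⟨k, hk, h'⟩ ↦ ⟨k, by omega, h'⟩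
    · exact Or.inr ⟨m, by omega, hα, h⟩

/-- The action of a scalar on the `m`-torsion depends on its class modulo `𝔭 ^ m`. -/
theorem IsLT.evR_brk_congr (hf : IsLT f) {m : ℕ} {α : Λ} (hα : α ∈ torsΛ f m) {a b : A}
    (hab : a - b ∈ IsLocalRing.maximalIdeal A ^ m) : evR α (hf.brk a) = evR α (hf.brk b) := by
  rcases hf.exists_level hα with rfl | ⟨k, hk, h1, h2⟩
  · rw [evR_zero (hf.isBrk a).zero, evR_zero (hf.isBrk b).zero]
  have hab' : a - b ∈ IsLocalRing.maximalIdeal A ^ (k + 1) := Ideal.pow_le_pow_right hk hab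
  -- By surjectivity `[c]α` is `[x]α` for the representative of some class `x`, and the norm bound
  -- forces `x` to be the class of `c`.
  have key : ∀ c : A, evR α (hf.brk c) =
      evR α (hf.brk (Ideal.Quotient.mk (IsLocalRing.maximalIdeal A ^ (k + 1)) c).out) := by
    intro c
    obtain ⟨x, hx⟩ := (hf.bijective_evR_brk h1 h2).2
      ⟨evR α (hf.brk c), (hf.isBrk _).evR_mem_tors hf hf h1⟩
    have hx' : evR α (hf.brk x.out) = evR α (hf.brk c) := congrArg Subtype.val hx
    have := hf.norm_emb_sub_le h1 h2 hx'
    rw [emb_sub_le_iff A F Ω Λ, ← Ideal.Quotient.eq, Ideal.Quotient.mk_out] at this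
    rw [← hx', this]
  rw [key a, key b, Ideal.Quotient.eq.2 hab']

end Brackets

/-! ### The reciprocity map on automorphisms of the separable closure -/

section Lifts

variable {A F Ω Λ : Type*} [CommRing A] [IsDomain A] [IsDiscreteValuationRing A]
  [Finite (IsLocalRing.ResidueField A)] [Field F] [Algebra A F] [IsFractionRing A F]
  [Field Ω] [Algebra F Ω] [Algebra A Ω] [IsScalarTower A F Ω] [IsSepClosure F Ω]
  [NormedField Λ] [CompleteSpace Λ] [IsUltrametricDist Λ] [Algebra Ω Λ]

local notation "ι" => algebraMap Ω Λ
local notation "q" => resCard A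
local notation "ρ" => unifNorm A Ω Λ
local notation "𝓡" => unrRing A F Ω Λ
local notation "Φ" => frobR A F Ω Λ
local notation "ϖ" => unifR A F Ω Λ

/-- A relation `φ^d = 1` is tested on the unramified extension of degree `d + 1`, where the first `d
+ 1` powers of Frobenius are distinct. -/
theorem frob_zpow_injective (Λ : Type*) [NormedField Λ] [CompleteSpace Λ] [IsUltrametricDist Λ]
    [Algebra Ω Λ] [LocalCompletion A F Ω Λ] {i j : ℤ}
    (h : ∀ x ∈ maxUnr A F Ω, (frob A F Ω ^ i) x = (frob A F Ω ^ j) x) : i = j := by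
  have key : ∀ d : ℕ, (∀ x ∈ maxUnr A F Ω, (frob A F Ω ^ d) x = x) → d = 0 := by
    intro d hd
    have h1 : frobUnr A F Ω (d + 1) ^ d = frobUnr A F Ω (d + 1) ^ 0 := by
      ext x
      rw [coe_frobUnr_pow, hd x (unr_le_maxUnr (by omega) x.2), pow_zero]
      rfl
    have := (bijective_frobUnr_pow A F Ω Λ (n := d + 1) (by omega)).1
      (a₁ := ⟨d, by omega⟩) (a₂ := ⟨0, by omega⟩) h1
    simpa using this
  have key' : ∀ (i j : ℤ), j ≤ i →
      (∀ x ∈ maxUnr A F Ω, (frob A F Ω ^ i) x = (frob A F Ω ^ j) x) → i = j := by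
    intro i j hij h
    obtain ⟨d, hd⟩ := Int.eq_ofNat_of_zero_le (sub_nonneg.2 hij)
    have h0 := key d fun x hx ↦ by
      have h2 := h x hx
      rw [← zpow_natCast, ← hd, sub_eq_neg_add, zpow_add, AlgEquiv.mul_apply, h2,
        ← AlgEquiv.mul_apply, ← zpow_add]
      simp
    omega
  rcases le_total j i with hij | hij
  · exact key' i j hij h
  · exact (key' j i hij fun x hx ↦ (h x hx).symm).symm

/-! ### The cocycle `j ↦ π_j` -/

section PiZ

variable [LocalCompletion A F Ω Λ] {f g : Polynomial (unrRing A F Ω Λ)}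

/-- `π_m` for natural numbers `m`. -/
def piR (f : Polynomial 𝓡) (m : ℕ) : 𝓡 := ∏ t ∈ Finset.range m, Φ t (f.coeff 1)

/-- `π_j` for integers `j`. -/
def piZ (f : Polynomial 𝓡) : ℤ → Λ
  | Int.ofNat m => (piR f m : Λ)
  | Int.negSucc m => galExt A Λ (frob A F Ω ^ Int.negSucc m) ((piR f (m + 1) : Λ)⁻¹)

theorem piZ_zero (f : Polynomial 𝓡) : piZ f 0 = 1 := by
  change (piR f 0 : Λ) = 1
  simp [piR]

theorem IsLT.coeff_one_ne_zero (hf : IsLT f) : (f.coeff 1 : Λ) ≠ 0 := by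
  rw [← norm_pos_iff, hf.norm_coeff_one]
  exact unifNorm_pos F

theorem piR_succ' (f : Polynomial 𝓡) (m : ℕ) : piR f (m + 1) = f.coeff 1 * Φ 1 (piR f m) := by
  rw [piR, Finset.prod_range_succ', piR, map_prod, mul_comm]
  congr 1
  · exact frobR_zero _
  · refine Finset.prod_congr rfl fun t _ ↦ ?_
    rw [← frobR_add, add_comm]
    push_cast
    rfl

theorem IsLT.piZ_succ (hf : IsLT f) (j : ℤ) :
    piZ f (j + 1) = piZ f j * galExt A Λ (frob A F Ω ^ j) (f.coeff 1) := by
  rcases j with m | m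
  · change ((piR f (m + 1) : 𝓡) : Λ) = _
    rw [piR, Finset.prod_range_succ, Subring.coe_mul]
    rfl
  · have h1 := hf.coeff_one_ne_zero
    have h2 : ((piR f (m + 1) : 𝓡) : Λ)⁻¹ * (f.coeff 1 : Λ) =
        galExt A Λ (frob A F Ω) ((piR f m : Λ)⁻¹) := by
      rw [piR_succ', Subring.coe_mul, mul_inv, mul_comm, mul_inv_cancel_left₀ h1, coe_frobR,
        zpow_one, map_inv₀]
    have h3 : piZ f (Int.negSucc m) * galExt A Λ (frob A F Ω ^ Int.negSucc m) (f.coeff 1) =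
        galExt A Λ (frob A F Ω ^ (Int.negSucc m + 1)) ((piR f m : Λ)⁻¹) := by
      change galExt A Λ _ _ * _ = _
      rw [← map_mul, h2, ← galExt_mul, zpow_add_one]
    rw [h3]
    rcases m with _ | m
    · change piZ f 0 = galExt A Λ (frob A F Ω ^ (0 : ℤ)) _
      rw [piZ_zero, zpow_zero, galExt_one]
      simp [piR]
    · rfl

/-- This cocycle relation makes the linear coefficients of composed brackets match under
multiplication of lifts. -/
theorem IsLT.piZ_add (hf : IsLT f) (i j : ℤ) :
    piZ f (i + j) = piZ f i * galExt A Λ (frob A F Ω ^ i) (piZ f j) := by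
  induction j with
  | zero => simp [piZ_zero]
  | succ j ih =>
    rw [← add_assoc, hf.piZ_succ, ih, hf.piZ_succ, map_mul, ← galExt_mul, zpow_add, mul_assoc]
  | pred j ih =>
    have h1 := hf.piZ_succ (i + (-j - 1))
    have h2 := hf.piZ_succ (-j - 1)
    rw [show i + (-(j : ℤ) - 1) + 1 = i + -j by ring, ih] at h1
    rw [sub_add_cancel] at h2
    rw [h2, map_mul, ← galExt_mul, ← zpow_add, ← mul_assoc] at h1
    exact (mul_right_cancel₀ ((_root_.map_ne_zero _).2 hf.coeff_one_ne_zero) h1).symm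

theorem IsLT.norm_piZ (hf : IsLT f) (j : ℤ) : ‖piZ f j‖ = ρ ^ j := by
  have hρ := (unifNorm_pos F (A := A) (Ω := Ω) (Λ := Λ)).ne'
  have h : ∀ j : ℤ, ‖piZ f (j + 1)‖ = ‖piZ f j‖ * ρ := fun j ↦ by
    rw [hf.piZ_succ, norm_mul, norm_galExt, hf.norm_coeff_one]
  induction j with
  | zero => simp [piZ_zero]
  | succ j ih => rw [h, ih, zpow_add_one₀ hρ]
  | pred j ih =>
    have := h (-j - 1)
    rw [sub_add_cancel, ih] at this
    rw [zpow_sub_one₀ hρ, this, mul_assoc, mul_inv_cancel₀ hρ, mul_one]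

/-- Up to powers of the uniformizer, `π_j` is a unit of the completed ring. -/
theorem IsLT.exists_piZ_eq (hf : IsLT f) (j : ℤ) :
    ∃ θ : 𝓡, (θ : Λ) * emb A Ω Λ (unif A) ^ j = piZ f j := by
  have hϖ := emb_unif_ne_zero F (A := A) (Ω := Ω) (Λ := Λ)
  have hdvd : ∀ j : ℤ, ∃ w : 𝓡, Φ j (f.coeff 1) = ϖ * w ∧ IsUnit w := fun j ↦ by
    have : Associated ϖ (Φ j (f.coeff 1)) := by
      rw [unrRing_associated_iff, norm_frobR, hf.norm_coeff_one, norm_unifR]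
    obtain ⟨w, hw⟩ := this
    exact ⟨w, hw.symm, w.isUnit⟩
  induction j with
  | zero => exact ⟨1, by simp [piZ_zero]⟩
  | succ j ih =>
    obtain ⟨θ, hθ⟩ := ih
    obtain ⟨w, hw, -⟩ := hdvd j
    refine ⟨θ * w, ?_⟩
    rw [hf.piZ_succ, ← hθ, ← coe_frobR, hw, zpow_add_one₀ hϖ, Subring.coe_mul, Subring.coe_mul]
    change _ = _ * (emb A Ω Λ (unif A) * _)
    ring
  | pred j ih =>
    obtain ⟨θ, hθ⟩ := ih
    obtain ⟨w, hw, hwu⟩ := hdvd (-j - 1)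
    obtain ⟨v, hv⟩ := hwu.exists_right_inv
    refine ⟨θ * v, ?_⟩
    have h1 := hf.piZ_succ (-j - 1)
    rw [sub_add_cancel, ← hθ, ← coe_frobR, hw] at h1
    have hv' : (w : Λ) * v = 1 := congrArg Subtype.val hv
    have h2 : (ϖ : Λ) = emb A Ω Λ (unif A) := rfl
    rw [Subring.coe_mul, h2] at h1
    have hw0 : (w : Λ) ≠ 0 := left_ne_zero_of_mul_eq_one hv'
    apply mul_right_cancel₀ (mul_ne_zero hϖ hw0)
    rw [← h1, zpow_sub_one₀ hϖ, Subring.coe_mul]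
    have : (θ : Λ) * v * (emb A Ω Λ (unif A) ^ (-(j : ℤ)) * (emb A Ω Λ (unif A))⁻¹) *
        (emb A Ω Λ (unif A) * w) = θ * emb A Ω Λ (unif A) ^ (-(j : ℤ)) *
          ((emb A Ω Λ (unif A))⁻¹ * emb A Ω Λ (unif A)) * (w * v) := by ring
    rw [this, hv', inv_mul_cancel₀ hϖ, mul_one, mul_one]

/-- Computing `π_{j+1}` from `π_j` on either side gives the condition under which a bracket from `f`
to its `j`-th twist exists; `x` drops out because Frobenius fixes it. -/
theorem IsLT.coeff_mul_eq (hf : IsLT f) {j : ℤ} {x : F} {θ : 𝓡}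
    (hθ : (θ : Λ) = ι (algebraMap F Ω x) * piZ f j) :
    (f.map (Φ j)).coeff 1 * θ = Φ 1 θ * f.coeff 1 := by
  apply Subtype.ext
  have h1 := hf.piZ_succ j
  have h2 := hf.piZ_add 1 j
  have h3 : piZ f 1 = f.coeff 1 := by
    have := hf.piZ_succ 0
    rwa [zero_add, piZ_zero, one_mul, zpow_zero, galExt_one] at this
  rw [add_comm, h1, h3] at h2
  rw [Subring.coe_mul, Subring.coe_mul, coeff_map, coe_frobR, coe_frobR, hθ, map_mul,
    galExt_algebraMap, AlgEquiv.commutes]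
  linear_combination (ι (algebraMap F Ω x)) * h2

theorem IsLT.exists_theta (hf : IsLT f) {j : ℤ} {x : F}
    (hx : ‖ι (algebraMap F Ω x)‖ = ρ ^ (-j)) :
    ∃ θ : 𝓡, (θ : Λ) = ι (algebraMap F Ω x) * piZ f j ∧ IsUnit θ := by
  obtain ⟨θ₀, h₀⟩ := hf.exists_piZ_eq j
  have hϖ := emb_unif_ne_zero F (A := A) (Ω := Ω) (Λ := Λ)
  have hy : ‖ι (algebraMap F Ω (x * algebraMap A F (unif A) ^ j))‖ = 1 := by
    have := norm_unit_mul_zpow (A := A) (F := F) (Ω := Ω) (Λ := Λ) 1 j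
    rw [Units.val_one, map_one, one_mul] at this
    rw [map_mul, map_mul, norm_mul, hx, this, ← zpow_add₀ (unifNorm_pos F).ne']
    simp
  obtain ⟨a, ha⟩ := LubinTate.exists_algebraMap_eq (A := A) hy.le
  have h1 : ((embR A F Ω Λ a * θ₀ : 𝓡) : Λ) = ι (algebraMap F Ω x) * piZ f j := by
    rw [Subring.coe_mul, coe_embR, emb_eq (F := F), ha, ← h₀, map_mul, map_mul, map_zpow₀,
      map_zpow₀, ← emb_eq]
    ring
  refine ⟨embR A F Ω Λ a * θ₀, h1, ?_⟩
  rw [unrRing_isUnit_iff, h1, norm_mul, hx, hf.norm_piZ, ← zpow_add₀ (unifNorm_pos F).ne']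
  simp

end PiZ

variable [LocalCompletion A F Ω Λ] {f g : Polynomial (unrRing A F Ω Λ)}

/-- The automorphism `s` acts on the maximal unramified extension as the `j`-th power of Frobenius
and on the torsion points as the power series `[x π_j]`. -/
structure IsLift (f : Polynomial 𝓡) (x : F) (j : ℤ) (s : Ω ≃ₐ[F] Ω) : Prop where
  norm_eq : ‖ι (algebraMap F Ω x)‖ = ρ ^ (-j)
  eq_frob : ∀ y ∈ maxUnr A F Ω, s y = (frob A F Ω ^ j) y
  exists_brk : ∃ (θ : 𝓡) (h : PowerSeries 𝓡), (θ : Λ) = ι (algebraMap F Ω x) * piZ f j ∧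
    IsBrk f (f.map (Φ j)) θ h ∧ ∀ m, ∀ α ∈ torsΛ f m, galExt A Λ s α = evR α h

theorem IsLift.ne_zero {x : F} {j : ℤ} {s : Ω ≃ₐ[F] Ω} (h : IsLift f x j s) : x ≠ 0 := by
  rintro rfl
  have := h.norm_eq
  rw [map_zero, map_zero, norm_zero] at this
  exact (zpow_pos (unifNorm_pos F) _).ne this

theorem isUnit_theta (hf : IsLT f) {x : F} {j : ℤ} (hx : ‖ι (algebraMap F Ω x)‖ = ρ ^ (-j))
    {θ : 𝓡} (hθ : (θ : Λ) = ι (algebraMap F Ω x) * piZ f j) : IsUnit θ := by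
  rw [unrRing_isUnit_iff, hθ, norm_mul, hx, hf.norm_piZ, ← zpow_add₀ (unifNorm_pos F).ne']
  simp

/-- Multiplicativity. -/
theorem IsLift.mul (hf : IsLT f) {x y : F} {j k : ℤ} {s t : Ω ≃ₐ[F] Ω} (hs : IsLift f x j s)
    (ht : IsLift f y k t) : IsLift f (x * y) (j + k) (s * t) := by
  obtain ⟨θ, h, hθ, hh, hsα⟩ := hs.exists_brk
  obtain ⟨η, h', hη, hh', htα⟩ := ht.exists_brk
  -- Since `s` acts on coefficients through `φ^j`, the second bracket appears twisted. Its linear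
  -- coefficient times that of the first is `x y π_{j+k}` by the cocycle relation.
  refine ⟨?_, fun z hz ↦ ?_, Φ j η * θ, PowerSeries.subst h (PowerSeries.map (Φ j) h'), ?_, ?_, ?_⟩
  · rw [map_mul, map_mul, norm_mul, hs.norm_eq, ht.norm_eq, ← zpow_add₀ (unifNorm_pos F).ne']
    congr 1
    ring
  · rw [AlgEquiv.mul_apply, ht.eq_frob z hz, hs.eq_frob _ (galois_mem_maxUnr _ hz),
      ← AlgEquiv.mul_apply, ← zpow_add]
  · rw [Subring.coe_mul, coe_frobR, hη, hθ, map_mul, galExt_algebraMap, AlgEquiv.commutes,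
      hf.piZ_add, map_mul, map_mul]
    ring
  · have := hh.comp hf (hf.map_frobR j) (hh'.map hf j)
    rwa [map_frobR_map] at this
  · intro m α hα
    have h1 := hf.norm_lt_one hα
    rw [galExt_mul, htα m α hα, galExt_evR hs.eq_frob h1, hsα m α hα, evR_subst h1 hh.zero]

/-- An action on the torsion is determined by what it does to one primitive point. -/
theorem IsLT.galExt_eq_of_primitive (hf : IsLT f) {s : Ω ≃ₐ[F] Ω} {j : ℤ}
    (hs : ∀ y ∈ maxUnr A F Ω, s y = (frob A F Ω ^ j) y) {θ : 𝓡} {h : PowerSeries 𝓡}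
    (hh : IsBrk f (f.map (Φ j)) θ h) {m : ℕ} {α : Λ} (h1 : α ∈ torsΛ f (m + 1))
    (h2 : α ∉ torsΛ f m) (hα : galExt A Λ s α = evR α h) {β : Λ} (hβ : β ∈ torsΛ f (m + 1)) :
    galExt A Λ s β = evR β h := by
  have hα1 := hf.norm_lt_one h1
  obtain ⟨b, rfl⟩ := hf.exists_evR_brk_eq h1 h2 hβ
  rw [galExt_evR hs hα1, hα]
  refine IsBrk.evR_comp_eq hf (hf.map_frobR j) hf (hf.map_frobR j) hh ((hf.isBrk b).map hf j)
    (hf.isBrk b) hh ?_ hα1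
  rw [frobR_embR, mul_comm]

/-- The limit exists in `Λ`, and it lies in `F` because `F`, as a finite-dimensional subspace, is
closed. Thus adic completeness of `A` need not be assumed once a suitable `Λ` is given. -/
theorem exists_adic_limit (A F Ω Λ : Type*) [CommRing A] [IsDomain A] [IsDiscreteValuationRing A]
    [Finite (IsLocalRing.ResidueField A)] [Field F] [Algebra A F] [IsFractionRing A F]
    [Field Ω] [Algebra F Ω] [Algebra A Ω] [IsScalarTower A F Ω] [IsSepClosure F Ω]
    [NormedField Λ] [CompleteSpace Λ] [IsUltrametricDist Λ] [Algebra Ω Λ]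
    [LocalCompletion A F Ω Λ] (u : ℕ → A)
    (hu : ∀ m, u (m + 1) - u m ∈ IsLocalRing.maximalIdeal A ^ (m + 1)) :
    ∃ a : A, ∀ m, a - u m ∈ IsLocalRing.maximalIdeal A ^ (m + 1) := by
  have hρ0 := unifNorm_pos F (A := A) (Ω := Ω) (Λ := Λ)
  have hρ1 := unifNorm_lt_one F (A := A) (Ω := Ω) (Λ := Λ)
  have hcs : CauchySeq fun m ↦ emb A Ω Λ (u m) := by
    refine cauchySeq_of_le_geometric (unifNorm A Ω Λ) (unifNorm A Ω Λ) hρ1 fun m ↦ ?_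
    rw [dist_comm, dist_eq_norm, ← pow_succ']
    exact (emb_sub_le_iff A F Ω Λ).2 (hu m)
  obtain ⟨z, hz⟩ := cauchySeq_tendsto_of_complete hcs
  have hcl := LocalCompletion.isClosed_image A (Λ := Λ)
    (⊥ : IntermediateField F Ω).toSubalgebra.toSubmodule
    (inferInstanceAs (FiniteDimensional F (⊥ : IntermediateField F Ω)))
  have hmem : z ∈ algebraMap Ω Λ ''
      ((⊥ : IntermediateField F Ω).toSubalgebra.toSubmodule : Set Ω) := by
    refine hcl.mem_of_tendsto hz (Filter.Eventually.of_forall fun m ↦ ?_)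
    refine ⟨algebraMap A Ω (u m), ?_, rfl⟩
    rw [IsScalarTower.algebraMap_apply A F Ω]
    exact (⊥ : IntermediateField F Ω).algebraMap_mem _
  obtain ⟨y, hy, rfl⟩ := hmem
  obtain ⟨y, rfl⟩ := IntermediateField.mem_bot.1 hy
  have hle : ‖algebraMap Ω Λ (algebraMap F Ω y)‖ ≤ 1 :=
    le_of_tendsto' hz.norm fun m ↦ norm_emb_le_one F (u m)
  obtain ⟨a, rfl⟩ := exists_algebraMap_eq (A := A) hle
  refine ⟨a, fun m ↦ (emb_sub_le_iff A F Ω Λ).1 ?_⟩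
  rw [← emb_eq] at hz
  have hk : ∀ k, ‖emb A Ω Λ (u (m + k)) - emb A Ω Λ (u m)‖ ≤ unifNorm A Ω Λ ^ (m + 1) := by
    intro k
    rw [emb_sub_le_iff A F Ω Λ]
    induction k with
    | zero => simp
    | succ k ih =>
      have h1 := Ideal.pow_le_pow_right (show m + 1 ≤ m + k + 1 by omega) (hu (m + k))
      have := add_mem h1 ih
      rwa [sub_add_sub_cancel] at this
  have hz' := (hz.comp (Filter.tendsto_add_atTop_nat m)).sub_const (emb A Ω Λ (u m))
  refine le_of_tendsto' hz'.norm fun k ↦ ?_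
  have := hk k
  rw [add_comm] at this
  exact this

/-- Every automorphism that acts on the maximal unramified extension as an integral power of
Frobenius is a lift. -/
theorem IsLT.exists_isLift (hf : IsLT f) {s : Ω ≃ₐ[F] Ω} {j : ℤ}
    (hs : ∀ y ∈ maxUnr A F Ω, s y = (frob A F Ω ^ j) y) : ∃ x : F, IsLift f x j s := by
  -- This is a reference element of the right valuation with bracket `h₀`. The element sought is `x₀
  -- a` for a unit `a`, which is determined level by level.
  set x₀ : F := algebraMap A F (unif A) ^ (-j) with hx₀
  have hx₀n : ‖ι (algebraMap F Ω x₀)‖ = ρ ^ (-j) := by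
    have := norm_unit_mul_zpow (A := A) (F := F) (Ω := Ω) (Λ := Λ) 1 (-j)
    rwa [Units.val_one, map_one, one_mul] at this
  obtain ⟨θ₀, hθ₀, hθ₀u⟩ := hf.exists_theta hx₀n
  obtain ⟨h₀, hh₀⟩ := exists_isBrk hf (hf.map_frobR j) (hf.coeff_mul_eq hθ₀)
  obtain ⟨η₀, k₀, -, hk₀, -, hk₀h⟩ := hh₀.exists_inverse hf (hf.map_frobR j) hθ₀u
  have hsub : ∀ a : A, IsBrk f (f.map (Φ j)) (θ₀ * embR A F Ω Λ a)
      (PowerSeries.subst (hf.brk a) h₀) := fun a ↦ (hf.isBrk a).comp hf hf hh₀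
  have hlev : ∀ m : ℕ, ∃ u : A, IsUnit u ∧ ∀ α ∈ torsΛ f (m + 1),
      galExt A Λ s α = evR (evR α (hf.brk u)) h₀ := by
    intro m
    obtain ⟨α, h1, h2⟩ := hf.exists_primitive m
    have hα1 := hf.norm_lt_one h1
    have h3 := (hf.galExt_mem_tors hs).2 h1
    have hs1 := (hf.map_frobR j).norm_lt_one h3
    obtain ⟨u, hu⟩ := hf.exists_evR_brk_eq h1 h2 (hk₀.evR_mem_tors (hf.map_frobR j) hf h3)
    have hsα : galExt A Λ s α = evR (evR α (hf.brk u)) h₀ := by rw [hu, hk₀h _ hs1]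
    refine ⟨u, ?_, fun β hβ ↦ ?_⟩
    -- A non-unit `u` is a multiple of the uniformizer and would lower the level of `α`, but `s`
    -- preserves levels.
    · by_contra hnu
      have hmem : u ∈ IsLocalRing.maximalIdeal A := (IsLocalRing.mem_maximalIdeal _).2 hnu
      rw [(irreducible_unif A).maximalIdeal_eq, Ideal.mem_span_singleton] at hmem
      obtain ⟨c, rfl⟩ := hmem
      apply h2
      rw [← hf.galExt_mem_tors hs, hsα]
      refine hh₀.evR_mem_tors hf (hf.map_frobR j) ?_
      rw [mul_comm, hf.evR_brk_mul _ _ hα1]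
      exact (hf.isBrk c).evR_mem_tors hf hf ((hf.evR_unif_mem_tors_iff hα1).2 h1)
    · rw [← evR_subst (hf.norm_lt_one hβ) (hf.isBrk u).zero]
      rw [← evR_subst hα1 (hf.isBrk u).zero] at hsα
      exact hf.galExt_eq_of_primitive hs (hsub u) h1 h2 hsα hβ
  choose u huu hu using hlev
  -- The scalars of consecutive levels act alike on a primitive point of the lower level, hence are
  -- congruent modulo the corresponding power of the maximal ideal.
  obtain ⟨a, ha⟩ := exists_adic_limit A F Ω Λ u fun m ↦ by
    obtain ⟨α, h1, h2⟩ := hf.exists_primitive m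
    have hα1 := hf.norm_lt_one h1
    rw [← emb_sub_le_iff A F Ω Λ]
    refine hf.norm_emb_sub_le h1 h2 (hh₀.evR_injective hf (hf.map_frobR j) hθ₀u
      (hf.norm_evR_brk _ hα1) (hf.norm_evR_brk _ hα1) ?_)
    rw [← hu _ _ h1, ← hu _ _ (hf.tors_succ h1)]
  have hau : IsUnit a := by
    by_contra hna
    have hmem : a ∈ IsLocalRing.maximalIdeal A := (IsLocalRing.mem_maximalIdeal _).2 hna
    have h0 := ha 0
    rw [zero_add, pow_one] at h0
    have := sub_mem hmem h0
    rw [sub_sub_cancel] at this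
    exact (IsLocalRing.mem_maximalIdeal _).1 this (huu 0)
  refine ⟨x₀ * algebraMap A F a, ?_, hs, θ₀ * embR A F Ω Λ a, _, ?_, hsub a, ?_⟩
  · rw [map_mul, map_mul, norm_mul, hx₀n, ← emb_eq, (norm_emb_eq_one_iff F).2 hau, mul_one]
  · rw [Subring.coe_mul, hθ₀, coe_embR, emb_eq (F := F), map_mul, map_mul]
    ring
  · intro m α hα
    have hα1 := hf.norm_lt_one hα
    rw [evR_subst hα1 (hf.isBrk a).zero, hf.evR_brk_congr (hf.tors_succ hα) (ha m),
      hu m α (hf.tors_succ hα)]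

/-- The action on the maximal unramified extension determines the exponent, so the two elements
differ by a unit `a`. By injectivity of the unit bracket, `[a]` fixes primitive points of every
level. Hence `a - 1` is divisible by all powers of the uniformizer. -/
theorem IsLift.unique (hf : IsLT f) {x y : F} {j k : ℤ} {s : Ω ≃ₐ[F] Ω} (hx : IsLift f x j s)
    (hy : IsLift f y k s) : x = y := by
  obtain rfl : j = k := frob_zpow_injective (A := A) (F := F) Λ fun z hz ↦ by
    rw [← hx.eq_frob z hz, hy.eq_frob z hz]
  obtain ⟨θ, h, hθ, hh, hsα⟩ := hx.exists_brk
  obtain ⟨η, h', hη, hh', hsα'⟩ := hy.exists_brk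
  have hθu := isUnit_theta hf hx.norm_eq hθ
  have hx0 := hx.ne_zero
  have hnorm : ‖ι (algebraMap F Ω (y / x))‖ = 1 := by
    rw [map_div₀, map_div₀, norm_div, hx.norm_eq, hy.norm_eq,
      div_self (zpow_pos (unifNorm_pos F) _).ne']
  obtain ⟨a, ha⟩ := LubinTate.exists_algebraMap_eq (A := A) hnorm.le
  have hηθ : η = θ * embR A F Ω Λ a := by
    apply Subtype.ext
    rw [Subring.coe_mul, hη, hθ, coe_embR, emb_eq (F := F), ha, mul_right_comm, ← map_mul,
      ← map_mul, mul_div_cancel₀ _ hx0]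
  rw [hηθ] at hh'
  have hh'' := IsBrk.unique hf (hf.map_frobR j) hh' ((hf.isBrk a).comp hf hf hh)
  have ha1 : emb A Ω Λ a = emb A Ω Λ 1 := by
    refine eq_of_forall_norm_sub_le (unifNorm_pos F (A := A) (Ω := Ω) (Λ := Λ)).le
      (unifNorm_lt_one F) fun m ↦ ?_
    obtain ⟨α, h1, h2⟩ := hf.exists_primitive m
    have hα1 := hf.norm_lt_one h1
    refine (hf.norm_emb_sub_le h1 h2 (hh.evR_injective hf (hf.map_frobR j) hθu
      (hf.norm_evR_brk _ hα1) (hf.norm_evR_brk _ hα1) ?_)).trans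
      (pow_le_pow_of_le_one (unifNorm_pos F).le (unifNorm_lt_one F).le (Nat.le_succ m))
    rw [hf.evR_brk_one, ← evR_subst hα1 (hf.isBrk a).zero, ← hh'', ← hsα' _ _ h1, hsα _ _ h1]
  rw [emb_injective F ha1, map_one] at ha
  exact ((div_eq_one_iff_eq hx0).1 ha.symm).symm

theorem isLift_unit (hf : IsLT f) {a : A} (ha : IsUnit a) {s : Ω ≃ₐ[F] Ω}
    (hs : ∀ y ∈ maxUnr A F Ω, s y = y)
    (hsα : ∀ m, ∀ α ∈ torsΛ f m, galExt A Λ s α = evR α (hf.brk a)) :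
    IsLift f (algebraMap A F a) 0 s where
  norm_eq := by rw [← emb_eq, (norm_emb_eq_one_iff F).2 ha, neg_zero, zpow_zero]
  eq_frob y hy := by rw [hs y hy, zpow_zero]; rfl
  exists_brk := ⟨embR A F Ω Λ a, hf.brk a, by rw [coe_embR, emb_eq (F := F), piZ_zero, mul_one],
    by rw [map_frobR_zero]; exact hf.isBrk a, hsα⟩

/-- At each level transitivity gives an automorphism over the maximal unramified extension that
agrees with `[a]` at one primitive point, hence on the whole level. Compactness combines the levels.
-/
theorem IsLT.exists_galois_unit (hf : IsLT f) {a : A} (ha : IsUnit a) :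
    ∃ s : Ω ≃ₐ[F] Ω, IsLift f (algebraMap A F a) 0 s := by
  have hfix : ∀ s : Ω ≃ₐ[F] Ω, (∀ y ∈ maxUnr A F Ω, s y = y) →
      ∀ y ∈ maxUnr A F Ω, s y = (frob A F Ω ^ (0 : ℤ)) y := fun s hs y hy ↦ by
    rw [hs y hy, zpow_zero]; rfl
  have hb : IsBrk f (f.map (Φ 0)) (embR A F Ω Λ a) (hf.brk a) := by
    rw [map_frobR_zero]; exact hf.isBrk a
  have hau : IsUnit (embR A F Ω Λ a) := ha.map _
  obtain ⟨s, hs⟩ := exists_galois_of_directed (F := F) (Ω := Ω)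
    (fun m ↦ {σ | (∀ y ∈ maxUnr A F Ω, σ y = y) ∧
      ∀ b c : Ω, ι b ∈ torsΛ f (m + 1) → ι c = evR (ι b) (hf.brk a) → σ b = c})
    (fun m ↦ by
      have : {σ : Ω ≃ₐ[F] Ω | (∀ y ∈ maxUnr A F Ω, σ y = y) ∧
          ∀ b c : Ω, ι b ∈ torsΛ f (m + 1) → ι c = evR (ι b) (hf.brk a) → σ b = c} =
          (⋂ (y : Ω) (_ : y ∈ maxUnr A F Ω), {σ | σ y = y}) ∩
          ⋂ (b : Ω) (c : Ω) (_ : ι b ∈ torsΛ f (m + 1)) (_ : ι c = evR (ι b) (hf.brk a)),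
            {σ | σ b = c} := by ext; simp
      rw [this]
      refine IsClosed.inter ?_ ?_
      · exact isClosed_iInter fun y ↦ isClosed_iInter fun _ ↦ isClosed_setOf_apply_eq y y
      · exact isClosed_iInter fun b ↦ isClosed_iInter fun c ↦ isClosed_iInter fun _ ↦
          isClosed_iInter fun _ ↦ isClosed_setOf_apply_eq b c)
    (fun m ↦ by
      obtain ⟨α, h1, h2⟩ := hf.exists_primitive m
      have hα1 := hf.norm_lt_one h1
      obtain ⟨σ, hσ, hσα⟩ := hf.exists_galois h1 h2 ((hf.isBrk a).evR_mem_tors hf hf h1)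
        (fun h ↦ h2 (((hf.isBrk a).evR_mem_tors_iff hf hf hau hα1).1 h))
      refine ⟨σ, hσ, fun b c hb' hc ↦ (algebraMap Ω Λ).injective ?_⟩
      rw [← galExt_algebraMap (A := A), hc]
      exact hf.galExt_eq_of_primitive (hfix σ hσ) hb h1 h2 hσα hb')
    (fun m n ↦ ⟨max m n, fun σ hσ ↦ ⟨hσ.1, fun b c hb ↦ hσ.2 b c (hf.tors_mono (by omega) hb)⟩,
      fun σ hσ ↦ ⟨hσ.1, fun b c hb ↦ hσ.2 b c (hf.tors_mono (by omega) hb)⟩⟩)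
  refine ⟨s, isLift_unit hf ha (hs 0).1 fun m α hα ↦ ?_⟩
  obtain ⟨b, rfl⟩ := hf.exists_algebraMap_eq hα
  obtain ⟨c, hc⟩ := hf.exists_algebraMap_eq ((hf.isBrk a).evR_mem_tors hf hf hα)
  rw [galExt_algebraMap, (hs m).2 b c (hf.tors_succ hα) hc, hc]

/-- Every element of the multiplicative group has a lift. -/
theorem IsLT.exists_galois_isLift (hf : IsLT f) {x : F} {j : ℤ}
    (hx : ‖ι (algebraMap F Ω x)‖ = ρ ^ (-j)) : ∃ s : Ω ≃ₐ[F] Ω, IsLift f x j s := by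
  obtain ⟨x₀, h₀⟩ := hf.exists_isLift (s := frob A F Ω ^ j) (j := j) fun _ _ ↦ rfl
  have hx0 := h₀.ne_zero
  have hnorm : ‖ι (algebraMap F Ω (x / x₀))‖ = 1 := by
    rw [map_div₀, map_div₀, norm_div, hx, h₀.norm_eq, div_self (zpow_pos (unifNorm_pos F) _).ne']
  obtain ⟨a, ha⟩ := LubinTate.exists_algebraMap_eq (A := A) hnorm.le
  have hau : IsUnit a := by
    rw [← norm_emb_eq_one_iff F (Ω := Ω) (Λ := Λ), emb_eq (F := F), ha, hnorm]
  obtain ⟨s, hs⟩ := hf.exists_galois_unit hau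
  refine ⟨frob A F Ω ^ j * s, ?_⟩
  have := h₀.mul hf hs
  rwa [ha, mul_div_cancel₀ _ hx0, add_zero] at this

theorem IsLift.apply_eq_of_one (hf : IsLT f) {j : ℤ} {s : Ω ≃ₐ[F] Ω} (hs : IsLift f 1 j s) :
    j = 0 ∧ (∀ y ∈ maxUnr A F Ω, s y = y) ∧
      ∀ (m : ℕ) (b : Ω), ι b ∈ torsΛ f m → s b = b := by
  have hj : j = 0 := by
    have := hs.norm_eq
    rw [map_one, map_one, norm_one, ← zpow_zero ρ] at this
    have := unifNorm_zpow_injective F (A := A) (Ω := Ω) (Λ := Λ) this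
    simpa using this.symm
  subst hj
  refine ⟨rfl, fun y hy ↦ by rw [hs.eq_frob y hy, zpow_zero]; rfl, fun m b hb ↦ ?_⟩
  obtain ⟨θ, h, hθ, hh, hsα⟩ := hs.exists_brk
  rw [map_one, map_one, one_mul, piZ_zero] at hθ
  have hθ1 : θ = 1 := Subtype.ext hθ
  rw [hθ1, map_frobR_zero] at hh
  apply (algebraMap Ω Λ).injective
  rw [← galExt_algebraMap (A := A), hsα m _ hb, IsBrk.unique hf hf hh (IsBrk.X hf), evR_X]

/-- Lifts do not depend on the Lubin–Tate polynomial. -/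
theorem IsLift.change (hf : IsLT f) (hg : IsLT g) {x : F} {j : ℤ} {s : Ω ≃ₐ[F] Ω}
    (hs : IsLift f x j s) : IsLift g x j s := by
  obtain ⟨u, hu⟩ : f.coeff 1 ∣ g.coeff 1 := by
    rw [unrRing_dvd_iff, hf.norm_coeff_one, hg.norm_coeff_one]
  have hu1 : ‖(u : Λ)‖ = 1 := by
    have := congrArg (fun x : 𝓡 ↦ ‖(x : Λ)‖) hu
    simp only [Subring.coe_mul, norm_mul, hf.norm_coeff_one, hg.norm_coeff_one] at this
    exact (mul_eq_left₀ (unifNorm_pos F).ne').1 this.symm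
  -- If the linear coefficients differ by the unit `u`, a unit `θ` with `φ θ = u θ` is the linear
  -- coefficient of an invertible bracket from `f` to `g`. Such a `θ` is found by passing to the
  -- completed ring.
  obtain ⟨θ, hθ1, hθ⟩ := exists_frobR_eq_mul le_rfl hu1
  rw [Nat.cast_one] at hθ
  have hθu : IsUnit θ := unrRing_isUnit_iff.2 hθ1
  obtain ⟨T, hT⟩ := exists_isBrk (θ := θ) hf hg (by rw [hθ, hu]; ring)
  -- The unit `θ` turns one cocycle `π_j` into the other, which makes the square formed by the two
  -- brackets of `x` and the isomorphism commute.
  have hcoc : ∀ j : ℤ, ((Φ j θ : 𝓡) : Λ) * piZ f j = piZ g j * θ := by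
    have hθ0 : (θ : Λ) ≠ 0 := by rw [← norm_pos_iff, hθ1]; exact one_pos
    have hstep : ∀ j : ℤ, ((Φ (j + 1) θ : 𝓡) : Λ) * galExt A Λ (frob A F Ω ^ j) (f.coeff 1) =
        galExt A Λ (frob A F Ω ^ j) (g.coeff 1) * ((Φ j θ : 𝓡) : Λ) := by
      intro j
      rw [frobR_add, hθ, hu, ← coe_frobR, ← coe_frobR, ← Subring.coe_mul, ← Subring.coe_mul,
        ← map_mul, ← map_mul]
      congr 2
      ring
    intro j
    induction j with
    | zero => rw [piZ_zero, piZ_zero, frobR_zero, mul_one, one_mul]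
    | succ j ih =>
      rw [hf.piZ_succ, hg.piZ_succ]
      linear_combination (piZ f j) * hstep j + galExt A Λ (frob A F Ω ^ (j : ℤ)) (g.coeff 1) * ih
    | pred j ih =>
      have h1 := hf.piZ_succ (-j - 1)
      have h2 := hg.piZ_succ (-j - 1)
      have h3 := hstep (-j - 1)
      rw [sub_add_cancel] at h1 h2 h3
      rw [h1, h2] at ih
      have h4 : galExt A Λ (frob A F Ω ^ (-(j : ℤ) - 1)) (g.coeff 1) ≠ 0 :=
        (_root_.map_ne_zero _).2 hg.coeff_one_ne_zero
      apply mul_left_cancel₀ h4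
      linear_combination ih - piZ f (-(j : ℤ) - 1) * h3
  obtain ⟨η, h, hη, hh, hsα⟩ := hs.exists_brk
  obtain ⟨η', hη', -⟩ := hg.exists_theta hs.norm_eq
  obtain ⟨h', hh'⟩ := exists_isBrk hg (hg.map_frobR j) (hg.coeff_mul_eq hη')
  refine ⟨hs.norm_eq, hs.eq_frob, η', h', hη', hh', fun m β hβ ↦ ?_⟩
  obtain ⟨η₁, k, -, hk, -, hkT⟩ := hT.exists_inverse hf hg hθu
  have hβ1 := hg.norm_lt_one hβ
  have hα := hk.evR_mem_tors hg hf hβ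
  have hα1 := hf.norm_lt_one hα
  have h1 := IsBrk.evR_comp_eq hf (hf.map_frobR j) hg (hg.map_frobR j) hh (hT.map hf j) hT hh' (by
    apply Subtype.ext
    rw [Subring.coe_mul, Subring.coe_mul, hη, hη']
    linear_combination ι (algebraMap F Ω x) * hcoc j) hα1
  rw [hkT β hβ1, ← hsα m _ hα, ← galExt_evR hs.eq_frob hα1, hkT β hβ1] at h1
  exact h1

end Lifts

/-! ### Determinants of polynomials in a matrix -/

section Matrices

variable {S : Type*} [CommRing S] {n : Type*} [Fintype n] [DecidableEq n]

open Matrix in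
-- Over the fraction field `M` can be factored out, and the linear coefficient of `det (1 + X N)` is
-- the trace.
theorem coeff_one_det_add_X_smul [IsDomain S] (M N : Matrix n n S) (hM : M.det ≠ 0) :
    (det (M.map C + (X : Polynomial S) • N.map C)).coeff 1 = trace (adjugate M * N) := by
  let i := algebraMap S (FractionRing S)
  have hi : Function.Injective i := IsFractionRing.injective S (FractionRing S)
  apply hi
  have hu : IsUnit (M.map i).det := by
    rw [← RingHom.mapMatrix_apply, ← RingHom.map_det]
    exact ((map_ne_zero_iff i hi).2 hM).isUnit
  have h1 : (M.map C + (X : Polynomial S) • N.map C).map (mapRingHom i) =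
      (M.map i).map C *
        (1 + (X : Polynomial (FractionRing S)) • ((M.map i)⁻¹ * N.map i).map C) := by
    have h2 : (M.map i).map C * ((M.map i)⁻¹ * N.map i).map C = (N.map i).map C := by
      rw [← Matrix.map_mul, ← Matrix.mul_assoc, Matrix.mul_nonsing_inv _ hu, Matrix.one_mul]
    rw [mul_add, mul_one, mul_smul_comm, h2]
    ext a b : 2
    simp [Matrix.map_apply, i]
  have h3 : i ((det (M.map C + (X : Polynomial S) • N.map C)).coeff 1) =
      (det ((M.map C + (X : Polynomial S) • N.map C).map (mapRingHom i))).coeff 1 := by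
    rw [← RingHom.mapMatrix_apply (mapRingHom i), ← RingHom.map_det, coe_mapRingHom, coeff_map]
  have h4 : ((M.map i).map (C : FractionRing S →+* _)).det = C ((M.map i).det) := by
    rw [← RingHom.mapMatrix_apply, ← RingHom.map_det]
  rw [h3, h1, det_mul, h4, coeff_C_mul, coeff_det_one_add_X_smul_one]
  have h5 : i (trace (adjugate M * N)) = trace ((adjugate M * N).map i) := by
    simp only [trace, diag_apply, Matrix.map_apply, map_sum]
  have h6 : (adjugate M).map i = adjugate (M.map i) := by
    have := RingHom.map_adjugate i M
    simpa using this
  rw [h5, Matrix.map_mul, h6, Matrix.inv_def, Matrix.smul_mul, trace_smul, smul_eq_mul,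
    ← mul_assoc, Ring.mul_inverse_cancel _ hu, one_mul]

open Matrix in
theorem det_add_smul_eq [IsDomain S] (M N : Matrix n n S) (hM : M.det ≠ 0) (r : S) :
    ∃ c, det (M + r • N) = det M + r * trace (adjugate M * N) + r ^ 2 * c := by
  let p := det (M.map C + (X : Polynomial S) • N.map C)
  have h1 : det (M + r • N) = p.eval r := by
    simp only [p]
    rw [← coe_evalRingHom, RingHom.map_det]
    congr 1
    ext a b
    simp only [RingHom.mapMatrix_apply, Matrix.map_apply, Matrix.add_apply, Matrix.smul_apply,
      smul_eq_mul, coe_evalRingHom, eval_add, eval_mul, eval_C, eval_X]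
  have h0 : p.coeff 0 = det M := by
    rw [coeff_zero_eq_eval_zero]
    simp only [p, eval_det_add_X_smul]
    rw [← RingHom.mapMatrix_apply, ← RingHom.map_det, eval_C]
  refine ⟨p.divX.divX.eval r, ?_⟩
  rw [← coeff_one_det_add_X_smul M N hM, h1, ← h0]
  conv_lhs => rw [← divX_mul_X_add p, ← divX_mul_X_add p.divX]
  rw [coeff_divX]
  simp only [eval_add, eval_mul, eval_X, eval_C, p]
  ring

/-- A first order expansion of `f (B + r N)`, seen by traces against matrices commuting
with `B`. -/
theorem exists_aeval_add_smul_eq (B N : Matrix n n S) (r : S) (f : Polynomial S) :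
    ∃ W, aeval (B + r • N) f = aeval B f + r • W ∧ ∀ Z, Commute Z B → ∃ c,
      Matrix.trace (Z * W) = Matrix.trace (Z * aeval B (derivative f) * N) + r * c := by
  induction f using Polynomial.induction_on' with
  | add p p' hp hp' =>
    obtain ⟨W, h, hW⟩ := hp
    obtain ⟨W', h', hW'⟩ := hp'
    refine ⟨W + W', by rw [map_add, map_add, h, h', smul_add]; abel, fun Z hZ ↦ ?_⟩
    obtain ⟨c, hc⟩ := hW Z hZ
    obtain ⟨c', hc'⟩ := hW' Z hZ
    refine ⟨c + c', ?_⟩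
    rw [mul_add, Matrix.trace_add, hc, hc', map_add, map_add, mul_add, add_mul, Matrix.trace_add]
    ring
  | monomial k a =>
    induction k with
    | zero => exact ⟨0, by simp, fun Z _ ↦ ⟨0, by simp⟩⟩
    | succ k ih =>
      obtain ⟨W, h, hW⟩ := ih
      have hm : monomial (k + 1) a = X * monomial k a := by
        rw [X_mul_monomial]
      refine ⟨N * aeval B (monomial k a) + B * W + r • (N * W), ?_, fun Z hZ ↦ ?_⟩
      · rw [hm, map_mul, map_mul, aeval_X, aeval_X, h]
        simp only [add_mul, mul_add, smul_mul_assoc, mul_smul_comm, smul_add]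
        abel
      · obtain ⟨c, hc⟩ := hW (Z * B) (hZ.mul_left rfl)
        have hcomm : Commute Z (aeval B (monomial k a)) := by
          rw [aeval_monomial]
          exact (Algebra.commute_algebraMap_right a Z).mul_right (hZ.pow_right k)
        refine ⟨c + Matrix.trace (Z * (N * W)), ?_⟩
        rw [hm, derivative_mul, derivative_X, one_mul, map_add, map_mul, aeval_X]
        simp only [mul_add, add_mul, Matrix.trace_add, mul_smul_comm, Matrix.trace_smul,
          smul_eq_mul]
        rw [← mul_assoc Z B W, hc, ← mul_assoc Z B, ← mul_assoc Z N, Matrix.trace_mul_comm (Z * N),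
          ← mul_assoc, ← hcomm.eq]
        ring

/-- After multiplication by the nonzero determinant this is the commutation of `M` and `B`. -/
theorem commute_adjugate [IsDomain S] {M B : Matrix n n S} (hM : M.det ≠ 0) (h : Commute M B) :
    Commute M.adjugate B := by
  have h1 : M.det • (M.adjugate * B) = M.det • (B * M.adjugate) := by
    calc M.det • (M.adjugate * B) = M.adjugate * B * (M * M.adjugate) := by
          rw [Matrix.mul_adjugate, mul_smul_comm, mul_one]
      _ = M.adjugate * (M * B) * M.adjugate := by rw [h.eq]; simp only [mul_assoc]
      _ = M.det • (B * M.adjugate) := by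
          rw [← mul_assoc M.adjugate, Matrix.adjugate_mul, smul_mul_assoc, one_mul, smul_mul_assoc]
  exact smul_right_injective _ hM h1

/-- Perturbing `B` by `ϖ ^ i N` changes the characteristic polynomial of `f (B)` to first order by
`ϖ ^ i` times a trace. The adjugate commutes with `B`, so the derivative of `f` can be collected
inside this trace and contributes another factor `ϖ`. The higher order terms carry `ϖ ^ (2 i)`,
which suffices because `i ≥ 1`. -/
theorem charpoly_aeval_sub_dvd {R : Type*} [CommRing R] [IsDomain R] {ϖ : R} {f w : Polynomial R}
    (hf : derivative f = C ϖ * w) (B N : Matrix n n R) {i : ℕ} (hi : 1 ≤ i) :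
    C ϖ ^ (i + 1) ∣ (aeval (B + ϖ ^ i • N) f).charpoly - (aeval B f).charpoly := by
  have hmap : ∀ M : Matrix n n R, (aeval M f).map C = aeval (M.map C) (f.map C) := by
    intro M
    have h0 := aeval_map_algebraMap (Polynomial R) (M.map C : Matrix n n (Polynomial R)) f
    rw [Polynomial.algebraMap_eq] at h0
    rw [h0]
    have := (aeval_algHom_apply ((Algebra.ofId R (Polynomial R)).mapMatrix) M f).symm
    exact this
  obtain ⟨W, h1, hW⟩ := exists_aeval_add_smul_eq (B.map C) (N.map C) (C ϖ ^ i) (f.map C)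
  have hc : ∀ M : Matrix n n R, (aeval M f).charpoly =
      (Matrix.scalar n X - aeval (M.map C) (f.map C)).det := by
    intro M
    rw [Matrix.charpoly, Matrix.charmatrix, RingHom.mapMatrix_apply, hmap]
  have hB : (B + ϖ ^ i • N).map C = B.map C + C ϖ ^ i • N.map C := by
    ext a b : 2
    simp
  have hd : (Matrix.scalar n X - aeval (B.map C) (f.map C)).det ≠ 0 := by
    rw [← hc]
    exact (Matrix.charpoly_monic _).ne_zero
  obtain ⟨c, h2⟩ := det_add_smul_eq _ (-W) hd (C ϖ ^ i)
  have hcomm : Commute (Matrix.scalar n X - aeval (B.map C) (f.map C)) (B.map C) := by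
    refine Commute.sub_left ?_ ?_
    · exact Matrix.scalar_commute _ (fun _ ↦ Commute.all _ _) _
    · have h5 := (Commute.all (f.map C) X).map (aeval (B.map C : Matrix n n (Polynomial R)))
      rwa [aeval_X] at h5
  obtain ⟨c', h3⟩ := hW _ (commute_adjugate hd hcomm)
  rw [hc, hc, hB, h1, ← sub_sub, sub_eq_add_neg _ ((C ϖ ^ i) • W), ← smul_neg, h2, mul_neg,
    Matrix.trace_neg, h3, derivative_map, hf, Polynomial.map_mul, map_mul, map_C, aeval_C]
  have h4 : ∃ c'', Matrix.trace
      ((Matrix.scalar n X - aeval (B.map C) (f.map C)).adjugate *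
        (algebraMap (Polynomial R) (Matrix n n (Polynomial R)) (C ϖ) *
          aeval (B.map C) (w.map C)) * N.map C) = C ϖ * c'' := by
    refine ⟨Matrix.trace ((Matrix.scalar n X - aeval (B.map C) (f.map C)).adjugate *
      aeval (B.map C) (w.map C) * N.map C), ?_⟩
    rw [← Algebra.smul_def, mul_smul_comm, smul_mul_assoc, Matrix.trace_smul, smul_eq_mul]
  obtain ⟨c'', h4⟩ := h4
  rw [h4]
  obtain ⟨k, rfl⟩ := Nat.exists_eq_add_of_le hi
  refine ⟨-c'' - C ϖ ^ k * c' + C ϖ ^ k * c, ?_⟩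
  ring

/-- In characteristic `p` one has `(X - M) ^ (p ^ r) = X ^ (p ^ r) - M ^ (p ^ r)` for the commuting
`X` and `M`. Taking determinants gives the claim after the substitution `X ↦ X ^ (p ^ r)`, which is
injective. -/
theorem charpoly_pow_eq {k : Type*} [CommRing k] {p : ℕ} [Fact p.Prime] [CharP k p]
    (M : Matrix n n k) (r : ℕ) :
    (M ^ p ^ r).charpoly = M.charpoly.map (iterateFrobenius k p r) := by
  cases (isEmpty_or_nonempty n).symm
  · have : Nontrivial k := CharP.nontrivial_of_char_ne_one (R := k) (Fact.out : p.Prime).one_lt.ne'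
    apply expand_injective (R := k) (pow_pos (Fact.out : p.Prime).pos r)
    rw [← map_expand, map_iterateFrobenius_expand]
    unfold Matrix.charpoly
    rw [AlgHom.map_det, ← Matrix.det_pow]
    apply congrArg Matrix.det
    refine matPolyEquiv.injective ?_
    rw [map_pow, Matrix.matPolyEquiv_charmatrix, sub_pow_char_pow_of_commute, ← C_pow]
    · exact (id (matPolyEquiv_eq_X_pow_sub_C (p ^ r) M) : _)
    · exact (C M).commute_X
  · simp [Matrix.charpoly, Matrix.det_isEmpty]

/-- The companion matrix of a monic polynomial. -/
def companion {R : Type*} [CommRing R] (g : Polynomial R) (d : ℕ) : Matrix (Fin d) (Fin d) R :=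
  Matrix.of fun i j ↦ if (j : ℕ) + 1 = d then -g.coeff i else if (i : ℕ) = j + 1 then 1 else 0

/-- The companion matrix is the matrix of multiplication by the root in `AdjoinRoot g` with respect
to its power basis. -/
theorem charpoly_companion {R : Type*} [CommRing R] {g : Polynomial R} (hg : g.Monic) :
    (companion g g.natDegree).charpoly = g := by
  nontriviality R
  let pb := AdjoinRoot.powerBasis' hg
  have hmin : minpoly R pb.gen = g := by
    refine (minpoly.unique' R pb.gen hg ?_ ?_).symm
    · change aeval (AdjoinRoot.root g) g = 0
      rw [AdjoinRoot.aeval_eq, AdjoinRoot.mk_self]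
    · intro p hp
      refine or_iff_not_imp_left.2 fun h0 h1 ↦ ?_
      change aeval (AdjoinRoot.root g) p = 0 at h1
      rw [AdjoinRoot.aeval_eq] at h1
      exact AdjoinRoot.mk_ne_zero_of_degree_lt hg h0 hp h1
  have h := charpoly_leftMulMatrix pb
  rw [PowerBasis.leftMulMatrix, pb.minpolyGen_eq, hmin] at h
  exact h

theorem exists_companion_eq {R : Type*} [CommRing R] {g₁ g₂ : Polynomial R} {r : R} (d : ℕ)
    (h : C r ∣ g₁ - g₂) : ∃ N, companion g₁ d = companion g₂ d + r • N := by
  obtain ⟨k, hk⟩ := h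
  refine ⟨Matrix.of fun i j ↦ if (j : ℕ) + 1 = d then -k.coeff i else 0, ?_⟩
  ext i j
  have := congrArg (fun p ↦ coeff p i) hk
  simp only [coeff_sub, coeff_C_mul] at this
  simp only [companion, Matrix.add_apply, Matrix.of_apply, Matrix.smul_apply, smul_eq_mul]
  split_ifs
  · linear_combination -this
  · simp
  · simp

end Matrices

/-! ### Congruences for norms along the Lubin-Tate tower -/

section NormCongruence

variable {A F Ω Λ : Type*} [CommRing A] [IsDomain A] [IsDiscreteValuationRing A]
  [Finite (IsLocalRing.ResidueField A)] [Field F] [Algebra A F] [IsFractionRing A F]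
  [Field Ω] [Algebra F Ω] [Algebra A Ω] [IsScalarTower A F Ω] [IsSepClosure F Ω]
  [NormedField Λ] [CompleteSpace Λ] [IsUltrametricDist Λ] [Algebra Ω Λ]

local notation "ι" => algebraMap Ω Λ
local notation "q" => resCard A
local notation "ρ" => unifNorm A Ω Λ
local notation "𝓡" => unrRing A F Ω Λ
local notation "Φ" => frobR A F Ω Λ
local notation "ϖ" => unifR A F Ω Λ

theorem map_aeval_matrix {R S : Type*} [CommRing R] [CommRing S] {n : Type*} [Fintype n]
    [DecidableEq n] (i : R →+* S) (M : Matrix n n R) (f : Polynomial R) :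
    (aeval M f).map i = aeval (M.map i) (f.map i) := by
  induction f using Polynomial.induction_on' with
  | add p p' hp hp' =>
    rw [map_add, Matrix.map_add _ (map_add i), hp, hp', Polynomial.map_add, map_add]
  | monomial k a =>
    rw [aeval_monomial, map_monomial, aeval_monomial, Matrix.map_mul, Matrix.map_pow,
      Matrix.algebraMap_eq_diagonal, Matrix.algebraMap_eq_diagonal,
      Matrix.diagonal_map (map_zero i)]
    rfl

variable [LocalCompletion A F Ω Λ] {f g g₁ g₂ : Polynomial (unrRing A F Ω Λ)}

/-- Over `Λ` the iterate is a product of linear factors, so the determinant is the product of the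
determinants of `M - β`. Even size makes these equal to the values of the characteristic polynomial
without signs. -/
theorem IsLT.coe_det_aeval (hf : IsLT f) (m : ℕ) {d : ℕ} (hd : Even d)
    (M : Matrix (Fin d) (Fin d) 𝓡) :
    ((aeval M (ltIter f m)).det : Λ) = ∏ β ∈ torsΛ f m, aeval β M.charpoly := by
  have h1 : ((aeval M (ltIter f m)).det : Λ) =
      algebraMap 𝓡 Λ (aeval M (ltIter f m)).det := rfl
  rw [h1, RingHom.map_det, RingHom.mapMatrix_apply, map_aeval_matrix, hf.iter_eq_prod]
  let D : Polynomial Λ →* Λ := Matrix.detMonoidHom.comp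
    (aeval (M.map (algebraMap 𝓡 Λ))).toRingHom.toMonoidHom
  refine (map_prod D _ _).trans ?_
  refine Finset.prod_congr rfl fun β _ ↦ ?_
  have h2 : aeval β M.charpoly = ((M.map (algebraMap 𝓡 Λ)).charpoly).eval β := by
    rw [Matrix.charpoly_map, eval_map_algebraMap]
  have h3 : D (X - C β) = (M.map (algebraMap 𝓡 Λ) - Matrix.scalar _ β).det := by
    change Matrix.det (aeval (M.map (algebraMap 𝓡 Λ)) (X - C β)) = _
    rw [map_sub, aeval_X, aeval_C]
    rfl
  rw [h2, h3, Matrix.eval_charpoly, ← neg_sub, Matrix.det_neg, Fintype.card_fin, hd.neg_one_pow,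
    one_mul]

/-- The determinant of `f_m` at the companion matrix of `g`, which up to sign is the product of
the values of `g` at the roots of `f_m`. -/
def torsDet (f : Polynomial 𝓡) (m : ℕ) (g : Polynomial 𝓡) : 𝓡 :=
  (aeval (companion g g.natDegree) (ltIter f m)).det

theorem IsLT.coe_torsDet (hf : IsLT f) (m : ℕ) (hg : g.Monic) (hd : Even g.natDegree) :
    (torsDet f m g : Λ) = ∏ β ∈ torsΛ f m, aeval β g := by
  rw [torsDet, hf.coe_det_aeval m hd, charpoly_companion hg]

/-- The monic polynomial whose roots are the images under `f` of the roots of `g`. -/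
def pushPoly (f g : Polynomial 𝓡) : Polynomial 𝓡 :=
  (aeval (companion g g.natDegree) f).charpoly

theorem pushPoly_monic (f g : Polynomial 𝓡) : (pushPoly f g).Monic := Matrix.charpoly_monic _

theorem natDegree_pushPoly (f g : Polynomial 𝓡) : (pushPoly f g).natDegree = g.natDegree := by
  rw [pushPoly, Matrix.charpoly_natDegree_eq_dim, Fintype.card_fin]

/-- Since `f_{m+1}` is the `m`-th iterate of the twist of `f` composed with `f`, the innermost `f`
can be absorbed into the matrix. -/
theorem IsLT.torsDet_succ (hf : IsLT f) (m : ℕ) (hd : Even g.natDegree) :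
    torsDet f (m + 1) g = torsDet (f.map (Φ 1)) m (pushPoly f g) := by
  apply Subtype.ext
  rw [(hf.map_frobR 1).coe_torsDet m (pushPoly_monic f g) (by rwa [natDegree_pushPoly]), torsDet,
    ltIter_succ', aeval_comp, (hf.map_frobR 1).coe_det_aeval m hd]
  rfl

theorem torsDet_zero (f : Polynomial 𝓡) (hg : g.Monic) (hd : Even g.natDegree) :
    torsDet f 0 g = g.coeff 0 := by
  rw [torsDet, ltIter, aeval_X, Matrix.det_eq_sign_charpoly_coeff, charpoly_companion hg,
    Fintype.card_fin, hd.neg_one_pow, one_mul]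

theorem IsLT.pushPoly_congr (hf : IsLT f) {i : ℕ} (hi : 1 ≤ i)
    (hd : g₁.natDegree = g₂.natDegree) (h : C ϖ ^ i ∣ g₁ - g₂) :
    C ϖ ^ (i + 1) ∣ pushPoly f g₁ - pushPoly f g₂ := by
  obtain ⟨w, hw, -⟩ := hf.derivative_eq
  rw [← map_pow] at h
  obtain ⟨N, hN⟩ := exists_companion_eq g₂.natDegree h
  rw [pushPoly, pushPoly, hd, hN]
  exact charpoly_aeval_sub_dvd hw _ _ hi

/-- Each of the `m` pushes along a Lubin–Tate polynomial improves the congruence by one factor `ϖ`;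
at level 0 it is read off at the constant terms. -/
theorem IsLT.torsDet_congr (hf : IsLT f) {i : ℕ} (hi : 1 ≤ i) (hg₁ : g₁.Monic) (hg₂ : g₂.Monic)
    (hd : g₁.natDegree = g₂.natDegree) (hd' : Even g₁.natDegree) (h : C ϖ ^ i ∣ g₁ - g₂) (m : ℕ) :
    ϖ ^ (i + m) ∣ torsDet f m g₁ - torsDet f m g₂ := by
  induction m generalizing f g₁ g₂ i with
  | zero =>
    rw [torsDet_zero f hg₁ hd', torsDet_zero f hg₂ (hd ▸ hd'), ← coeff_sub]
    rw [← map_pow] at h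
    exact (C_dvd_iff_dvd_coeff _ _).1 h 0
  | succ m ih =>
    rw [hf.torsDet_succ m hd', hf.torsDet_succ m (hd ▸ hd')]
    have := ih (hf.map_frobR 1) (Nat.le_add_left 1 i) (pushPoly_monic f g₁) (pushPoly_monic f g₂)
      (by rw [natDegree_pushPoly, natDegree_pushPoly, hd]) (by rwa [natDegree_pushPoly])
      (hf.pushPoly_congr hi hd h)
    rwa [show i + (m + 1) = i + 1 + m by omega]

/-- Modulo `ϖ` the polynomial `f` becomes `X ^ q`, so the push is the characteristic polynomial of
the `q`-th power of the companion matrix. That is the Frobenius twist of `g`, and `Φ 1` induces the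
same twist. -/
theorem IsLT.pushPoly_sub_dvd (hf : IsLT f) (hg : g.Monic) :
    C ϖ ∣ pushPoly f g - g.map (Φ 1) := by
  have hl := isFrobeniusLift A F Ω Λ
  obtain ⟨p, r, hp, hr, hq, hc⟩ := hl.exists_char
  have : Fact p.Prime := ⟨hp⟩
  let k := Ideal.Quotient.mk (Ideal.span {ϖ})
  have hk : ∀ x y : Polynomial 𝓡, C ϖ ∣ x - y ↔ x.map k = y.map k := by
    intro x y
    rw [C_dvd_iff_dvd_coeff, Polynomial.ext_iff]
    refine forall_congr' fun i ↦ ?_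
    rw [coeff_map, coeff_map, Ideal.Quotient.eq, Ideal.mem_span_singleton, coeff_sub]
  rw [hk, pushPoly, ← Matrix.charpoly_map, map_aeval_matrix, (hk _ _).1 hf.dvd, Polynomial.map_pow,
    map_X, map_pow, aeval_X, hq, charpoly_pow_eq, Matrix.charpoly_map, charpoly_companion hg,
    Polynomial.map_map, Polynomial.map_map]
  congr 1
  ext x
  rw [RingHom.comp_apply, RingHom.comp_apply, iterateFrobenius_def, ← map_pow, ← hq, eq_comm,
    Ideal.Quotient.eq, Ideal.mem_span_singleton]
  exact hl.dvd_sub x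

theorem frobR_torsDet (f : Polynomial 𝓡) (m : ℕ) (hg : g.Monic) (j : ℤ) :
    Φ j (torsDet f m g) = torsDet (f.map (Φ j)) m (g.map (Φ j)) := by
  have h : (companion g g.natDegree).map (Φ j) = companion (g.map (Φ j)) g.natDegree := by
    ext a b : 2
    simp only [companion, Matrix.map_apply, Matrix.of_apply, coeff_map]
    split_ifs <;> simp
  rw [torsDet, RingHom.map_det, RingHom.mapMatrix_apply, map_aeval_matrix, ltIter_map, h, torsDet,
    hg.natDegree_map]

/-- The first push agrees with the Frobenius twist of `g` modulo `ϖ`, and the remaining `m` pushes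
contribute `m` further factors. This is the congruence from which the norm estimate follows. -/
theorem IsLT.torsDet_succ_sub_dvd (hf : IsLT f) (hg : g.Monic) (hd : Even g.natDegree) (m : ℕ) :
    ϖ ^ (m + 1) ∣ torsDet f (m + 1) g - Φ 1 (torsDet f m g) := by
  rw [hf.torsDet_succ m hd, frobR_torsDet f m hg, add_comm m 1]
  refine (hf.map_frobR 1).torsDet_congr le_rfl (pushPoly_monic f g) (hg.map _) ?_ ?_ ?_ m
  · rw [natDegree_pushPoly, hg.natDegree_map]
  · rwa [natDegree_pushPoly]
  · rw [pow_one]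
    exact hf.pushPoly_sub_dvd hg

theorem IsLT.isUnit_torsDet (hf : IsLT f) (hg : g.Monic) (hd : Even g.natDegree)
    (h0 : IsUnit (g.coeff 0)) (m : ℕ) : IsUnit (torsDet f m g) := by
  induction m with
  | zero => rwa [torsDet_zero f hg hd]
  | succ m ih =>
    obtain ⟨c, hc⟩ := (dvd_pow_self ϖ (Nat.succ_ne_zero m)).trans (hf.torsDet_succ_sub_dvd hg hd m)
    have h1 : ‖(ϖ : Λ) * (c : Λ)‖ < 1 := by
      rw [norm_mul, norm_unifR]
      exact mul_lt_one_of_nonneg_of_lt_one_left (unifNorm_pos F).le (unifNorm_lt_one F)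
        (norm_unrRing_le c)
    have h2 : ‖(Φ 1 (torsDet f m g) : Λ)‖ = 1 := by
      rw [norm_frobR, unrRing_isUnit_iff.1 ih]
    rw [unrRing_isUnit_iff, eq_add_of_sub_eq hc, Subring.coe_add, Subring.coe_mul]
    rw [IsUltrametricDist.norm_add_eq_max_of_norm_ne_norm (by rw [h2]; exact h1.ne), h2]
    exact max_eq_right h1.le

/-- The factors are merely permuted cyclically. -/
theorem prod_frobR_eq {n : ℕ} (hn : 1 ≤ n) {P : 𝓡} (hP : Φ n P = P) :
    ∏ i ∈ Finset.range n, Φ i (Φ 1 P) = ∏ i ∈ Finset.range n, Φ i P := by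
  obtain ⟨k, rfl⟩ := Nat.exists_eq_add_of_le' hn
  rw [Finset.prod_range_succ, Finset.prod_range_succ' _ k, ← frobR_add]
  congr 1
  · refine Finset.prod_congr rfl fun i _ ↦ ?_
    rw [← frobR_add]
    push_cast
    rfl
  · push_cast at hP
    rw [hP, Nat.cast_zero, frobR_zero]

open Classical in
/-- The primitive roots of level `m + 1`. -/
def primΛ (f : Polynomial 𝓡) (m : ℕ) : Finset Λ := torsΛ f (m + 1) \ torsΛ f m

theorem mem_primΛ {m : ℕ} {α : Λ} : α ∈ primΛ f m ↔ α ∈ torsΛ f (m + 1) ∧ α ∉ torsΛ f m := by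
  classical
  rw [primΛ, Finset.mem_sdiff]

theorem IsLT.prod_primΛ_mul (hf : IsLT f) (m : ℕ) (h : Λ → Λ) :
    (∏ β ∈ primΛ f m, h β) * ∏ β ∈ torsΛ f m, h β = ∏ β ∈ torsΛ f (m + 1), h β := by
  classical
  exact Finset.prod_sdiff fun _ ↦ hf.tors_succ

theorem IsLT.card_primΛ (hf : IsLT f) (m : ℕ) : (primΛ f m).card = q ^ m * (q - 1) := by
  classical
  rw [primΛ, Finset.card_sdiff_of_subset fun _ ↦ hf.tors_succ, hf.card_tors, hf.card_tors, pow_succ,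
    Nat.mul_sub, mul_one]

/-- The norm to `F` of the value of `g` at a primitive root of level `m + 1` is congruent to `1`
modulo the `(m + 1)`-st power of the maximal ideal if that value is a unit. -/
theorem IsLT.norm_prod_frobR_sub_one_le (hf : IsLT f) (hg : g.Monic) (hd : Even g.natDegree)
    (h0 : IsUnit (g.coeff 0)) {n : ℕ} (hn : 1 ≤ n) (hfn : f.map (Φ n) = f)
    (hgn : g.map (Φ n) = g) {m : ℕ} {w : 𝓡}
    (hw : (w : Λ) = ∏ β ∈ primΛ f m, aeval β g) :
    ‖((∏ i ∈ Finset.range n, Φ i w : 𝓡) : Λ) - 1‖ ≤ ρ ^ (m + 1) := by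
  have hwP : w * torsDet f m g = torsDet f (m + 1) g := by
    apply Subtype.ext
    rw [Subring.coe_mul, hw, hf.coe_torsDet m hg hd, hf.coe_torsDet (m + 1) hg hd]
    exact hf.prod_primΛ_mul m fun β ↦ aeval β g
  have hP : Φ n (torsDet f m g) = torsDet f m g := by rw [frobR_torsDet f m hg, hfn, hgn]
  -- The second product may be replaced by that of the Frobenius twists. Then the congruence between
  -- consecutive levels applies factor by factor.
  have hmain : ϖ ^ (m + 1) ∣ (∏ i ∈ Finset.range n, Φ i w) * (∏ i ∈ Finset.range n,
      Φ i (torsDet f m g)) - ∏ i ∈ Finset.range n, Φ i (torsDet f m g) := by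
    rw [← Finset.prod_mul_distrib, ← prod_frobR_eq hn hP, ← Ideal.mem_span_singleton,
      ← Ideal.Quotient.eq, map_prod, map_prod]
    refine Finset.prod_congr rfl fun i _ ↦ ?_
    rw [← map_mul, hwP, Ideal.Quotient.eq, Ideal.mem_span_singleton, ← map_sub]
    obtain ⟨c, hc⟩ := hf.torsDet_succ_sub_dvd hg hd m
    rw [hc, map_mul, map_pow, frobR_unifR]
    exact dvd_mul_right _ _
  have hu : IsUnit (∏ i ∈ Finset.range n, Φ i (torsDet f m g)) := by
    rw [IsUnit.prod_iff]
    exact fun i _ ↦ (hf.isUnit_torsDet hg hd h0 m).map _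
  rw [← sub_one_mul, IsUnit.dvd_mul_right hu, unifR_pow_dvd_iff] at hmain
  exact hmain

end NormCongruence

/-! ### Norms in finite extensions -/

section Extensions

variable {A F Ω Λ : Type*} [CommRing A] [IsDomain A] [IsDiscreteValuationRing A]
  [Finite (IsLocalRing.ResidueField A)] [Field F] [Algebra A F] [IsFractionRing A F]
  [Field Ω] [Algebra F Ω] [Algebra A Ω] [IsScalarTower A F Ω] [IsSepClosure F Ω]
  [NormedField Λ] [CompleteSpace Λ] [IsUltrametricDist Λ] [Algebra Ω Λ]

local notation "ι" => algebraMap Ω Λ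
local notation "q" => resCard A
local notation "ρ" => unifNorm A Ω Λ
local notation "𝓡" => unrRing A F Ω Λ
local notation "Φ" => frobR A F Ω Λ
local notation "ϖ" => unifR A F Ω Λ

section Norm

variable {E T : Type*} [Field E] [Field T] [Algebra F E] [Algebra E T] [Algebra E Ω]
  [Algebra T Ω] [IsScalarTower F E Ω] [IsScalarTower E T Ω]

variable (A F) in
theorem norm_algebraNorm [LocalCompletion A F Ω Λ] [FiniteDimensional E T] (x : T) :
    ‖ι (algebraMap E Ω (Algebra.norm E x))‖ =
      ‖ι (algebraMap T Ω x)‖ ^ Module.finrank E T := by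
  have : IsGalois E Ω := IsGalois.tower_top_of_isGalois F E Ω
  have hmin : minpoly E x = minpoly E (algebraMap T Ω x) :=
    (minpoly.algebraMap_eq (FaithfulSMul.algebraMap_injective T Ω) x).symm
  have hs : ((minpoly E x).map (algebraMap E Ω)).Splits := by
    rw [hmin]
    exact Normal.splits inferInstance _
  have hr : ∀ b ∈ ((minpoly E x).aroots Ω).map fun b ↦ ‖ι b‖, b = ‖ι (algebraMap T Ω x)‖ := by
    intro b hb
    obtain ⟨b, hb', rfl⟩ := Multiset.mem_map.1 hb
    rw [hmin, mem_aroots] at hb'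
    obtain ⟨σ, hσ⟩ := minpoly.exists_algEquiv_of_root
      (Algebra.IsIntegral.isIntegral (R := E) (algebraMap T Ω x)).isAlgebraic hb'.2
    rw [← hσ]
    exact (norm_galois (A := A) (Λ := Λ) (σ.restrictScalars F) b).symm
  have hp : ‖ι ((minpoly E x).aroots Ω).prod‖ = (((minpoly E x).aroots Ω).map fun b ↦ ‖ι b‖).prod :=
    map_multiset_prod ((normHom : Λ →*₀ ℝ).toMonoidHom.comp (algebraMap Ω Λ).toMonoidHom) _
  have hx : IsIntegral E x := Algebra.IsIntegral.isIntegral x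
  rw [Algebra.norm_eq_prod_roots Ω hs, map_pow, norm_pow, hp, Multiset.eq_replicate_card.2 hr,
    Multiset.prod_replicate, Multiset.card_map, ← hs.natDegree_eq_card_roots, natDegree_map,
    ← IntermediateField.adjoin.finrank hx, ← pow_mul, Module.finrank_mul_finrank]

/-- A uniformizer of a discretely valued extension. -/
structure IsUniformizer (Ω Λ : Type*) {T : Type*} [Field Ω] [NormedField Λ] [Algebra Ω Λ] [Field T]
    [Algebra T Ω] (t : T) : Prop where
  ne_zero : t ≠ 0
  norm_lt_one : ‖algebraMap Ω Λ (algebraMap T Ω t)‖ < 1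
  exists_zpow : ∀ x : T, x ≠ 0 →
    ∃ k : ℤ, ‖algebraMap Ω Λ (algebraMap T Ω x)‖ = ‖algebraMap Ω Λ (algebraMap T Ω t)‖ ^ k

theorem IsUniformizer.norm_pos {t : T} (ht : IsUniformizer Ω Λ t) :
    0 < ‖ι (algebraMap T Ω t)‖ := by
  rw [norm_pos_iff]
  exact (_root_.map_ne_zero _).2 ((_root_.map_ne_zero _).2 ht.ne_zero)

variable (A F E) in
-- Raised to the degree, norms of elements of `E` are powers of `ρ`. An element realising the least
-- positive exponent is a uniformizer, by division with remainder on exponents.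
theorem exists_isUniformizer [LocalCompletion A F Ω Λ] [FiniteDimensional F E] :
    ∃ t : E, IsUniformizer Ω Λ t := by
  have hρ0 := unifNorm_pos F (A := A) (Ω := Ω) (Λ := Λ)
  have hρ1 := unifNorm_lt_one F (A := A) (Ω := Ω) (Λ := Λ)
  set N := Module.finrank F E
  have hN : 0 < N := Module.finrank_pos
  have hval : ∀ x : E, x ≠ 0 → ∃ k : ℤ, ‖ι (algebraMap E Ω x)‖ ^ N = ρ ^ k := by
    intro x hx
    rw [← norm_algebraNorm A F (E := F) (T := E) x]
    exact exists_norm_eq_zpow A (Algebra.norm_ne_zero_iff.2 hx)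
  have hex : ∃ k : ℕ, 0 < k ∧ ∃ x : E, x ≠ 0 ∧ ‖ι (algebraMap E Ω x)‖ ^ N = ρ ^ k := by
    refine ⟨N, hN, algebraMap F E (algebraMap A F (unif A)), ?_, ?_⟩
    · have := emb_unif_ne_zero (A := A) F (Ω := Ω) (Λ := Λ)
      rw [emb_eq (F := F)] at this
      intro h
      rw [IsScalarTower.algebraMap_apply F E Ω, h] at this
      simp at this
    · rw [← IsScalarTower.algebraMap_apply F E Ω, ← emb_eq]
      rfl
  classical
  obtain ⟨hk0, t, ht0, ht⟩ := Nat.find_spec hex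
  have hmin := fun k ↦ Nat.find_min hex (m := k)
  generalize Nat.find hex = k₀ at hk0 ht hmin
  refine ⟨t, ht0, ?_, fun x hx ↦ ?_⟩
  · have h1 : ‖ι (algebraMap E Ω t)‖ ^ N < 1 := by
      rw [ht]
      exact pow_lt_one₀ hρ0.le hρ1 hk0.ne'
    exact (pow_lt_one_iff_of_nonneg (norm_nonneg _) hN.ne').1 h1
  · obtain ⟨k, hk⟩ := hval x hx
    refine ⟨k / k₀, ?_⟩
    have h2 : ‖ι (algebraMap E Ω (x * t ^ (-(k / k₀) : ℤ)))‖ ^ N = ρ ^ (k % k₀).toNat := by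
      have h3 : ((k % k₀).toNat : ℤ) = k + k₀ * (-(k / k₀)) := by
        rw [Int.toNat_of_nonneg (Int.emod_nonneg _ (by omega))]
        have := Int.emod_add_mul_ediv k k₀
        linarith
      rw [map_mul, map_mul, norm_mul, mul_pow, hk, map_zpow₀, map_zpow₀, norm_zpow, ← zpow_natCast,
        ← zpow_mul, mul_comm (-(k / k₀)), zpow_mul, zpow_natCast, ht, ← zpow_natCast, ← zpow_mul,
        ← zpow_add₀ hρ0.ne', ← h3, zpow_natCast]
    have h4 : (k % k₀).toNat = 0 := by
      by_contra h
      refine hmin _ ?_ ⟨Nat.pos_of_ne_zero h, _, ?_, h2⟩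
      · have := Int.emod_lt_of_pos k (show (0 : ℤ) < k₀ by omega)
        omega
      · exact mul_ne_zero hx (zpow_ne_zero _ ht0)
    rw [h4, pow_zero, pow_eq_one_iff_of_nonneg (norm_nonneg _) hN.ne', map_mul, map_mul, norm_mul,
      zpow_neg, map_inv₀, map_inv₀, norm_inv, map_zpow₀, map_zpow₀, norm_zpow] at h2
    exact (mul_inv_eq_one₀ (zpow_pos (norm_pos_iff.2 ((_root_.map_ne_zero _).2
      ((_root_.map_ne_zero _).2 ht0))) _).ne').1 h2

/-- In a totally ramified extension, the norm of a uniformizer is a uniformizer. -/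
theorem norm_algebraNorm_of_totallyRamified [LocalCompletion A F Ω Λ] [FiniteDimensional F E]
    [FiniteDimensional E T] {e : E} (he : IsUniformizer Ω Λ e) {t : T}
    (ht : IsUniformizer Ω Λ t) (hres : ∀ x : T, ‖ι (algebraMap T Ω x)‖ = 1 →
      ∃ c : E, ‖ι (algebraMap T Ω x) - ι (algebraMap E Ω c)‖ < 1) :
    ‖ι (algebraMap E Ω (Algebra.norm E t))‖ = ‖ι (algebraMap E Ω e)‖ := by
  have ht0 := ht.norm_pos
  have hET : ∀ c : E, algebraMap T Ω (algebraMap E T c) = algebraMap E Ω c := fun c ↦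
    (IsScalarTower.algebraMap_apply E T Ω c).symm
  have hanti : ∀ {i j : ℤ}, ‖ι (algebraMap T Ω t)‖ ^ i = ‖ι (algebraMap T Ω t)‖ ^ j ↔ i = j :=
    (zpow_right_injective₀ ht0 ht.norm_lt_one.ne).eq_iff
  obtain ⟨k, hk⟩ := ht.exists_zpow (algebraMap E T e) ((_root_.map_ne_zero _).2 he.ne_zero)
  rw [hET] at hk
  have hk0 : 0 < k := by
    by_contra! h
    have := one_le_zpow_of_nonpos₀ ht0 ht.norm_lt_one.le h
    rw [← hk] at this
    exact this.not_gt he.norm_lt_one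
  obtain ⟨d, rfl⟩ := Int.eq_ofNat_of_zero_le hk0.le
  -- Here `d` is the ramification index. Any `x` is approximated by a product of a power of `e`, a
  -- power of `t` below `d` and an element of `E` of the same residue class. Iteration shows that
  -- `V` is dense, and finite-dimensionality makes it closed, so `V` is all of `T`.
  let V : Submodule E T := Submodule.span E (Set.range fun i : Fin d ↦ t ^ (i : ℕ))
  have happrox : ∀ x : T, ∃ v ∈ V, ‖ι (algebraMap T Ω (x - v))‖ ≤
      ‖ι (algebraMap T Ω t)‖ * ‖ι (algebraMap T Ω x)‖ := by
    intro x
    rcases eq_or_ne x 0 with rfl | hx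
    · exact ⟨0, zero_mem _, by simp⟩
    obtain ⟨l, hl⟩ := ht.exists_zpow x hx
    obtain ⟨b, hb⟩ := Int.eq_ofNat_of_zero_le (Int.emod_nonneg l hk0.ne')
    have hbd : b < d := by
      have := Int.emod_lt_of_pos l hk0
      omega
    have hld : (d : ℤ) * (l / d) + b = l := by
      rw [← hb]
      exact Int.mul_ediv_add_emod l d
    let y : T := algebraMap E T (e ^ (l / d)) * t ^ b
    have hy0 : y ≠ 0 := mul_ne_zero ((_root_.map_ne_zero _).2 (zpow_ne_zero _ he.ne_zero))
      (pow_ne_zero _ ht.ne_zero)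
    have hy : ‖ι (algebraMap T Ω y)‖ = ‖ι (algebraMap T Ω x)‖ := by
      simp only [y]
      rw [map_mul, map_mul, norm_mul, hET, map_zpow₀, map_zpow₀, norm_zpow, hk, ← zpow_mul,
        map_pow, map_pow, norm_pow, ← zpow_natCast _ b, ← zpow_add₀ ht0.ne', hl]
      exact congrArg _ hld
    have hxy : ‖ι (algebraMap T Ω (x / y))‖ = 1 := by
      rw [map_div₀, map_div₀, norm_div, hy, div_self]
      rw [hl]
      exact (zpow_pos ht0 _).ne'
    obtain ⟨c, hc⟩ := hres _ hxy
    refine ⟨algebraMap E T c * y, ?_, ?_⟩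
    · simp only [y]
      rw [← mul_assoc, ← map_mul, ← Algebra.smul_def]
      exact V.smul_mem _ (Submodule.subset_span ⟨⟨b, hbd⟩, rfl⟩)
    · have h1 : x - algebraMap E T c * y = (x / y - algebraMap E T c) * y := by
        rw [sub_mul, div_mul_cancel₀ _ hy0]
      rw [h1, map_mul, map_mul, norm_mul, hy]
      refine mul_le_mul_of_nonneg_right ?_ (norm_nonneg _)
      rcases eq_or_ne (x / y - algebraMap E T c) 0 with h0 | h0
      · rw [h0, map_zero, map_zero, norm_zero]
        exact ht0.le
      · obtain ⟨r, hr⟩ := ht.exists_zpow _ h0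
        rw [← hET, ← map_sub, ← map_sub, hr] at hc
        have hr1 : 1 ≤ r := by
          by_contra! h
          exact (one_le_zpow_of_nonpos₀ ht0 ht.norm_lt_one.le (by omega)).not_gt hc
        rw [hr]
        calc _ ≤ ‖ι (algebraMap T Ω t)‖ ^ (1 : ℤ) :=
              zpow_le_zpow_right_of_le_one₀ ht0 ht.norm_lt_one.le hr1
          _ = _ := zpow_one _
  let W : Submodule E Ω := V.map (IsScalarTower.toAlgHom E T Ω).toLinearMap
  have hW : FiniteDimensional F W := Module.Finite.trans E W
  have hclosed : IsClosed (ι '' (W.restrictScalars F : Set Ω)) :=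
    LocalCompletion.isClosed_image A (W.restrictScalars F) hW
  have hiter : ∀ (x : T) (N : ℕ), ∃ v ∈ V, ‖ι (algebraMap T Ω (x - v))‖ ≤
      ‖ι (algebraMap T Ω t)‖ ^ N * ‖ι (algebraMap T Ω x)‖ := by
    intro x N
    induction N with
    | zero => exact ⟨0, zero_mem _, by simp⟩
    | succ N ih =>
      obtain ⟨v, hv, h⟩ := ih
      obtain ⟨v', hv', h'⟩ := happrox (x - v)
      refine ⟨v + v', add_mem hv hv', ?_⟩
      rw [← sub_sub, pow_succ', mul_assoc]
      exact h'.trans (mul_le_mul_of_nonneg_left h ht0.le)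
  have htop : V = ⊤ := by
    rw [eq_top_iff]
    intro x _
    have hx : ι (algebraMap T Ω x) ∈ ι '' (W.restrictScalars F : Set Ω) := by
      rw [← hclosed.closure_eq, Metric.mem_closure_iff]
      intro ε hε
      have hlim : Filter.Tendsto (fun N : ℕ ↦ ‖ι (algebraMap T Ω t)‖ ^ N *
          ‖ι (algebraMap T Ω x)‖) Filter.atTop (nhds 0) := by
        simpa using (tendsto_pow_atTop_nhds_zero_of_lt_one ht0.le ht.norm_lt_one).mul_const
          ‖ι (algebraMap T Ω x)‖
      obtain ⟨N, hN⟩ := (hlim.eventually (gt_mem_nhds hε)).exists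
      obtain ⟨v, hv, h⟩ := hiter x N
      refine ⟨_, ⟨algebraMap T Ω v, ⟨v, hv, rfl⟩, rfl⟩, ?_⟩
      rw [dist_eq_norm, ← map_sub, ← map_sub]
      exact h.trans_lt hN
    obtain ⟨_, ⟨v, hv, rfl⟩, h⟩ := hx
    have h1 : v = x := (algebraMap T Ω).injective ((algebraMap Ω Λ).injective h)
    exact h1 ▸ hv
  have hle : Module.finrank E T ≤ d := by
    rw [← finrank_top E T, ← htop]
    exact (finrank_range_le_card _).trans (Fintype.card_fin d).le
  obtain ⟨a, ha⟩ := he.exists_zpow (Algebra.norm E t) (Algebra.norm_ne_zero_iff.2 ht.ne_zero)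
  have hpos : 0 < Module.finrank E T := Module.finrank_pos
  -- The norm of `t` has absolute value `‖t‖` to the degree, and also `‖e‖ ^ a = ‖t‖ ^ (d a)`. As
  -- the degree is positive and at most `d`, the exponent `a` is 1.
  have h2 : (Module.finrank E T : ℤ) = d * a := by
    rw [← hanti, zpow_natCast, ← norm_algebraNorm A F, ha, hk, zpow_mul]
  have ha1 : a = 1 := by
    have h3 : 0 < a := by
      by_contra! h
      nlinarith
    have h4 : (d : ℤ) * a ≤ d * 1 := by omega
    have h5 := le_of_mul_le_mul_left h4 hk0
    omega
  rw [ha, ha1, zpow_one]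

end Norm

end Extensions

/-! ### Norms in Lubin-Tate extensions -/

section LubinTateExtension

variable {A F Ω Λ : Type*} [CommRing A] [IsDomain A] [IsDiscreteValuationRing A]
  [Finite (IsLocalRing.ResidueField A)] [Field F] [Algebra A F] [IsFractionRing A F]
  [Field Ω] [Algebra F Ω] [Algebra A Ω] [IsScalarTower A F Ω] [IsSepClosure F Ω]
  [NormedField Λ] [CompleteSpace Λ] [IsUltrametricDist Λ] [Algebra Ω Λ]

local notation "ι" => algebraMap Ω Λ
local notation "q" => resCard A
local notation "ρ" => unifNorm A Ω Λ
local notation "𝓡" => unrRing A F Ω Λ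
local notation "Φ" => frobR A F Ω Λ
local notation "ϖ" => unifR A F Ω Λ

open scoped IntermediateField

variable [LocalCompletion A F Ω Λ] {f g : Polynomial (unrRing A F Ω Λ)} {n m : ℕ} {a : Ω}

variable (A F Λ n) in
/-- The embedding of the unramified extension of degree `n` into the completion. -/
def finEmb : unr A F Ω n →+* Λ := (algebraMap Ω Λ).comp (algebraMap (unr A F Ω n) Ω)

/-- A polynomial fixed by the `n`-th power of Frobenius has coefficients in the unramified
extension of degree `n`. -/
theorem exists_unr_poly (hn : 1 ≤ n) {p : Polynomial 𝓡} (hp : p.map (Φ n) = p) :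
    ∃ P : Polynomial (unr A F Ω n), P.map (finEmb A F Λ n) = p.map (algebraMap 𝓡 Λ) := by
  rw [← mem_lifts, lifts_iff_coeff_lifts]
  intro k
  have h1 : Φ n (p.coeff k) = p.coeff k := by rw [← coeff_map, hp]
  obtain ⟨y, hy, h⟩ := exists_unr_of_frobR_eq hn h1
  rw [coeff_map]
  exact ⟨⟨y, hy⟩, h⟩

theorem galExt_aeval_of_fixed (hn : 1 ≤ n) {p : Polynomial 𝓡} (hp : p.map (Φ n) = p)
    {s : Ω ≃ₐ[F] Ω} (hs : ∀ x ∈ unr A F Ω n, s x = x) (α : Λ) :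
    galExt A Λ s (aeval α p) = aeval (galExt A Λ s α) p := by
  obtain ⟨P, hP⟩ := exists_unr_poly hn hp
  rw [← eval_map_algebraMap, ← eval_map_algebraMap, ← hP, eval_map, eval_map, hom_eval₂]
  congr 1
  ext x
  exact (galExt_algebraMap s _).trans (congrArg ι (hs x x.2))

theorem IsLT.galExt_mem_tors_of_fixed (hf : IsLT f) (hn : 1 ≤ n) (hfn : f.map (Φ n) = f)
    {s : Ω ≃ₐ[F] Ω} (hs : ∀ x ∈ unr A F Ω n, s x = x) {k : ℕ} {α : Λ} :
    galExt A Λ s α ∈ torsΛ f k ↔ α ∈ torsΛ f k := by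
  rw [hf.mem_tors, hf.mem_tors, ← galExt_aeval_of_fixed hn (by rw [ltIter_map, hfn]) hs,
    map_eq_zero]

/-- Conjugates of `a` over `F_n` are again primitive because `f` has coefficients there. The degree
of `a` over the maximal unramified extension is at least the number of primitive roots, so all of
them occur. -/
theorem IsLT.map_roots_minpoly (hf : IsLT f) (hn : 1 ≤ n) (hfn : f.map (Φ n) = f)
    (ha : ι a ∈ primΛ f m) :
    ((minpoly (unr A F Ω n) a).aroots Ω).map ι = (primΛ f m).val ∧
      (minpoly (unr A F Ω n) a).natDegree = q ^ m * (q - 1) := by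
  classical
  have hinteg : IsIntegral (unr A F Ω n) a := Algebra.IsIntegral.isIntegral a
  have hsep : IsSeparable (unr A F Ω n) a := Algebra.IsSeparable.isSeparable _ a
  set μ := minpoly (unr A F Ω n) a
  have hspl : (μ.map (algebraMap (unr A F Ω n) Ω)).Splits := Normal.splits inferInstance a
  have hcard : (μ.aroots Ω).card = μ.natDegree := by
    rw [aroots, ← hspl.natDegree_eq_card_roots, natDegree_map]
  have hnd : ((μ.aroots Ω).map ι).Nodup :=
    (nodup_roots (Separable.map hsep)).map (algebraMap Ω Λ).injective
  have hsub : ((μ.aroots Ω).map ι).toFinset ⊆ primΛ f m := by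
    intro b hb
    obtain ⟨b, hb', rfl⟩ := Multiset.mem_map.1 (Multiset.mem_toFinset.1 hb)
    obtain ⟨σ, hσ⟩ := minpoly.exists_algEquiv_of_root' hinteg.isAlgebraic (mem_aroots.1 hb').2
    have hfix : ∀ x ∈ unr A F Ω n, σ.restrictScalars F x = x := fun x hx ↦ σ.commutes ⟨x, hx⟩
    have hg : galExt A Λ (σ.restrictScalars F) (ι a) = ι b := by
      rw [galExt_algebraMap]
      exact congrArg ι hσ
    rw [mem_primΛ] at ha ⊢
    rw [← hg, hf.galExt_mem_tors_of_fixed hn hfn hfix, hf.galExt_mem_tors_of_fixed hn hfn hfix]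
    exact ha
  have hdeg : q ^ m * (q - 1) ≤ μ.natDegree := by
    by_contra! hlt
    rw [mem_primΛ] at ha
    let j := IntermediateField.inclusion (unr_le_maxUnr (A := A) (F := F) (Ω := Ω) hn)
    refine hf.aeval_ne_zero ha.1 ha.2 (P := μ.map (j : unr A F Ω n →+* maxUnr A F Ω)) ?_ ?_ ?_
    · exact Polynomial.map_ne_zero (minpoly.ne_zero hinteg)
    · rwa [natDegree_map]
    · rw [aeval_def, eval₂_map]
      exact minpoly.aeval _ a
  have hcard' : ((μ.aroots Ω).map ι).toFinset.card = μ.natDegree := by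
    rw [Multiset.toFinset_card_of_nodup hnd, Multiset.card_map, hcard]
  have heq : ((μ.aroots Ω).map ι).toFinset = primΛ f m :=
    Finset.eq_of_subset_of_card_le hsub (by rw [hcard', hf.card_primΛ]; exact hdeg)
  refine ⟨?_, ?_⟩
  · rw [← heq, Multiset.toFinset_val, hnd.dedup]
  · rw [← hcard', heq, hf.card_primΛ]

theorem IsLT.finrank_adjoin (hf : IsLT f) (hn : 1 ≤ n) (hfn : f.map (Φ n) = f)
    (ha : ι a ∈ primΛ f m) :
    Module.finrank (unr A F Ω n) (unr A F Ω n)⟮a⟯ = q ^ m * (q - 1) := by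
  rw [IntermediateField.adjoin.finrank (Algebra.IsIntegral.isIntegral a),
    (hf.map_roots_minpoly hn hfn ha).2]

/-- The norm is the product over all embeddings into an algebraic closure of `Ω`. These correspond
to the roots of the minimal polynomial, which already lie in `Ω`. -/
theorem norm_aeval_gen {L Ω : Type*} [Field L] [Field Ω] [Algebra L Ω] [IsGalois L Ω] (a : Ω)
    (G : Polynomial L) :
    algebraMap L Ω (Algebra.norm L (aeval (IntermediateField.AdjoinSimple.gen L a) G)) =
      (((minpoly L a).aroots Ω).map fun b ↦ aeval b G).prod := by
  classical
  have hinteg : IsIntegral L a := Algebra.IsIntegral.isIntegral a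
  have : FiniteDimensional L L⟮a⟯ := IntermediateField.adjoin.finiteDimensional hinteg
  have : Algebra.IsSeparable L L⟮a⟯ := Algebra.isSeparable_tower_bot_of_isSeparable L L⟮a⟯ Ω
  apply (algebraMap Ω (AlgebraicClosure Ω)).injective
  have hspl : ((minpoly L a).map (algebraMap L Ω)).Splits := Normal.splits inferInstance a
  have hroots : (minpoly L a).aroots (AlgebraicClosure Ω) =
      ((minpoly L a).aroots Ω).map (algebraMap Ω (AlgebraicClosure Ω)) := by
    rw [aroots, aroots, ← hspl.roots_map (algebraMap Ω (AlgebraicClosure Ω)), Polynomial.map_map,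
      ← IsScalarTower.algebraMap_eq]
  have hnd : ((minpoly L a).aroots (AlgebraicClosure Ω)).Nodup :=
    nodup_roots (Separable.map (Algebra.IsSeparable.isSeparable L a))
  rw [← IsScalarTower.algebraMap_apply, Algebra.norm_eq_prod_embeddings L (AlgebraicClosure Ω),
    map_multiset_prod, Multiset.map_map]
  have h1 : (((minpoly L a).aroots Ω).map
      (algebraMap Ω (AlgebraicClosure Ω) ∘ fun b ↦ aeval b G)).prod =
      (((minpoly L a).aroots (AlgebraicClosure Ω)).map fun b ↦ aeval b G).prod := by
    rw [hroots, Multiset.map_map]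
    congr 1
    refine Multiset.map_congr rfl fun b _ ↦ ?_
    exact (aeval_algebraMap_apply (AlgebraicClosure Ω) b G).symm
  rw [h1]
  have h2 : (((minpoly L a).aroots (AlgebraicClosure Ω)).map fun b ↦ aeval b G).prod =
      ∏ b ∈ ((minpoly L a).aroots (AlgebraicClosure Ω)).toFinset, aeval b G := by
    rw [Finset.prod_eq_multiset_prod, Multiset.toFinset_val, hnd.dedup]
  rw [h2, ← Finset.prod_coe_sort (Multiset.toFinset _)]
  let e : (L⟮a⟯ →ₐ[L] AlgebraicClosure Ω) ≃ ((minpoly L a).aroots (AlgebraicClosure Ω)).toFinset :=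
    (IntermediateField.algHomAdjoinIntegralEquiv L hinteg).trans
      (Equiv.subtypeEquivRight fun b ↦ Multiset.mem_toFinset.symm)
  refine Fintype.prod_equiv e
    (fun σ ↦ σ (aeval (IntermediateField.AdjoinSimple.gen L a) G))
    (fun b ↦ aeval (b : AlgebraicClosure Ω) G) fun σ ↦ ?_
  rw [← aeval_algHom_apply]
  rfl

theorem IsLT.norm_aeval_gen_eq (hf : IsLT f) (hn : 1 ≤ n) (hfn : f.map (Φ n) = f)
    (ha : ι a ∈ primΛ f m) {G : Polynomial (unr A F Ω n)}
    (hG : G.map (finEmb A F Λ n) = g.map (algebraMap 𝓡 Λ)) :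
    ι (Algebra.norm (unr A F Ω n)
      (aeval (IntermediateField.AdjoinSimple.gen (unr A F Ω n) a) G) : unr A F Ω n) =
      ∏ β ∈ primΛ f m, aeval β g := by
  have h := norm_aeval_gen a G
  rw [Finset.prod_eq_multiset_prod, ← (hf.map_roots_minpoly hn hfn ha).1, Multiset.map_map]
  refine (congrArg ι h).trans ?_
  rw [map_multiset_prod, Multiset.map_map]
  congr 1
  refine Multiset.map_congr rfl fun b _ ↦ ?_
  simp only [Function.comp_apply]
  rw [← eval_map_algebraMap g, ← hG, eval_map, aeval_def, hom_eval₂]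
  rfl

/-- The norm of `x` to `F_n` has absolute value an integral power of `ρ`, and `ρ` is the absolute
value of `a` raised to the degree; so `‖x‖` is an integral power of `‖a‖`. -/
theorem IsLT.isUniformizer_gen (hf : IsLT f) (hn : 1 ≤ n) (hfn : f.map (Φ n) = f)
    (ha : ι a ∈ primΛ f m) :
    IsUniformizer Ω Λ (IntermediateField.AdjoinSimple.gen (unr A F Ω n) a) := by
  have hα := hf.norm_pow_eq (mem_primΛ.1 ha).1 (mem_primΛ.1 ha).2
  have hfr := hf.finrank_adjoin hn hfn ha
  have hfd : FiniteDimensional (unr A F Ω n) (unr A F Ω n)⟮a⟯ :=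
    IntermediateField.adjoin.finiteDimensional (Algebra.IsIntegral.isIntegral a)
  have hd : 0 < Module.finrank (unr A F Ω n) (unr A F Ω n)⟮a⟯ := Module.finrank_pos
  rw [hfr] at hd
  refine ⟨?_, hf.norm_lt_one (mem_primΛ.1 ha).1, fun x hx ↦ ?_⟩
  · intro h
    have h1 : a = 0 := congrArg (algebraMap (unr A F Ω n)⟮a⟯ Ω) h
    rw [h1, map_zero, norm_zero, zero_pow hd.ne'] at hα
    exact (unifNorm_pos F (A := A) (Ω := Ω) (Λ := Λ)).ne hα
  · have h1 := norm_algebraNorm A F (Λ := Λ) (Ω := Ω) (E := unr A F Ω n) (T := (unr A F Ω n)⟮a⟯) x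
    obtain ⟨k, hk⟩ := exists_norm_eq_zpow_of_mem_maxUnr (A := A) (F := F) (Λ := Λ)
      (unr_le_maxUnr hn (Algebra.norm (unr A F Ω n) x).2)
      (by simpa using (Algebra.norm_ne_zero_iff (R := unr A F Ω n)).2 hx)
    refine ⟨k, ?_⟩
    have h2 : ‖ι (algebraMap (unr A F Ω n)⟮a⟯ Ω x)‖ ^ (q ^ m * (q - 1)) =
        (‖ι a‖ ^ k) ^ (q ^ m * (q - 1)) := by
      rw [← hfr, ← h1, hfr, ← zpow_natCast, ← zpow_mul, mul_comm, zpow_mul, zpow_natCast, hα]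
      exact hk
    exact (pow_left_inj₀ (norm_nonneg _) (zpow_nonneg (norm_nonneg _) _) hd.ne').1 h2

end LubinTateExtension

/-! ### Norms of units and uniformizers of the Lubin–Tate levels -/

section LubinTateNorm

variable {A F Ω Λ : Type*} [CommRing A] [IsDomain A] [IsDiscreteValuationRing A]
  [Finite (IsLocalRing.ResidueField A)] [Field F] [Algebra A F] [IsFractionRing A F]
  [Field Ω] [Algebra F Ω] [Algebra A Ω] [IsScalarTower A F Ω] [IsSepClosure F Ω]
  [NormedField Λ] [CompleteSpace Λ] [IsUltrametricDist Λ] [Algebra Ω Λ]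

local notation "ι" => algebraMap Ω Λ
local notation "q" => resCard A
local notation "ρ" => unifNorm A Ω Λ
local notation "𝓡" => unrRing A F Ω Λ
local notation "Φ" => frobR A F Ω Λ
local notation "ϖ" => unifR A F Ω Λ

open scoped IntermediateField

variable [LocalCompletion A F Ω Λ] {f g : Polynomial (unrRing A F Ω Λ)} {n m : ℕ} {a : Ω}

/-- The integers of a Lubin-Tate extension are polynomials in a primitive root. -/
theorem IsLT.exists_integral_poly (hf : IsLT f) (hn : 1 ≤ n) (hfn : f.map (Φ n) = f)
    (ha : ι a ∈ primΛ f m) (z : (unr A F Ω n)⟮a⟯) (hz : ‖ι (z : Ω)‖ ≤ 1) :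
    ∃ (G : Polynomial (unr A F Ω n)) (g : Polynomial 𝓡),
      aeval (IntermediateField.AdjoinSimple.gen (unr A F Ω n) a) G = z ∧
      G.map (finEmb A F Λ n) = g.map (algebraMap 𝓡 Λ) ∧ g.map (Φ n) = g ∧
      g.natDegree < q ^ m * (q - 1) := by
  have hρ0 := unifNorm_pos F (A := A) (Ω := Ω) (Λ := Λ)
  have hρ1 := unifNorm_lt_one F (A := A) (Ω := Ω) (Λ := Λ)
  have hinteg : IsIntegral (unr A F Ω n) a := Algebra.IsIntegral.isIntegral a
  obtain ⟨G, hGdeg, hG⟩ := (IntermediateField.adjoin.powerBasis hinteg).exists_eq_aeval z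
  rw [IntermediateField.adjoin.powerBasis_dim, (hf.map_roots_minpoly hn hfn ha).2] at hGdeg
  rw [IntermediateField.adjoin.powerBasis_gen] at hG
  rw [mem_primΛ] at ha
  have hα := hf.norm_pow_eq ha.1 ha.2
  have hα1 := hf.norm_lt_one ha.1
  have hα0 : 0 < ‖ι a‖ := by
    rw [norm_pos_iff]
    intro h
    exact ha.2 (h ▸ hf.zero_mem_tors m)
  let j := IntermediateField.inclusion (unr_le_maxUnr (A := A) (F := F) (Ω := Ω) hn)
  have hz' : aeval a (G.map (j : unr A F Ω n →+* maxUnr A F Ω)) = (z : Ω) := by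
    rw [hG, aeval_def, eval₂_map, aeval_def]
    exact (hom_eval₂ G (algebraMap (unr A F Ω n) (unr A F Ω n)⟮a⟯) (algebraMap (unr A F Ω n)⟮a⟯ Ω)
      (IntermediateField.AdjoinSimple.gen (unr A F Ω n) a)).symm
  have hcoeff : ∀ i, ‖ι (G.coeff i : Ω)‖ ≤ 1 := by
    intro i
    rcases eq_or_ne (G.coeff i) 0 with h0 | h0
    · rw [h0]
      simp
    have h1 := hf.norm_coeff_mul_pow_le ha.1 ha.2
      (P := G.map (j : unr A F Ω n →+* maxUnr A F Ω)) (by rwa [natDegree_map]) i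
    rw [hz', coeff_map] at h1
    have h2 : ‖ι (G.coeff i : Ω)‖ * ‖ι a‖ ^ i ≤ 1 := h1.trans hz
    obtain ⟨k, hk⟩ := exists_norm_eq_zpow_of_mem_maxUnr (A := A) (F := F) (Λ := Λ)
      (unr_le_maxUnr hn (G.coeff i).2) (by simpa using h0)
    -- A non-integral coefficient has norm at least `ρ⁻¹`, whereas `‖a‖ ^ i > ρ` because `i` is
    -- below the degree. Then the corresponding term alone would exceed 1.
    by_contra! hlt
    have hk1 : k < 0 := by
      by_contra! h
      rw [hk] at hlt
      exact hlt.not_ge (zpow_le_one₀ hρ0 hρ1.le h)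
    have hi : i < q ^ m * (q - 1) :=
      (le_natDegree_of_ne_zero h0).trans_lt hGdeg
    have h3 : ρ ^ (-1 : ℤ) ≤ ‖ι (G.coeff i : Ω)‖ := by
      rw [hk]
      exact zpow_le_zpow_right_of_le_one₀ hρ0 hρ1.le (by omega)
    have h4 : ρ < ‖ι a‖ ^ i := by
      conv_lhs => rw [← hα]
      exact pow_lt_pow_right_of_lt_one₀ hα0 hα1 hi
    have h5 : 1 < ‖ι (G.coeff i : Ω)‖ * ‖ι a‖ ^ i := by
      calc (1 : ℝ) = ρ ^ (-1 : ℤ) * ρ := by rw [zpow_neg_one, inv_mul_cancel₀ hρ0.ne']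
        _ < ρ ^ (-1 : ℤ) * ‖ι a‖ ^ i := mul_lt_mul_of_pos_left h4 (zpow_pos hρ0 _)
        _ ≤ _ := mul_le_mul_of_nonneg_right h3 (by positivity)
    exact h5.not_ge h2
  have hlift : G.map (finEmb A F Λ n) ∈ Polynomial.lifts (algebraMap 𝓡 Λ) := by
    rw [lifts_iff_coeff_lifts]
    intro i
    rw [coeff_map]
    exact ⟨⟨ι (G.coeff i : Ω), algebraMap_mem_unrRing (unr_le_maxUnr hn (G.coeff i).2) (hcoeff i)⟩,
      rfl⟩
  obtain ⟨g, hg⟩ := (mem_lifts _).1 hlift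
  have hinj : Function.Injective (algebraMap 𝓡 Λ) := Subtype.val_injective
  refine ⟨G, g, hG.symm, hg.symm, ?_, ?_⟩
  · ext i
    have h6 : ((g.coeff i : 𝓡) : Λ) = ι (G.coeff i : Ω) := by
      have := congrArg (fun p ↦ coeff p i) hg
      simp only [coeff_map] at this
      exact this
    rw [coeff_map, coe_frobR, h6, galExt_algebraMap, zpow_natCast,
      frob_pow_eq_self Λ hn (G.coeff i).2]
  · rw [← natDegree_map_eq_of_injective hinj, hg, natDegree_map]
    exact hGdeg

theorem coe_algebraNorm (hn : 1 ≤ n) {x : unr A F Ω n} {w : 𝓡}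
    (hw : ι (x : Ω) = w) :
    ι (algebraMap F Ω (Algebra.norm F x)) = ((∏ i ∈ Finset.range n, Φ i w : 𝓡) : Λ) := by
  rw [norm_unr Λ hn, map_prod]
  refine Eq.trans ?_ (map_prod (algebraMap 𝓡 Λ) _ _).symm
  refine Finset.prod_congr rfl fun i _ ↦ ?_
  change _ = ((Φ i w : 𝓡) : Λ)
  rw [coe_frobR, ← hw, galExt_algebraMap, zpow_natCast]

/-- Norms of units from the Lubin-Tate extension of level `m + 1`. -/
theorem IsLT.norm_algebraNorm_unit_sub_one_le (hf : IsLT f) (hn : 1 ≤ n) (hfn : f.map (Φ n) = f)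
    (ha : ι a ∈ primΛ f m) {z : (unr A F Ω n)⟮a⟯} (hz : ‖ι (z : Ω)‖ = 1) :
    ‖ι (algebraMap F Ω (Algebra.norm F z)) - 1‖ ≤ ρ ^ (m + 1) := by
  obtain ⟨G, g, hG, hGg, hgn, hdeg⟩ := hf.exists_integral_poly hn hfn ha z hz.le
  have hfd := finiteDimensional_unr A F Ω Λ hn
  have hfd' : FiniteDimensional (unr A F Ω n) (unr A F Ω n)⟮a⟯ :=
    IntermediateField.adjoin.finiteDimensional (Algebra.IsIntegral.isIntegral a)
  -- Adding `h` to `g` produces a monic polynomial of even degree without changing the values at the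
  -- roots of `f_{m+1}`, the constant term or the invariance under `φ^n`.
  let h := ltIter f (m + 1) * X ^ q ^ (m + 1)
  have hmon : h.Monic := (hf.iter_monic _).mul (monic_X_pow _)
  have hhdeg : h.natDegree = 2 * q ^ (m + 1) := by
    rw [(hf.iter_monic _).natDegree_mul (monic_X_pow _), hf.iter_natDegree,
      natDegree_X_pow, two_mul]
  have hlt : g.natDegree < h.natDegree := by
    have h1 : q ^ m * (q - 1) ≤ q ^ (m + 1) := by
      rw [pow_succ]
      exact Nat.mul_le_mul_left _ (Nat.sub_le _ _)
    omega
  have hlt' : g.degree < h.degree := degree_lt_degree hlt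
  have hgm : (h + g).Monic := hmon.add_of_left hlt'
  have hgd : (h + g).natDegree = 2 * q ^ (m + 1) := by
    rw [natDegree_add_eq_left_of_natDegree_lt hlt, hhdeg]
  have hval : ∀ β ∈ primΛ f m, aeval β (h + g) = aeval β g := by
    intro β hβ
    rw [map_add, map_mul, hf.mem_tors.1 (mem_primΛ.1 hβ).1, zero_mul, zero_add]
  have hprod := hf.norm_aeval_gen_eq hn hfn ha hGg
  rw [← Finset.prod_congr rfl hval, hG] at hprod
  have hga : aeval (ι a) g = ι (z : Ω) := by
    rw [← eval_map_algebraMap, ← hGg, eval_map, ← hG, aeval_def]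
    exact (hom_eval₂ G (algebraMap (unr A F Ω n) (unr A F Ω n)⟮a⟯)
      ((algebraMap Ω Λ).comp (algebraMap (unr A F Ω n)⟮a⟯ Ω))
      (IntermediateField.AdjoinSimple.gen (unr A F Ω n) a)).symm
  have hα1 := hf.norm_lt_one (mem_primΛ.1 ha).1
  have h0 : IsUnit ((h + g).coeff 0) := by
    have h1 : (h + g).coeff 0 = g.coeff 0 := by
      rw [coeff_add, mul_coeff_zero, hf.iter_coeff_zero, zero_mul, zero_add]
    rw [h1, unrRing_isUnit_iff]
    have h2 : ι (z : Ω) = ι a * aeval (ι a) g.divX + g.coeff 0 := by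
      rw [← hga]
      conv_lhs => rw [← divX_mul_X_add g]
      rw [map_add, map_mul, aeval_X, aeval_C, mul_comm]
      rfl
    have h3 : ‖ι a * aeval (ι a) g.divX‖ < 1 := by
      rw [norm_mul]
      exact mul_lt_one_of_nonneg_of_lt_one_left (norm_nonneg _) hα1 (norm_aeval_le hα1.le _)
    have h4 : ((g.coeff 0 : 𝓡) : Λ) = ι (z : Ω) + -(ι a * aeval (ι a) g.divX) := by
      rw [h2]
      ring
    rw [h4, IsUltrametricDist.norm_add_eq_max_of_norm_ne_norm
      (by rw [hz, norm_neg]; exact h3.ne'), hz,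
      norm_neg]
    exact max_eq_left h3.le
  have hx1 : ‖ι (Algebra.norm (unr A F Ω n) z : unr A F Ω n)‖ ≤ 1 := by
    have := norm_algebraNorm A F (Λ := Λ) (Ω := Ω) (E := unr A F Ω n)
      (T := (unr A F Ω n)⟮a⟯) z
    refine this.le.trans ?_
    rw [show algebraMap (unr A F Ω n)⟮a⟯ Ω z = (z : Ω) from rfl, hz, one_pow]
  let w : 𝓡 := ⟨_, algebraMap_mem_unrRing (unr_le_maxUnr hn (Algebra.norm (unr A F Ω n) z).2) hx1⟩
  have hmain := hf.norm_prod_frobR_sub_one_le hgm (by rw [hgd]; exact even_two_mul _) h0 hn hfn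
    (by rw [Polynomial.map_add, Polynomial.map_mul, ltIter_map, hfn, Polynomial.map_pow, map_X,
      hgn])
    (w := w) hprod
  rw [← Algebra.norm_norm (S := unr A F Ω n), coe_algebraNorm hn (w := w) rfl]
  exact hmain

/-- The primitive roots are the roots of `f_{m+1} / f_m`, which is the `m`-th twist of `f / X`
composed with `f_m`; its constant term is the twist of the linear coefficient. For `m ≥ 1` their
number is even, also when `q` is even, so no sign appears. -/
theorem IsLT.prod_primΛ (hf : IsLT f) (hm : 1 ≤ m) :
    ∏ β ∈ primΛ f m, β = ((Φ m (f.coeff 1) : 𝓡) : Λ) := by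
  have hfm := hf.map_frobR m
  have h1 : ltIter f (m + 1) = (f.map (Φ m)).divX.comp (ltIter f m) * ltIter f m := by
    conv_lhs => rw [ltIter, ← divX_mul_X_add (f.map (Φ m)), hfm.coeff_zero]
    simp
  have h2 : ((f.map (Φ m)).divX.comp (ltIter f m)).map (algebraMap 𝓡 Λ) =
      ∏ β ∈ primΛ f m, (X - C β) := by
    refine mul_right_cancel₀ ((hf.iter_monic m).map (algebraMap 𝓡 Λ)).ne_zero ?_
    rw [← Polynomial.map_mul, ← h1, hf.iter_eq_prod, hf.iter_eq_prod]
    classical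
    exact (Finset.prod_sdiff fun _ ↦ hf.tors_succ).symm
  have h3 := congrArg (eval 0) h2
  rw [eval_prod] at h3
  simp only [eval_sub, eval_X, eval_C, zero_sub] at h3
  have heven : Even (primΛ f m).card := by
    rw [hf.card_primΛ]
    rcases Nat.even_or_odd q with h | h
    · exact (h.pow_of_ne_zero (by omega)).mul_right _
    · exact (Nat.Odd.sub_odd h odd_one).mul_left _
  rw [Finset.prod_neg, heven.neg_one_pow, one_mul] at h3
  rw [← h3, ← coeff_zero_eq_eval_zero, coeff_map, coeff_zero_eq_eval_zero, eval_comp,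
    ← coeff_zero_eq_eval_zero, hf.iter_coeff_zero, ← coeff_zero_eq_eval_zero, coeff_divX, coeff_map]
  rfl

/-- The norm of `a` to `F_n` is `φ^m` of the linear coefficient. In the norm from `F_n` to `F` the
shift by `m` disappears. -/
theorem IsLT.algebraNorm_gen (hf : IsLT f) (hn : 1 ≤ n) (hfn : f.map (Φ n) = f)
    (ha : ι a ∈ primΛ f m) (hm : 1 ≤ m) :
    ι (algebraMap F Ω (Algebra.norm F (IntermediateField.AdjoinSimple.gen (unr A F Ω n) a))) =
      piR f n := by
  have hfd := finiteDimensional_unr A F Ω Λ hn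
  have hfd' : FiniteDimensional (unr A F Ω n) (unr A F Ω n)⟮a⟯ :=
    IntermediateField.adjoin.finiteDimensional (Algebra.IsIntegral.isIntegral a)
  have h := hf.norm_aeval_gen_eq hn hfn ha (G := X) (g := X) (by rw [map_X, map_X])
  simp only [aeval_X] at h
  rw [hf.prod_primΛ hm] at h
  rw [← Algebra.norm_norm (S := unr A F Ω n), coe_algebraNorm hn h, piR]
  congr 1
  have hfix : Φ n (f.coeff 1) = f.coeff 1 := by rw [← coeff_map, hfn]
  clear h hm ha
  induction m with
  | zero => simp [frobR_zero]
  | succ m ih =>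
    rw [← ih, ← prod_frobR_eq hn (P := Φ m (f.coeff 1)) (by rw [frobR_comm, hfix])]
    refine Finset.prod_congr rfl fun i _ ↦ ?_
    rw [← frobR_add (1 : ℤ) m]
    push_cast
    rw [add_comm]

/-- Norms of uniformizers from a totally ramified extension of a Lubin-Tate extension of level
`m + 1`. -/
theorem IsLT.norm_algebraNorm_sub_le (hf : IsLT f) (hn : 1 ≤ n) (hfn : f.map (Φ n) = f)
    (ha : ι a ∈ primΛ f m) {T : Type*} [Field T] [Algebra F T]
    [Algebra (unr A F Ω n)⟮a⟯ T] [Algebra T Ω] [IsScalarTower F (unr A F Ω n)⟮a⟯ T]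
    [IsScalarTower (unr A F Ω n)⟮a⟯ T Ω] [FiniteDimensional F T] {t : T}
    (ht : IsUniformizer Ω Λ t) (hres : ∀ x : T, ‖ι (algebraMap T Ω x)‖ = 1 →
      ∃ c ∈ unr A F Ω n, ‖ι (algebraMap T Ω x) - ι c‖ < 1) :
    ∃ u : F, Algebra.norm F t * u = Algebra.norm F (IntermediateField.AdjoinSimple.gen
      (unr A F Ω n) a) ∧ ‖ι (algebraMap F Ω u) - 1‖ ≤ ρ ^ (m + 1) := by
  have hfd := finiteDimensional_unr A F Ω Λ hn
  have hfd' : FiniteDimensional (unr A F Ω n) (unr A F Ω n)⟮a⟯ :=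
    IntermediateField.adjoin.finiteDimensional (Algebra.IsIntegral.isIntegral a)
  have hfd2 : FiniteDimensional F (unr A F Ω n)⟮a⟯ := Module.Finite.trans (unr A F Ω n) _
  have hfd3 : FiniteDimensional (unr A F Ω n)⟮a⟯ T := Module.Finite.of_restrictScalars_finite F _ _
  have htow : IsScalarTower F (unr A F Ω n)⟮a⟯ Ω := IsScalarTower.of_algebraMap_eq fun _ ↦ rfl
  have hgen := hf.isUniformizer_gen hn hfn ha
  have h1 := norm_algebraNorm_of_totallyRamified (A := A) (F := F) hgen ht fun x hx ↦ by
    obtain ⟨c, hc, h⟩ := hres x hx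
    exact ⟨algebraMap (unr A F Ω n) _ ⟨c, hc⟩, h⟩
  have hN0 : Algebra.norm (unr A F Ω n)⟮a⟯ t ≠ 0 := Algebra.norm_ne_zero_iff.2 ht.ne_zero
  let z : (unr A F Ω n)⟮a⟯ := IntermediateField.AdjoinSimple.gen (unr A F Ω n) a /
    Algebra.norm (unr A F Ω n)⟮a⟯ t
  have hz : ‖ι (z : Ω)‖ = 1 := by
    have h2 : (z : Ω) = algebraMap _ Ω (IntermediateField.AdjoinSimple.gen (unr A F Ω n) a) /
        algebraMap _ Ω (Algebra.norm (unr A F Ω n)⟮a⟯ t) := rfl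
    rw [h2, map_div₀, norm_div, h1, div_self hgen.norm_pos.ne']
  refine ⟨Algebra.norm F z, ?_, hf.norm_algebraNorm_unit_sub_one_le hn hfn ha hz⟩
  rw [← Algebra.norm_norm (S := (unr A F Ω n)⟮a⟯) (a := t), ← map_mul, mul_div_cancel₀ _ hN0]

end LubinTateNorm

/-! ### Polynomials adapted to an automorphism -/

section Adapted

variable {A F Ω Λ : Type*} [CommRing A] [IsDomain A] [IsDiscreteValuationRing A]
  [Finite (IsLocalRing.ResidueField A)] [Field F] [Algebra A F] [IsFractionRing A F]
  [Field Ω] [Algebra F Ω] [Algebra A Ω] [IsScalarTower A F Ω] [IsSepClosure F Ω]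
  [NormedField Λ] [CompleteSpace Λ] [IsUltrametricDist Λ] [Algebra Ω Λ]

local notation "ι" => algebraMap Ω Λ
local notation "q" => resCard A
local notation "ρ" => unifNorm A Ω Λ
local notation "𝓡" => unrRing A F Ω Λ
local notation "Φ" => frobR A F Ω Λ
local notation "ϖ" => unifR A F Ω Λ

variable [LocalCompletion A F Ω Λ] {f g : Polynomial (unrRing A F Ω Λ)} {n : ℕ}

/-- Elements of `F` of valuation `n` are norms of uniformizers of the unramified extension of
degree `n`. -/
theorem exists_uniformizer_prod_eq (hn : 1 ≤ n) {y : F} (hy : ‖ι (algebraMap F Ω y)‖ = ρ ^ n) :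
    ∃ π : 𝓡, ‖(π : Λ)‖ = ρ ∧ Φ n π = π ∧
      ((∏ t ∈ Finset.range n, Φ t π : 𝓡) : Λ) = ι (algebraMap F Ω y) := by
  have hρ0 := unifNorm_pos F (A := A) (Ω := Ω) (Λ := Λ)
  have hϖ : (ϖ : Λ) ≠ 0 := fun h ↦ unifR_ne_zero (Subtype.ext h)
  have hemb : (ϖ : Λ) = ι (algebraMap F Ω (algebraMap A F (unif A))) := emb_eq _
  have hu1 : ‖ι (algebraMap F Ω (y / algebraMap A F (unif A) ^ n))‖ = 1 := by
    rw [map_div₀, map_div₀, norm_div, hy, map_pow, map_pow, norm_pow, ← hemb, norm_unifR,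
      div_self (pow_pos hρ0 n).ne']
  obtain ⟨a, ha⟩ := exists_algebraMap_eq (A := A) hu1.le
  let u := embR A F Ω Λ a
  have hu : (u : Λ) = ι (algebraMap F Ω (y / algebraMap A F (unif A) ^ n)) := by
    rw [← ha]
    exact emb_eq _
  obtain ⟨η, hη1, hη⟩ := exists_frobR_eq_mul hn (u := u) (by rw [hu, hu1])
  obtain ⟨η', hη'⟩ := (unrRing_isUnit_iff.2 hη1).exists_right_inv
  -- With `φ^n η = u η` and `u` in the base, `ε = φ η / η` is fixed by `φ^n`, and the product of its
  -- conjugates telescopes to `φ^n η / η = u`.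
  let ε := Φ 1 η * η'
  have hε : ε * η = Φ 1 η := by
    simp only [ε]
    rw [mul_assoc, mul_comm η', hη', mul_one]
  have hη0 : η ≠ 0 := (unrRing_isUnit_iff.2 hη1).ne_zero
  have hεn : Φ n ε = ε := by
    refine mul_right_cancel₀ (b := Φ n η) ?_ ?_
    · rw [hη]
      refine mul_ne_zero ?_ hη0
      exact (unrRing_isUnit_iff.2 (by rw [hu, hu1])).ne_zero
    · rw [← map_mul, hε, frobR_comm, hη, map_mul, frobR_embR, ← hε]
      ring
  have htel : ∀ k : ℕ, (∏ t ∈ Finset.range k, Φ t ε) * η = Φ k η := by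
    intro k
    induction k with
    | zero => simp [frobR_zero]
    | succ k ih =>
      rw [Finset.prod_range_succ, mul_right_comm, ih, mul_comm, ← map_mul, hε, ← frobR_add]
      push_cast
      rfl
  have hprod : ∏ t ∈ Finset.range n, Φ t ε = u := by
    refine mul_right_cancel₀ hη0 ?_
    rw [htel, hη]
  refine ⟨ϖ * ε, ?_, by rw [map_mul, frobR_unifR, hεn], ?_⟩
  · have h1 : ‖(ε : Λ)‖ = 1 := by
      have := congrArg (fun x : 𝓡 ↦ ‖(x : Λ)‖) hε
      simpa [hη1, norm_frobR] using this
    rw [Subring.coe_mul, norm_mul, h1, mul_one, norm_unifR]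
  · simp only [map_mul, frobR_unifR]
    rw [Finset.prod_mul_distrib, Finset.prod_const, Finset.card_range, hprod, Subring.coe_mul,
      Subring.coe_pow, hu, map_div₀, map_div₀, map_pow, map_pow, ← hemb, mul_div_cancel₀]
    exact pow_ne_zero _ hϖ

theorem isLT_X_pow_add (hn : 1 ≤ n) {π : 𝓡} (hπ : ‖(π : Λ)‖ = ρ) (hπn : Φ n π = π) :
    IsLT (X ^ q + C π * X : Polynomial 𝓡) where
  monic := by
    refine (monic_X_pow q).add_of_left ?_
    rw [degree_X_pow]
    refine (degree_C_mul_X_le π).trans_lt ?_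
    exact_mod_cast two_le_resCard A
  coeff_zero := by
    simp [(resCard_ne_zero A).symm]
  norm_coeff_one := by
    have : (1 : ℕ) ≠ q := by
      have := two_le_resCard A
      omega
    rw [coeff_add, coeff_X_pow, if_neg this, zero_add, coeff_C_mul, coeff_X_one, mul_one, hπ]
  dvd := by
    rw [add_sub_cancel_left]
    refine Dvd.dvd.mul_right (_root_.map_dvd C ?_) X
    rw [unifR_dvd_iff, hπ]
    exact unifNorm_lt_one F
  lifts := by
    obtain ⟨y, hy, h⟩ := exists_unr_of_frobR_eq hn hπn
    rw [mem_lifts]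
    refine ⟨X ^ q + C ⟨y, unr_le_maxUnr hn hy⟩ * X, ?_⟩
    simp only [Polynomial.map_add, Polynomial.map_mul, Polynomial.map_pow, map_X, map_C]
    congr 3

theorem isLift_one (hf : IsLT f) : IsLift f 1 0 (1 : Ω ≃ₐ[F] Ω) := by
  have := isLift_unit hf (a := 1) isUnit_one (s := 1) (fun _ _ ↦ rfl) fun m α _ ↦ by
    rw [galExt_one, hf.evR_brk_one]
  rwa [map_one] at this

/-- The inverse is a lift of some element, and by multiplicativity and uniqueness its product with
`x` is 1. -/
theorem IsLift.inv (hf : IsLT f) {x : F} {j : ℤ} {s : Ω ≃ₐ[F] Ω} (hs : IsLift f x j s) :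
    IsLift f x⁻¹ (-j) s⁻¹ := by
  have h1 : ∀ y ∈ maxUnr A F Ω, s⁻¹ y = (frob A F Ω ^ (-j)) y := by
    intro y hy
    have h2 := hs.eq_frob _ (galois_mem_maxUnr (frob A F Ω ^ (-j)) hy)
    rw [← AlgEquiv.mul_apply (frob A F Ω ^ j), ← zpow_add, add_neg_cancel, zpow_zero] at h2
    apply s.injective
    rw [h2, ← AlgEquiv.mul_apply, mul_inv_cancel]
  obtain ⟨y, hy⟩ := hf.exists_isLift h1
  have h3 := hs.mul hf hy
  rw [mul_inv_cancel] at h3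
  have h4 := IsLift.unique hf h3 (isLift_one hf)
  rwa [← eq_inv_of_mul_eq_one_right h4]

/-- An automorphism inducing a positive power of Frobenius fixes the torsion of a suitable
Lubin-Tate polynomial. -/
theorem IsLift.exists_fixed (hf : IsLT f) (hn : 1 ≤ n) {x : F} {s : Ω ≃ₐ[F] Ω}
    (hs : IsLift f x n s) : ∃ g : Polynomial 𝓡, IsLT g ∧ g.map (Φ n) = g ∧
      (piR g n : Λ) = ι (algebraMap F Ω x⁻¹) ∧ ∀ m, ∀ α ∈ torsΛ g m, galExt A Λ s α = α := by
  have hy : ‖ι (algebraMap F Ω x⁻¹)‖ = ρ ^ n := by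
    rw [map_inv₀, map_inv₀, norm_inv, hs.norm_eq, zpow_neg, inv_inv, zpow_natCast]
  obtain ⟨π, hπ, hπn, hprod⟩ := exists_uniformizer_prod_eq hn hy
  have hg := isLT_X_pow_add hn hπ hπn
  have hgn : (X ^ q + C π * X : Polynomial 𝓡).map (Φ n) = X ^ q + C π * X := by
    simp only [Polynomial.map_add, Polynomial.map_mul, Polynomial.map_pow, map_X, map_C, hπn]
  have h1 : (X ^ q + C π * X : Polynomial 𝓡).coeff 1 = π := by
    have : (1 : ℕ) ≠ q := by
      have := two_le_resCard A
      omega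
    rw [coeff_add, coeff_X_pow, if_neg this, zero_add, coeff_C_mul, coeff_X_one, mul_one]
  have hpi : (piR (X ^ q + C π * X : Polynomial 𝓡) n : Λ) = ι (algebraMap F Ω x⁻¹) := by
    rw [← hprod, piR, h1]
  refine ⟨_, hg, hgn, hpi, fun m α hα ↦ ?_⟩
  obtain ⟨θ, h, hθ, hh, hev⟩ := (hs.change hf hg).exists_brk
  -- The polynomial was chosen with `π_n = x⁻¹`, so the bracket describing `s` has linear
  -- coefficient `x π_n = 1`. As the polynomial is its own `n`-th twist, this bracket is the series
  -- `X`.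
  have hθ1 : θ = 1 := by
    apply Subtype.ext
    have h2 : piZ (X ^ q + C π * X : Polynomial 𝓡) n = (piR (X ^ q + C π * X) n : 𝓡) := rfl
    rw [hθ, h2, hpi, ← map_mul, ← map_mul, mul_inv_cancel₀ hs.ne_zero, map_one, map_one]
    rfl
  rw [hgn, hθ1] at hh
  rw [hev m α hα, IsBrk.unique hg hg hh (IsBrk.X hg), evR_X]

end Adapted

/-! ### Norms of elements close to one -/

section NormOne

variable {A F Ω Λ : Type*} [CommRing A] [IsDomain A] [IsDiscreteValuationRing A]
  [Finite (IsLocalRing.ResidueField A)] [Field F] [Algebra A F] [IsFractionRing A F]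
  [Field Ω] [Algebra F Ω] [Algebra A Ω] [IsScalarTower A F Ω] [IsSepClosure F Ω]
  [NormedField Λ] [CompleteSpace Λ] [IsUltrametricDist Λ] [Algebra Ω Λ]

theorem norm_multiset_prod_sub_one_le {r : ℝ} (hr : 0 ≤ r) (hr1 : r ≤ 1) (s : Multiset Λ)
    (h : ∀ x ∈ s, ‖x - 1‖ ≤ r) : ‖s.prod - 1‖ ≤ r := by
  induction s using Multiset.induction_on with
  | empty => simpa using hr
  | cons x s ih =>
    have hx := h x (Multiset.mem_cons_self x s)
    have hs := ih fun y hy ↦ h y (Multiset.mem_cons_of_mem hy)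
    have hx1 : ‖x‖ ≤ 1 := by
      have h2 := IsUltrametricDist.norm_add_le_max (x - 1) 1
      rw [sub_add_cancel, norm_one] at h2
      exact h2.trans (max_le (hx.trans hr1) le_rfl)
    have h1 : (x ::ₘ s).prod - 1 = x * (s.prod - 1) + (x - 1) := by
      rw [Multiset.prod_cons]
      ring
    rw [h1]
    refine (IsUltrametricDist.norm_add_le_max _ _).trans (max_le ?_ hx)
    rw [norm_mul]
    exact (mul_le_of_le_one_left (norm_nonneg _) hx1).trans hs

/-- The norm is a product of conjugates, and Galois invariance of the absolute value makes all of
them equally close to 1. -/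
theorem norm_algebraNorm_sub_one_le [LocalCompletion A F Ω Λ] {T : Type*} [Field T] [Algebra F T]
    [Algebra T Ω] [IsScalarTower F T Ω] [FiniteDimensional F T] {r : ℝ} (hr : 0 ≤ r) (hr1 : r ≤ 1)
    {x : T} (hx : ‖algebraMap Ω Λ (algebraMap T Ω x) - 1‖ ≤ r) :
    ‖algebraMap Ω Λ (algebraMap F Ω (Algebra.norm F x)) - 1‖ ≤ r := by
  have hmin : minpoly F x = minpoly F (algebraMap T Ω x) :=
    (minpoly.algebraMap_eq (FaithfulSMul.algebraMap_injective T Ω) x).symm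
  have hs : ((minpoly F x).map (algebraMap F Ω)).Splits := by
    rw [hmin]
    exact Normal.splits inferInstance _
  rw [Algebra.norm_eq_prod_roots Ω hs, map_pow, map_multiset_prod, ← Multiset.prod_nsmul]
  refine norm_multiset_prod_sub_one_le hr hr1 _ fun b hb ↦ ?_
  obtain ⟨b, hb', rfl⟩ := Multiset.mem_map.1 (Multiset.mem_of_mem_nsmul hb)
  rw [hmin, mem_aroots] at hb'
  obtain ⟨σ, hσ⟩ := minpoly.exists_algEquiv_of_root'
    (Algebra.IsIntegral.isIntegral (R := F) (algebraMap T Ω x)).isAlgebraic hb'.2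
  rw [← hσ, ← map_one (algebraMap Ω Λ), ← map_sub, ← map_one σ, ← map_sub,
    norm_galois (A := A), map_sub, map_one]
  exact hx

end NormOne

/-! ### Base change -/

section BaseChange

open scoped IntermediateField

variable {A F A' F' Ω Λ : Type*} [CommRing A] [IsDomain A] [IsDiscreteValuationRing A]
  [Finite (IsLocalRing.ResidueField A)] [Field F] [Algebra A F] [IsFractionRing A F]
  [Field Ω] [Algebra F Ω] [Algebra A Ω] [IsScalarTower A F Ω] [IsSepClosure F Ω]
  [NormedField Λ] [CompleteSpace Λ] [IsUltrametricDist Λ] [Algebra Ω Λ]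
  [CommRing A'] [IsDomain A'] [IsDiscreteValuationRing A']
  [Finite (IsLocalRing.ResidueField A')] [Field F'] [Algebra A' F'] [IsFractionRing A' F']
  [Algebra F' Ω] [Algebra A' Ω] [IsScalarTower A' F' Ω] [IsSepClosure F' Ω]
  [Algebra F F'] [IsScalarTower F F' Ω] [FiniteDimensional F F']

local notation "ι" => algebraMap Ω Λ

theorem exists_resCard_eq_pow (A F A' F' Ω Λ : Type*) [CommRing A] [IsDomain A]
    [IsDiscreteValuationRing A]
    [Finite (IsLocalRing.ResidueField A)] [Field F] [Algebra A F] [IsFractionRing A F]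
    [Field Ω] [Algebra F Ω] [Algebra A Ω] [IsScalarTower A F Ω] [IsSepClosure F Ω]
    [NormedField Λ] [CompleteSpace Λ] [IsUltrametricDist Λ] [Algebra Ω Λ]
    [CommRing A'] [IsDomain A'] [IsDiscreteValuationRing A']
    [Finite (IsLocalRing.ResidueField A')] [Field F'] [Algebra A' F'] [IsFractionRing A' F']
    [Algebra F' Ω] [Algebra A' Ω] [IsScalarTower A' F' Ω] [IsSepClosure F' Ω]
    [Algebra A A'] [IsScalarTower A A' Ω]
    [LocalCompletion A F Ω Λ] [LocalCompletion A' F' Ω Λ] :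
    ∃ d, 1 ≤ d ∧ resCard A' = resCard A ^ d := by
  have hloc : IsLocalHom (algebraMap A A') := ⟨fun a ha ↦ by
    rw [← norm_emb_eq_one_iff F' (Ω := Ω) (Λ := Λ)] at ha
    rw [← norm_emb_eq_one_iff F (Ω := Ω) (Λ := Λ), ← ha]
    exact congrArg (fun y ↦ ‖algebraMap Ω Λ y‖) (IsScalarTower.algebraMap_apply A A' Ω a)⟩
  let := (IsLocalRing.ResidueField.map (algebraMap A A')).toAlgebra
  refine ⟨Module.finrank (IsLocalRing.ResidueField A) (IsLocalRing.ResidueField A'),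
    Module.finrank_pos, ?_⟩
  rw [resCard_eq, resCard_eq]
  exact Module.natCard_eq_pow_finrank

variable [LocalCompletion A F Ω Λ] [LocalCompletion A' F' Ω Λ]
  {f : Polynomial (unrRing A F Ω Λ)} {f' : Polynomial (unrRing A' F' Ω Λ)}

/-- On the roots of unity that generate the maximal unramified extension of `F`, the Frobenius of
`F'` is the power with exponent `resCard A' = resCard A ^ d`. -/
theorem frob_eq_frob_pow (Λ : Type*) [NormedField Λ] [CompleteSpace Λ] [IsUltrametricDist Λ]
    [Algebra Ω Λ] [LocalCompletion A F Ω Λ] [LocalCompletion A' F' Ω Λ] {d : ℕ}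
    (hd : resCard A' = resCard A ^ d)
    {s : Ω ≃ₐ[F'] Ω} (hs : ∀ y ∈ maxUnr A' F' Ω, s y = frob A' F' Ω y) :
    ∀ y ∈ maxUnr A F Ω, s y = (frob A F Ω ^ d) y := by
  intro y hy
  rw [maxUnr_eq_adjoin] at hy
  refine eqOn_adjoin (F := F) (σ := (s.restrictScalars F).toAlgHom)
    (τ := (frob A F Ω ^ d).toAlgHom) ?_ hy
  rintro ζ ⟨n, hn, hζ⟩
  have hζ' : ζ ^ resCard A' ^ n = ζ := by
    rw [hd, ← pow_mul, mul_comm]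
    exact pow_mul_eq_self hζ d
  change s ζ = (frob A F Ω ^ d) ζ
  rw [hs ζ (unr_le_maxUnr hn (mem_unr_of_pow_eq hn hζ')), frob_apply Λ hn hζ', hd,
    frob_pow_apply Λ hn hζ]

theorem mem_of_mem_adjoin {k : Type*} [Field k] [Algebra k Ω] {S : Set Ω} {R : Subfield Ω}
    (hk : ∀ c, algebraMap k Ω c ∈ R) (hS : S ⊆ R) {x : Ω}
    (hx : x ∈ IntermediateField.adjoin k S) : x ∈ R := by
  induction hx using IntermediateField.adjoin_induction with
  | mem x hx => exact hS hx
  | algebraMap x => exact hk x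
  | add x y _ _ hx hy => exact add_mem hx hy
  | inv x _ hx => exact inv_mem hx
  | mul x y _ _ hx hy => exact mul_mem hx hy

/-- An element fixed by a Frobenius automorphism is congruent to a root of unity in the base. -/
theorem exists_teichmuller_of_fixed {s : Ω ≃ₐ[F'] Ω}
    (hs : ∀ y ∈ maxUnr A' F' Ω, s y = frob A' F' Ω y) {x : Ω} (hsx : s x = x) (hx : ‖ι x‖ = 1) :
    ∃ ζ : Ω, ζ ^ resCard A' = ζ ∧ ‖ι x - ι ζ‖ < 1 := by
  obtain ⟨n, ζ, hn, hζ, h⟩ := exists_teichmuller A' F' hx.le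
  refine ⟨ζ, ?_, h⟩
  have h1 : ‖ι x - ι (ζ ^ resCard A')‖ < 1 := by
    rw [← frob_apply (F := F') Λ hn hζ, ← hs ζ (unr_le_maxUnr hn (mem_unr_of_pow_eq hn hζ))]
    nth_rw 1 [← hsx]
    rw [← map_sub, ← map_sub, norm_galois (A := A'), map_sub]
    exact h
  have h2 : ‖ι (ζ ^ resCard A') - ι ζ‖ < 1 := by
    rw [norm_sub_rev] at h1
    exact norm_sub_lt_trans h1 h
  apply (algebraMap Ω Λ).injective
  refine eq_of_norm_sub_lt_one (A := A') F' Ω hn ?_ ?_ h2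
  · rw [← map_pow, ← pow_mul, mul_comm, pow_mul, hζ]
  · rw [← map_pow, hζ]

/-- The relation between the norms of uniformizers of `F'` and `F`, up to units close to `1`. -/
theorem norm_algebraNorm_mul_sub_one_le {d : ℕ} (hd1 : 1 ≤ d)
    (hd : resCard A' = resCard A ^ d) {g : Polynomial (unrRing A F Ω Λ)}
    {g' : Polynomial (unrRing A' F' Ω Λ)} (hg : IsLT g) (hg' : IsLT g')
    (hgn : g.map (frobR A F Ω Λ d) = g) (hgn' : g'.map (frobR A' F' Ω Λ (1 : ℕ)) = g')
    {x : F} {x' : F'} (hx' : x' ≠ 0)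
    (hpi : (piR g d : Λ) = ι (algebraMap F Ω x⁻¹))
    (hpi' : (piR g' 1 : Λ) = ι (algebraMap F' Ω x'⁻¹)) {s : Ω ≃ₐ[F'] Ω}
    (hs : ∀ y ∈ maxUnr A' F' Ω, s y = frob A' F' Ω y)
    (hfix : ∀ m, ∀ α ∈ torsΛ g m, galExt A Λ (s.restrictScalars F) α = α)
    (hfix' : ∀ m, ∀ α ∈ torsΛ g' m, galExt A' Λ s α = α) {m : ℕ} (hm : 1 ≤ m) :
    ‖ι (algebraMap F Ω (Algebra.norm F x' * x⁻¹)) - 1‖ ≤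
      max (unifNorm A Ω Λ ^ (m + 1)) (unifNorm A' Ω Λ ^ (m + 1)) := by
  have hsF := frob_eq_frob_pow (A := A) (F := F) Λ hd hs
  obtain ⟨α, hα1, hα2⟩ := hg.exists_primitive m
  obtain ⟨a, rfl⟩ := hg.exists_algebraMap_eq hα1
  obtain ⟨α', hα1', hα2'⟩ := hg'.exists_primitive m
  obtain ⟨a', rfl⟩ := hg'.exists_algebraMap_eq hα1'
  have ha := mem_primΛ.2 ⟨hα1, hα2⟩
  have ha' := mem_primΛ.2 ⟨hα1', hα2'⟩
  obtain ⟨ζ, hζ⟩ := exists_isPrimitiveRoot A F Λ (Ω := Ω) hd1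
  obtain ⟨ζ', hζ'⟩ := exists_isPrimitiveRoot A' F' Λ (Ω := Ω) le_rfl
  have hζm : ζ ∈ unr A F Ω d := mem_unr_of_pow_eq hd1 (isPrimitiveRoot_pow_eq hd1 hζ)
  have hζm' : ζ' ∈ unr A' F' Ω 1 := mem_unr_of_pow_eq le_rfl (isPrimitiveRoot_pow_eq le_rfl hζ')
  -- `T` is generated by elements fixed by `s`, and it contains both Lubin–Tate levels; a
  -- uniformizer of `T` links the two norm computations.
  let T := IntermediateField.adjoin F' ({ζ, ζ', a, a'} : Set Ω)
  have hTfd : FiniteDimensional F' T := by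
    refine IntermediateField.finiteDimensional_adjoin fun x _ ↦ Algebra.IsIntegral.isIntegral x
  have hTfd' : FiniteDimensional F T := Module.Finite.trans F' T
  have hsub := IntermediateField.subset_adjoin F' ({ζ, ζ', a, a'} : Set Ω)
  have hsT : ∀ y ∈ T, s y = y := by
    intro y hy
    refine eqOn_adjoin (σ := s.toAlgHom) (τ := AlgHom.id F' Ω) ?_ hy
    intro z hz
    change s z = z
    rcases hz with rfl | rfl | rfl | rfl
    · rw [hsF _ (unr_le_maxUnr hd1 hζm), frob_pow_eq_self Λ hd1 hζm]
    · rw [hs _ (unr_le_maxUnr le_rfl hζm'), ← pow_one (frob A' F' Ω),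
        frob_pow_eq_self Λ le_rfl hζm']
    · apply (algebraMap Ω Λ).injective
      have := hfix _ _ hα1
      rwa [galExt_algebraMap] at this
    · apply (algebraMap Ω Λ).injective
      have := hfix' _ _ hα1'
      rwa [galExt_algebraMap] at this
  have hF : ∀ c : F, algebraMap F Ω c ∈ T.toSubfield := fun c ↦ by
    rw [IsScalarTower.algebraMap_apply F F' Ω]
    exact T.algebraMap_mem _
  have hE : ∀ y ∈ (unr A F Ω d)⟮a⟯, y ∈ T.toSubfield := by
    intro y hy
    refine mem_of_mem_adjoin (fun c ↦ ?_) ?_ hy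
    · have hc := (unr_eq_adjoin_simple hd1 hζ).le c.2
      exact mem_of_mem_adjoin hF (Set.singleton_subset_iff.2 (hsub (by simp))) hc
    · exact Set.singleton_subset_iff.2 (hsub (by simp))
  have hE' : ∀ y ∈ (unr A' F' Ω 1)⟮a'⟯, y ∈ T.toSubfield := by
    intro y hy
    refine mem_of_mem_adjoin (fun c ↦ ?_) ?_ hy
    · have hc := (unr_eq_adjoin_simple le_rfl hζ').le c.2
      exact mem_of_mem_adjoin (fun c ↦ T.algebraMap_mem c)
        (Set.singleton_subset_iff.2 (hsub (by simp))) hc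
    · exact Set.singleton_subset_iff.2 (hsub (by simp))
  -- Because `s` fixes `T` and acts as Frobenius on roots of unity, residue classes of `T` are
  -- already those of `F'`. Since `resCard A' = resCard A ^ d`, they are also those of the
  -- unramified extension of `F` of degree `d`. So `T` is totally ramified over both levels.
  have hres : ∀ y : T, ‖ι (algebraMap T Ω y)‖ = 1 →
      ∃ ζ : Ω, ζ ^ resCard A' = ζ ∧ ‖ι (algebraMap T Ω y) - ι ζ‖ < 1 := fun y hy ↦
    exists_teichmuller_of_fixed hs (hsT y y.2) hy
  obtain ⟨t, ht⟩ := exists_isUniformizer A' F' T (Ω := Ω) (Λ := Λ)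
  have hu : ∃ u : F, Algebra.norm F t * u = x⁻¹ ∧
      ‖ι (algebraMap F Ω u) - 1‖ ≤ unifNorm A Ω Λ ^ (m + 1) := by
    let i : (unr A F Ω d)⟮a⟯ →+* T :=
      (algebraMap (unr A F Ω d)⟮a⟯ Ω).codRestrict T fun y ↦ hE y y.2
    let := i.toAlgebra
    have : IsScalarTower F (unr A F Ω d)⟮a⟯ T := IsScalarTower.of_algebraMap_eq fun c ↦
      rfl
    have : IsScalarTower (unr A F Ω d)⟮a⟯ T Ω := IsScalarTower.of_algebraMap_eq fun _ ↦ rfl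
    obtain ⟨u, h1, h2⟩ := hg.norm_algebraNorm_sub_le hd1 hgn ha ht fun y hy ↦ by
      obtain ⟨ζ, h1, h2⟩ := hres y hy
      exact ⟨ζ, mem_unr_of_pow_eq hd1 (hd ▸ h1), h2⟩
    refine ⟨u, h1.trans ?_, h2⟩
    apply (algebraMap F Ω).injective
    apply (algebraMap Ω Λ).injective
    rw [hg.algebraNorm_gen hd1 hgn ha hm, hpi]
  have hu' : ∃ u : F', Algebra.norm F' t * u = x'⁻¹ ∧
      ‖ι (algebraMap F' Ω u) - 1‖ ≤ unifNorm A' Ω Λ ^ (m + 1) := by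
    let i : (unr A' F' Ω 1)⟮a'⟯ →+* T :=
      (algebraMap (unr A' F' Ω 1)⟮a'⟯ Ω).codRestrict T fun y ↦ hE' y y.2
    let := i.toAlgebra
    have : IsScalarTower F' (unr A' F' Ω 1)⟮a'⟯ T := IsScalarTower.of_algebraMap_eq fun c ↦ rfl
    have : IsScalarTower (unr A' F' Ω 1)⟮a'⟯ T Ω := IsScalarTower.of_algebraMap_eq fun _ ↦ rfl
    obtain ⟨u, h1, h2⟩ := hg'.norm_algebraNorm_sub_le le_rfl hgn' ha' ht fun y hy ↦ by
      obtain ⟨ζ, h1, h2⟩ := hres y hy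
      exact ⟨ζ, mem_unr_of_pow_eq le_rfl (by rwa [pow_one]), h2⟩
    refine ⟨u, h1.trans ?_, h2⟩
    apply (algebraMap F' Ω).injective
    apply (algebraMap Ω Λ).injective
    rw [hg'.algebraNorm_gen le_rfl hgn' ha' hm, hpi']
  obtain ⟨u, h1, h2⟩ := hu
  obtain ⟨u', h1', h2'⟩ := hu'
  have hρ0 := unifNorm_pos F' (A := A') (Ω := Ω) (Λ := Λ)
  have hρ1 := unifNorm_lt_one F' (A := A') (Ω := Ω) (Λ := Λ)
  have h3 := norm_algebraNorm_sub_one_le (A := A) (F := F) (pow_nonneg hρ0.le _)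
    (pow_le_one₀ hρ0.le hρ1.le) h2'
  have hNt : Algebra.norm F t ≠ 0 := Algebra.norm_ne_zero_iff.2 ht.ne_zero
  have h4 : Algebra.norm F t * Algebra.norm F u' = (Algebra.norm F x')⁻¹ := by
    rw [← Algebra.norm_norm (S := F'), ← map_mul, h1']
    exact eq_inv_of_mul_eq_one_left (by rw [← map_mul, inv_mul_cancel₀ hx', map_one])
  have hNx : Algebra.norm F x' ≠ 0 := Algebra.norm_ne_zero_iff.2 hx'
  have hNu : Algebra.norm F u' ≠ 0 := by
    intro h
    rw [h, mul_zero] at h4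
    exact inv_ne_zero hNx h4.symm
  -- The norm of `t` to `F` is computed through the level over `F` and, by transitivity, through the
  -- level over `F'`; dividing the two eliminates `t`.
  have h5 : Algebra.norm F x' * x⁻¹ = u / Algebra.norm F u' := by
    rw [eq_div_iff hNu, ← h1]
    have h6 : Algebra.norm F x' * (Algebra.norm F t * Algebra.norm F u') = 1 := by
      rw [h4, mul_inv_cancel₀ hNx]
    linear_combination u * h6
  have h7 : ‖ι (algebraMap F Ω (Algebra.norm F u'))‖ = 1 := by
    have h8 : ‖ι (algebraMap F Ω (Algebra.norm F u')) - 1‖ < 1 :=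
      h3.trans_lt (pow_lt_one₀ hρ0.le hρ1 (Nat.succ_ne_zero m))
    have h9 := IsUltrametricDist.norm_add_eq_max_of_norm_ne_norm
      (x := ι (algebraMap F Ω (Algebra.norm F u')) - 1) (y := 1) (by rw [norm_one]; exact h8.ne)
    rwa [sub_add_cancel, norm_one, max_eq_right h8.le] at h9
  have h10 : ι (algebraMap F Ω (Algebra.norm F u')) ≠ 0 := by
    rw [← norm_ne_zero_iff, h7]
    exact one_ne_zero
  rw [h5, map_div₀, map_div₀, div_sub_one h10, norm_div, h7, div_one,
    ← sub_sub_sub_cancel_right _ _ (1 : Λ)]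
  exact (norm_sub_le_max' _ _).trans (max_le_max h2 h3)

/-- With polynomials whose torsion is fixed by `s`, the quotient of the two elements is within `ρ ^
(m + 1)`, for the larger of the two `ρ`, of 1. This holds for every `m ≥ 1`, hence the quotient is
1. -/
theorem IsLift.algebraNorm_eq (hf : IsLT f) (hf' : IsLT f') {d : ℕ} (hd1 : 1 ≤ d)
    (hd : resCard A' = resCard A ^ d) {x : F} {x' : F'} {s : Ω ≃ₐ[F'] Ω} (hs' : IsLift f' x' 1 s)
    (hs : IsLift f x d (s.restrictScalars F)) : Algebra.norm F x' = x := by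
  obtain ⟨g, hg, hgn, hpi, hfix⟩ := hs.exists_fixed hf hd1
  have hs1 : IsLift f' x' (1 : ℕ) s := by exact_mod_cast hs'
  obtain ⟨g', hg', hgn', hpi', hfix'⟩ := hs1.exists_fixed hf' le_rfl
  have hfrob : ∀ y ∈ maxUnr A' F' Ω, s y = frob A' F' Ω y := fun y hy ↦ by
    have := hs'.eq_frob y hy
    rwa [zpow_one] at this
  have hb := fun m hm ↦ norm_algebraNorm_mul_sub_one_le hd1 hd hg hg' hgn hgn'
    hs'.ne_zero hpi hpi' hfrob hfix hfix' (m := m) hm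
  have h0 : ∀ r : ℝ, 0 < r → r < 1 →
      Filter.Tendsto (fun m : ℕ ↦ r ^ (m + 1)) Filter.atTop (nhds 0) := fun r h h' ↦
    (tendsto_pow_atTop_nhds_zero_of_lt_one h.le h').comp (Filter.tendsto_add_atTop_nat 1)
  have hlim := (h0 _ (unifNorm_pos F (A := A) (Ω := Ω) (Λ := Λ)) (unifNorm_lt_one F)).max
    (h0 _ (unifNorm_pos F' (A := A') (Ω := Ω) (Λ := Λ)) (unifNorm_lt_one F'))
  rw [max_self] at hlim
  have h1 : ‖ι (algebraMap F Ω (Algebra.norm F x' * x⁻¹)) - 1‖ ≤ 0 :=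
    ge_of_tendsto hlim (Filter.eventually_atTop.2 ⟨1, hb⟩)
  rw [norm_le_zero_iff, sub_eq_zero, ← map_one (algebraMap Ω Λ),
    (algebraMap Ω Λ).injective.eq_iff, ← map_one (algebraMap F Ω),
    (algebraMap F Ω).injective.eq_iff, mul_inv_eq_one₀ hs.ne_zero] at h1
  exact h1

/-- Base change for the reciprocity map on automorphisms of the separable closure. -/
theorem IsLift.baseChange [Algebra A A'] [IsScalarTower A A' Ω] (hf : IsLT f) (hf' : IsLT f')
    {x' : F'} {j : ℤ} {s : Ω ≃ₐ[F'] Ω} (hs : IsLift f' x' j s) :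
    ∃ k, IsLift f (Algebra.norm F x') k (s.restrictScalars F) := by
  obtain ⟨d, hd1, hd⟩ := exists_resCard_eq_pow A F A' F' Ω Λ
  -- The automorphisms that satisfy base change for some element form a group. It contains
  -- everything inducing the Frobenius of `F'`, and uniqueness of the element finally identifies it
  -- with `x'`.
  let P : (Ω ≃ₐ[F'] Ω) → Prop := fun s ↦ ∃ (x' : F') (j k : ℤ), IsLift f' x' j s ∧
    IsLift f (Algebra.norm F x') k (s.restrictScalars F)
  have hP1 : ∀ s : Ω ≃ₐ[F'] Ω, (∀ y ∈ maxUnr A' F' Ω, s y = (frob A' F' Ω ^ (1 : ℤ)) y) → P s := by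
    intro s hs
    obtain ⟨y', hy'⟩ := hf'.exists_isLift hs
    have hs1 := frob_eq_frob_pow (A := A) (F := F) Λ hd (s := s) fun y hy ↦ by
      rw [hs y hy, zpow_one]
    obtain ⟨y, hy⟩ := hf.exists_isLift (s := s.restrictScalars F) (j := d) fun y hy ↦ by
      rw [zpow_natCast]
      exact hs1 y hy
    refine ⟨y', 1, d, hy', ?_⟩
    rwa [hy'.algebraNorm_eq hf hf' hd1 hd hy]
  have hmul : ∀ s t, P s → P t → P (s * t) := by
    rintro s t ⟨x, j, k, h1, h2⟩ ⟨y, j', k', h1', h2'⟩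
    refine ⟨x * y, _, k + k', h1.mul hf' h1', ?_⟩
    rw [map_mul]
    exact h2.mul hf h2'
  have hinv : ∀ s, P s → P s⁻¹ := by
    rintro s ⟨x, j, k, h1, h2⟩
    refine ⟨x⁻¹, _, -k, h1.inv hf', ?_⟩
    have : Algebra.norm F x⁻¹ = (Algebra.norm F x)⁻¹ :=
      eq_inv_of_mul_eq_one_left (by rw [← map_mul, inv_mul_cancel₀ h1.ne_zero, map_one])
    rw [this]
    exact h2.inv hf
  let G : Subgroup (Ω ≃ₐ[F'] Ω) :=
    { carrier := {s | P s}
      mul_mem' := fun {s t} ↦ hmul s t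
      one_mem' := ⟨1, 0, 0, isLift_one hf', by rw [map_one]; exact isLift_one hf⟩
      inv_mem' := fun {s} ↦ hinv s }
  have hfr : frob A' F' Ω ∈ G := hP1 _ fun y _ ↦ by rw [zpow_one]
  -- Correcting `s` by a power of a Frobenius lift makes it act as the first power of Frobenius, the
  -- case already settled.
  have hst : s * frob A' F' Ω ^ (1 - j) ∈ G := hP1 _ fun y hy ↦ by
    rw [AlgEquiv.mul_apply, hs.eq_frob _ (galois_mem_maxUnr _ hy), ← AlgEquiv.mul_apply, ← zpow_add,
      add_sub_cancel]
  have hsG : s ∈ G := by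
    have := G.mul_mem hst (G.zpow_mem hfr (j - 1))
    rwa [mul_assoc, ← zpow_add, sub_add_sub_cancel, sub_self, zpow_zero, mul_one] at this
  obtain ⟨y', i, k, h1, h2⟩ := hsG
  rw [IsLift.unique hf' hs h1]
  exact ⟨k, h2⟩

end BaseChange

/-! ### The data of the statement inside the completion -/

namespace Datum

section Link

variable {A F Ω Λ : Type*} [CommRing A] [IsDomain A] [IsDiscreteValuationRing A]
  [Finite (IsLocalRing.ResidueField A)] [Field F] [Algebra A F] [IsFractionRing A F]
  [Field Ω] [Algebra F Ω] [Algebra A Ω] [IsScalarTower A F Ω] [IsSepClosure F Ω]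
  [NormedField Λ] [CompleteSpace Λ] [IsUltrametricDist Λ] [Algebra Ω Λ]

local notation "ι" => algebraMap Ω Λ
local notation "q" => resCard A
local notation "ρ" => unifNorm A Ω Λ
local notation "𝓡" => unrRing A F Ω Λ
local notation "Φ" => frobR A F Ω Λ
local notation "ϖ" => unifR A F Ω Λ

variable (Λ) in
/-- The embedding of `O_L` into the completed maximal unramified extension. -/
def toUnr [LocalCompletion A F Ω Λ] (D : Datum A F Ω) : D.OL →+* 𝓡 :=
  ((algebraMap Ω Λ).comp (algebraMap D.OL Ω)).codRestrict 𝓡 fun a ↦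
    algebraMap_mem_unrRing (unr_le_maxUnr D.one_le_n (a : D.L).2) (norm_intRing_le_one a)

variable [LocalCompletion A F Ω Λ] (D : Datum A F Ω)

local notation "𝐞" => toUnr Λ D

theorem coe_toUnr (a : D.OL) : (𝐞 a : Λ) = ι ((a : D.L) : Ω) := rfl

theorem toUnr_injective : Function.Injective 𝐞 := fun _ _ h ↦
  Subtype.ext (Subtype.ext ((algebraMap Ω Λ).injective (congrArg Subtype.val h)))

theorem toUnr_φO (i : ℤ) (a : D.OL) : 𝐞 (D.φO i a) = Φ i (𝐞 a) := by
  apply Subtype.ext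
  rw [coe_frobR, coe_toUnr, coe_toUnr, galExt_algebraMap,
    ← coe_arithFrob_unr_zpow Λ D.one_le_n]
  rfl

variable (Λ) in
/-- The Lubin-Tate polynomial of the datum. -/
def poly : Polynomial 𝓡 := D.f.map 𝐞

theorem norm_π : ‖ι ((D.π : D.L) : Ω)‖ = ρ := by
  have h1 : D.π ∈ maxIdeal D.OL := D.span_π ▸ Ideal.mem_span_singleton_self _
  rw [mem_maxIdeal_iff (Λ := Λ)] at h1
  apply le_antisymm
  · exact norm_le_unifNorm (x := 𝐞 D.π) h1
  · have h2 : algebraMap A D.OL (unif A) ∈ maxIdeal D.OL := by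
      rw [mem_maxIdeal_iff (Λ := Λ)]
      exact (unifNorm_lt_one F (A := A) (Ω := Ω) (Λ := Λ))
    rw [← D.span_π, Ideal.mem_span_singleton] at h2
    obtain ⟨c, hc⟩ := h2
    have h3 : ρ = ‖ι ((D.π : D.L) : Ω)‖ * ‖ι ((c : D.L) : Ω)‖ := by
      rw [← norm_mul, ← map_mul]
      exact congrArg (fun x : D.OL ↦ ‖ι ((x : D.L) : Ω)‖) hc
    rw [h3]
    exact mul_le_of_le_one_right (norm_nonneg _) (norm_intRing_le_one c)

theorem isLT_poly : IsLT (D.poly Λ) where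
  monic := D.monic.map _
  coeff_zero := by rw [poly, coeff_map, D.coeff_zero, map_zero]
  norm_coeff_one := by rw [poly, coeff_map, D.coeff_one, coe_toUnr, D.norm_π]
  dvd := by
    rw [C_dvd_iff_dvd_coeff]
    intro i
    have h := (mem_maxIdeal_iff (Λ := Λ)).1 (D.congr_X_pow i)
    have h1 : (D.poly Λ - X ^ q).coeff i = 𝐞 ((D.f - X ^ q).coeff i) := by
      rw [← coeff_map, Polynomial.map_sub, Polynomial.map_pow, map_X, poly]
    rw [h1, unifR_dvd_iff]
    exact h
  lifts := by
    rw [lifts_iff_coeff_lifts]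
    intro i
    rw [coeff_map, poly, coeff_map]
    exact ⟨⟨_, unr_le_maxUnr D.one_le_n (D.f.coeff i : D.L).2⟩, rfl⟩

theorem map_toUnr_φO (i : ℤ) (p : Polynomial D.OL) :
    (p.map (D.φO i)).map 𝐞 = (p.map 𝐞).map (Φ i) := by
  ext k
  simp only [coeff_map, toUnr_φO]

theorem series_map_toUnr_φO (i : ℤ) (p : PowerSeries D.OL) :
    (PowerSeries.map (D.φO i) p).map 𝐞 = (p.map 𝐞).map (Φ i) := by
  ext k
  simp only [PowerSeries.coeff_map, toUnr_φO]

theorem ltIter_poly (m : ℕ) : ltIter (D.poly Λ) m = (D.fIter m).map 𝐞 := by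
  induction m with
  | zero => rw [ltIter, fIter, map_X]
  | succ m ih => rw [ltIter, fIter, Polynomial.map_comp, ih, map_toUnr_φO, poly]

theorem algebraMap_aeval (b : Ω) (p : Polynomial D.OL) :
    ι (aeval b p) = aeval (ι b) (p.map 𝐞) := by
  rw [aeval_def, hom_eval₂, aeval_def, eval₂_map]
  rfl

theorem mem_torsion_iff {m : ℕ} {b : Ω} : b ∈ D.torsion m ↔ ι b ∈ torsΛ (D.poly Λ) m := by
  rw [D.isLT_poly.mem_tors, D.ltIter_poly, ← algebraMap_aeval, map_eq_zero]
  rfl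

theorem coe_φ_zpow (Λ : Type*) [NormedField Λ] [CompleteSpace Λ] [IsUltrametricDist Λ]
    [Algebra Ω Λ] [LocalCompletion A F Ω Λ] (D : Datum A F Ω) (j : ℤ) (x : D.L) :
    ((D.φ ^ j) x : Ω) = (frob A F Ω ^ j) x :=
  coe_arithFrob_unr_zpow Λ D.one_le_n j x

theorem algebraMap_piNat (m : ℕ) : ι (D.piNat m : Ω) = piR (D.poly Λ) m := by
  have h1 : (D.piNat m : Ω) = ∏ t ∈ Finset.range m, ((D.φ ^ t) (D.π : D.L) : Ω) :=
    map_prod (algebraMap D.L Ω) _ _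
  have h2 : ((piR (D.poly Λ) m : 𝓡) : Λ) =
      ∏ t ∈ Finset.range m, ((Φ t ((D.poly Λ).coeff 1) : 𝓡) : Λ) := map_prod (algebraMap 𝓡 Λ) _ _
  rw [h1, h2, map_prod]
  refine Finset.prod_congr rfl fun t _ ↦ ?_
  rw [coe_frobR, poly, coeff_map, D.coeff_one, coe_toUnr, galExt_algebraMap,
    ← coe_φ_zpow Λ, zpow_natCast]

theorem algebraMap_piInt (j : ℤ) : ι (D.piInt j : Ω) = piZ (D.poly Λ) j := by
  cases j with
  | ofNat m => exact D.algebraMap_piNat m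
  | negSucc m =>
    rw [piZ, ← D.algebraMap_piNat, ← map_inv₀, galExt_algebraMap, piInt, coe_φ_zpow Λ]
    rfl

theorem hasVal_iff {x : Fˣ} {n : ℤ} : HasVal A x n ↔ ‖ι (algebraMap F Ω x)‖ = ρ ^ n := by
  have hspan : Ideal.span {unif A} = maxIdeal A := by
    rw [maxIdeal_eq_maximalIdeal, (IsDiscreteValuationRing.irreducible_iff_uniformizer _).1
      (irreducible_unif A)]
  constructor
  · rintro ⟨p, hp, u, hx⟩
    rw [← hspan, Ideal.span_singleton_eq_span_singleton] at hp
    obtain ⟨w, hw⟩ := hp.symm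
    have h1 : (x : F) = algebraMap A F (u * w ^ n : Aˣ) * algebraMap A F (unif A) ^ n := by
      have h2 : algebraMap A F ((w ^ n : Aˣ) : A) = (algebraMap A F w) ^ n := by
        have h3 : ∀ v : Aˣ, algebraMap A F (v : A) =
            ((Units.map (algebraMap A F : A →* F) v : Fˣ) : F) := fun _ ↦ rfl
        rw [h3, h3, map_zpow, Units.val_zpow_eq_zpow_val]
      rw [hx, ← hw, Units.val_mul, map_mul, map_mul, h2, mul_zpow]
      ring
    rw [h1, norm_unit_mul_zpow]
  · intro h
    obtain ⟨u, k, hx⟩ := exists_eq_unit_mul_zpow (A := A) x.ne_zero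
    rw [hx, norm_unit_mul_zpow] at h
    have := unifNorm_zpow_injective F (A := A) (Ω := Ω) (Λ := Λ) h
    exact ⟨unif A, hspan, u, this ▸ hx⟩

/-- The embedding of `O_L` is injective and intertwines the Frobenius maps, so each of the three
defining conditions can be checked after it. -/
theorem isBracket_iff {j : ℤ} {x : F} {θ : 𝓡}
    (hθ : (θ : Λ) = ι (algebraMap F Ω x) * piZ (D.poly Λ) j) {g : PowerSeries D.OL} :
    D.IsBracket j (algebraMap F D.L x * D.piInt j) g ↔
      IsBrk (D.poly Λ) ((D.poly Λ).map (Φ j)) θ (PowerSeries.map 𝐞 g) := by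
  have hinj : Function.Injective (PowerSeries.map 𝐞) := fun a b h ↦ by
    ext k
    have := congrArg (PowerSeries.coeff k) h
    rw [PowerSeries.coeff_map, PowerSeries.coeff_map] at this
    exact congrArg (fun y : D.OL ↦ ((y : D.L) : Ω)) (D.toUnr_injective this)
  have h0 : PowerSeries.constantCoeff (PowerSeries.map 𝐞 g) = 0 ↔
      PowerSeries.constantCoeff g = 0 := by
    rw [← PowerSeries.coeff_zero_eq_constantCoeff_apply, PowerSeries.coeff_map,
      PowerSeries.coeff_zero_eq_constantCoeff_apply, map_eq_zero_iff _ D.toUnr_injective]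
  have h1 : PowerSeries.coeff 1 (PowerSeries.map 𝐞 g) = θ ↔
      ((PowerSeries.coeff 1 g : D.OL) : D.L) = algebraMap F D.L x * D.piInt j := by
    rw [PowerSeries.coeff_map, ← Subtype.coe_inj, hθ, coe_toUnr, ← D.algebraMap_piInt, ← map_mul,
      (algebraMap Ω Λ).injective.eq_iff, ← Subtype.coe_inj]
    rfl
  have h2 : PowerSeries.constantCoeff g = 0 → ((PowerSeries.subst g
      ((D.f.map (D.φO j) : D.OL[X]) : PowerSeries D.OL) =
        PowerSeries.subst ((D.f : D.OL[X]) : PowerSeries D.OL) (PowerSeries.map (D.φO 1) g)) ↔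
      (PowerSeries.subst (PowerSeries.map 𝐞 g) (((D.poly Λ).map (Φ j) : Polynomial 𝓡) :
        PowerSeries 𝓡) : PowerSeries 𝓡) = PowerSeries.subst ((D.poly Λ : Polynomial 𝓡) :
          PowerSeries 𝓡) (PowerSeries.map (Φ 1) (PowerSeries.map 𝐞 g))) := by
    intro hg
    have hf0 : PowerSeries.constantCoeff ((D.f : D.OL[X]) : PowerSeries D.OL) = 0 := by
      rw [← PowerSeries.coeff_zero_eq_constantCoeff_apply, Polynomial.coeff_coe, D.coeff_zero]
    rw [← hinj.eq_iff, map_subst_of_zero _ hg, map_subst_of_zero _ hf0, series_map_toUnr_φO,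
      ← polynomial_map_coe, ← polynomial_map_coe, map_toUnr_φO]
    rfl
  constructor
  · rintro ⟨a, b, c⟩
    exact ⟨h0.2 a, h1.2 b, (h2 a).1 c⟩
  · rintro ⟨a, b, c⟩
    exact ⟨h0.1 a, h1.1 b, (h2 (h0.1 a)).2 c⟩

theorem exists_toUnr_eq {x : 𝓡} (hx : Φ D.n x = x) : ∃ a : D.OL, 𝐞 a = x := by
  obtain ⟨y, hy, h⟩ := exists_unr_of_frobR_eq D.one_le_n hx
  obtain ⟨a, ha⟩ := exists_intRing_eq (A := A) (Λ := Λ) hy (by rw [h]; exact norm_unrRing_le x)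
  exact ⟨a, Subtype.ext (by rw [coe_toUnr, ha, h])⟩

theorem frobR_toUnr (a : D.OL) : Φ D.n (𝐞 a) = 𝐞 a := by
  apply Subtype.ext
  rw [coe_frobR, coe_toUnr, galExt_algebraMap, zpow_natCast,
    frob_pow_eq_self Λ D.one_le_n (a : D.L).2]

theorem poly_map_frobR : (D.poly Λ).map (Φ D.n) = D.poly Λ := by
  ext k : 1
  rw [coeff_map, poly, coeff_map, frobR_toUnr]

/-- The brackets of the completed theory have coefficients in `O_L`. -/
theorem exists_series_eq {j : ℤ} {x : F} {θ : 𝓡}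
    (hθ : (θ : Λ) = ι (algebraMap F Ω x) * piZ (D.poly Λ) j) {h : PowerSeries 𝓡}
    (hh : IsBrk (D.poly Λ) ((D.poly Λ).map (Φ j)) θ h) :
    ∃ g : PowerSeries D.OL, PowerSeries.map 𝐞 g = h := by
  have hθn : Φ D.n θ = θ := by
    apply Subtype.ext
    rw [coe_frobR, hθ, ← D.algebraMap_piInt, ← map_mul, galExt_algebraMap, zpow_natCast,
      frob_pow_eq_self Λ D.one_le_n]
    exact mul_mem ((unr A F Ω D.n).algebraMap_mem x) (D.piInt j).2
  -- Twisting the bracket by `φ^n` gives a bracket with the same data, since `f` and `x π_j` are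
  -- defined over `L`. By uniqueness its coefficients are fixed by `φ^n`, so they come from `O_L`.
  have h1 := hh.map D.isLT_poly (D.n : ℤ)
  rw [hθn, map_frobR_map, add_comm, ← map_frobR_map, poly_map_frobR] at h1
  have h2 := IsBrk.unique D.isLT_poly (D.isLT_poly.map_frobR j) h1 hh
  have h3 : ∀ k, ∃ a : D.OL, 𝐞 a = PowerSeries.coeff k h := fun k ↦
    D.exists_toUnr_eq (by rw [← PowerSeries.coeff_map, h2])
  choose c hc using h3
  refine ⟨PowerSeries.mk c, ?_⟩
  ext k : 1
  rw [PowerSeries.coeff_map, PowerSeries.coeff_mk, hc]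

end Link

end Datum

namespace Datum

/-! ### Values of power series at torsion points of a datum -/

section Artin

variable {A F Ω Λ : Type*} [CommRing A] [IsDomain A] [IsDiscreteValuationRing A]
  [Finite (IsLocalRing.ResidueField A)] [Field F] [Algebra A F] [IsFractionRing A F]
  [Field Ω] [Algebra F Ω] [Algebra A Ω] [IsScalarTower A F Ω] [IsSepClosure F Ω]
  [NormedField Λ] [CompleteSpace Λ] [IsUltrametricDist Λ] [Algebra Ω Λ]

local notation "ι" => algebraMap Ω Λ
local notation "q" => resCard A
local notation "ρ" => unifNorm A Ω Λ
local notation "𝓡" => unrRing A F Ω Λ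
local notation "Φ" => frobR A F Ω Λ
local notation "ϖ" => unifR A F Ω Λ

variable [LocalCompletion A F Ω Λ] (D : Datum A F Ω)

local notation "𝐞" => toUnr Λ D

theorem finite_torsion (Λ : Type*) [NormedField Λ] [CompleteSpace Λ] [IsUltrametricDist Λ]
    [Algebra Ω Λ] [LocalCompletion A F Ω Λ] (D : Datum A F Ω) (m : ℕ) : (D.torsion m).Finite := by
  refine Set.Finite.of_injOn (f := algebraMap Ω Λ) (t := (torsΛ (D.poly Λ) m : Set Λ))
    (fun b hb ↦ D.mem_torsion_iff.1 hb) (algebraMap Ω Λ).injective.injOn (Finset.finite_toSet _)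

theorem finiteDimensional_level (Λ : Type*) [NormedField Λ] [CompleteSpace Λ]
    [IsUltrametricDist Λ] [Algebra Ω Λ] [LocalCompletion A F Ω Λ] (D : Datum A F Ω) (m : ℕ) :
    FiniteDimensional F (D.level m) := by
  have h1 := finiteDimensional_unr A F Ω Λ D.one_le_n
  have h2 : FiniteDimensional F (IntermediateField.adjoin F (D.torsion m)) := by
    have := (D.finite_torsion Λ m).to_subtype
    exact IntermediateField.finiteDimensional_adjoin fun x _ ↦ Algebra.IsIntegral.isIntegral x
  exact IntermediateField.finiteDimensional_sup _ _

/-- Powers of the maximal ideal in terms of a uniformizer. -/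
theorem mem_maxIdeal_pow_iff {E : IntermediateField F Ω} {t : E} (ht : IsUniformizer Ω Λ t)
    (N : ℕ) (c : intRing A E) :
    c ∈ maxIdeal (intRing A E) ^ N ↔ ‖ι ((c : E) : Ω)‖ ≤ ‖ι (t : Ω)‖ ^ N := by
  have ht1 : ‖ι (t : Ω)‖ < 1 := ht.norm_lt_one
  have ht0 : 0 < ‖ι (t : Ω)‖ := ht.norm_pos
  obtain ⟨p, hp⟩ := exists_intRing_eq (A := A) (Λ := Λ) t.2 ht1.le
  have hspan : maxIdeal (intRing A E) = Ideal.span {p} := by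
    apply le_antisymm
    · intro a ha
      rw [mem_maxIdeal_iff (Λ := Λ)] at ha
      rw [Ideal.mem_span_singleton]
      rcases eq_or_ne a 0 with rfl | ha0
      · exact dvd_zero _
      have ha1 : (a : E) ≠ 0 := by simpa using ha0
      obtain ⟨k, hk⟩ := ht.exists_zpow (a : E) ha1
      have hk' : ‖ι ((a : E) : Ω)‖ = ‖ι (t : Ω)‖ ^ k := hk
      have hk1 : 1 ≤ k := by
        by_contra! h
        rw [hk'] at ha
        exact (one_le_zpow_of_nonpos₀ ht0 ht1.le (by omega)).not_gt ha
      obtain ⟨b, hb⟩ := exists_intRing_eq (A := A) (Λ := Λ) (x := (a : E) / (t : Ω))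
        (div_mem (a : E).2 t.2) (by
          rw [map_div₀, norm_div, hk', div_le_one ht0]
          calc _ ≤ ‖ι (t : Ω)‖ ^ (1 : ℤ) := zpow_le_zpow_right_of_le_one₀ ht0 ht1.le hk1
            _ = _ := zpow_one _)
      refine ⟨b, Subtype.ext (Subtype.ext ?_)⟩
      change ((a : E) : Ω) = ((p : E) : Ω) * ((b : E) : Ω)
      rw [hp, hb, mul_div_cancel₀]
      simpa using ht.ne_zero
    · rw [Ideal.span_singleton_le_iff_mem, mem_maxIdeal_iff (Λ := Λ), hp]
      exact ht1
  rw [hspan, Ideal.span_singleton_pow, Ideal.mem_span_singleton]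
  constructor
  · rintro ⟨b, rfl⟩
    have : (((p ^ N * b : intRing A E) : E) : Ω) = (t : Ω) ^ N * ((b : E) : Ω) := by
      rw [← hp]
      rfl
    rw [this, map_mul, map_pow, norm_mul, norm_pow]
    exact mul_le_of_le_one_right (by positivity) (norm_intRing_le_one b)
  · intro h
    have ht0' : (t : Ω) ≠ 0 := by simpa using ht.ne_zero
    obtain ⟨b, hb⟩ := exists_intRing_eq (A := A) (Λ := Λ) (x := (c : E) / (t : Ω) ^ N)
      (div_mem (c : E).2 (pow_mem t.2 N)) (by
        rw [map_div₀, norm_div, map_pow, norm_pow, div_le_one (by positivity)]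
        exact h)
    refine ⟨b, Subtype.ext (Subtype.ext ?_)⟩
    change ((c : E) : Ω) = ((p : E) : Ω) ^ N * ((b : E) : Ω)
    rw [hp, hb, mul_div_cancel₀ _ (pow_ne_zero N ht0')]

theorem torsion_mem_level {m : ℕ} {α : Ω} (hα : α ∈ D.torsion m) : α ∈ D.level m :=
  (le_sup_right : _ ≤ D.level m) (IntermediateField.subset_adjoin F _ hα)

theorem aeval_mem_level {m : ℕ} {α : Ω} (hα : α ∈ D.torsion m) (p : Polynomial D.OL) :
    aeval α p ∈ D.level m := by
  rw [aeval_eq_sum_range]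
  refine sum_mem fun i _ ↦ ?_
  rw [Algebra.smul_def]
  exact mul_mem ((le_sup_left : D.L ≤ D.level m) (p.coeff i : D.L).2)
    (pow_mem (D.torsion_mem_level hα) _)

theorem norm_evR_sub_le {m : ℕ} {α : Ω} (hα : α ∈ D.torsion m) (g : PowerSeries D.OL) (N : ℕ) :
    ‖evR (ι α) (PowerSeries.map 𝐞 g) - ι (aeval α (PowerSeries.trunc N g))‖ ≤ ‖ι α‖ ^ N := by
  have h := norm_evalSeries_sub_le (i := algebraMap 𝓡 Λ) norm_algebraMap_unrRing_le
    (D.isLT_poly.norm_lt_one (D.mem_torsion_iff.1 hα)) (PowerSeries.map 𝐞 g) N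
  have h1 : (PowerSeries.trunc N (PowerSeries.map 𝐞 g)).eval₂ (algebraMap 𝓡 Λ) (ι α) =
      ι (aeval α (PowerSeries.trunc N g)) := by
    rw [D.algebraMap_aeval, aeval_def]
    congr 1
    ext k : 1
    rw [PowerSeries.coeff_trunc, coeff_map, PowerSeries.coeff_trunc, PowerSeries.coeff_map]
    split_ifs <;> simp
  rw [h1] at h
  exact h

/-- The truncations take values in the level field, which is finite over `F` and therefore closed.
-/
theorem exists_level_eq_evR {m : ℕ} {α : Ω} (hα : α ∈ D.torsion m) (g : PowerSeries D.OL) :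
    ∃ y ∈ D.level m, ι y = evR (ι α) (PowerSeries.map 𝐞 g) := by
  have hα1 := D.isLT_poly.norm_lt_one (D.mem_torsion_iff (Λ := Λ).1 hα)
  have hcl := LocalCompletion.isClosed_image A (Λ := Λ) (D.level m).toSubmodule
    (D.finiteDimensional_level Λ m)
  have hmem : evR (ι α) (PowerSeries.map 𝐞 g) ∈ ι '' ((D.level m).toSubmodule : Set Ω) := by
    rw [← hcl.closure_eq, Metric.mem_closure_iff]
    intro ε hε
    obtain ⟨N, hN⟩ := exists_pow_lt_of_lt_one hε hα1
    refine ⟨_, ⟨_, D.aeval_mem_level hα (PowerSeries.trunc N g), rfl⟩, ?_⟩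
    rw [dist_eq_norm]
    exact (D.norm_evR_sub_le hα g N).trans_lt hN
  obtain ⟨y, hy, h⟩ := hmem
  exact ⟨y, hy, h⟩

/-- In terms of a uniformizer `t` of the level field, membership in powers of the maximal ideal is a
bound by `‖t‖ ^ N`, and `‖α‖ ≤ ‖t‖`. So adic convergence of the truncations is convergence in `Λ`.
-/
theorem isEval_iff {m : ℕ} {α y : Ω} (hα : α ∈ D.torsion m) (g : PowerSeries D.OL) :
    D.IsEval (D.level m) g α y ↔ ι y = evR (ι α) (PowerSeries.map 𝐞 g) := by
  have := D.finiteDimensional_level Λ m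
  have hα1 := D.isLT_poly.norm_lt_one (D.mem_torsion_iff (Λ := Λ).1 hα)
  obtain ⟨t, ht⟩ := exists_isUniformizer A F (D.level m) (Ω := Ω) (Λ := Λ)
  have ht1 : ‖ι (t : Ω)‖ < 1 := ht.norm_lt_one
  have hαt : ‖ι α‖ ≤ ‖ι (t : Ω)‖ := by
    obtain ⟨c, hc⟩ := exists_intRing_eq (A := A) (Λ := Λ) (D.torsion_mem_level hα) hα1.le
    have h1 : c ∈ maxIdeal (intRing A (D.level m)) ^ 1 := by
      rw [pow_one, mem_maxIdeal_iff (Λ := Λ), hc]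
      exact hα1
    rw [mem_maxIdeal_pow_iff ht, hc, pow_one] at h1
    exact h1
  constructor
  · intro h
    refine eq_of_forall_norm_sub_le (norm_nonneg (ι (t : Ω))) ht1 fun N ↦ ?_
    obtain ⟨c, hc, hy⟩ := h N
    rw [mem_maxIdeal_pow_iff ht] at hc
    have h1 : ι y - evR (ι α) (PowerSeries.map 𝐞 g) = ι ((c : D.level m) : Ω) -
        (evR (ι α) (PowerSeries.map 𝐞 g) - ι (aeval α (PowerSeries.trunc N g))) := by
      rw [hy, map_add, show algebraMap (intRing A (D.level m)) Ω c = ((c : D.level m) : Ω) from rfl]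
      ring
    rw [h1]
    exact (norm_sub_le_max' _ _).trans (max_le hc ((D.norm_evR_sub_le hα g N).trans
      (pow_le_pow_left₀ (norm_nonneg _) hαt N)))
  · intro h N
    obtain ⟨z, hz, hyz⟩ := D.exists_level_eq_evR (Λ := Λ) hα g
    have hy : y = z := (algebraMap Ω Λ).injective (h.trans hyz.symm)
    subst hy
    have h1 := (D.norm_evR_sub_le (Λ := Λ) hα g N)
    rw [← h, ← map_sub] at h1
    obtain ⟨c, hc⟩ := exists_intRing_eq (A := A) (Λ := Λ)
      (sub_mem hz (D.aeval_mem_level hα (PowerSeries.trunc N g)))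
      (h1.trans (pow_le_one₀ (norm_nonneg _) hα1.le))
    refine ⟨c, ?_, ?_⟩
    · rw [mem_maxIdeal_pow_iff ht, hc]
      exact h1.trans (pow_le_pow_left₀ (norm_nonneg _) hαt N)
    · rw [show algebraMap (intRing A (D.level m)) Ω c = ((c : D.level m) : Ω) from rfl, hc]
      ring

/-- Only levels `m ≥ 1` enter the union; passing to level `m + 1` covers `m = 0` as well. -/
theorem maxUnr_sup_level_le (Λ : Type*) [NormedField Λ] [CompleteSpace Λ] [IsUltrametricDist Λ]
    [Algebra Ω Λ] [LocalCompletion A F Ω Λ] (D : Datum A F Ω) (m : ℕ) :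
    maxUnr A F Ω ⊔ D.level m ≤ D.lubinTateField := by
  refine le_trans (sup_le_sup le_rfl (sup_le_sup le_rfl (IntermediateField.adjoin.mono F _
    (D.torsion (m + 1)) fun x hx ↦ ?_))) (le_iSup₂ (f := fun (m : ℕ) (_ : 1 ≤ m) ↦
      maxUnr A F Ω ⊔ D.level m) (m + 1) (by omega))
  rw [D.mem_torsion_iff (Λ := Λ)] at hx ⊢
  exact D.isLT_poly.tors_succ hx

theorem maxUnr_le (D : Datum A F Ω) : maxUnr A F Ω ≤ D.lubinTateField :=
  le_sup_left.trans (le_iSup₂ (f := fun (m : ℕ) (_ : 1 ≤ m) ↦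
      maxUnr A F Ω ⊔ D.level m) 1 le_rfl)

theorem level_le (Λ : Type*) [NormedField Λ] [CompleteSpace Λ] [IsUltrametricDist Λ]
    [Algebra Ω Λ] [LocalCompletion A F Ω Λ] (D : Datum A F Ω) (m : ℕ) :
    D.level m ≤ D.lubinTateField :=
  le_sup_right.trans (D.maxUnr_sup_level_le Λ m)

theorem lubinTateField_eq_adjoin (Λ : Type*) [NormedField Λ] [CompleteSpace Λ]
    [IsUltrametricDist Λ] [Algebra Ω Λ] [LocalCompletion A F Ω Λ] (D : Datum A F Ω) :
    D.lubinTateField =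
    IntermediateField.adjoin F ((maxUnr A F Ω : Set Ω) ∪ ⋃ m, D.torsion m) := by
  apply le_antisymm
  · refine iSup₂_le fun m _ ↦ sup_le ?_ (sup_le ?_ ?_)
    · exact fun x hx ↦ IntermediateField.subset_adjoin F _ (Or.inl hx)
    · exact fun x hx ↦ IntermediateField.subset_adjoin F _
        (Or.inl (unr_le_maxUnr D.one_le_n hx))
    · exact IntermediateField.adjoin.mono F _ _ fun x hx ↦ Or.inr (Set.mem_iUnion.2 ⟨m, hx⟩)
  · rw [IntermediateField.adjoin_le_iff]
    rintro x (hx | hx)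
    · exact D.maxUnr_le hx
    · obtain ⟨m, hm⟩ := Set.mem_iUnion.1 hx
      exact D.level_le Λ m (D.torsion_mem_level hm)

end Artin

end Datum

namespace Datum

/-! ### The Artin map as restriction of lifts -/

section Artin

variable {A F Ω Λ : Type*} [CommRing A] [IsDomain A] [IsDiscreteValuationRing A]
  [Finite (IsLocalRing.ResidueField A)] [Field F] [Algebra A F] [IsFractionRing A F]
  [Field Ω] [Algebra F Ω] [Algebra A Ω] [IsScalarTower A F Ω] [IsSepClosure F Ω]
  [NormedField Λ] [CompleteSpace Λ] [IsUltrametricDist Λ] [Algebra Ω Λ]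

local notation "ι" => algebraMap Ω Λ
local notation "q" => resCard A
local notation "ρ" => unifNorm A Ω Λ
local notation "𝓡" => unrRing A F Ω Λ
local notation "Φ" => frobR A F Ω Λ
local notation "ϖ" => unifR A F Ω Λ

variable [LocalCompletion A F Ω Λ] {D : Datum A F Ω}

local notation "𝐞" => toUnr Λ D

theorem apply_mem_lubinTateField {x : F} {j : ℤ} {s : Ω ≃ₐ[F] Ω} (hs : IsLift (D.poly Λ) x j s)
    {y : Ω} (hy : y ∈ D.lubinTateField) : s y ∈ D.lubinTateField := by
  suffices h : D.lubinTateField ≤ D.lubinTateField.comap s.toAlgHom from h hy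
  conv_lhs => rw [D.lubinTateField_eq_adjoin Λ]
  rw [IntermediateField.adjoin_le_iff]
  rintro y (hy | hy)
  · exact D.maxUnr_le (galois_mem_maxUnr s hy)
  · obtain ⟨m, hm⟩ := Set.mem_iUnion.1 hy
    obtain ⟨θ, h, hθ, hh, hsα⟩ := hs.exists_brk
    obtain ⟨g, rfl⟩ := D.exists_series_eq hθ hh
    obtain ⟨z, hz, hz'⟩ := D.exists_level_eq_evR (Λ := Λ) hm g
    have h1 := hsα m _ (D.mem_torsion_iff.1 hm)
    rw [galExt_algebraMap, ← hz', (algebraMap Ω Λ).injective.eq_iff] at h1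
    change s y ∈ D.lubinTateField
    rw [h1]
    exact D.level_le Λ m hz

/-- A lift restricts to the Lubin–Tate extension. -/
theorem exists_restrict {x : F} {j : ℤ} {s : Ω ≃ₐ[F] Ω} (hs : IsLift (D.poly Λ) x j s) :
    ∃ σ : D.lubinTateField ≃ₐ[F] D.lubinTateField, ∀ a, (σ a : Ω) = s a := by
  have hs' := hs.inv D.isLT_poly
  let r : (s : Ω ≃ₐ[F] Ω) → (∀ y ∈ D.lubinTateField, s y ∈ D.lubinTateField) →
      (D.lubinTateField →ₐ[F] D.lubinTateField) := fun s h ↦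
    (s.toAlgHom.comp D.lubinTateField.val).codRestrict D.lubinTateField.toSubalgebra
      fun y ↦ h y y.2
  refine ⟨AlgEquiv.ofAlgHom (r s fun y ↦ apply_mem_lubinTateField hs)
    (r s⁻¹ fun y ↦ apply_mem_lubinTateField hs') ?_ ?_, fun a ↦ rfl⟩
  · ext a
    exact s.apply_symm_apply a
  · ext a
    exact s.symm_apply_apply a

theorem isArtin_of_isLift {x : Fˣ} {j : ℤ} {s : Ω ≃ₐ[F] Ω} (hs : IsLift (D.poly Λ) (x : F) j s)
    {σ : D.lubinTateField ≃ₐ[F] D.lubinTateField} (hσ : ∀ a, (σ a : Ω) = s a) :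
    D.IsArtin x σ := by
  obtain ⟨θ, h, hθ, hh, hsα⟩ := hs.exists_brk
  obtain ⟨g, rfl⟩ := D.exists_series_eq hθ hh
  refine ⟨j, hasVal_iff.2 hs.norm_eq, fun a b hab ↦ ?_, g, (D.isBracket_iff hθ).2 hh,
    fun m _ α hα ↦ ?_⟩
  · rw [hσ, hab, coe_arithFrob_maxUnr_zpow Λ, hs.eq_frob b b.2]
  · rw [D.isEval_iff (Λ := Λ) hα, hσ, ← galExt_algebraMap (A := A),
      hsα m _ (D.mem_torsion_iff.1 hα)]

/-- The valuation of `x` fixes the exponent and uniqueness of brackets fixes the series. So both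
maps agree on the maximal unramified extension and on the torsion, which generate the Lubin–Tate
field. -/
theorem IsArtin.coe_apply {x : Fˣ} {j : ℤ} {s : Ω ≃ₐ[F] Ω} (hs : IsLift (D.poly Λ) (x : F) j s)
    {σ : D.lubinTateField ≃ₐ[F] D.lubinTateField} (hσ : D.IsArtin x σ) (a : D.lubinTateField) :
    (σ a : Ω) = s a := by
  obtain ⟨θ, h, hθ, hh, hsα⟩ := hs.exists_brk
  obtain ⟨k, hk, hur, g, hg, hgα⟩ := hσ
  obtain rfl : k = j := by
    have := (hasVal_iff (Λ := Λ) (Ω := Ω)).1 hk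
    rw [hs.norm_eq] at this
    simpa using (unifNorm_zpow_injective F (A := A) (Ω := Ω) (Λ := Λ) this).symm
  rw [D.isBracket_iff hθ] at hg
  have hgh := IsBrk.unique D.isLT_poly (D.isLT_poly.map_frobR k) hg hh
  have key := IntermediateField.algHom_ext_of_eq_adjoin F (D.lubinTateField_eq_adjoin Λ)
    (φ₁ := D.lubinTateField.val.comp σ.toAlgHom) (φ₂ := s.toAlgHom.comp D.lubinTateField.val) (by
      rintro y (hy | hy)
      · have hy' : y ∈ D.lubinTateField := D.maxUnr_le hy
        change (σ ⟨y, hy'⟩ : Ω) = s y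
        rw [hur ⟨y, hy'⟩ ⟨y, hy⟩ rfl, coe_arithFrob_maxUnr_zpow Λ, hs.eq_frob y hy]
      · obtain ⟨m, hm⟩ := Set.mem_iUnion.1 hy
        have hm1 : y ∈ D.torsion (m + 1) :=
          D.mem_torsion_iff.2 (D.isLT_poly.tors_succ (D.mem_torsion_iff (Λ := Λ).1 hm))
        have hy' : y ∈ D.lubinTateField := D.level_le Λ _ (D.torsion_mem_level hm1)
        change (σ ⟨y, hy'⟩ : Ω) = s y
        apply (algebraMap Ω Λ).injective
        have h1 := hgα (m + 1) (by omega) ⟨y, hy'⟩ hm1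
        rw [D.isEval_iff (Λ := Λ) hm1, hgh] at h1
        rw [h1, ← galExt_algebraMap (A := A), hsα _ _ (D.mem_torsion_iff.1 hm1)])
  exact DFunLike.congr_fun key a

theorem exists_isLift (Λ : Type*) [NormedField Λ] [CompleteSpace Λ] [IsUltrametricDist Λ]
    [Algebra Ω Λ] [LocalCompletion A F Ω Λ] (D : Datum A F Ω) (x : Fˣ) :
    ∃ (j : ℤ) (s : Ω ≃ₐ[F] Ω), IsLift (D.poly Λ) (x : F) j s := by
  obtain ⟨k, hk⟩ := exists_norm_eq_zpow A (F := F) (Ω := Ω) (Λ := Λ) x.ne_zero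
  exact ⟨-k, D.isLT_poly.exists_galois_isLift (by rw [hk, neg_neg])⟩

theorem IsArtin.unique (Λ : Type*) [NormedField Λ] [CompleteSpace Λ] [IsUltrametricDist Λ]
    [Algebra Ω Λ] [LocalCompletion A F Ω Λ] {D : Datum A F Ω} {x : Fˣ}
    {σ τ : D.lubinTateField ≃ₐ[F] D.lubinTateField} (hσ : D.IsArtin x σ) (hτ : D.IsArtin x τ) :
    σ = τ := by
  obtain ⟨j, s, hs⟩ := D.exists_isLift Λ x
  ext a
  rw [hσ.coe_apply hs, hτ.coe_apply hs]

/-- Restrictions of chosen lifts satisfy the characterising property. They form a homomorphism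
because a product of lifts is a lift of the product and the property determines the automorphism. So
the definition of `art` does not fall back to its default. -/
theorem isArtin_art (Λ : Type*) [NormedField Λ] [CompleteSpace Λ] [IsUltrametricDist Λ]
    [Algebra Ω Λ] [LocalCompletion A F Ω Λ] (D : Datum A F Ω) (x : Fˣ) :
    D.IsArtin x (D.art x) := by
  have hex : ∃ a : Fˣ →* (D.lubinTateField ≃ₐ[F] D.lubinTateField), ∀ x, D.IsArtin x (a x) := by
    choose j s hs using D.exists_isLift Λ
    choose r hr using fun x ↦ exists_restrict (hs x)
    have hA : ∀ x, D.IsArtin x (r x) := fun x ↦ isArtin_of_isLift (hs x) (hr x)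
    refine ⟨MonoidHom.mk' r fun x y ↦ IsArtin.unique Λ (hA _) ?_, hA⟩
    have h1 := (hs x).mul D.isLT_poly (hs y)
    rw [← Units.val_mul] at h1
    refine isArtin_of_isLift h1 fun a ↦ ?_
    rw [AlgEquiv.mul_apply, AlgEquiv.mul_apply, hr, hr]
  rw [art, dif_pos hex]
  exact hex.choose_spec x

theorem isArtin_iff (Λ : Type*) [NormedField Λ] [CompleteSpace Λ] [IsUltrametricDist Λ]
    [Algebra Ω Λ] [LocalCompletion A F Ω Λ] (D : Datum A F Ω) (x : Fˣ)
    (σ : D.lubinTateField ≃ₐ[F] D.lubinTateField) : D.IsArtin x σ ↔ σ = D.art x :=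
  ⟨fun h ↦ h.unique Λ (D.isArtin_art Λ x), fun h ↦ h ▸ D.isArtin_art Λ x⟩

end Artin

/-! ### Base change for the Artin maps of two data -/

section BaseChange

variable {A F A' F' Ω : Type*} [CommRing A] [IsDomain A] [IsDiscreteValuationRing A]
  [Finite (IsLocalRing.ResidueField A)] [Field F] [Algebra A F] [IsFractionRing A F]
  [Field Ω] [Algebra F Ω] [Algebra A Ω] [IsScalarTower A F Ω] [IsSepClosure F Ω]
  [CommRing A'] [IsDomain A'] [IsDiscreteValuationRing A']
  [Finite (IsLocalRing.ResidueField A')] [Field F'] [Algebra A' F'] [IsFractionRing A' F']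
  [Algebra F' Ω] [Algebra A' Ω] [IsScalarTower A' F' Ω] [IsSepClosure F' Ω]
  [Algebra F F'] [IsScalarTower F F' Ω] [FiniteDimensional F F']
  [Algebra A A'] [IsScalarTower A A' Ω]

theorem isLift_one_of_forall_eq {Λ : Type*} [NormedField Λ] [CompleteSpace Λ]
    [IsUltrametricDist Λ] [Algebra Ω Λ] [LocalCompletion A F Ω Λ] {D : Datum A F Ω}
    {s : Ω ≃ₐ[F] Ω} (hs : ∀ y ∈ D.lubinTateField, s y = y) : IsLift (D.poly Λ) 1 0 s := by
  have := isLift_unit (D.isLT_poly (Λ := Λ)) (a := 1) isUnit_one (s := s)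
    (fun y hy ↦ hs y (D.maxUnr_le hy)) fun m α hα ↦ by
      obtain ⟨b, rfl⟩ := D.isLT_poly.exists_algebraMap_eq hα
      rw [galExt_algebraMap, hs b (D.level_le Λ m (D.torsion_mem_level (D.mem_torsion_iff.2 hα))),
        D.isLT_poly.evR_brk_one]
  rwa [map_one] at this

theorem IsLift.eq_of_mem_lubinTateField {Λ : Type*} [NormedField Λ] [CompleteSpace Λ]
    [IsUltrametricDist Λ] [Algebra Ω Λ] [LocalCompletion A F Ω Λ] {D : Datum A F Ω} {j : ℤ}
    {s : Ω ≃ₐ[F] Ω} (hs : IsLift (D.poly Λ) 1 j s) {y : Ω} (hy : y ∈ D.lubinTateField) :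
    s y = y := by
  obtain ⟨-, hur, hα⟩ := hs.apply_eq_of_one D.isLT_poly
  have key := IntermediateField.algHom_ext_of_eq_adjoin F (D.lubinTateField_eq_adjoin Λ)
    (φ₁ := s.toAlgHom.comp D.lubinTateField.val) (φ₂ := D.lubinTateField.val) (by
      rintro y (hy | hy)
      · exact hur y hy
      · obtain ⟨m, hm⟩ := Set.mem_iUnion.1 hy
        exact hα m y (D.mem_torsion_iff.1 hm))
  exact DFunLike.congr_fun key ⟨y, hy⟩

/-- An automorphism fixing the larger Lubin–Tate field is a lift of 1. By base change it is a lift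
of the norm of 1 over `F`, so it fixes the Lubin–Tate field of `F`. Infinite Galois theory turns
this into the inclusion. -/
theorem mem_lubinTateField_of_mem (Λ : Type*) [NormedField Λ] [CompleteSpace Λ]
    [IsUltrametricDist Λ] [Algebra Ω Λ] [LocalCompletion A F Ω Λ] [LocalCompletion A' F' Ω Λ]
    (D : Datum A F Ω) (D' : Datum A' F' Ω) {y : Ω} (hy : y ∈ D.lubinTateField) :
    y ∈ D'.lubinTateField := by
  have : IsGalois F' Ω := IsSepClosure.isGalois
  rw [← InfiniteGalois.fixedField_fixingSubgroup D'.lubinTateField]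
  rw [IntermediateField.mem_fixedField_iff]
  intro s hs
  rw [IntermediateField.mem_fixingSubgroup_iff] at hs
  obtain ⟨k, hk⟩ := (isLift_one_of_forall_eq (Λ := Λ) hs).baseChange (f := D.poly Λ) D.isLT_poly
    D'.isLT_poly
  rw [map_one] at hk
  exact IsLift.eq_of_mem_lubinTateField hk hy

/-- One automorphism of `Ω` computes both sides: a lift of `x'` is, over `F`, a lift of its norm. -/
theorem art_apply_eq_art_norm (Λ : Type*) [NormedField Λ] [CompleteSpace Λ]
    [IsUltrametricDist Λ] [Algebra Ω Λ] [LocalCompletion A F Ω Λ] [LocalCompletion A' F' Ω Λ]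
    (D : Datum A F Ω) (D' : Datum A' F' Ω) (x' : F'ˣ) (a : D.lubinTateField)
    (a' : D'.lubinTateField) (haa' : (a' : Ω) = a) :
    (D'.art x' a' : Ω) = D.art (Units.map (Algebra.norm F) x') a := by
  obtain ⟨j, s, hs⟩ := D'.exists_isLift Λ x'
  obtain ⟨k, hk⟩ := hs.baseChange (f := D.poly Λ) D.isLT_poly D'.isLT_poly
  rw [(D'.isArtin_art Λ x').coe_apply hs, (D.isArtin_art Λ _).coe_apply
    (x := Units.map (Algebra.norm F) x') hk, haa']
  rfl

end BaseChange

end Datum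

/-! ### Construction of the completion -/

section Completion

open UniformSpace

universe u

/-- A separable closure of a complete nonarchimedean field, completed for the spectral norm. -/
theorem exists_localCompletion_of_norm {A K : Type*} {Ω : Type u} [CommRing A] [IsDomain A]
    [IsIntegrallyClosed A] [NontriviallyNormedField K] [CompleteSpace K] [IsUltrametricDist K]
    [Algebra A K] [IsFractionRing A K] [Field Ω] [Algebra K Ω] [Algebra A Ω]
    [IsScalarTower A K Ω] [IsSepClosure K Ω]
    (hA : ∀ x : K, ‖x‖ ≤ 1 ↔ ∃ a, algebraMap A K a = x) :
    ∃ (Λ : Type u) (_ : NormedField Λ) (_ : CompleteSpace Λ) (_ : IsUltrametricDist Λ)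
      (_ : Algebra Ω Λ), LocalCompletion A K Ω Λ := by
  have : Algebra.IsAlgebraic K Ω := (IsSepClosure.separable (k := K) (K := Ω)).isAlgebraic
  let nf : NormedField Ω := spectralNorm.normedField K Ω
  let na : NormedAlgebra K Ω := spectralNorm.normedAlgebra K Ω
  have hnorm : ∀ x : Ω, ‖x‖ = spectralNorm K Ω x := fun _ ↦ rfl
  have hu : IsUltrametricDist Ω := IsUltrametricDist.isUltrametricDist_of_isNonarchimedean_norm
    isNonarchimedean_spectralNorm
  have huc : IsUltrametricDist (Completion Ω) := by
    refine IsUltrametricDist.isUltrametricDist_of_forall_norm_add_le_max_norm fun x y ↦ ?_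
    induction x, y using Completion.induction_on₂ with
    | hp => apply isClosed_le <;> fun_prop
    | ih x y =>
      rw [← Completion.coe_add, Completion.norm_coe, Completion.norm_coe, Completion.norm_coe]
      exact IsUltrametricDist.norm_add_le_max x y
  have hι : ∀ x : Ω, algebraMap Ω (Completion Ω) x = (x : Completion Ω) := fun _ ↦ rfl
  refine ⟨Completion Ω, inferInstance, inferInstance, huc, inferInstance, ?_, ?_, ?_, ?_⟩
  · intro x
    have hx : IsIntegral K x := Algebra.IsIntegral.isIntegral x
    -- The spectral norm is at most 1 exactly when the minimal polynomial has coefficients in `A`.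
    -- As `A` is integrally closed, this is integrality.
    rw [hι, Completion.norm_coe, hnorm, spectralNorm, spectralValue_le_one_iff (minpoly.monic hx)]
    constructor
    · intro h
      have h1 : minpoly K x ∈ Polynomial.lifts (algebraMap A K) := by
        rw [Polynomial.lifts_iff_coeff_lifts]
        exact fun n ↦ (hA _).1 (h n)
      obtain ⟨p, hp, -, hpm⟩ := Polynomial.lifts_and_natDegree_eq_and_monic h1 (minpoly.monic hx)
      refine ⟨p, hpm, ?_⟩
      rw [IsScalarTower.algebraMap_eq A K Ω, ← eval₂_map, hp]
      exact minpoly.aeval K x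
    · intro h n
      rw [minpoly.isIntegrallyClosed_eq_field_fractions' K h, coeff_map]
      exact (hA _).2 ⟨_, rfl⟩
  · intro V hV
    let i : Ω →ₗ[K] Completion Ω := (Completion.toComplL (𝕜 := K) (E := Ω)).toLinearMap
    have : FiniteDimensional K (V.map i) := inferInstance
    exact Submodule.closed_of_finiteDimensional (V.map i)
  · intro σ
    have hσ : ∀ x, ‖σ x‖ = ‖x‖ := fun x ↦ (spectralNorm_eq_of_equiv σ x).symm
    have hc : Continuous (σ : Ω →+* Ω) := (AddMonoidHomClass.isometry_of_norm σ hσ).continuous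
    refine ⟨Completion.mapRingHom (σ : Ω →+* Ω) hc, fun x ↦ ?_, fun x ↦ ?_⟩
    · induction x using Completion.induction_on with
      | hp => exact isClosed_eq (Completion.continuous_map.norm) continuous_norm
      | ih x =>
        rw [Completion.mapRingHom_coe, Completion.norm_coe, Completion.norm_coe]
        exact hσ x
    · exact Completion.mapRingHom_coe hc x
  · exact Completion.denseRange_coe

/-- The adic absolute value makes the fraction field a complete ultrametric field with `A` as unit
ball. -/
theorem exists_localCompletion {A K : Type*} {Ω : Type u} [CommRing A] [IsDomain A]
    [IsDiscreteValuationRing A] [IsAdicComplete (IsLocalRing.maximalIdeal A) A] [Field K]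
    [Algebra A K] [IsFractionRing A K] [Field Ω] [Algebra K Ω] [Algebra A Ω]
    [IsScalarTower A K Ω] [IsSepClosure K Ω] :
    ∃ (Λ : Type u) (_ : NormedField Λ) (_ : CompleteSpace Λ) (_ : IsUltrametricDist Λ)
      (_ : Algebra Ω Λ), LocalCompletion A K Ω Λ := by
  let v := IsDiscreteValuationRing.maximalIdeal A
  have h2 : (1 : NNReal) < 2 := one_lt_two
  let w : AbsoluteValue K ℝ := v.adicAbv h2
  have hA : ∀ x : K, w x ≤ 1 ↔ ∃ a, algebraMap A K a = x := fun x ↦ by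
    constructor
    · intro h
      have h1 : v.adicAbvDef h2 x ≤ 1 := h
      exact IsDiscreteValuationRing.exists_lift_of_le_one
        ((WithZeroMulInt.toNNReal_le_one_iff h2).1 h1)
    · rintro ⟨a, rfl⟩
      exact v.adicAbv_coe_le_one h2 a
  have hp := irreducible_unif A
  have hp0 : algebraMap A K (unif A) ≠ 0 := by
    simpa using hp.ne_zero
  have hp1 : w (algebraMap A K (unif A)) < 1 :=
    (v.adicAbv_coe_lt_one_iff h2 _).2 ((IsLocalRing.mem_maximalIdeal _).2 hp.not_isUnit)
  have hp2 : 0 < w (algebraMap A K (unif A)) := w.pos hp0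
  have hm : ∀ (n : ℕ) (a : A), a ∈ IsLocalRing.maximalIdeal A ^ n ↔
      w (algebraMap A K a) ≤ w (algebraMap A K (unif A)) ^ n := fun n a ↦ by
    have hpn : algebraMap A K (unif A ^ n) ≠ 0 := by
      rw [map_pow]
      exact pow_ne_zero n hp0
    rw [(IsDiscreteValuationRing.irreducible_iff_uniformizer _).1 hp, Ideal.span_singleton_pow,
      Ideal.mem_span_singleton, ← map_pow, ← map_pow, ← div_le_one (w.pos hpn), ← map_div₀, hA]
    refine exists_congr fun b ↦ ?_
    rw [eq_div_iff hpn, ← map_mul, (IsFractionRing.injective A K).eq_iff,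
      mul_comm, eq_comm]
  let nf : NontriviallyNormedField K :=
    { w.toNormedField with
      non_trivial := ⟨(algebraMap A K (unif A))⁻¹, by
        change 1 < w _
        rw [map_inv₀]
        exact (one_lt_inv₀ hp2).2 hp1⟩ }
  have hn : ∀ x : K, ‖x‖ = w x := fun _ ↦ rfl
  have hu : IsUltrametricDist K := IsUltrametricDist.isUltrametricDist_of_isNonarchimedean_norm
    (v.isNonarchimedean_adicAbv h2)
  have hc : CompleteSpace K := by
    -- For a sequence controlled by powers of the uniformizer the differences to its first term lie
    -- in `A`, where adic completeness provides the limit.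
    refine Metric.complete_of_convergent_controlled_sequences
      (fun n ↦ ‖algebraMap A K (unif A)‖ ^ n) (fun n ↦ pow_pos hp2 n) fun u hu ↦ ?_
    have h1 : ∀ n, ∃ a, algebraMap A K a = u n - u 0 := fun n ↦ by
      rw [← hA, ← hn, ← dist_eq_norm]
      simpa using (hu 0 n 0 (Nat.zero_le _) le_rfl).le
    choose a ha using h1
    have h3 : ∀ n k, algebraMap A K (a n - a k) = u n - u k := fun n k ↦ by
      rw [map_sub, ha, ha]; ring
    obtain ⟨l, hl⟩ := IsPrecomplete.prec' (I := IsLocalRing.maximalIdeal A) a (fun {m n} hmn ↦ by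
      rw [SModEq.sub_mem, smul_eq_mul, Ideal.mul_top, hm, h3, ← hn, ← hn, ← dist_eq_norm]
      exact (hu m m n le_rfl hmn).le)
    refine ⟨algebraMap A K l + u 0, ?_⟩
    rw [tendsto_iff_norm_sub_tendsto_zero]
    refine squeeze_zero (fun _ ↦ norm_nonneg _) (fun n ↦ ?_)
      (tendsto_pow_atTop_nhds_zero_of_lt_one hp2.le hp1)
    have h4 := hl n
    rw [SModEq.sub_mem, smul_eq_mul, Ideal.mul_top, hm, map_sub, ha, ← hn] at h4
    rwa [← sub_sub, sub_right_comm]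
  exact exists_localCompletion_of_norm hA

end Completion

/-! ### The ring of integers of a finite extension -/

section FiniteExtension

variable {A F Ω Λ : Type*} [CommRing A] [IsDomain A] [IsDiscreteValuationRing A]
  [Finite (IsLocalRing.ResidueField A)] [Field F] [Algebra A F] [IsFractionRing A F]
  [Field Ω] [Algebra F Ω] [IsSepClosure F Ω] [Algebra A Ω] [IsScalarTower A F Ω]
  (E : IntermediateField F Ω)

theorem isSepClosure_intermediateField : IsSepClosure E Ω where
  sep_closed := IsSepClosure.sep_closed F
  separable := by
    have : Algebra.IsSeparable F Ω := IsSepClosure.separable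
    exact Algebra.isSeparable_tower_top_of_isSeparable F E Ω

theorem isScalarTower_integralClosure : IsScalarTower A (integralClosure A E) Ω :=
  IsScalarTower.of_algebraMap_eq fun _ ↦ rfl

theorem algebraMap_integralClosure_injective :
    Function.Injective (algebraMap A (integralClosure A E)) := by
  have := isScalarTower_integralClosure (A := A) E
  have h : Function.Injective (algebraMap A Ω) := by
    rw [IsScalarTower.algebraMap_eq A F Ω]
    exact (algebraMap F Ω).injective.comp (IsFractionRing.injective A F)
  rw [IsScalarTower.algebraMap_eq A (integralClosure A E) Ω, RingHom.coe_comp] at h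
  exact Function.Injective.of_comp h

variable [NormedField Λ] [CompleteSpace Λ] [IsUltrametricDist Λ] [Algebra Ω Λ]
  [LocalCompletion A F Ω Λ]

variable [FiniteDimensional F E]

/-- The same `Λ` serves for the finite extension: integrality over `A` and over its integral closure
in `E` agree, and the remaining properties pass down from `E` to `F`. -/
theorem localCompletion_integralClosure : LocalCompletion (integralClosure A E) E Ω Λ where
  norm_le_one_iff x := by
    have := isScalarTower_integralClosure (A := A) E
    rw [norm_le_one_iff A F]
    refine ⟨fun h ↦ h.tower_top, fun h ↦ ?_⟩
    have : Algebra.IsIntegral A (integralClosure A E) := inferInstance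
    exact isIntegral_trans (R := A) x h
  isClosed_image V hV := by
    have : FiniteDimensional F V := FiniteDimensional.trans F E V
    exact LocalCompletion.isClosed_image A (V.restrictScalars F) this
  exists_extension σ := LocalCompletion.exists_extension (A := A) (σ.restrictScalars F)
  denseRange := LocalCompletion.denseRange A F

/-- The nonunits form the open unit ball, so the ring is local; it is a Dedekind domain as an
integral closure in a finite separable extension, and not a field because `A` is not. -/
theorem isDiscreteValuationRing_integralClosure (A : Type*) {F Ω : Type*} (Λ : Type*) [CommRing A]
    [IsDomain A] [IsDiscreteValuationRing A] [Finite (IsLocalRing.ResidueField A)] [Field F]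
    [Algebra A F] [IsFractionRing A F] [Field Ω] [Algebra F Ω] [IsSepClosure F Ω] [Algebra A Ω]
    [IsScalarTower A F Ω] [NormedField Λ] [CompleteSpace Λ] [IsUltrametricDist Λ] [Algebra Ω Λ]
    [LocalCompletion A F Ω Λ] (E : IntermediateField F Ω) [FiniteDimensional F E] :
    IsDiscreteValuationRing (integralClosure A E) := by
  have : Algebra.IsSeparable F Ω := IsSepClosure.separable
  have : Algebra.IsSeparable F E := Algebra.isSeparable_tower_bot_of_isSeparable F E Ω
  have : IsLocalRing (integralClosure A E) :=
    IsLocalRing.of_nonunits_add fun a b ha hb ↦ by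
      have h : a + b ∈ maxIdeal (intRing A E) :=
        add_mem (Ideal.subset_span ha) (Ideal.subset_span hb)
      rw [mem_maxIdeal_iff (Λ := Λ)] at h
      rw [mem_nonunits_iff, isUnit_intRing_iff (Λ := Λ)]
      exact h.ne
  have : IsDedekindDomain (integralClosure A E) := integralClosure.isDedekindDomain A F E
  have hnf : ¬ IsField (integralClosure A E) := by
    rw [← Algebra.IsIntegral.isField_iff_isField (R := A) (algebraMap_integralClosure_injective E)]
    exact IsDiscreteValuationRing.not_isField A
  exact ((IsDiscreteValuationRing.TFAE _ hnf).out 2 0).1 this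

theorem finite_residueField_integralClosure [IsLocalRing (integralClosure A E)] :
    Finite (IsLocalRing.ResidueField (integralClosure A E)) := by
  have : Algebra.IsSeparable F Ω := IsSepClosure.separable
  have : Algebra.IsSeparable F E := Algebra.isSeparable_tower_bot_of_isSeparable F E Ω
  have : Module.Finite A (integralClosure A E) := IsIntegralClosure.finite A F E _
  have : IsLocalHom (algebraMap A (integralClosure A E)) :=
    (algebraMap_isIntegral_iff.2 inferInstance).isLocalHom (algebraMap_integralClosure_injective E)
  exact Module.finite_of_finite (IsLocalRing.ResidueField A)

end FiniteExtension

end LubinTate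

end

/-- The first two clauses ensure that both `art` maps are the homomorphisms determined by the
characterising property, not default values. Everything needed about the ring of integers of `K'` is
deduced from the completion attached to `K`. -/
theorem mainTheorem2
    {O K Ω : Type*} [CommRing O] [IsDomain O] [IsDiscreteValuationRing O]
    [IsAdicComplete (IsLocalRing.maximalIdeal O) O] [Finite (IsLocalRing.ResidueField O)]
    [Field K] [Algebra O K] [IsFractionRing O K]
    [Field Ω] [Algebra K Ω] [IsSepClosure K Ω] [Algebra O Ω] [IsScalarTower O K Ω]
    (K' : IntermediateField K Ω) [FiniteDimensional K K']
    (D : LubinTate.Datum O K Ω) (D' : LubinTate.Datum (integralClosure O K') K' Ω) :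
    (∀ x σ, D.IsArtin x σ ↔ σ = D.art x) ∧
    (∀ x' σ', D'.IsArtin x' σ' ↔ σ' = D'.art x') ∧
    ∃ h : D.lubinTateField ≤ D'.lubinTateField.restrictScalars K,
      ∀ (x' : (K')ˣ) (a : D.lubinTateField),
        (D'.art x' ⟨a, h a.2⟩ : Ω) = D.art (Units.map (Algebra.norm K) x') a := by
  obtain ⟨Λ, _, _, _, _, _⟩ := LubinTate.exists_localCompletion (A := O) (K := K) (Ω := Ω)
  have := LubinTate.isSepClosure_intermediateField K'
  have := LubinTate.localCompletion_integralClosure (A := O) (Λ := Λ) K'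
  have := LubinTate.isDiscreteValuationRing_integralClosure O Λ K'
  have := LubinTate.finite_residueField_integralClosure (A := O) K'
  have := LubinTate.isScalarTower_integralClosure (A := O) K'
  have : IsFractionRing (integralClosure O K') K' :=
    integralClosure.isFractionRing_of_finite_extension K K'
  exact ⟨D.isArtin_iff Λ, D'.isArtin_iff Λ, fun y hy ↦ D.mem_lubinTateField_of_mem Λ D' hy,
    fun x' a ↦ D.art_apply_eq_art_norm Λ D' x' a _ rfl⟩
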